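/- **Setting.** Let $(\mathfrak X,\pi)$ be a probability space, $\mathcal B(\mathfrak X,\mathbb D)$ the bounded measurable functions $\mathfrak X\to\mathbb D$ with norm $\|w\|=\sup_x|w_x|$, and $\langle w\rangle=\int w_x\,\pi(dx)$. Let $a\in\mathcal B(\mathfrak X,\mathbb R)$ and let $s\in\mathcal B(\mathfrak X^2,[0,\infty))$ be symmetric, $s_{xy}=s_{yx}$. Put $(Sw)_x=\int s_{xy}w_y\,\pi(dy)$, let $\|S\|$ be the operator norm induced by $\|\cdot\|$, and $\kappa=\|a\|+2\|S\|^{1/2}$. Assume: * **(A)** there is a symmetric $r\in\mathcal B(\mathfrak X^2,[0,\infty))$ with $s_{xy}\ge\int r_{xu}r_{uy}\,\pi(du)$ for all $x,y$ and $\inf_x\int r_{xy}\,\pi(dy)>0$; * **(B)** for some $K\ge1$ the integral kernel $s^{(K)}$ of $S^K$ satisfies $\inf_{x,y}s^{(K)}_{xy}>0$; * **(C)** $\displaystyle\lim_{\varepsilon\downarrow0}\inf_x\int\frac{\pi(dy)}{\varepsilon+(a_x-a_y)^2+\int(s_{xu}-s_{yu})^2\,\pi(du)}=\infty.$ The quadratic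 vector equation $-1/m(z)=z+a+Sm(z)$, $\operatorname{Im}z>0$, has a unique solution with $m(z)\in\mathcal B(\mathfrak X,\{\operatorname{Im}>0\})$; it extends continuously to $\operatorname{Im}z\ge0$, and the extension is also called $m$. There are continuous probability densities $v_x$ on $\mathbb R$ with $m_x(z)=\int_{\mathbb R}\frac{v_x(t)\,dt}{t-z}$ for $\operatorname{Im}z>0$. The set $\mathfrak S=\{\tau\in\mathbb R: v_x(\tau)>0\}$ does not depend on $x$, and $\partial\mathfrak S\subset[-\kappa,\kappa]$. For $\tau\in\mathbb R$ let $(F(\tau)w)_x=|m_x(\tau)|\int s_{xy}|m_y(\tau)|w_y\,\pi(dy)$, let $\|F(\tau)\|_2$ be its norm on $L^2(\pi)$, and let $f(\tau)\in\mathcal B(\mathfrak X,[0,\infty))$ be the (existing and unique) function with $F(\tau)f(\tau)=\|F(\tau)\|_2f(\tau)$ and $\langle f(\tau)^2\rangle=1$. Let $Q(\tau)w=w-\langle f(\tau)w\rangle f(\tau)$ and $\operatorname{sign}\zeta=\zeta/|\zeta|$. For $\tau\in[-\kappa,\kappa]$ the operator $1-F(\tau)$ is invertible on $\{h\in\mathcal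 B(\mathfrak X,\mathbb C):\langle f(\tau)h\rangle=0\}$; with this inverse define $$\mathcal D_\tau(w)=\Big\langle \overline w\;Q(\tau)\frac{1+F(\tau)}{1-F(\tau)}Q(\tau)w\Big\rangle,\qquad w\in\mathcal B(\mathfrak X,\mathbb C),$$ $$\sigma(\tau)=\langle f(\tau)^3\operatorname{sign}m(\tau)\rangle,\qquad \psi(\tau)=\mathcal D_\tau\big(f(\tau)^2\operatorname{sign}m(\tau)\big),$$ $$\Theta(\omega;\tau)=\Big\langle f(\tau)\frac{m(\tau+\omega)-m(\tau)}{|m(\tau)|}\Big\rangle .$$ **Proposition (Cubic equation).** The form $\mathcal D_\tau$ is real and non-negative for $\tau\in[-\kappa,\kappa]$, and $\sigma(\tau),\psi(\tau)$ are real for $\tau\in\partial\mathfrak S$. There are constants $c,C>0$, depending only on $(\mathfrak X,\pi)$, $a$ and $s$, such that the following holds for all $\tau\in\partial\mathfrak S$ and $\omega\in[-\kappa,\kappa]$, where $\Theta=\Theta(\omega;\tau)$: 1. $\big|m_x(\tau+\omega)-m_x(\tau)-\Theta\,|m_x(\tau)|f_x(\tau)\big|\le C(|\Theta|^2+|\omega|)$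 for all $x\in\mathfrak X$. 2. $\psi(\tau)\Theta^3+\sigma(\tau)\Theta^2+\langle|m(\tau)|f(\tau)\rangle\,\omega=e(\omega;\tau)$, where $|e(\omega;\tau)|\le C(|\omega||\Theta|+|\omega|^2)$ and $|\operatorname{Im}e(\omega;\tau)|\le C|\omega|\operatorname{Im}\Theta$. 3. $c\le\psi(\tau)+\sigma(\tau)^2\le C$; moreover $c\le\psi(\tau)+|\sigma(\tau)|^2\le C$ for every $\tau\in[-\kappa,\kappa]$. -/

import Mathlib

open MeasureTheory Set Filter Topology

namespace QVE

noncomputable section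

/-- Bounded measurable functions: membership in the space `𝓑(X, E)`. -/
def BddMeas {X E : Type*} [MeasurableSpace X] [NormedAddCommGroup E] [MeasurableSpace E]
    (w : X → E) : Prop :=
  Measurable w ∧ ∃ C : ℝ, ∀ x, ‖w x‖ ≤ C

/-- The norm `‖w‖ = sup_x |w_x|` of `𝓑(X, E)`. -/
def supNorm {X E : Type*} [NormedAddCommGroup E] (w : X → E) : ℝ := ⨆ x, ‖w x‖

/-- The operator norm on `𝓑(X, ℂ)` induced by the supremum norm. -/
def supOpNorm {X : Type*} [MeasurableSpace X] (T : (X → ℂ) → X → ℂ) : ℝ :=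
  sInf {c : ℝ | 0 ≤ c ∧ ∀ w : X → ℂ, BddMeas w → supNorm (T w) ≤ c * supNorm w}

/-- The operator norm on `L²(X, π)`. -/
def l2OpNorm {X : Type*} [MeasurableSpace X] (π : Measure X) (T : (X → ℂ) → X → ℂ) : ℝ :=
  sInf {c : ℝ | 0 ≤ c ∧ ∀ w : X → ℂ, MemLp w 2 π →
    eLpNorm (T w) 2 π ≤ ENNReal.ofReal c * eLpNorm w 2 π}

/-- The average `⟨w⟩ = ∫ w_x π(dx)`. -/
def avg {X : Type*} [MeasurableSpace X] (π : Measure X) (w : X → ℂ) : ℂ := ∫ x, w x ∂π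

/-- A bounded, measurable, non-negative and symmetric kernel on `X × X`. -/
structure IsSymmKernel {X : Type*} [MeasurableSpace X] (s : X → X → ℝ) : Prop where
  measurable : Measurable (Function.uncurry s)
  bounded : ∃ C : ℝ, ∀ x y, s x y ≤ C
  nonneg : ∀ x y, 0 ≤ s x y
  symm : ∀ x y, s x y = s y x

/-- The integral operator `S` with kernel `s`. -/
def intOp {X : Type*} [MeasurableSpace X] (π : Measure X) (s : X → X → ℝ) (w : X → ℂ) :
    X → ℂ :=
  fun x => ∫ y, (s x y : ℂ) * w y ∂π

/-- `kernelPow π s n` is the integral kernel of the power `S ^ (n + 1)`. -/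
def kernelPow {X : Type*} [MeasurableSpace X] (π : Measure X) (s : X → X → ℝ) :
    ℕ → X → X → ℝ
  | 0 => s
  | n + 1 => fun x y => ∫ u, s x u * kernelPow π s n u y ∂π

/-- Assumption (A), diagonal positivity. -/
def DiagonalPositivity {X : Type*} [MeasurableSpace X] (π : Measure X) (s : X → X → ℝ) : Prop :=
  ∃ r : X → X → ℝ, IsSymmKernel r ∧ (∀ x y, ∫ u, r x u * r u y ∂π ≤ s x y) ∧
    ∃ c : ℝ, 0 < c ∧ ∀ x, c ≤ ∫ y, r x y ∂π

/-- Assumption (B), uniform primitivity: the kernel of some power `S ^ K` with `K ≥ 1` is bounded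
below by a positive constant. -/
def UniformPrimitivity {X : Type*} [MeasurableSpace X] (π : Measure X) (s : X → X → ℝ) : Prop :=
  ∃ n : ℕ, ∃ c : ℝ, 0 < c ∧ ∀ x y, c ≤ kernelPow π s n x y

/-- Assumption (C), component regularity. -/
def ComponentRegularity {X : Type*} [MeasurableSpace X] (π : Measure X) (a : X → ℝ)
    (s : X → X → ℝ) : Prop :=
  Tendsto
    (fun ε : ℝ => ⨅ x, ∫ y, 1 / (ε + (a x - a y) ^ 2 + ∫ u, (s x u - s y u) ^ 2 ∂π) ∂π)
    (𝓝[>] 0) atTop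

/-- `κ = ‖a‖ + 2 ‖S‖^{1/2}`. -/
def kappa {X : Type*} [MeasurableSpace X] (π : Measure X) (a : X → ℝ) (s : X → X → ℝ) : ℝ :=
  supNorm a + 2 * Real.sqrt (supOpNorm (intOp π s))

/-- `m` solves the quadratic vector equation `-1/m(z) = z + a + S m(z)` on the upper half plane,
with values in bounded measurable functions from `X` to the upper half plane. -/
def IsSolution {X : Type*} [MeasurableSpace X] (π : Measure X) (a : X → ℝ) (s : X → X → ℝ)
    (m : ℂ → X → ℂ) : Prop :=
  ∀ z : ℂ, 0 < z.im → BddMeas (m z) ∧ (∀ x, 0 < (m z x).im) ∧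
    ∀ x, -1 / m z x = z + a x + intOp π s (m z) x

/-- `m` is the solution of the QVE together with its continuous extension to the closed upper
half plane (the values of `m` in the open lower half plane carry no meaning). -/
def IsExtendedSolution {X : Type*} [MeasurableSpace X] (π : Measure X) (a : X → ℝ)
    (s : X → X → ℝ) (m : ℂ → X → ℂ) : Prop :=
  IsSolution π a s m ∧ ∀ x, ContinuousOn (fun z => m z x) {z : ℂ | 0 ≤ z.im}

/-- `μ` is the generating measure at `x`: the probability measure on `ℝ` whose Stieltjes transform
is `m_x`. -/
def IsGeneratingMeasure {X : Type*} (m : ℂ → X → ℂ) (x : X) (μ : Measure ℝ) : Prop :=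
  IsProbabilityMeasure μ ∧ ∀ z : ℂ, 0 < z.im → m z x = ∫ t : ℝ, 1 / ((t : ℂ) - z) ∂μ

/-- `v` is the (continuous version of the) generating density: `v_x(τ) dτ` is the generating
measure at `x`. -/
def IsGeneratingDensity {X : Type*} (m : ℂ → X → ℂ) (v : ℝ → X → ℝ) : Prop :=
  ∀ x, Continuous (fun t => v t x) ∧ (∀ t, 0 ≤ v t x) ∧
    IsGeneratingMeasure m x (volume.withDensity fun t => ENNReal.ofReal (v t x))

/-- The set `𝔖` on which the generating density is positive. -/
def posSet {X : Type*} (v : ℝ → X → ℝ) : Set ℝ := {t | ∀ x, 0 < v t x}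

/-- The operator `F` built from the value `μ = m(z)` of the solution:
`(F w)_x = |μ_x| ∫ s_{xy} |μ_y| w_y π(dy)`. -/
def opF {X : Type*} [MeasurableSpace X] (π : Measure X) (s : X → X → ℝ) (μ : X → ℂ)
    (w : X → ℂ) : X → ℂ :=
  fun x => (‖μ x‖ : ℂ) * intOp π s (fun y => (‖μ y‖ : ℂ) * w y) x

/-- `f` is the non-negative bounded eigenfunction of `F` for the eigenvalue `‖F‖₂`, normalized in
`L²(X, π)`. -/
structure IsTopEigenfunction {X : Type*} [MeasurableSpace X] (π : Measure X) (s : X → X → ℝ)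
    (μ : X → ℂ) (f : X → ℝ) : Prop where
  bddMeas : BddMeas f
  nonneg : ∀ x, 0 ≤ f x
  normalized : ∫ x, f x ^ 2 ∂π = 1
  eigen : ∀ x, opF π s μ (fun y => (f y : ℂ)) x = (l2OpNorm π (opF π s μ) : ℂ) * f x

/-- The projection `Q w = w - ⟨f w⟩ f`. -/
def projQ {X : Type*} [MeasurableSpace X] (π : Measure X) (f : X → ℝ) (w : X → ℂ) : X → ℂ :=
  fun x => w x - avg π (fun y => (f y : ℂ) * w y) * f x

/-- `g = (1 - F)⁻¹ h` within the bounded functions orthogonal to `f`. -/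
def IsReducedInverse {X : Type*} [MeasurableSpace X] (π : Measure X) (s : X → X → ℝ) (μ : X → ℂ)
    (f : X → ℝ) (h g : X → ℂ) : Prop :=
  BddMeas g ∧ avg π (fun x => (f x : ℂ) * g x) = 0 ∧ ∀ x, g x - opF π s μ g x = h x

/-- The inverse of `1 - F` on the bounded functions orthogonal to `f`, applied to `h`. -/
def reducedInverse {X : Type*} [MeasurableSpace X] (π : Measure X) (s : X → X → ℝ) (μ : X → ℂ)
    (f : X → ℝ) (h : X → ℂ) : X → ℂ :=
  Classical.epsilon (IsReducedInverse π s μ f h)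

/-- The form `𝓓(w) = ⟨w̄ Q (1 + F)/(1 - F) Q w⟩`. The conjugate makes it a non-negative form on
complex functions; it plays no role for real `w`. -/
def formD {X : Type*} [MeasurableSpace X] (π : Measure X) (s : X → X → ℝ) (μ : X → ℂ)
    (f : X → ℝ) (w : X → ℂ) : ℂ :=
  let g := reducedInverse π s μ f (projQ π f w)
  avg π (fun x => (starRingEnd ℂ) (w x) * projQ π f (fun y => g y + opF π s μ g y) x)

/-- `sign ζ = ζ / |ζ|`. -/
def csign (ζ : ℂ) : ℂ := ζ / (‖ζ‖ : ℂ)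

/-- `σ = ⟨f³ sign m⟩`, for `μ = m(τ)`. -/
def sigma {X : Type*} [MeasurableSpace X] (π : Measure X) (μ : X → ℂ) (f : X → ℝ) : ℂ :=
  avg π (fun x => (f x : ℂ) ^ 3 * csign (μ x))

/-- `ψ = 𝓓(f² sign m)`, for `μ = m(τ)`. -/
def psi {X : Type*} [MeasurableSpace X] (π : Measure X) (s : X → X → ℝ) (μ : X → ℂ)
    (f : X → ℝ) : ℂ :=
  formD π s μ f (fun x => (f x : ℂ) ^ 2 * csign (μ x))

/-- `Θ(ω; τ) = ⟨f(τ) (m(τ + ω) - m(τ)) / |m(τ)|⟩`. -/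
def Theta {X : Type*} [MeasurableSpace X] (π : Measure X) (m : ℂ → X → ℂ) (f : ℝ → X → ℝ)
    (ω τ : ℝ) : ℂ :=
  avg π (fun x => (f τ x : ℂ) * ((m ((τ + ω : ℝ) : ℂ) x - m (τ : ℂ) x) / (‖m (τ : ℂ) x‖ : ℂ)))

end

end QVE

/-!
The solution `m` of the quadratic vector equation can only be singular where the linearized operator
`1 - m² S` is. With `F = |m| S |m|` and `U = (m/|m|)²` this operator is similar to `1 - U F`, and
all of the argument rests on the spectral picture of the symmetric positivity preserving operator
`F`.

*A priori bounds.* The imaginary part of the equation says that `v = Im m / |m|` satisfies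
`v = Im z · |m| + F v` (`SolvesAt.sinArg_eq`). By the Schur test `F` has norm at most one on `L²`
(`SolvesAt.n2_intOp_kerF_le`). Diagonal positivity turns this into an `L²` bound on `m`
(`SolvesAt.n2_le`), and component regularity turns the `L²` bound into a uniform one, since a large
value of `m` at one point forces large values at many others (`exists_sup_bound`).

*Spectral gap.* By uniform primitivity a power of `F` has a kernel that is bounded below. Hence `F`
has a positive top eigenfunction `f` (`exists_perron`), and its norm on the complement of `f` is at
most some `q < 1` (`exists_gap`). All constants depend only on the bounds on `m`.

*Existence and regularity.* The map `u ↦ -1/(z + a + S u)` contracts the hyperbolic distance on the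
upper half plane (`qveMap_contraction`). This gives the solution (`exists_solvesAt`) and the
Schwarz–Pick estimate `|m'| ≲ v / Im z`. A solution of the linearized equation is decomposed into
its component along `f`, which is controlled by the distance of `U` from `1`, and the rest, which is
controlled by the gap (`IsGapped.n2_stability`); this gives `|m'| ≲ ⟨v⟩⁻²`. The two estimates on
`m'` combine to `|m'| ≲ (Im z)^(-2/3)`, that is, `m` is `1/3`-Hölder continuous and extends to the
real line (`exists_hasDerivAt`, `exists_holder`, `exists_isExtendedSolution`). The density is
`Im m / π` by the Cauchy integral formula in the half plane (`integral_im_div_sub`,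
`im_eq_pi_mul_density`).

*The edge of the support.* At a boundary point `τ` of the set where the density is positive, `m` is
real, and `F` has norm one, because `F v = v` at points of that set close to `τ`
(`frontier_posSet`). Thus `F f = f`. With `u = (m(τ + ω) - m(τ)) / |m(τ)|` and `p = sign m(τ)` the
equation becomes `(1 - F) u = |m| ω + p u F u + ω m u`. Its component orthogonal to `f` is solved to
second order, `u = Θ f + Θ² (1 - F)⁻¹ Q (p f²) + O(ω)` (`exists_first_order`); the component along
`f` is then the cubic equation for `Θ` (`exists_cubic_bounds`). The error terms are of the claimed
order because the Hölder bound gives `|Θ|³ ≲ |ω|`, and their imaginary parts because `Im u` is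
everywhere comparable to `Im Θ`.

*Non-degeneracy.* For `g = (1 - F)⁻¹ Q w` the form is `𝓓(w) = ‖g‖² - ‖F g‖²` (`IsGapped.formD_eq`),
which is at least a multiple of `‖Q w‖²`. For `w = f² sign m` this equals `⟨f⁴⟩ - |σ|² ≥ 1 - |σ|²`,
so that `ψ` and `σ` cannot both be small (`IsGapped.psi_add_sigma_bounds`).
-/

namespace QVE


attribute [fun_prop] BddMeas

/-! ### Bounded measurable functions -/

section Bounded

variable {X E : Type*} [MeasurableSpace X]

@[fun_prop]
lemma BddMeas.const [NormedAddCommGroup E] [MeasurableSpace E] (c : E) :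
    BddMeas (fun _ : X => c) :=
  ⟨measurable_const, ‖c‖, fun _ => le_rfl⟩

@[fun_prop]
lemma BddMeas.add [NormedAddCommGroup E] [MeasurableSpace E] [MeasurableAdd₂ E] {u w : X → E}
    (hu : BddMeas u) (hw : BddMeas w) : BddMeas (fun x => u x + w x) := by
  obtain ⟨hu, C, hC⟩ := hu
  obtain ⟨hw, D, hD⟩ := hw
  exact ⟨hu.add hw, C + D, fun x => (norm_add_le _ _).trans (add_le_add (hC x) (hD x))⟩

@[fun_prop]
lemma BddMeas.neg [NormedAddCommGroup E] [MeasurableSpace E] [MeasurableNeg E] {u : X → E}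
    (hu : BddMeas u) : BddMeas (fun x => -u x) := by
  obtain ⟨hu, C, hC⟩ := hu
  exact ⟨hu.neg, C, fun x => by simpa using hC x⟩

@[fun_prop]
lemma BddMeas.sub [NormedAddCommGroup E] [MeasurableSpace E] [MeasurableSub₂ E] {u w : X → E}
    (hu : BddMeas u) (hw : BddMeas w) : BddMeas (fun x => u x - w x) := by
  obtain ⟨hu, C, hC⟩ := hu
  obtain ⟨hw, D, hD⟩ := hw
  exact ⟨hu.sub hw, C + D, fun x => (norm_sub_le _ _).trans (add_le_add (hC x) (hD x))⟩

@[fun_prop]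
lemma BddMeas.mul [NormedRing E] [MeasurableSpace E] [MeasurableMul₂ E] {u w : X → E}
    (hu : BddMeas u) (hw : BddMeas w) : BddMeas (fun x => u x * w x) := by
  obtain ⟨hu, C, hC⟩ := hu
  obtain ⟨hw, D, hD⟩ := hw
  exact ⟨hu.mul hw, C * D, fun x => (norm_mul_le _ _).trans
    (mul_le_mul (hC x) (hD x) (norm_nonneg _) ((norm_nonneg _).trans (hC x)))⟩

@[fun_prop]
lemma BddMeas.pow [NormedRing E] [MeasurableSpace E] [MeasurableMul₂ E] {u : X → E}
    (hu : BddMeas u) (n : ℕ) : BddMeas (fun x => u x ^ n) := by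
  induction n with
  | zero => simpa using BddMeas.const (1 : E)
  | succ n ih => simp only [pow_succ]; exact ih.mul hu

@[fun_prop]
lemma BddMeas.div_const [NormedField E] [MeasurableSpace E] [MeasurableMul₂ E] {u : X → E}
    (hu : BddMeas u) (c : E) : BddMeas (fun x => u x / c) := by
  simp only [div_eq_mul_inv]; exact hu.mul (BddMeas.const _)

@[fun_prop]
lemma BddMeas.ofReal {u : X → ℝ} (hu : BddMeas u) : BddMeas (fun x => (u x : ℂ)) := by
  obtain ⟨hu, C, hC⟩ := hu
  exact ⟨by fun_prop, C, fun x => by simpa using hC x⟩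

@[fun_prop]
lemma BddMeas.norm {u : X → ℂ} (hu : BddMeas u) : BddMeas (fun x => ‖u x‖) := by
  obtain ⟨hu, C, hC⟩ := hu
  exact ⟨by fun_prop, C, fun x => by simpa using hC x⟩

@[fun_prop]
lemma BddMeas.re {u : X → ℂ} (hu : BddMeas u) : BddMeas (fun x => (u x).re) := by
  obtain ⟨hu, C, hC⟩ := hu
  exact ⟨by fun_prop, C, fun x => (Complex.abs_re_le_norm _).trans (hC x)⟩

@[fun_prop]
lemma BddMeas.im {u : X → ℂ} (hu : BddMeas u) : BddMeas (fun x => (u x).im) := by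
  obtain ⟨hu, C, hC⟩ := hu
  exact ⟨by fun_prop, C, fun x => (Complex.abs_im_le_norm _).trans (hC x)⟩

@[fun_prop]
lemma BddMeas.conj {u : X → ℂ} (hu : BddMeas u) : BddMeas (fun x => (starRingEnd ℂ) (u x)) := by
  obtain ⟨hu, C, hC⟩ := hu
  exact ⟨Complex.continuous_conj.measurable.comp hu, C, fun x => by simpa using hC x⟩

lemma BddMeas.inv [NormedField E] [MeasurableSpace E] [MeasurableInv E] {u : X → E}
    (hu : BddMeas u) {c : ℝ} (hc : 0 < c) (h : ∀ x, c ≤ ‖u x‖) : BddMeas (fun x => (u x)⁻¹) :=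
  ⟨hu.1.inv, c⁻¹, fun x => by rw [norm_inv]; exact inv_anti₀ hc (h x)⟩

lemma BddMeas.inv_real {u : X → ℝ} (hu : BddMeas u) {c : ℝ} (hc : 0 < c) (h : ∀ x, c ≤ u x) :
    BddMeas (fun x => (u x)⁻¹) :=
  hu.inv hc fun x => (h x).trans (le_abs_self _)

lemma BddMeas.le_const {u : X → ℝ} (hu : BddMeas u) : ∃ C, 0 < C ∧ ∀ x, |u x| ≤ C := by
  obtain ⟨_, C, hC⟩ := hu
  exact ⟨max C 1, by positivity, fun x => (hC x).trans (le_max_left _ _)⟩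

lemma BddMeas.norm_le_const [NormedAddCommGroup E] [MeasurableSpace E] {u : X → E}
    (hu : BddMeas u) : ∃ C, 0 < C ∧ ∀ x, ‖u x‖ ≤ C := by
  obtain ⟨_, C, hC⟩ := hu
  exact ⟨max C 1, by positivity, fun x => (hC x).trans (le_max_left _ _)⟩

lemma BddMeas.integrable [NormedAddCommGroup E] [MeasurableSpace E] [BorelSpace E]
    [SecondCountableTopology E] {π : Measure X} [IsFiniteMeasure π] {u : X → E}
    (hu : BddMeas u) : Integrable u π := by
  obtain ⟨hu, C, hC⟩ := hu
  exact Integrable.of_bound hu.aestronglyMeasurable C (Eventually.of_forall hC)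

lemma le_integral_of_const_le {π : Measure X} [IsProbabilityMeasure π] {g : X → ℝ} {c : ℝ}
    (hg : BddMeas g) (h : ∀ x, c ≤ g x) : c ≤ ∫ x, g x ∂π := by
  simpa using integral_mono (μ := π) (integrable_const c) hg.integrable h

lemma integral_le_of_le_const {π : Measure X} [IsProbabilityMeasure π] {g : X → ℝ} {c : ℝ}
    (hg : BddMeas g) (h : ∀ x, g x ≤ c) : ∫ x, g x ∂π ≤ c := by
  simpa using integral_mono (μ := π) hg.integrable (integrable_const c) h

end Bounded

/-! ### The Cauchy–Schwarz inequality and the norm of `L²` -/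

section CauchySchwarz

variable {X : Type*} [MeasurableSpace X] {π : Measure X}

/-- The Cauchy–Schwarz inequality in pointwise form: it serves weighted integrals as well. -/
lemma sq_integral_le_mul {a b c : X → ℝ} (ha : Integrable a π) (hb : Integrable b π)
    (hc : Integrable c π) (ha0 : ∀ x, 0 ≤ a x) (hb0 : ∀ x, 0 ≤ b x)
    (h : ∀ x, c x ^ 2 ≤ a x * b x) : (∫ x, c x ∂π) ^ 2 ≤ (∫ x, a x ∂π) * ∫ x, b x ∂π := by
  -- the quadratic polynomial `∫ (t² a + 2 t c + b)` is non-negative, so its discriminant is `≤ 0`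
  have key : ∀ t : ℝ, 0 ≤ (∫ x, a x ∂π) * (t * t) + (2 * ∫ x, c x ∂π) * t + ∫ x, b x ∂π := by
    intro t
    have h1 : 0 ≤ ∫ x, (t * t * a x + 2 * t * c x + b x) ∂π := by
      refine integral_nonneg fun x => ?_
      rcases (ha0 x).eq_or_lt with h0 | h0
      · have : c x = 0 := by have := h x; rw [← h0] at this; nlinarith
        simp [← h0, this, hb0 x]
      · have : 0 ≤ a x * (t * t * a x + 2 * t * c x + b x) := by
          nlinarith [sq_nonneg (a x * t + c x), h x]
        exact nonneg_of_mul_nonneg_right this h0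
    rw [integral_add (by fun_prop) (by fun_prop), integral_add (by fun_prop) (by fun_prop),
      integral_const_mul, integral_const_mul] at h1
    linarith
  have := discrim_le_zero key
  unfold discrim at this
  nlinarith

end CauchySchwarz

section LTwo

variable {X : Type*} [MeasurableSpace X] {π : Measure X}

/-- The norm of `L²(X, π)`, for bounded measurable functions. -/
noncomputable def n2 (π : Measure X) (w : X → ℂ) : ℝ := √(∫ x, ‖w x‖ ^ 2 ∂π)

lemma n2_nonneg (w : X → ℂ) : 0 ≤ n2 π w := Real.sqrt_nonneg _

lemma n2_sq (w : X → ℂ) : n2 π w ^ 2 = ∫ x, ‖w x‖ ^ 2 ∂π :=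
  Real.sq_sqrt (integral_nonneg fun _ => by positivity)

variable [IsProbabilityMeasure π]

lemma n2_le_of_bound {w : X → ℂ} {C : ℝ} (hw : BddMeas w) (hC : ∀ x, ‖w x‖ ≤ C) :
    n2 π w ≤ C := by
  have hC0 : 0 ≤ C := by
    obtain ⟨x⟩ := π.nonempty_of_neZero
    exact (norm_nonneg _).trans (hC x)
  refine Real.sqrt_le_iff.2 ⟨hC0, ?_⟩
  calc ∫ x, ‖w x‖ ^ 2 ∂π ≤ ∫ _, C ^ 2 ∂π := by
        refine integral_mono (BddMeas.integrable (by fun_prop)) (integrable_const _) fun x => ?_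
        exact pow_le_pow_left₀ (norm_nonneg _) (hC x) 2
    _ = C ^ 2 := by simp

lemma n2_mono {u w : X → ℂ} (hu : BddMeas u) (hw : BddMeas w) (h : ∀ x, ‖u x‖ ≤ ‖w x‖) :
    n2 π u ≤ n2 π w := by
  refine Real.sqrt_le_sqrt (integral_mono (BddMeas.integrable (by fun_prop))
    (BddMeas.integrable (by fun_prop)) fun x => ?_)
  exact pow_le_pow_left₀ (norm_nonneg _) (h x) 2

omit [IsProbabilityMeasure π] in
lemma n2_congr {u w : X → ℂ} (h : ∀ x, ‖u x‖ = ‖w x‖) : n2 π u = n2 π w := by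
  simp only [n2, h]

lemma integral_norm_mul_le_n2 {u w : X → ℂ} (hu : BddMeas u) (hw : BddMeas w) :
    ∫ x, ‖u x‖ * ‖w x‖ ∂π ≤ n2 π u * n2 π w := by
  refine le_of_sq_le_sq ?_ (mul_nonneg (n2_nonneg _) (n2_nonneg _))
  rw [mul_pow, n2_sq, n2_sq]
  refine sq_integral_le_mul (BddMeas.integrable (by fun_prop)) (BddMeas.integrable (by fun_prop))
    (BddMeas.integrable (by fun_prop)) (fun x => by positivity) (fun x => by positivity)
    fun x => (mul_pow _ _ _).le

lemma norm_integral_mul_le_n2 {u w : X → ℂ} (hu : BddMeas u) (hw : BddMeas w) :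
    ‖∫ x, u x * w x ∂π‖ ≤ n2 π u * n2 π w := by
  refine (norm_integral_le_integral_norm _).trans ?_
  simp only [norm_mul]
  exact integral_norm_mul_le_n2 hu hw

lemma integral_norm_le_n2 {w : X → ℂ} (hw : BddMeas w) : ∫ x, ‖w x‖ ∂π ≤ n2 π w := by
  have h := integral_norm_mul_le_n2 (π := π) (u := fun _ => 1) (by fun_prop) hw
  have h1 : n2 π (fun _ => (1 : ℂ)) = 1 := by simp [n2]
  simpa [h1] using h

lemma n2_add_le {u w : X → ℂ} (hu : BddMeas u) (hw : BddMeas w) :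
    n2 π (fun x => u x + w x) ≤ n2 π u + n2 π w := by
  refine le_of_sq_le_sq ?_ (add_nonneg (n2_nonneg _) (n2_nonneg _))
  have h1 : ∫ x, ‖u x + w x‖ ^ 2 ∂π
      ≤ ∫ x, (‖u x‖ ^ 2 + 2 * (‖u x‖ * ‖w x‖) + ‖w x‖ ^ 2) ∂π := by
    refine integral_mono (BddMeas.integrable (by fun_prop)) (BddMeas.integrable (by fun_prop))
      fun x => ?_
    calc ‖u x + w x‖ ^ 2 ≤ (‖u x‖ + ‖w x‖) ^ 2 :=
          pow_le_pow_left₀ (norm_nonneg _) (norm_add_le _ _) 2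
      _ = _ := by ring
  rw [integral_add (BddMeas.integrable (by fun_prop)) (BddMeas.integrable (by fun_prop)),
    integral_add (BddMeas.integrable (by fun_prop)) (BddMeas.integrable (by fun_prop)),
    integral_const_mul, ← n2_sq u, ← n2_sq w] at h1
  nlinarith [n2_sq (π := π) (fun x => u x + w x), integral_norm_mul_le_n2 (π := π) hu hw]

omit [IsProbabilityMeasure π] in
lemma n2_const_mul (c : ℂ) (w : X → ℂ) : n2 π (fun x => c * w x) = ‖c‖ * n2 π w := by
  simp only [n2, norm_mul, mul_pow]
  rw [integral_const_mul, Real.sqrt_mul (by positivity), Real.sqrt_sq (norm_nonneg _)]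

end LTwo

/-! ### Integral operators with symmetric kernels -/

section Kernel

variable {X : Type*} [MeasurableSpace X] {π : Measure X} [IsProbabilityMeasure π]

/-- The integral operator with kernel `k` on real functions. -/
noncomputable def rOp (π : Measure X) (k : X → X → ℝ) (g : X → ℝ) : X → ℝ :=
  fun x => ∫ y, k x y * g y ∂π

lemma IsSymmKernel.bddMeas {k : X → X → ℝ} (hk : IsSymmKernel k) (x : X) :
    BddMeas (fun y => k x y) := by
  obtain ⟨C, hC⟩ := hk.bounded
  exact ⟨hk.measurable.comp measurable_prodMk_left, C, fun y => by
    rw [Real.norm_of_nonneg (hk.nonneg x y)]; exact hC x y⟩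

lemma IsSymmKernel.bddMeas_right {k : X → X → ℝ} (hk : IsSymmKernel k) (y : X) :
    BddMeas (fun x => k x y) := by
  simpa only [hk.symm y] using hk.bddMeas y

lemma IsSymmKernel.exists_bound {k : X → X → ℝ} (hk : IsSymmKernel k) :
    ∃ M, 0 < M ∧ ∀ x y, k x y ≤ M := by
  obtain ⟨C, hC⟩ := hk.bounded
  exact ⟨max C 1, by positivity, fun x y => (hC x y).trans (le_max_left _ _)⟩

omit [IsProbabilityMeasure π] in
lemma intOp_ofReal (k : X → X → ℝ) (g : X → ℝ) (x : X) :
    intOp π k (fun y => (g y : ℂ)) x = (rOp π k g x : ℂ) := by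
  simp only [intOp, rOp, ← Complex.ofReal_mul]
  exact integral_ofReal

omit [IsProbabilityMeasure π] in
lemma norm_intOp_le {k : X → X → ℝ} (hk : IsSymmKernel k) (w : X → ℂ) (x : X) :
    ‖intOp π k w x‖ ≤ rOp π k (fun y => ‖w y‖) x := by
  refine (norm_integral_le_integral_norm _).trans_eq (integral_congr_ae (.of_forall fun y => ?_))
  simp [abs_of_nonneg (hk.nonneg x y)]

/-- Bounded kernels map `L²` to bounded functions; this is how estimates in `L²` become uniform. -/
lemma norm_intOp_le_n2 {k : X → X → ℝ} (hk : IsSymmKernel k) {M : ℝ} (hM : ∀ x y, k x y ≤ M)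
    {w : X → ℂ} (hw : BddMeas w) (x : X) : ‖intOp π k w x‖ ≤ M * n2 π w := by
  have hM0 : 0 ≤ M := (hk.nonneg x x).trans (hM x x)
  have hb := hk.bddMeas x
  calc ‖intOp π k w x‖ ≤ rOp π k (fun y => ‖w y‖) x := norm_intOp_le hk w x
    _ ≤ ∫ y, M * ‖w y‖ ∂π := by
        refine integral_mono (BddMeas.integrable (by fun_prop)) (BddMeas.integrable (by fun_prop))
          fun y => ?_
        exact mul_le_mul_of_nonneg_right (hM x y) (norm_nonneg _)
    _ = M * ∫ y, ‖w y‖ ∂π := integral_const_mul _ _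
    _ ≤ M * n2 π w := mul_le_mul_of_nonneg_left (integral_norm_le_n2 hw) hM0

lemma rOp_mono {k : X → X → ℝ} (hk : IsSymmKernel k) {g h : X → ℝ} (hg : BddMeas g)
    (hh : BddMeas h) (hgh : ∀ x, g x ≤ h x) (x : X) : rOp π k g x ≤ rOp π k h x := by
  have hb := hk.bddMeas x
  exact integral_mono (BddMeas.integrable (by fun_prop)) (BddMeas.integrable (by fun_prop))
    fun y => mul_le_mul_of_nonneg_left (hgh y) (hk.nonneg x y)

omit [IsProbabilityMeasure π] in
lemma rOp_nonneg {k : X → X → ℝ} (hk : IsSymmKernel k) {g : X → ℝ} (hg : ∀ x, 0 ≤ g x) (x : X) :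
    0 ≤ rOp π k g x :=
  integral_nonneg fun y => mul_nonneg (hk.nonneg x y) (hg y)

lemma rOp_le {k : X → X → ℝ} (hk : IsSymmKernel k) {M : ℝ} (hM : ∀ x y, k x y ≤ M) {g : X → ℝ}
    (hg : BddMeas g) (h0 : ∀ x, 0 ≤ g x) (x : X) : rOp π k g x ≤ M * ∫ y, g y ∂π := by
  have hb := hk.bddMeas x
  rw [← integral_const_mul]
  exact integral_mono (BddMeas.integrable (by fun_prop)) (BddMeas.integrable (by fun_prop))
    fun y => mul_le_mul_of_nonneg_right (hM x y) (h0 y)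

lemma rOp_le_const {k : X → X → ℝ} (hk : IsSymmKernel k) {M C : ℝ} (hM : ∀ x y, k x y ≤ M)
    (hM0 : 0 ≤ M) {g : X → ℝ} (hg : BddMeas g) (h0 : ∀ x, 0 ≤ g x) (hC : ∀ x, g x ≤ C) (x : X) :
    rOp π k g x ≤ M * C := by
  refine (rOp_le hk hM hg h0 x).trans (mul_le_mul_of_nonneg_left ?_ hM0)
  calc ∫ y, g y ∂π ≤ ∫ _, C ∂π := integral_mono hg.integrable (integrable_const _) hC
    _ = C := by simp

@[fun_prop]
lemma BddMeas.rOp {k : X → X → ℝ} (hk : IsSymmKernel k) {g : X → ℝ} (hg : BddMeas g) :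
    BddMeas (fun x => rOp π k g x) := by
  obtain ⟨M, hM0, hM⟩ := hk.exists_bound
  obtain ⟨C, hC0, hC⟩ := hg.le_const
  refine ⟨?_, M * C, fun x => ?_⟩
  · have : StronglyMeasurable (Function.uncurry fun x y => k x y * g y) :=
      (hk.measurable.mul (hg.1.comp measurable_snd)).stronglyMeasurable
    exact this.integral_prod_right.measurable
  · have := (norm_integral_le_integral_norm (μ := π) (f := fun y => k x y * g y)).trans
      (integral_mono (g := fun _ => M * C) (BddMeas.integrable ?_) (integrable_const _) fun y => ?_)
    · simpa [QVE.rOp] using this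
    · have hb := hk.bddMeas x
      exact ⟨by have := (hb.mul hg).1; fun_prop, (hb.mul hg).2.imp fun _ h y => by simpa using h y⟩
    · simp only [norm_mul, Real.norm_eq_abs, abs_of_nonneg (hk.nonneg x y)]
      exact mul_le_mul (hM x y) (hC y) (abs_nonneg _) hM0.le

@[fun_prop]
lemma BddMeas.intOp {k : X → X → ℝ} (hk : IsSymmKernel k) {w : X → ℂ} (hw : BddMeas w) :
    BddMeas (fun x => intOp π k w x) := by
  obtain ⟨M, hM0, hM⟩ := hk.exists_bound
  refine ⟨?_, M * n2 π w, norm_intOp_le_n2 hk hM hw⟩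
  have : StronglyMeasurable (Function.uncurry fun x y => (k x y : ℂ) * w y) :=
    ((Complex.measurable_ofReal.comp hk.measurable).mul
      (hw.1.comp measurable_snd)).stronglyMeasurable
  exact this.integral_prod_right.measurable

lemma intOp_add {k : X → X → ℝ} (hk : IsSymmKernel k) {u w : X → ℂ} (hu : BddMeas u)
    (hw : BddMeas w) (x : X) :
    intOp π k (fun y => u y + w y) x = intOp π k u x + intOp π k w x := by
  have hb := hk.bddMeas x
  simp only [intOp, mul_add]
  exact integral_add (BddMeas.integrable (by fun_prop)) (BddMeas.integrable (by fun_prop))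

lemma intOp_sub {k : X → X → ℝ} (hk : IsSymmKernel k) {u w : X → ℂ} (hu : BddMeas u)
    (hw : BddMeas w) (x : X) :
    intOp π k (fun y => u y - w y) x = intOp π k u x - intOp π k w x := by
  have hb := hk.bddMeas x
  simp only [intOp, mul_sub]
  exact integral_sub (BddMeas.integrable (by fun_prop)) (BddMeas.integrable (by fun_prop))

omit [IsProbabilityMeasure π] in
lemma intOp_const_mul (k : X → X → ℝ) (c : ℂ) (w : X → ℂ) (x : X) :
    intOp π k (fun y => c * w y) x = c * intOp π k w x := by
  simp only [intOp, ← integral_const_mul]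
  congr 1; ext y; ring

lemma rOp_sub {k : X → X → ℝ} (hk : IsSymmKernel k) {u w : X → ℝ} (hu : BddMeas u)
    (hw : BddMeas w) (x : X) : rOp π k (fun y => u y - w y) x = rOp π k u x - rOp π k w x := by
  have hb := hk.bddMeas x
  simp only [rOp, mul_sub]
  exact integral_sub (BddMeas.integrable (by fun_prop)) (BddMeas.integrable (by fun_prop))

omit [IsProbabilityMeasure π] in
lemma rOp_const_mul (k : X → X → ℝ) (c : ℝ) (g : X → ℝ) (x : X) :
    rOp π k (fun y => c * g y) x = c * rOp π k g x := by
  simp only [rOp, ← integral_const_mul]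
  congr 1; ext y; ring

lemma intOp_im {k : X → X → ℝ} (hk : IsSymmKernel k) {w : X → ℂ} (hw : BddMeas w) (x : X) :
    (intOp π k w x).im = rOp π k (fun y => (w y).im) x := by
  have hb := hk.bddMeas x
  have h := integral_im (𝕜 := ℂ) (μ := π) (f := fun y => (k x y : ℂ) * w y)
    (BddMeas.integrable (by fun_prop))
  simp only [intOp, rOp]
  exact (by simpa using h.symm)

omit [IsProbabilityMeasure π] in
lemma intOp_conj (k : X → X → ℝ) (w : X → ℂ) (x : X) :
    intOp π k (fun y => (starRingEnd ℂ) (w y)) x = (starRingEnd ℂ) (intOp π k w x) := by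
  simp only [intOp, ← integral_conj, map_mul, Complex.conj_ofReal]

/-- An integral operator with symmetric kernel is symmetric for the bilinear pairing. -/
lemma integral_mul_intOp {k : X → X → ℝ} (hk : IsSymmKernel k) {u w : X → ℂ} (hu : BddMeas u)
    (hw : BddMeas w) : ∫ x, u x * intOp π k w x ∂π = ∫ x, intOp π k u x * w x ∂π := by
  obtain ⟨M, hM0, hM⟩ := hk.exists_bound
  obtain ⟨C, hC0, hC⟩ := hu.norm_le_const
  obtain ⟨D, hD0, hD⟩ := hw.norm_le_const
  have hint : Integrable (Function.uncurry fun x y => u x * ((k x y : ℂ) * w y)) (π.prod π) := by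
    refine Integrable.of_bound (C := C * (M * D)) (((hu.1.comp measurable_fst).mul
      ((Complex.measurable_ofReal.comp hk.measurable).mul
        (hw.1.comp measurable_snd))).aestronglyMeasurable) (.of_forall fun p => ?_)
    simp only [Function.uncurry, norm_mul, Complex.norm_real, Real.norm_eq_abs,
      abs_of_nonneg (hk.nonneg _ _)]
    exact mul_le_mul (hC _) (mul_le_mul (hM _ _) (hD _) (norm_nonneg _) hM0.le)
      (mul_nonneg (hk.nonneg _ _) (norm_nonneg _)) hC0.le
  calc ∫ x, u x * intOp π k w x ∂π = ∫ x, ∫ y, u x * ((k x y : ℂ) * w y) ∂π ∂π := by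
        simp only [intOp, integral_const_mul]
    _ = ∫ y, ∫ x, u x * ((k x y : ℂ) * w y) ∂π ∂π := integral_integral_swap hint
    _ = ∫ x, intOp π k u x * w x ∂π := by
        simp only [intOp, ← integral_mul_const]
        congr 1; ext y; congr 1; ext x
        rw [hk.symm x y]; ring

lemma integral_mul_rOp {k : X → X → ℝ} (hk : IsSymmKernel k) {u w : X → ℝ} (hu : BddMeas u)
    (hw : BddMeas w) : ∫ x, u x * rOp π k w x ∂π = ∫ x, rOp π k u x * w x ∂π := by
  have h := integral_mul_intOp (π := π) hk hu.ofReal hw.ofReal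
  simp only [intOp_ofReal, ← Complex.ofReal_mul] at h
  exact Complex.ofReal_injective (integral_ofReal.symm.trans (h.trans integral_ofReal))

end Kernel

/-! ### The Schur test -/

section Schur

variable {X : Type*} [MeasurableSpace X] {π : Measure X} [IsProbabilityMeasure π]

/-- **Schur test.** A symmetric non-negative kernel with a positive `f` such that `k f ≤ μ f` has
norm at most `μ` on `L²`. The function `w` is only required to be square integrable. -/
lemma integral_norm_sq_intOp_le {k : X → X → ℝ} (hk : IsSymmKernel k) {f : X → ℝ}
    (hf : BddMeas f) {c μ : ℝ} (hc : 0 < c) (hcf : ∀ x, c ≤ f x) (hμ : 0 ≤ μ)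
    (hkf : ∀ x, rOp π k f x ≤ μ * f x) {w : X → ℂ} (hw : Measurable w)
    (hw2 : Integrable (fun x => ‖w x‖ ^ 2) π) :
    Integrable (fun x => ‖intOp π k w x‖ ^ 2) π ∧
      ∫ x, ‖intOp π k w x‖ ^ 2 ∂π ≤ μ ^ 2 * ∫ x, ‖w x‖ ^ 2 ∂π := by
  obtain ⟨M, hM0, hM⟩ := hk.exists_bound
  obtain ⟨D, hD0, hD⟩ := hf.le_const
  have hfpos : ∀ x, 0 < f x := fun x => hc.trans_le (hcf x)
  have hw1 : Integrable (fun x => ‖w x‖) π := by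
    refine (hw2.add (integrable_const (1 : ℝ))).mono' hw.norm.aestronglyMeasurable
      (.of_forall fun x => ?_)
    simp only [norm_norm, Pi.add_apply]
    nlinarith [sq_nonneg (‖w x‖ - 1), norm_nonneg (w x)]
  have hwf : Integrable (fun x => ‖w x‖ ^ 2 / f x) π := by
    refine (hw2.const_mul c⁻¹).mono' ((hw.norm.pow_const 2).div hf.1).aestronglyMeasurable
      (.of_forall fun x => ?_)
    rw [Real.norm_of_nonneg (by have := hfpos x; positivity), div_eq_mul_inv, mul_comm]
    exact mul_le_mul_of_nonneg_right (inv_anti₀ hc (hcf x)) (by positivity)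
  have hkI : ∀ (g : X → ℝ), Integrable g π → ∀ x, Integrable (fun y => k x y * g y) π := by
    intro g hg x
    refine hg.bdd_mul (c := M) (hk.bddMeas x).1.aestronglyMeasurable (.of_forall fun y => ?_)
    rw [Real.norm_of_nonneg (hk.nonneg x y)]; exact hM x y
  -- Cauchy–Schwarz for `k |w| = √(k f) √(k |w|² / f)`, and `k f ≤ μ f` in the first factor
  have h1 : ∀ x, ‖intOp π k w x‖ ^ 2 ≤ μ * (f x * ∫ y, k x y * (‖w y‖ ^ 2 / f y) ∂π) := by
    intro x
    have h2 : ‖intOp π k w x‖ ^ 2 ≤ (∫ y, k x y * ‖w y‖ ∂π) ^ 2 :=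
      pow_le_pow_left₀ (norm_nonneg _) (norm_intOp_le hk w x) 2
    have h3 : (∫ y, k x y * ‖w y‖ ∂π) ^ 2
        ≤ (∫ y, k x y * f y ∂π) * ∫ y, k x y * (‖w y‖ ^ 2 / f y) ∂π := by
      refine sq_integral_le_mul (hkI _ hf.integrable x) (hkI _ hwf x) (hkI _ hw1 x)
        (fun y => mul_nonneg (hk.nonneg x y) (hfpos y).le)
        (fun y => mul_nonneg (hk.nonneg x y) (by have := hfpos y; positivity)) fun y => le_of_eq ?_
      have := (hfpos y).ne'
      field_simp
    refine h2.trans (h3.trans ?_)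
    rw [← mul_assoc]
    exact mul_le_mul_of_nonneg_right (hkf x)
      (integral_nonneg fun y => mul_nonneg (hk.nonneg x y) (by have := hfpos y; positivity))
  have hmeas : Measurable (fun x => intOp π k w x) := by
    have : StronglyMeasurable (Function.uncurry fun x y => (k x y : ℂ) * w y) :=
      ((Complex.measurable_ofReal.comp hk.measurable).mul
        (hw.comp measurable_snd)).stronglyMeasurable
    exact this.integral_prod_right.measurable
  -- Fubini, with `k f ≤ μ f` applied in the other variable
  have hprod : Integrable (Function.uncurry fun x y => f x * (k x y * (‖w y‖ ^ 2 / f y)))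
      (π.prod π) := by
    have h4 : Integrable (fun p : X × X => ‖w p.2‖ ^ 2 / f p.2) (π.prod π) := hwf.comp_snd π
    have h5 := h4.bdd_mul (f := fun p : X × X => f p.1 * k p.1 p.2) (c := D * M)
      ((hf.1.comp measurable_fst).mul hk.measurable).aestronglyMeasurable
      (.of_forall fun p => by
        rw [norm_mul, Real.norm_of_nonneg (hk.nonneg _ _)]
        exact mul_le_mul (hD _) (hM _ _) (hk.nonneg _ _) hD0.le)
    refine h5.congr (.of_forall fun p => ?_)
    simp only [Function.uncurry]; ring
  have hI : Integrable (fun x => μ * (f x * ∫ y, k x y * (‖w y‖ ^ 2 / f y) ∂π)) π := by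
    have := hprod.integral_prod_left
    simp only [Function.uncurry, integral_const_mul] at this
    exact this.const_mul μ
  have hI' : Integrable (fun x => ‖intOp π k w x‖ ^ 2) π :=
    hI.mono' (hmeas.norm.pow_const 2).aestronglyMeasurable (.of_forall fun x => by
      rw [Real.norm_of_nonneg (by positivity)]; exact h1 x)
  refine ⟨hI', ?_⟩
  calc ∫ x, ‖intOp π k w x‖ ^ 2 ∂π
      ≤ ∫ x, μ * (f x * ∫ y, k x y * (‖w y‖ ^ 2 / f y) ∂π) ∂π := integral_mono hI' hI h1
    _ = μ * ∫ x, ∫ y, f x * (k x y * (‖w y‖ ^ 2 / f y)) ∂π ∂π := by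
        simp only [integral_const_mul]
    _ = μ * ∫ y, ∫ x, f x * (k x y * (‖w y‖ ^ 2 / f y)) ∂π ∂π := by
        rw [integral_integral_swap hprod]
    _ = μ * ∫ y, rOp π k f y * (‖w y‖ ^ 2 / f y) ∂π := by
        congr 2; ext y
        simp only [rOp, ← integral_mul_const]
        congr 1; ext x
        rw [hk.symm x y]; ring
    _ ≤ μ * ∫ y, μ * ‖w y‖ ^ 2 ∂π := by
        refine mul_le_mul_of_nonneg_left (integral_mono_of_nonneg (.of_forall fun y => ?_)
          (hw2.const_mul μ) (.of_forall fun y => ?_)) hμ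
        · exact mul_nonneg (rOp_nonneg hk (fun x => (hfpos x).le) y)
            (by have := hfpos y; positivity)
        · have h6 := mul_le_mul_of_nonneg_right (hkf y)
            (show 0 ≤ ‖w y‖ ^ 2 / f y by have := hfpos y; positivity)
          refine h6.trans_eq ?_
          have := (hfpos y).ne'
          field_simp
    _ = μ ^ 2 * ∫ x, ‖w x‖ ^ 2 ∂π := by rw [integral_const_mul]; ring

lemma n2_intOp_le {k : X → X → ℝ} (hk : IsSymmKernel k) {f : X → ℝ} (hf : BddMeas f) {c μ : ℝ}
    (hc : 0 < c) (hcf : ∀ x, c ≤ f x) (hμ : 0 ≤ μ) (hkf : ∀ x, rOp π k f x ≤ μ * f x) {w : X → ℂ}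
    (hw : BddMeas w) : n2 π (fun x => intOp π k w x) ≤ μ * n2 π w := by
  refine le_of_sq_le_sq ?_ (mul_nonneg hμ (n2_nonneg _))
  rw [mul_pow, n2_sq, n2_sq]
  exact (integral_norm_sq_intOp_le hk hf hc hcf hμ hkf hw.1 (BddMeas.integrable (by fun_prop))).2

end Schur

/-! ### Powers of an integral operator -/

section KernelPow

variable {X : Type*} [MeasurableSpace X] {π : Measure X} [IsProbabilityMeasure π]

omit [IsProbabilityMeasure π] in
lemma kernelPow_nonneg {k : X → X → ℝ} (hk : IsSymmKernel k) (n : ℕ) :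
    ∀ x y, 0 ≤ kernelPow π k n x y := by
  induction n with
  | zero => exact hk.nonneg
  | succ n ih => exact fun x y => integral_nonneg fun u => mul_nonneg (hk.nonneg x u) (ih u y)

lemma measurable_kernelPow {k : X → X → ℝ} (hk : IsSymmKernel k) (n : ℕ) :
    Measurable (Function.uncurry (kernelPow π k n)) := by
  induction n with
  | zero => exact hk.measurable
  | succ n ih =>
    have : StronglyMeasurable (fun q : (X × X) × X => k q.1.1 q.2 * kernelPow π k n q.2 q.1.2) :=
      ((hk.measurable.comp ((measurable_fst.comp measurable_fst).prodMk measurable_snd)).mul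
        (ih.comp (measurable_snd.prodMk (measurable_snd.comp measurable_fst)))).stronglyMeasurable
    exact (this.integral_prod_right' (ν := π)).measurable

lemma kernelPow_le {k : X → X → ℝ} (hk : IsSymmKernel k) {M : ℝ} (hM : ∀ x y, k x y ≤ M)
    (hM0 : 0 ≤ M) (n : ℕ) : ∀ x y, kernelPow π k n x y ≤ M ^ (n + 1) := by
  induction n with
  | zero => simpa [kernelPow] using hM
  | succ n ih =>
    intro x y
    have hb : BddMeas (fun u => kernelPow π k n u y) :=
      ⟨(measurable_kernelPow hk n).comp measurable_prodMk_right, M ^ (n + 1), fun u => by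
        rw [Real.norm_of_nonneg (kernelPow_nonneg hk n u y)]; exact ih u y⟩
    have := rOp_le_const (π := π) hk hM hM0 hb (fun u => kernelPow_nonneg hk n u y)
      (fun u => ih u y) x
    rw [pow_succ']; exact this

lemma bddMeas_kernelPow_right {k : X → X → ℝ} (hk : IsSymmKernel k) (n : ℕ) (y : X) :
    BddMeas (fun u => kernelPow π k n u y) := by
  obtain ⟨M, hM0, hM⟩ := hk.exists_bound
  exact ⟨(measurable_kernelPow hk n).comp measurable_prodMk_right, M ^ (n + 1), fun u => by
    rw [Real.norm_of_nonneg (kernelPow_nonneg hk n u y)]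
    exact kernelPow_le hk hM hM0.le n u y⟩

lemma bddMeas_rOp_iterate {k : X → X → ℝ} (hk : IsSymmKernel k) {g : X → ℝ} (hg : BddMeas g)
    (n : ℕ) : BddMeas ((rOp π k)^[n] g) := by
  induction n with
  | zero => exact hg
  | succ n ih => rw [Function.iterate_succ_apply']; exact ih.rOp hk

lemma bddMeas_intOp_iterate {k : X → X → ℝ} (hk : IsSymmKernel k) {g : X → ℂ} (hg : BddMeas g)
    (n : ℕ) : BddMeas ((intOp π k)^[n] g) := by
  induction n with
  | zero => exact hg
  | succ n ih => rw [Function.iterate_succ_apply']; exact ih.intOp hk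

lemma integral_mul_rOp_iterate {k : X → X → ℝ} (hk : IsSymmKernel k) {u w : X → ℝ}
    (hu : BddMeas u) (hw : BddMeas w) (n : ℕ) :
    ∫ x, u x * (rOp π k)^[n] w x ∂π = ∫ x, (rOp π k)^[n] u x * w x ∂π := by
  induction n generalizing u with
  | zero => rfl
  | succ n ih =>
    simp only [Function.iterate_succ_apply' _ _ w]
    rw [integral_mul_rOp hk hu (bddMeas_rOp_iterate hk hw n), ih (hu.rOp hk)]
    rfl

omit [IsProbabilityMeasure π] in
/-- Iterating the operator in the first variable only reduces facts about the kernels of powers to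
facts about iterates. -/
lemma kernelPow_eq_iterate (k : X → X → ℝ) (n : ℕ) (y : X) :
    (fun x => kernelPow π k n x y) = (rOp π k)^[n] (fun x => k x y) := by
  induction n with
  | zero => rfl
  | succ n ih => rw [Function.iterate_succ_apply', ← ih]; rfl

lemma kernelPow_symm {k : X → X → ℝ} (hk : IsSymmKernel k) (n : ℕ) (x y : X) :
    kernelPow π k n x y = kernelPow π k n y x := by
  rcases n with - | n
  · exact hk.symm x y
  · have h : ∀ x y, kernelPow π k (n + 1) x y = ∫ u, k x u * (rOp π k)^[n] (fun v => k v y) u ∂π :=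
      fun x y => by rw [← kernelPow_eq_iterate]; rfl
    have e : (fun v => k v x) = fun v => k x v := funext fun v => hk.symm v x
    rw [h, h, integral_mul_rOp_iterate hk (hk.bddMeas x) (hk.bddMeas_right y), e]
    congr 1; ext u
    rw [hk.symm y u, mul_comm]

lemma isSymmKernel_kernelPow {k : X → X → ℝ} (hk : IsSymmKernel k) (n : ℕ) :
    IsSymmKernel (kernelPow π k n) := by
  obtain ⟨M, hM0, hM⟩ := hk.exists_bound
  exact ⟨measurable_kernelPow hk n, ⟨M ^ (n + 1), kernelPow_le hk hM hM0.le n⟩,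
    kernelPow_nonneg hk n, kernelPow_symm hk n⟩

/-- `kernelPow π k n` is the kernel of the `(n + 1)`-st power of the operator. -/
lemma rOp_kernelPow {k : X → X → ℝ} (hk : IsSymmKernel k) {g : X → ℝ} (hg : BddMeas g) (n : ℕ)
    (x : X) : rOp π (kernelPow π k n) g x = (rOp π k)^[n + 1] g x := by
  have h1 : rOp π (kernelPow π k n) g x = ∫ y, (rOp π k)^[n] (fun u => k u x) y * g y ∂π := by
    rw [← kernelPow_eq_iterate]
    simp only [rOp, kernelPow_symm hk n x]
  rw [h1, ← integral_mul_rOp_iterate hk (hk.bddMeas_right x) hg, Function.iterate_succ_apply']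
  simp only [hk.symm _ x]
  rfl

lemma intOp_iterate_eq (k : X → X → ℝ) (hk : IsSymmKernel k) {w : X → ℂ} (hw : BddMeas w)
    (n : ℕ) (x : X) : (intOp π k)^[n] w x
      = ((rOp π k)^[n] (fun y => (w y).re) x : ℂ) + ((rOp π k)^[n] (fun y => (w y).im) x : ℂ) *
        Complex.I := by
  induction n generalizing x with
  | zero => simp
  | succ n ih =>
    simp only [Function.iterate_succ_apply', ← intOp_ofReal]
    have h1 := bddMeas_rOp_iterate (π := π) hk hw.re n
    have h2 := bddMeas_rOp_iterate (π := π) hk hw.im n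
    rw [mul_comm, ← intOp_const_mul, ← intOp_add hk h1.ofReal (by fun_prop)]
    congr 1; ext y
    rw [ih y]; ring

lemma intOp_kernelPow {k : X → X → ℝ} (hk : IsSymmKernel k) {w : X → ℂ} (hw : BddMeas w) (n : ℕ)
    (x : X) : intOp π (kernelPow π k n) w x = (intOp π k)^[n + 1] w x := by
  rw [intOp_iterate_eq k hk hw, ← rOp_kernelPow hk hw.re, ← rOp_kernelPow hk hw.im]
  have := intOp_iterate_eq (π := π) _ (isSymmKernel_kernelPow (π := π) hk n) hw 1 x
  simpa using this

end KernelPow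

/-! ### Perron–Frobenius eigenfunctions -/

section Perron

variable {X : Type*} [MeasurableSpace X] {π : Measure X} [IsProbabilityMeasure π]

lemma mul_integral_le_rOp {L : X → X → ℝ} (hL : IsSymmKernel L) {c : ℝ} (hc : ∀ x y, c ≤ L x y)
    {g : X → ℝ} (hg : BddMeas g) (h0 : ∀ x, 0 ≤ g x) (x : X) :
    c * ∫ y, g y ∂π ≤ rOp π L g x := by
  have hb := hL.bddMeas x
  rw [← integral_const_mul]
  exact integral_mono (BddMeas.integrable (by fun_prop)) (BddMeas.integrable (by fun_prop))
    fun y => mul_le_mul_of_nonneg_right (hc x y) (h0 y)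

/-- **Birkhoff contraction.** An operator whose kernel lies between `c` and `M` shrinks, by the
factor `1 - c / M`, the oscillation of the quotient of two functions. -/
lemma rOp_quotient_contraction {L : X → X → ℝ} (hL : IsSymmKernel L) {c M : ℝ} (hM0 : 0 < M)
    (hc0 : 0 < c) (hc : ∀ x y, c ≤ L x y) (hM : ∀ x y, L x y ≤ M) {g h : X → ℝ} (hg : BddMeas g)
    (hh : BddMeas h) (hpos : ∀ x, 0 ≤ h x) (hint : 0 < ∫ x, h x ∂π) {α β : ℝ}
    (hα : ∀ x, α * h x ≤ g x) (hβ : ∀ x, g x ≤ β * h x) :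
    ∃ α' β' : ℝ, α ≤ α' ∧ β' ≤ β ∧ β' - α' = (1 - c / M) * (β - α) ∧
      (∀ x, α' * rOp π L h x ≤ rOp π L g x) ∧ ∀ x, rOp π L g x ≤ β' * rOp π L h x := by
  -- the operator maps `g - α h ≥ 0` to at least `c ⟨g - α h⟩`, and `L h` is at most `M ⟨h⟩`;
  -- likewise for `β h - g`
  set I := ∫ x, h x ∂π with hI
  set J := ∫ x, g x ∂π with hJ
  have i1 : ∫ x, (g x - α * h x) ∂π = J - α * I := by
    rw [integral_sub (BddMeas.integrable (by fun_prop)) (BddMeas.integrable (by fun_prop)),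
      integral_const_mul]
  have i2 : ∫ x, (β * h x - g x) ∂π = β * I - J := by
    rw [integral_sub (BddMeas.integrable (by fun_prop)) (BddMeas.integrable (by fun_prop)),
      integral_const_mul]
  have p1 : 0 ≤ J - α * I := i1 ▸ integral_nonneg fun x => sub_nonneg.2 (hα x)
  have p2 : 0 ≤ β * I - J := i2 ▸ integral_nonneg fun x => sub_nonneg.2 (hβ x)
  have hup : ∀ x, rOp π L h x ≤ M * I := rOp_le hL hM hh hpos
  have key : ∀ (δ : ℝ) (x : X), 0 ≤ δ → c * δ / (M * I) * rOp π L h x ≤ c * δ := by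
    intro δ x hδ
    calc c * δ / (M * I) * rOp π L h x ≤ c * δ / (M * I) * (M * I) :=
          mul_le_mul_of_nonneg_left (hup x) (by positivity)
      _ = c * δ := by field_simp
  refine ⟨α + c * (J - α * I) / (M * I), β - c * (β * I - J) / (M * I), ?_, ?_, ?_, ?_, ?_⟩
  · have : 0 ≤ c * (J - α * I) / (M * I) := by positivity
    linarith
  · have : 0 ≤ c * (β * I - J) / (M * I) := by positivity
    linarith
  · field_simp; ring
  · intro x
    have h1 := mul_integral_le_rOp (π := π) hL hc (g := fun x => g x - α * h x) (by fun_prop)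
      (fun x => sub_nonneg.2 (hα x)) x
    rw [i1, rOp_sub hL hg (by fun_prop), rOp_const_mul] at h1
    linarith [key _ x p1]
  · intro x
    have h1 := mul_integral_le_rOp (π := π) hL hc (g := fun x => β * h x - g x) (by fun_prop)
      (fun x => sub_nonneg.2 (hβ x)) x
    rw [i2, rOp_sub hL (by fun_prop) hg, rOp_const_mul] at h1
    linarith [key _ x p2]

/-- The iterates of a bounded `g ≥ 0` become proportional to those of the constant function at a
geometric rate. -/
lemma rOp_iterate_quotient_contraction {L : X → X → ℝ} (hL : IsSymmKernel L) {c M : ℝ}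
    (hM0 : 0 < M) (hc0 : 0 < c) (hc : ∀ x y, c ≤ L x y) (hM : ∀ x y, L x y ≤ M) {g : X → ℝ}
    (hg : BddMeas g) {B : ℝ} (hg0 : ∀ x, 0 ≤ g x) (hgB : ∀ x, g x ≤ B) (j : ℕ) :
    (∀ x, 0 ≤ (rOp π L)^[j] (fun _ => 1) x) ∧ 0 < ∫ x, (rOp π L)^[j] (fun _ => 1) x ∂π ∧
    ∃ α β : ℝ, 0 ≤ α ∧ β ≤ B ∧ β - α = (1 - c / M) ^ j * B ∧
      (∀ x, α * (rOp π L)^[j] (fun _ => 1) x ≤ (rOp π L)^[j] g x) ∧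
      ∀ x, (rOp π L)^[j] g x ≤ β * (rOp π L)^[j] (fun _ => 1) x := by
  induction j with
  | zero => exact ⟨by simp, by simp, 0, B, le_rfl, le_rfl, by simp, by simpa, by simpa⟩
  | succ j ih =>
    obtain ⟨h0, hI, α, β, hα, hβ, hαβ, h1, h2⟩ := ih
    have hb := bddMeas_rOp_iterate (π := π) hL (BddMeas.const (X := X) (1 : ℝ)) j
    obtain ⟨α', β', e1, e2, e3, e4, e5⟩ := rOp_quotient_contraction (π := π) hL hM0 hc0 hc hM
      (bddMeas_rOp_iterate hL hg j) hb h0 hI h1 h2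
    simp only [Function.iterate_succ_apply']
    refine ⟨rOp_nonneg hL h0, ?_, α', β', hα.trans e1, e2.trans hβ, ?_, e4, e5⟩
    · calc 0 < c * ∫ x, (rOp π L)^[j] (fun _ => 1) x ∂π := by positivity
        _ = ∫ _, c * ∫ x, (rOp π L)^[j] (fun _ => 1) x ∂π ∂π := by simp
        _ ≤ _ := integral_mono (integrable_const _) (hb.rOp hL).integrable
            (mul_integral_le_rOp hL hc hb h0)
    · rw [e3, hαβ]; ring

/-- The operator commutes with its powers. -/
lemma rOp_rOp_kernelPow {k : X → X → ℝ} (hk : IsSymmKernel k) (n : ℕ) {g : X → ℝ}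
    (hg : BddMeas g) (j : ℕ) : (rOp π (kernelPow π k n))^[j] (rOp π k g)
      = rOp π k ((rOp π (kernelPow π k n))^[j] g) := by
  induction j with
  | zero => rfl
  | succ j ih =>
    rw [Function.iterate_succ_apply', ih, Function.iterate_succ_apply']
    have hb := bddMeas_rOp_iterate (π := π) (isSymmKernel_kernelPow (π := π) hk n) hg j
    set u := (rOp π (kernelPow π k n))^[j] g
    have e : rOp π (kernelPow π k n) u = (rOp π k)^[n + 1] u := funext (rOp_kernelPow hk hb n)
    rw [e]
    refine funext fun x => ?_
    rw [rOp_kernelPow hk (hb.rOp hk), ← Function.iterate_succ_apply, Function.iterate_succ_apply']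

lemma iterate_bounds_of_quotient_bounds {k : X → X → ℝ} (hk : IsSymmKernel k) {h : X → ℝ}
    (hh : BddMeas h) {α β : ℝ} (hα : 0 ≤ α) (hβ : 0 ≤ β) (h1 : ∀ x, α * h x ≤ rOp π k h x)
    (h2 : ∀ x, rOp π k h x ≤ β * h x) (i : ℕ) (x : X) :
    α ^ i * h x ≤ (rOp π k)^[i] h x ∧ (rOp π k)^[i] h x ≤ β ^ i * h x := by
  induction i generalizing x with
  | zero => simp
  | succ i ih =>
    have hb := bddMeas_rOp_iterate (π := π) hk hh i
    rw [Function.iterate_succ_apply']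
    have l1 := rOp_mono (π := π) hk (g := fun y => α ^ i * h y) (by fun_prop) hb
      (fun y => (ih y).1) x
    have l2 := rOp_mono (π := π) hk (h := fun y => β ^ i * h y) hb (by fun_prop)
      (fun y => (ih y).2) x
    rw [rOp_const_mul] at l1 l2
    constructor
    · calc α ^ (i + 1) * h x = α ^ i * (α * h x) := by ring
        _ ≤ _ := (mul_le_mul_of_nonneg_left (h1 x) (by positivity)).trans l1
    · calc _ ≤ β ^ i * (β * h x) :=
            l2.trans (mul_le_mul_of_nonneg_left (h2 x) (by positivity))
        _ = _ := by ring

/-- A sequence of approximate eigenfunctions that converges geometrically has an eigenfunction as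
its limit. -/
lemma exists_eigen_of_approx {k : X → X → ℝ} (hk : IsSymmKernel k) {f : ℕ → X → ℝ} {l : ℕ → ℝ}
    {q C δ B : ℝ} (hq0 : 0 ≤ q) (hq : q < 1) (hf : ∀ j, BddMeas (f j)) (hδ : ∀ j x, δ ≤ f j x)
    (hB : ∀ j x, |f j x| ≤ B) (hint : ∀ j, ∫ x, f j x ∂π = 1)
    (hstep : ∀ j x, |f (j + 1) x - f j x| ≤ C * q ^ j)
    (heig : ∀ j x, |rOp π k (f j) x - l j * f j x| ≤ C * q ^ j) :
    ∃ (g : X → ℝ) (l : ℝ), BddMeas g ∧ (∀ x, δ ≤ g x) ∧ ∀ x, rOp π k g x = l * g x := by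
  -- pointwise limit of the functions
  have hlim : ∀ x, ∃ y, Tendsto (fun j => f j x) atTop (𝓝 y) := fun x =>
    cauchySeq_tendsto_of_complete (cauchySeq_of_le_geometric q C hq fun j => by
      rw [dist_comm]; exact hstep j x)
  choose g hg using hlim
  have hq' : Tendsto (fun j : ℕ => C * q ^ j) atTop (𝓝 0) := by
    simpa using (tendsto_pow_atTop_nhds_zero_of_lt_one hq0 hq).const_mul C
  have hgm : BddMeas g :=
    ⟨measurable_of_tendsto_metrizable (fun j => (hf j).1) (tendsto_pi_nhds.2 hg), B, fun x =>
      le_of_tendsto (hg x).norm (.of_forall fun j => hB j x)⟩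
  have hT : ∀ x, Tendsto (fun j => rOp π k (f j) x) atTop (𝓝 (rOp π k g x)) := fun x => by
    have hb := hk.bddMeas x
    obtain ⟨M, hM0, hM⟩ := hb.le_const
    refine tendsto_integral_of_dominated_convergence (fun _ => M * B)
      (fun j => by have := hf j; exact (hb.mul this).1.aestronglyMeasurable)
      (integrable_const _) (fun j => .of_forall fun y => ?_)
      (.of_forall fun y => (hg y).const_mul _)
    rw [norm_mul]
    exact mul_le_mul (hM y) (hB j y) (norm_nonneg _) hM0.le
  -- the approximate eigenvalues converge because the functions have mean one
  have hlj : Tendsto l atTop (𝓝 (∫ x, rOp π k g x ∂π)) := by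
    have h1 : Tendsto (fun j => ∫ x, rOp π k (f j) x ∂π) atTop (𝓝 (∫ x, rOp π k g x ∂π)) := by
      obtain ⟨M, hM0, hM⟩ := hk.exists_bound
      refine tendsto_integral_of_dominated_convergence (fun _ => M * B)
        (fun j => ((hf j).rOp hk).1.aestronglyMeasurable) (integrable_const _)
        (fun j => .of_forall fun x => ?_) (.of_forall hT)
      have h2 := norm_intOp_le (π := π) hk (fun y => (f j y : ℂ)) x
      rw [intOp_ofReal, Complex.norm_real] at h2
      refine h2.trans (rOp_le_const hk hM hM0.le ?_ (fun y => norm_nonneg _) (fun y => ?_) x)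
      · have := hf j; fun_prop
      · simpa using hB j y
    have h2 : Tendsto (fun j => l j - ∫ x, rOp π k (f j) x ∂π) atTop (𝓝 0) := by
      refine squeeze_zero_norm (fun j => ?_) hq'
      have hfj := hf j
      have hTj := (hf j).rOp (π := π) hk
      have e : l j - ∫ x, rOp π k (f j) x ∂π = -∫ x, (rOp π k (f j) x - l j * f j x) ∂π := by
        rw [integral_sub hTj.integrable (BddMeas.integrable (by fun_prop)), integral_const_mul,
          hint]; ring
      rw [e, norm_neg]
      refine (norm_integral_le_of_norm_le_const (C := C * q ^ j)
        (.of_forall fun x => heig j x)).trans_eq ?_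
      simp
    simpa using h2.add h1
  refine ⟨g, ∫ x, rOp π k g x ∂π, hgm, fun x => ge_of_tendsto (hg x) (.of_forall fun j => hδ j x),
    fun x => ?_⟩
  have h3 : Tendsto (fun j => rOp π k (f j) x - l j * f j x) atTop (𝓝 0) :=
    squeeze_zero_norm (fun j => heig j x) hq'
  exact sub_eq_zero.1 (tendsto_nhds_unique ((hT x).sub (hlj.mul (hg x))) h3)

/-- If `g / h` lies between `α` and `β`, then so does the quotient of the means, and `g` is close to
the corresponding multiple of `h`. -/
lemma abs_sub_mean_quotient_le {g h : X → ℝ} (hg : BddMeas g) (hh : BddMeas h)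
    (hpos : ∀ x, 0 ≤ h x) (hint : 0 < ∫ x, h x ∂π) {α β : ℝ} (hα : ∀ x, α * h x ≤ g x)
    (hβ : ∀ x, g x ≤ β * h x) (x : X) :
    |g x - (∫ y, g y ∂π) / (∫ y, h y ∂π) * h x| ≤ (β - α) * h x := by
  have h1 := integral_mono (μ := π) (f := fun x => α * h x) (BddMeas.integrable (by fun_prop))
    hg.integrable hα
  have h2 := integral_mono (μ := π) (g := fun x => β * h x) hg.integrable
    (BddMeas.integrable (by fun_prop)) hβ
  rw [integral_const_mul] at h1 h2
  have h3 := mul_le_mul_of_nonneg_right ((le_div_iff₀ hint).2 h1) (hpos x)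
  have h4 := mul_le_mul_of_nonneg_right ((div_le_iff₀ hint).2 h2) (hpos x)
  rw [abs_le]
  constructor <;> linarith [hα x, hβ x]

/-- **Perron–Frobenius.** The eigenfunction is the limit of the normalized iterates of the
constant function `1`. -/
lemma exists_perron {k : X → X → ℝ} (hk : IsSymmKernel k) {n : ℕ} {c : ℝ} (hc0 : 0 < c)
    (hc : ∀ x y, c ≤ kernelPow π k n x y) :
    ∃ (f : X → ℝ) (l δ : ℝ), BddMeas f ∧ 0 < δ ∧ (∀ x, δ ≤ f x) ∧ 0 < l ∧ ∫ x, f x ^ 2 ∂π = 1 ∧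
      ∀ x, rOp π k f x = l * f x := by
  obtain ⟨M, hM0, hM⟩ := hk.exists_bound
  set N := n + 1 with hN
  set L := kernelPow π k n with hLdef
  have hL : IsSymmKernel L := isSymmKernel_kernelPow hk n
  have hLM : ∀ x y, L x y ≤ M ^ N := kernelPow_le hk hM hM0.le n
  have hMN : 0 < M ^ N := by positivity
  set T := rOp π k
  -- `h j` are the iterates of the constant function under `L = T ^ N`, and `a j` their means
  set h : ℕ → X → ℝ := fun j => (rOp π L)^[j] (fun _ => 1) with hh
  have hb : ∀ j, BddMeas (h j) := fun j => bddMeas_rOp_iterate hL (BddMeas.const (1 : ℝ)) j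
  have hT1 : ∀ x, T (fun _ => 1) x ≤ M := fun x => by
    have := rOp_le_const (π := π) hk hM hM0.le (BddMeas.const (1 : ℝ)) (fun _ => zero_le_one)
      (fun _ => le_rfl) x
    simpa using this
  have hmain := rOp_iterate_quotient_contraction (π := π) hL hMN hc0 hc hLM
    (g := T (fun _ => 1)) ((BddMeas.const (1 : ℝ)).rOp hk)
    (rOp_nonneg hk fun _ => zero_le_one) hT1
  set a : ℕ → ℝ := fun j => ∫ x, h j x ∂π with ha
  set q := 1 - c / M ^ N with hq
  have hcM : c ≤ M ^ N := by
    obtain ⟨x⟩ := π.nonempty_of_neZero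
    exact (hc x x).trans (hLM x x)
  have hq0 : 0 ≤ q := by rw [hq, sub_nonneg]; exact (div_le_one hMN).2 hcM
  have hq1 : q < 1 := by have : 0 < c / M ^ N := by positivity
                         linarith
  have h0 : ∀ j x, 0 ≤ h j x := fun j => (hmain j).1
  have ha0 : ∀ j, 0 < a j := fun j => (hmain j).2.1
  have hsucc : ∀ j x, h (j + 1) x = rOp π L (h j) x := fun j x => by
    simp only [hh, Function.iterate_succ_apply']
  -- since `c ≤ L ≤ M ^ N`, the normalized iterates `h j / a j` stay between two positive constants
  have hlow : ∀ j x, c * a j ≤ h (j + 1) x := fun j x => by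
    rw [hsucc]; exact mul_integral_le_rOp hL hc (hb j) (h0 j) x
  have hupp : ∀ j x, h (j + 1) x ≤ M ^ N * a j := fun j x => by
    rw [hsucc]; exact rOp_le hL hLM (hb j) (h0 j) x
  have halow : ∀ j, c * a j ≤ a (j + 1) := fun j =>
    le_integral_of_const_le (hb (j + 1)) (hlow j)
  have haupp : ∀ j, a (j + 1) ≤ M ^ N * a j := fun j =>
    integral_le_of_le_const (hb (j + 1)) (hupp j)
  have hfB : ∀ j x, h j x / a j ≤ M ^ N / c := by
    intro j x
    rw [div_le_div_iff₀ (ha0 j) hc0]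
    rcases j with - | j
    · simpa [hh, ha] using hcM
    · nlinarith [hupp j x, halow j]
  have hfδ : ∀ j x, c / M ^ N ≤ h j x / a j := by
    intro j x
    rw [div_le_div_iff₀ hMN (ha0 j)]
    rcases j with - | j
    · simpa [hh, ha] using hcM
    · nlinarith [hlow j x, haupp j]
  -- `T (h j)` is the `j`-th iterate of `T 1`, so that it is almost proportional to `h j`
  have hkey : ∀ j, ∃ α β : ℝ, 0 ≤ α ∧ 0 ≤ β ∧ α ≤ β ∧ β ≤ M ∧ β - α = q ^ j * M ∧
      (∀ x, α * h j x ≤ T (h j) x) ∧ ∀ x, T (h j) x ≤ β * h j x := by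
    intro j
    obtain ⟨_, _, α, β, h1, h2, h3, h4, h5⟩ := hmain j
    rw [rOp_rOp_kernelPow hk n (BddMeas.const (1 : ℝ))] at h4 h5
    have : 0 ≤ q ^ j * M := by positivity
    exact ⟨α, β, h1, by linarith, by linarith, h2, h3, h4, h5⟩
  have hNc : (1 : ℝ) ≤ N := by exact_mod_cast Nat.succ_le_succ (Nat.zero_le n)
  set C := M * (M ^ N / c) + M * (N * M ^ n) * (M ^ N / c) / c with hC
  -- iterating the comparison of `T (h j)` with `h j` compares `h (j + 1) = T ^ N (h j)` with `h j`
  have hstep : ∀ j x, |h (j + 1) x / a (j + 1) - h j x / a j| ≤ C * q ^ j := by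
    intro j x
    obtain ⟨α, β, hα, hβ, hαβ, hβM, hd, h1, h2⟩ := hkey j
    have hit := iterate_bounds_of_quotient_bounds (π := π) hk (hb j) hα hβ h1 h2 N
    have hTN : ∀ x, h (j + 1) x = (rOp π k)^[N] (h j) x := fun x => by
      rw [hsucc, hLdef, rOp_kernelPow hk (hb j)]
    have h3 := abs_sub_mean_quotient_le (hb (j + 1)) (hb j) (h0 j) (ha0 j) (α := α ^ N)
      (β := β ^ N) (fun x => by rw [hTN]; exact (hit x).1) (fun x => by rw [hTN]; exact (hit x).2) x
    have h4 : β ^ N - α ^ N ≤ q ^ j * M * (N * M ^ n) := by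
      have h5 := (le_abs_self _).trans (abs_pow_sub_pow_le β α N)
      rw [abs_of_nonneg (sub_nonneg.2 hαβ), hd, abs_of_nonneg hα, abs_of_nonneg hβ,
        max_eq_left hαβ, hN, Nat.add_sub_cancel, mul_assoc] at h5
      refine h5.trans ?_
      gcongr
    have e : h (j + 1) x / a (j + 1) - h j x / a j
        = (h (j + 1) x - a (j + 1) / a j * h j x) / a (j + 1) := by
      have := (ha0 j).ne'
      have := (ha0 (j + 1)).ne'
      field_simp
    rw [e, abs_div, abs_of_pos (ha0 (j + 1)), div_le_iff₀ (ha0 (j + 1))]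
    have h6 : h j x ≤ M ^ N / c * a j := (div_le_iff₀ (ha0 j)).1 (hfB j x)
    calc _ ≤ (β ^ N - α ^ N) * h j x := h3
      _ ≤ (q ^ j * M * (N * M ^ n)) * (M ^ N / c * (a (j + 1) / c)) := by
          refine mul_le_mul h4 (h6.trans ?_) (h0 j x) (by positivity)
          refine mul_le_mul_of_nonneg_left ?_ (by positivity)
          rw [le_div_iff₀ hc0, mul_comm]; exact halow j
      _ = (M * (N * M ^ n) * (M ^ N / c) / c) * q ^ j * a (j + 1) := by ring
      _ ≤ _ := by
          have := ha0 (j + 1)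
          have : 0 ≤ M * (M ^ N / c) * q ^ j * a (j + 1) := by positivity
          linarith
  -- the normalized iterates are approximate eigenfunctions of `T`
  have heig : ∀ j x, |rOp π k (fun x => h j x / a j) x
      - (∫ x, T (h j) x ∂π) / a j * (h j x / a j)| ≤ C * q ^ j := by
    intro j x
    obtain ⟨α, β, hα, hβ, hαβ, hβM, hd, h1, h2⟩ := hkey j
    have h3 := abs_sub_mean_quotient_le (π := π) ((hb j).rOp hk) (hb j) (h0 j) (ha0 j) h1 h2 x
    have e : rOp π k (fun x => h j x / a j) x = T (h j) x / a j := by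
      have := rOp_const_mul (π := π) k (a j)⁻¹ (h j) x
      simp only [div_eq_inv_mul]; exact this
    have e2 : T (h j) x / a j - (∫ x, T (h j) x ∂π) / a j * (h j x / a j)
        = (T (h j) x - (∫ x, T (h j) x ∂π) / a j * h j x) / a j := by ring
    rw [e, e2, abs_div, abs_of_pos (ha0 j), div_le_iff₀ (ha0 j)]
    have h6 : h j x ≤ M ^ N / c * a j := (div_le_iff₀ (ha0 j)).1 (hfB j x)
    have h7 : 0 ≤ q ^ j * M := by positivity
    calc _ ≤ (β - α) * h j x := h3
      _ ≤ q ^ j * M * (M ^ N / c * a j) := by rw [hd]; exact mul_le_mul_of_nonneg_left h6 h7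
      _ = M * (M ^ N / c) * q ^ j * a j := by ring
      _ ≤ _ := by
          have := ha0 j
          have : 0 ≤ M * (N * M ^ n) * (M ^ N / c) / c * q ^ j * a j := by positivity
          linarith
  obtain ⟨g, l, hg, hgδ, hgl⟩ := exists_eigen_of_approx (π := π) (k := k) hk
    (f := fun j x => h j x / a j) (l := fun j => (∫ x, T (h j) x ∂π) / a j) (q := q)
    (C := C) (δ := c / M ^ N) (B := M ^ N / c)
    hq0 hq1 (fun j => by have := hb j; fun_prop) hfδ
    (fun j x => by rw [abs_of_nonneg (div_nonneg (h0 j x) (ha0 j).le)]; exact hfB j x)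
    (fun j => by rw [integral_div]; exact div_self (ha0 j).ne')
      hstep heig
  have hgpos : ∀ x, 0 < g x := fun x => (show 0 < c / M ^ N by positivity).trans_le (hgδ x)
  have hδ : 0 < c / M ^ N := by positivity
  have hI : 0 < ∫ x, g x ^ 2 ∂π := by
    exact (show 0 < (c / M ^ N) ^ 2 by positivity).trans_le
      (le_integral_of_const_le (hg.pow 2) fun x => pow_le_pow_left₀ hδ.le (hgδ x) 2)
  set s := √(∫ x, g x ^ 2 ∂π) with hs
  have hs0 : 0 < s := Real.sqrt_pos.2 hI
  refine ⟨fun x => s⁻¹ * g x, l, s⁻¹ * (c / M ^ N), by fun_prop, by positivity, fun x =>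
    mul_le_mul_of_nonneg_left (hgδ x) (by positivity), ?_, ?_, fun x => ?_⟩
  · -- the power `l ^ N` is an eigenvalue of the positive kernel `L`
    obtain ⟨x⟩ := π.nonempty_of_neZero
    have hl0 : 0 ≤ l := by
      have h2 := rOp_nonneg (π := π) hk (fun x => (hgpos x).le) x
      rw [hgl] at h2
      exact nonneg_of_mul_nonneg_left h2 (hgpos x)
    refine hl0.lt_of_ne fun hl => ?_
    have h3 := iterate_bounds_of_quotient_bounds (π := π) hk hg (α := 0) (β := 0) le_rfl le_rfl
      (fun x => by rw [hgl, ← hl]) (fun x => by rw [hgl, ← hl]) N x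
    have h4 := mul_integral_le_rOp (π := π) hL hc hg (fun x => (hgpos x).le) x
    have h5 : 0 < ∫ x, g x ∂π := hδ.trans_le (le_integral_of_const_le hg hgδ)
    rw [hLdef, rOp_kernelPow hk hg] at h4
    have h6 := h3.2
    rw [zero_pow (by omega), zero_mul] at h6
    nlinarith [mul_pos hc0 h5]
  · simp only [mul_pow]
    rw [integral_const_mul, inv_pow, hs, Real.sq_sqrt hI.le]
    exact inv_mul_cancel₀ hI.ne'
  · show rOp π k (fun x => s⁻¹ * g x) x = _
    rw [rOp_const_mul, hgl]; ring

end Perron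

/-! ### Limits of bounded functions -/

section Limits

variable {X : Type*} [MeasurableSpace X] {π : Measure X} [IsProbabilityMeasure π]

lemma BddMeas.of_tendsto {E ι : Type*} [NormedAddCommGroup E] [MeasurableSpace E] [BorelSpace E]
    {F : Filter ι} [F.NeBot] [F.IsCountablyGenerated] {w : ι → X → E} {g : X → E} {B : ℝ}
    (hw : ∀ j, BddMeas (w j)) (hB : ∀ j x, ‖w j x‖ ≤ B)
    (hg : ∀ x, Tendsto (fun j => w j x) F (𝓝 (g x))) : BddMeas g :=
  ⟨measurable_of_tendsto_metrizable' F (fun j => (hw j).1) (tendsto_pi_nhds.2 hg), B, fun x =>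
    le_of_tendsto (hg x).norm (.of_forall fun j => hB j x)⟩

/-- Dominated convergence for the integral operator. -/
lemma tendsto_intOp {ι : Type*} {F : Filter ι} [F.IsCountablyGenerated] {k : X → X → ℝ}
    (hk : IsSymmKernel k) {w : ι → X → ℂ} {g : X → ℂ} {B : ℝ} (hw : ∀ j, BddMeas (w j))
    (hB : ∀ j x, ‖w j x‖ ≤ B) (hg : ∀ x, Tendsto (fun j => w j x) F (𝓝 (g x))) (x : X) :
    Tendsto (fun j => intOp π k (w j) x) F (𝓝 (intOp π k g x)) := by
  have hb := hk.bddMeas x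
  obtain ⟨M, hM0, hM⟩ := hb.le_const
  refine tendsto_integral_filter_of_dominated_convergence (fun _ => M * B)
    (.of_forall fun j => (hb.ofReal.mul (hw j)).1.aestronglyMeasurable)
    (.of_forall fun j => .of_forall fun y => ?_) (integrable_const _)
    (.of_forall fun y => (hg y).const_mul _)
  rw [norm_mul, Complex.norm_real]
  exact mul_le_mul (hM y) (hB j y) (norm_nonneg _) hM0.le

end Limits

/-! ### The spectral gap -/

section Gap

variable {X : Type*} [MeasurableSpace X] {π : Measure X} [IsProbabilityMeasure π]

/-- `f` is a normalized positive eigenfunction of the kernel `k`, for an eigenvalue `l ≤ 1`, and on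
the orthogonal complement of `f` the operator has norm at most `q`; the constants `M` and `δ` bound
the kernel from above and the eigenfunction from below. -/
structure IsGapped (π : Measure X) (k : X → X → ℝ) (f : X → ℝ) (l q M δ : ℝ) : Prop where
  symmKernel : IsSymmKernel k
  kernel_le : ∀ x y, k x y ≤ M
  bddMeas : BddMeas f
  le_eigenfunction : ∀ x, δ ≤ f x
  normalized : ∫ x, f x ^ 2 ∂π = 1
  eigen : ∀ x, rOp π k f x = l * f x
  eigenvalue_nonneg : 0 ≤ l
  eigenvalue_le_one : l ≤ 1
  gap : ∀ w : X → ℂ, BddMeas w → ∫ x, (f x : ℂ) * w x ∂π = 0 →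
    n2 π (fun x => intOp π k w x) ≤ q * n2 π w

omit [IsProbabilityMeasure π] in
lemma n2_ofReal_eq_one {f : X → ℝ} (hf : ∫ x, f x ^ 2 ∂π = 1) : n2 π (fun x => (f x : ℂ)) = 1 := by
  simp [n2, hf]

/-- Uniform bounds on a normalized eigenfunction. -/
lemma eigenfunction_bounds {k : X → X → ℝ} (hk : IsSymmKernel k) {n : ℕ} {c M : ℝ} (hc0 : 0 < c)
    (hM0 : 0 < M) (hc : ∀ x y, c ≤ kernelPow π k n x y) (hM : ∀ x y, k x y ≤ M) {f : X → ℝ} {l : ℝ}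
    (hf : BddMeas f) (hf0 : ∀ x, 0 ≤ f x) (hf1 : ∫ x, f x ^ 2 ∂π = 1)
    (hl : ∀ x, rOp π k f x = l * f x) (hl0 : 0 ≤ l) (hl1 : l ≤ 1) :
    (∀ x, f x ≤ M / c) ∧ (∀ x, c ^ 2 / M ≤ f x) ∧ c ≤ l := by
  have hI0 : 0 ≤ ∫ x, f x ∂π := integral_nonneg hf0
  have hI1 : ∫ x, f x ∂π ≤ 1 := by
    have := integral_norm_le_n2 (π := π) hf.ofReal
    rw [n2_ofReal_eq_one hf1] at this
    simpa [abs_of_nonneg (hf0 _)] using this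
  -- a bounded non-negative function of mean zero cannot be normalized in `L²`
  have hI : 0 < ∫ x, f x ∂π := by
    refine hI0.lt_of_ne fun h => ?_
    obtain ⟨D, hD0, hD⟩ := hf.le_const
    have : ∫ x, f x ^ 2 ∂π ≤ ∫ x, D * f x ∂π :=
      integral_mono (hf.pow 2).integrable (BddMeas.integrable (by fun_prop)) fun x => by
        nlinarith [hf0 x, (le_abs_self _).trans (hD x)]
    rw [integral_const_mul, ← h, hf1] at this
    linarith
  have hL := isSymmKernel_kernelPow (π := π) hk n
  -- the lower bound on the kernel of the power acts on the eigenfunction `f ≥ 0`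
  have hlow : ∀ x, c * ∫ y, f y ∂π ≤ l ^ (n + 1) * f x := fun x => by
    have h1 := mul_integral_le_rOp (π := π) hL hc hf hf0 x
    rw [rOp_kernelPow hk hf] at h1
    exact h1.trans (iterate_bounds_of_quotient_bounds hk hf hl0 hl0 (fun x => (hl x).ge)
      (fun x => (hl x).le) (n + 1) x).2
  have hcl : c ≤ l := by
    have h1 : c * ∫ y, f y ∂π ≤ ∫ x, l ^ (n + 1) * f x ∂π :=
      le_integral_of_const_le (by fun_prop) hlow
    rw [integral_const_mul] at h1
    exact (le_of_mul_le_mul_right h1 hI).trans (pow_le_of_le_one hl0 hl1 (by omega))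
  have hup : ∀ x, f x ≤ M / c := fun x => by
    have h1 := rOp_le (π := π) hk hM hf hf0 x
    rw [hl] at h1
    rw [le_div_iff₀ hc0]
    nlinarith [hf0 x]
  refine ⟨hup, fun x => ?_, hcl⟩
  have h1 : (1 : ℝ) ≤ M / c * ∫ x, f x ∂π := by
    rw [← hf1, ← integral_const_mul]
    exact integral_mono (hf.pow 2).integrable (BddMeas.integrable (by fun_prop)) fun x => by
      nlinarith [hf0 x, hup x]
  have h2 : l ^ (n + 1) * f x ≤ f x := mul_le_of_le_one_left (hf0 x) (pow_le_one₀ hl0 hl1)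
  calc c ^ 2 / M = c * (c / M) := by ring
    _ ≤ c * ∫ y, f y ∂π := by
        refine mul_le_mul_of_nonneg_left ?_ hc0.le
        rw [div_le_iff₀ hM0]
        rw [div_mul_eq_mul_div, le_div_iff₀ hc0] at h1
        linarith
    _ ≤ f x := (hlow x).trans h2

/-- For a symmetric operator `‖K w‖² = ⟨w, K² w⟩ ≤ ‖w‖ ‖K² w‖`, so that `j ↦ ‖K ^ j w‖` is
log-convex. -/
lemma n2_intOp_sq_le {k : X → X → ℝ} (hk : IsSymmKernel k) {w : X → ℂ} (hw : BddMeas w) :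
    n2 π (fun x => intOp π k w x) ^ 2
      ≤ n2 π w * n2 π (fun x => intOp π k (fun y => intOp π k w y) x) := by
  have h1 := hw.intOp (π := π) hk
  have h2 := h1.intOp (π := π) hk
  have e : ((n2 π (fun x => intOp π k w x) ^ 2 : ℝ) : ℂ)
      = ∫ x, (starRingEnd ℂ) (w x) * intOp π k (fun y => intOp π k w y) x ∂π := by
    rw [integral_mul_intOp hk hw.conj h1, n2_sq]
    refine integral_ofReal.symm.trans ?_
    congr 1; ext x
    rw [intOp_conj, ← Complex.normSq_eq_conj_mul_self, Complex.normSq_eq_norm_sq]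
    rfl
  have h3 := norm_integral_mul_le_n2 (π := π) hw.conj h2
  rw [← e, Complex.norm_real, Real.norm_of_nonneg (by positivity)] at h3
  rwa [n2_congr (u := fun x => (starRingEnd ℂ) (w x)) (w := w) fun x => by simp] at h3

/-- A log-convex sequence lies above the geometric sequence through its first two terms. For `b j =
‖K ^ j w‖` this passes from a bound on a power of a symmetric operator to a bound on the operator.
-/
lemma pow_le_of_log_convex {b : ℕ → ℝ} (h0 : ∀ j, 0 ≤ b j)
    (h : ∀ j, b (j + 1) ^ 2 ≤ b j * b (j + 2)) (N : ℕ) :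
    b 1 ^ (N + 1) ≤ b (N + 1) * b 0 ^ N := by
  have h1 : ∀ j, b 1 * b j ≤ b 0 * b (j + 1) := by
    intro j
    induction j with
    | zero => simp [mul_comm]
    | succ j ih =>
      rcases (h0 (j + 1)).eq_or_lt with e | e
      · rw [← e, mul_zero]; exact mul_nonneg (h0 _) (h0 _)
      · refine le_of_mul_le_mul_right ?_ e
        nlinarith [mul_le_mul_of_nonneg_left (h j) (h0 1),
          mul_le_mul_of_nonneg_right ih (h0 (j + 2))]
  induction N with
  | zero => simp
  | succ N ih =>
    calc b 1 ^ (N + 1 + 1) = b 1 * b 1 ^ (N + 1) := by ring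
      _ ≤ b 1 * (b (N + 1) * b 0 ^ N) := mul_le_mul_of_nonneg_left ih (h0 1)
      _ = (b 1 * b (N + 1)) * b 0 ^ N := by ring
      _ ≤ (b 0 * b (N + 1 + 1)) * b 0 ^ N :=
          mul_le_mul_of_nonneg_right (h1 _) (pow_nonneg (h0 0) _)
      _ = _ := by ring

/-- The power of the operator with kernel `L ≥ c` contracts the complement of the eigenfunction `f`:
there `L` acts as the kernel `L - c'' f ⊗ f`, which is still non-negative and has the smaller
eigenvalue `l ^ N - c''` on `f`, so that the Schur test applies. -/
lemma n2_iterate_le {k : X → X → ℝ} (hk : IsSymmKernel k) {n : ℕ} {c δ D : ℝ} (hc0 : 0 < c)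
    (hc : ∀ x y, c ≤ kernelPow π k n x y) {f : X → ℝ} {l : ℝ} (hf : BddMeas f) (hδ : 0 < δ)
    (hfδ : ∀ x, δ ≤ f x) (hD0 : 0 < D) (hfD : ∀ x, f x ≤ D) (hf1 : ∫ x, f x ^ 2 ∂π = 1)
    (hl : ∀ x, rOp π k f x = l * f x) (hl0 : 0 ≤ l) (hl1 : l ≤ 1) {w : X → ℂ} (hw : BddMeas w)
    (hfw : ∫ x, (f x : ℂ) * w x ∂π = 0) :
    n2 π ((intOp π k)^[n + 1] w) ≤ (1 - c / D ^ 2) * n2 π w := by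
  have hL := isSymmKernel_kernelPow (π := π) hk n
  set L := kernelPow π k n with hLdef
  set c' := c / D ^ 2 with hc'
  have hc'0 : 0 < c' := by positivity
  have hfpos : ∀ x, 0 < f x := fun x => hδ.trans_le (hfδ x)
  set L' : X → X → ℝ := fun x y => L x y - c' * (f x * f y) with hL'
  -- the subtracted kernel is at most `c`, hence the difference is still non-negative
  have hL'k : IsSymmKernel L' := by
    obtain ⟨M, hM0, hM⟩ := hL.exists_bound
    refine ⟨?_, ⟨M, fun x y => ?_⟩, fun x y => ?_, fun x y => ?_⟩
    · exact hL.measurable.sub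
        (((hf.1.comp measurable_fst).mul (hf.1.comp measurable_snd)).const_mul c')
    · have := hM x y
      have : 0 ≤ c' * (f x * f y) := by have := hfpos x; have := hfpos y; positivity
      simp only [hL']; linarith
    · have h1 : c' * (f x * f y) ≤ c' * (D * D) := mul_le_mul_of_nonneg_left
        (mul_le_mul (hfD x) (hfD y) (hfpos y).le hD0.le) hc'0.le
      have h2 : c' * (D * D) = c := by rw [hc']; field_simp
      have := hc x y
      simp only [hL']; linarith
    · simp only [hL', hL.symm x y, mul_comm (f x)]
  -- the subtraction lowers the eigenvalue of `f` and does not act on its complement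
  have hLf : ∀ x, rOp π L' f x = (l ^ (n + 1) - c') * f x := by
    intro x
    have hb := hL.bddMeas x
    have h1 : rOp π L f x = l ^ (n + 1) * f x := by
      have := iterate_bounds_of_quotient_bounds (π := π) hk hf hl0 hl0 (fun x => (hl x).ge)
        (fun x => (hl x).le) (n + 1) x
      rw [hLdef, rOp_kernelPow hk hf]
      exact le_antisymm this.2 this.1
    have h2 : rOp π L' f x = rOp π L f x - c' * f x * ∫ y, f y ^ 2 ∂π := by
      rw [← integral_const_mul]
      unfold rOp
      rw [← integral_sub (BddMeas.integrable (by fun_prop)) (BddMeas.integrable (by fun_prop))]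
      congr 1; ext y
      simp only [hL']; ring
    rw [h2, h1, hf1]; ring
  have hμ : 0 ≤ l ^ (n + 1) - c' := by
    obtain ⟨x⟩ := π.nonempty_of_neZero
    have := rOp_nonneg (π := π) hL'k (fun x => (hfpos x).le) x
    rw [hLf] at this
    exact nonneg_of_mul_nonneg_left this (hfpos x)
  have hLw : ∀ x, intOp π L' w x = intOp π L w x := by
    intro x
    have hb := hL.bddMeas x
    have h2 : intOp π L' w x = intOp π L w x - c' * f x * ∫ y, (f y : ℂ) * w y ∂π := by
      rw [← integral_const_mul]
      unfold intOp
      rw [← integral_sub (BddMeas.integrable (by fun_prop)) (BddMeas.integrable (by fun_prop))]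
      congr 1; ext y
      simp only [hL']; push_cast; ring
    rw [h2, hfw]; simp
  have h3 := n2_intOp_le (π := π) hL'k hf hδ hfδ hμ (fun x => (hLf x).le) hw
  have e : (fun x => intOp π L' w x) = (intOp π k)^[n + 1] w :=
    funext fun x => (hLw x).trans (intOp_kernelPow hk hw n x)
  rw [e] at h3
  refine h3.trans (mul_le_mul_of_nonneg_right ?_ (n2_nonneg _))
  have := pow_le_one₀ (n := n + 1) hl0 hl1
  linarith

/-- **Spectral gap**, with constants that depend on the bounds on the kernel only. -/
lemma exists_gap (n : ℕ) {c M : ℝ} (hc0 : 0 < c) (hM0 : 0 < M) :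
    ∃ q : ℝ, 0 ≤ q ∧ q < 1 ∧ ∀ (k : X → X → ℝ), IsSymmKernel k →
      (∀ x y, c ≤ kernelPow π k n x y) → (∀ x y, k x y ≤ M) → ∀ (f : X → ℝ) (l : ℝ), BddMeas f →
      (∀ x, 0 ≤ f x) → ∫ x, f x ^ 2 ∂π = 1 → (∀ x, rOp π k f x = l * f x) → 0 ≤ l → l ≤ 1 →
      IsGapped π k f l q M (c ^ 2 / M) := by
  set D := M / c
  have hD0 : 0 < D := by positivity
  set p := max (1 - c / D ^ 2) 0 with hp
  have hp0 : 0 ≤ p := le_max_right _ _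
  have hp1 : p < 1 := max_lt (by have : 0 < c / D ^ 2 := by positivity
                                 linarith) one_pos
  have hN : ((n + 1 : ℕ) : ℝ) ≠ 0 := by positivity
  -- the power `n + 1` has norm at most `p` on the complement, the operator its `(n + 1)`-st root
  refine ⟨p ^ ((n + 1 : ℕ) : ℝ)⁻¹, by positivity, Real.rpow_lt_one hp0 hp1 (by positivity), ?_⟩
  intro k hk hc hM f l hf hf0 hf1 hl hl0 hl1
  obtain ⟨hfD, hfδ, -⟩ := eigenfunction_bounds hk hc0 hM0 hc hM hf hf0 hf1 hl hl0 hl1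
  refine ⟨hk, hM, hf, hfδ, hf1, hl, hl0, hl1, fun w hw hfw => ?_⟩
  have h1 := n2_iterate_le hk hc0 hc hf (by positivity) hfδ hD0 hfD hf1 hl hl0 hl1 hw hfw
  have h2 := pow_le_of_log_convex (b := fun j => n2 π ((intOp π k)^[j] w)) (fun j => n2_nonneg _)
    (fun j => by
      have := n2_intOp_sq_le (π := π) hk (bddMeas_intOp_iterate (π := π) hk hw j)
      simp only [Function.iterate_succ_apply']
      exact this) n
  refine le_of_pow_le_pow_left₀ (n := n + 1) (by omega) (mul_nonneg (by positivity)
    (n2_nonneg _)) ?_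
  rw [mul_pow, ← Real.rpow_natCast (p ^ _), ← Real.rpow_mul hp0, inv_mul_cancel₀ hN, Real.rpow_one]
  calc _ ≤ _ := h2
    _ ≤ (p * n2 π w) * n2 π w ^ n := by
        refine mul_le_mul_of_nonneg_right (h1.trans ?_) (pow_nonneg (n2_nonneg _) _)
        exact mul_le_mul_of_nonneg_right (le_max_left _ _) (n2_nonneg _)
    _ = _ := by ring

end Gap

/-! ### Inversion on the complement of the eigenfunction -/

section Reduced

variable {X : Type*} [MeasurableSpace X] {π : Measure X} [IsProbabilityMeasure π]

variable {k : X → X → ℝ} {f : X → ℝ} {l q M δ : ℝ}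

lemma n2_sub_le {u w : X → ℂ} (hu : BddMeas u) (hw : BddMeas w) :
    n2 π (fun x => u x - w x) ≤ n2 π u + n2 π w := by
  have h := n2_add_le (π := π) hu (w := fun x => -w x) (by fun_prop)
  rw [n2_congr (u := fun x => -w x) (w := w) fun x => norm_neg _] at h
  simpa only [sub_eq_add_neg] using h

lemma IsGapped.integral_mul_intOp_eigen (h : IsGapped π k f l q M δ) {w : X → ℂ}
    (hw : BddMeas w) :
    ∫ x, (f x : ℂ) * intOp π k w x ∂π = l * ∫ x, (f x : ℂ) * w x ∂π := by
  rw [integral_mul_intOp h.symmKernel h.bddMeas.ofReal hw, ← integral_const_mul]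
  congr 1; ext x
  rw [intOp_ofReal, h.eigen]; push_cast; ring

/-- A solution of `(1 - k) g = h` in the complement of `f` is bounded by `h`. -/
lemma IsGapped.norm_le_of_sub_eq (h : IsGapped π k f l q M δ) (hq : q < 1) {g w : X → ℂ}
    (hg : BddMeas g) (hw : BddMeas w) (hfg : ∫ x, (f x : ℂ) * g x ∂π = 0)
    (hgw : ∀ x, g x - intOp π k g x = w x) {B : ℝ} (hB : ∀ x, ‖w x‖ ≤ B) :
    n2 π g ≤ n2 π w / (1 - q) ∧ ∀ x, ‖g x‖ ≤ (1 + M / (1 - q)) * B := by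
  have hK := hg.intOp (π := π) h.symmKernel
  have h1 : n2 π g ≤ n2 π w + q * n2 π g := by
    calc n2 π g = n2 π (fun x => w x + intOp π k g x) := by
          congr 1; ext x; rw [← hgw]; ring
      _ ≤ n2 π w + n2 π (fun x => intOp π k g x) := n2_add_le hw hK
      _ ≤ _ := by linarith [h.gap g hg hfg]
  have h2 : n2 π g ≤ n2 π w / (1 - q) := by
    rw [le_div_iff₀ (by linarith)]; linarith
  refine ⟨h2, fun x => ?_⟩
  have hM0 : 0 ≤ M := (h.symmKernel.nonneg x x).trans (h.kernel_le x x)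
  have hwB := n2_le_of_bound (π := π) hw hB
  calc ‖g x‖ = ‖w x + intOp π k g x‖ := by rw [← hgw]; ring_nf
    _ ≤ ‖w x‖ + ‖intOp π k g x‖ := norm_add_le _ _
    _ ≤ B + M * (B / (1 - q)) := by
        refine add_le_add (hB x) ((norm_intOp_le_n2 h.symmKernel h.kernel_le hg x).trans ?_)
        refine mul_le_mul_of_nonneg_left (h2.trans ?_) hM0
        exact div_le_div_of_nonneg_right hwB (by linarith)
    _ = _ := by ring

/-- The Neumann series solves `(1 - k) g = h` in the complement of `f`. -/
lemma IsGapped.exists_sub_eq (h : IsGapped π k f l q M δ) (hq0 : 0 ≤ q) (hq : q < 1) {w : X → ℂ}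
    (hw : BddMeas w) (hfw : ∫ x, (f x : ℂ) * w x ∂π = 0) :
    ∃ g : X → ℂ, BddMeas g ∧ ∫ x, (f x : ℂ) * g x ∂π = 0 ∧
      ∀ x, g x - intOp π k g x = w x := by
  have hk := h.symmKernel
  have hf := h.bddMeas
  obtain ⟨x₀⟩ := π.nonempty_of_neZero
  have hM0 : 0 ≤ M := (hk.nonneg x₀ x₀).trans (h.kernel_le x₀ x₀)
  -- the terms `d j = K ^ j w` of the series decay in `L²`, hence uniformly
  set d : ℕ → X → ℂ := fun j => (intOp π k)^[j] w with hd
  have hdb : ∀ j, BddMeas (d j) := fun j => bddMeas_intOp_iterate hk hw j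
  have hdsucc : ∀ j, d (j + 1) = intOp π k (d j) := fun j => Function.iterate_succ_apply' _ _ _
  have hdf : ∀ j, ∫ x, (f x : ℂ) * d j x ∂π = 0 := by
    intro j
    induction j with
    | zero => exact hfw
    | succ j ih => rw [hdsucc, h.integral_mul_intOp_eigen (hdb j), ih, mul_zero]
  have hdn : ∀ j, n2 π (d j) ≤ q ^ j * n2 π w := by
    intro j
    induction j with
    | zero => simp [hd]
    | succ j ih =>
      rw [hdsucc]
      refine (h.gap _ (hdb j) (hdf j)).trans ?_
      rw [pow_succ', mul_assoc]
      exact mul_le_mul_of_nonneg_left ih hq0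
  have hdx : ∀ j x, ‖d (j + 1) x‖ ≤ M * n2 π w * q ^ j := by
    intro j x
    rw [hdsucc]
    refine (norm_intOp_le_n2 hk h.kernel_le (hdb j) x).trans ?_
    rw [mul_assoc, mul_comm (n2 π w)]
    exact mul_le_mul_of_nonneg_left (hdn j) hM0
  -- the partial sums, in the form of the fixed point iteration `s ↦ w + K s`
  set s : ℕ → X → ℂ := fun j => Nat.rec w (fun _ u x => w x + intOp π k u x) j with hs
  have hs0 : s 0 = w := rfl
  have hss : ∀ j x, s (j + 1) x = w x + intOp π k (s j) x := fun j x => rfl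
  have hsb : ∀ j, BddMeas (s j) := by
    intro j
    induction j with
    | zero => exact hw
    | succ j ih => exact hw.add (ih.intOp hk)
  have hsd : ∀ j x, s (j + 1) x = s j x + d (j + 1) x := by
    intro j
    induction j with
    | zero => intro x; rw [hss, hs0, hdsucc]; rfl
    | succ j ih =>
      intro x
      rw [hss (j + 1) x, hss j x, funext ih, intOp_add hk (hsb j) (hdb _), hdsucc (j + 1)]; ring
  have hsf : ∀ j, ∫ x, (f x : ℂ) * s j x ∂π = 0 := by
    intro j
    have hj := hsb j
    induction j with
    | zero => exact hfw
    | succ j ih =>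
      have h1 := hdb (j + 1)
      have h2 := hsb j
      simp only [hsd, mul_add]
      rw [integral_add (BddMeas.integrable (by fun_prop)) (BddMeas.integrable (by fun_prop)),
        ih h2, hdf, add_zero]
  have hdist : ∀ x j, dist (s j x) (s (j + 1) x) ≤ M * n2 π w * q ^ j := fun x j => by
    rw [hsd, dist_self_add_right]; exact hdx j x
  have hlim : ∀ x, ∃ y, Tendsto (fun j => s j x) atTop (𝓝 y) := fun x =>
    cauchySeq_tendsto_of_complete (cauchySeq_of_le_geometric q _ hq (hdist x))
  choose g hg using hlim
  obtain ⟨W, hW0, hW⟩ := hw.norm_le_const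
  -- a uniform bound on the partial sums makes the limit bounded and allows passing to the limit in
  -- the equation
  obtain ⟨B, hsB⟩ : ∃ B, ∀ j x, ‖s j x‖ ≤ B := by
    refine ⟨W + (M * n2 π w / (1 - q) + M * n2 π w / (1 - q)), fun j x => ?_⟩
    have h1 := dist_le_of_le_geometric_of_tendsto₀ q _ hq (hdist x) (hg x)
    have h2 := dist_le_of_le_geometric_of_tendsto q _ hq (hdist x) (hg x) j
    have h3 : M * n2 π w * q ^ j / (1 - q) ≤ M * n2 π w / (1 - q) := by
      have : 0 ≤ M * n2 π w := mul_nonneg hM0 (n2_nonneg _)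
      exact div_le_div_of_nonneg_right (mul_le_of_le_one_right this (pow_le_one₀ hq0 hq.le))
        (by linarith)
    have h4 : ‖s j x‖ ≤ ‖s 0 x‖ + (dist (s 0 x) (g x) + dist (s j x) (g x)) := by
      rw [dist_comm (s j x), dist_eq_norm, dist_eq_norm]
      calc ‖s j x‖ = ‖s 0 x - ((s 0 x - g x) + (g x - s j x))‖ := by ring_nf
        _ ≤ _ := (norm_sub_le _ _).trans (add_le_add le_rfl (norm_add_le _ _))
    have h5 := hW x
    rw [hs0] at h4 h1
    linarith
  have hgb : BddMeas g := BddMeas.of_tendsto hsb hsB hg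
  refine ⟨g, hgb, ?_, fun x => ?_⟩
  · have hT : Tendsto (fun j => ∫ x, (f x : ℂ) * s j x ∂π) atTop
        (𝓝 (∫ x, (f x : ℂ) * g x ∂π)) := by
      obtain ⟨D, hD0, hD⟩ := hf.le_const
      refine tendsto_integral_of_dominated_convergence (fun _ => D * B)
        (fun j => (hf.ofReal.mul (hsb j)).1.aestronglyMeasurable) (integrable_const _)
        (fun j => .of_forall fun y => ?_) (.of_forall fun y => (hg y).const_mul _)
      rw [norm_mul, Complex.norm_real]
      exact mul_le_mul (hD y) (hsB j y) (norm_nonneg _) hD0.le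
    simp only [hsf] at hT
    exact (tendsto_nhds_unique hT tendsto_const_nhds)
  · have h1 := (tendsto_intOp (π := π) hk hsb hsB hg x).const_add (w x)
    have h2 : Tendsto (fun j => s (j + 1) x) atTop (𝓝 (g x)) :=
      (hg x).comp (tendsto_add_atTop_nat 1)
    simp only [hss] at h2
    rw [tendsto_nhds_unique h2 h1]; ring

/-- Pythagoras for the decomposition along the eigenfunction. -/
lemma IsGapped.n2_sq_eq (h : IsGapped π k f l q M δ) {r : X → ℂ} (hr : BddMeas r)
    (hfr : ∫ x, (f x : ℂ) * r x ∂π = 0) (θ : ℂ) :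
    n2 π (fun x => θ * f x + r x) ^ 2 = ‖θ‖ ^ 2 + n2 π r ^ 2 := by
  have hf := h.bddMeas
  obtain ⟨ρ, hρ⟩ : ∃ ρ : X → ℝ, ρ = fun x => ((starRingEnd ℂ) θ * ((f x : ℂ) * r x)).re := ⟨_, rfl⟩
  have hρb : BddMeas ρ := hρ ▸ BddMeas.re (by fun_prop)
  have e : ∀ x, ‖θ * f x + r x‖ ^ 2 = ‖θ‖ ^ 2 * f x ^ 2 + 2 * ρ x + ‖r x‖ ^ 2 := by
    intro x
    simp only [hρ, ← Complex.normSq_eq_norm_sq, Complex.normSq_apply, Complex.add_re, Complex.add_im,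
      Complex.mul_re, Complex.mul_im, Complex.conj_re, Complex.conj_im, Complex.ofReal_re,
      Complex.ofReal_im]
    ring
  have h0 : ∫ x, ρ x ∂π = 0 := by
    have h1 := integral_re (𝕜 := ℂ) (μ := π) (f := fun x => (starRingEnd ℂ) θ * ((f x : ℂ) * r x))
      (BddMeas.integrable (by fun_prop))
    rw [integral_const_mul, hfr, mul_zero] at h1
    rw [hρ]
    simpa using h1
  rw [n2_sq, n2_sq]
  simp only [e]
  rw [integral_add (BddMeas.integrable (by fun_prop)) (BddMeas.integrable (by fun_prop)),
    integral_add (BddMeas.integrable (by fun_prop)) (BddMeas.integrable (by fun_prop)),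
    integral_const_mul, integral_const_mul, h.normalized, h0]
  ring

end Reduced

/-! ### The operator norm on `L²` -/

section OpNorm

variable {X : Type*} [MeasurableSpace X] {π : Measure X} [IsProbabilityMeasure π]

omit [IsProbabilityMeasure π] in
lemma eLpNorm_two_eq {w : X → ℂ} (hw : MemLp w 2 π) :
    eLpNorm w 2 π = ENNReal.ofReal √(∫ x, ‖w x‖ ^ 2 ∂π) := by
  rw [hw.eLpNorm_eq_integral_rpow_norm (by norm_num) (by norm_num), Real.sqrt_eq_rpow]
  norm_num

/-- A positive eigenfunction of a symmetric non-negative kernel belongs to the `L²` norm. -/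
lemma l2OpNorm_intOp {k : X → X → ℝ} (hk : IsSymmKernel k) {f : X → ℝ} (hf : BddMeas f) {c l : ℝ}
    (hc : 0 < c) (hcf : ∀ x, c ≤ f x) (hl : 0 ≤ l) (hkf : ∀ x, rOp π k f x = l * f x) :
    l2OpNorm π (intOp π k) = l := by
  refine IsLeast.csInf_eq ⟨⟨hl, fun w hw => ?_⟩, fun d ⟨hd0, hd⟩ => ?_⟩
  -- the Schur test; `w` is replaced by a measurable representative
  · obtain ⟨w', hw'm, hww'⟩ := hw.1
    have hw' : MemLp w' 2 π := hw.ae_eq hww'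
    have e : intOp π k w = intOp π k w' := funext fun x =>
      integral_congr_ae (hww'.mono fun y hy => by simp [hy])
    have hsq : Integrable (fun x => ‖w' x‖ ^ 2) π := by
      have := hw'.integrable_norm_pow (p := 2) (by norm_num)
      simpa using this
    obtain ⟨h1, h2⟩ := integral_norm_sq_intOp_le hk hf hc hcf hl (fun x => (hkf x).le)
      hw'm.measurable hsq
    have hmeas : AEStronglyMeasurable (intOp π k w') π := by
      have : StronglyMeasurable (Function.uncurry fun x y => (k x y : ℂ) * w' y) :=
        ((Complex.measurable_ofReal.comp hk.measurable).mul
          (hw'm.measurable.comp measurable_snd)).stronglyMeasurable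
      exact this.integral_prod_right.aestronglyMeasurable
    have hM : MemLp (intOp π k w') 2 π := by
      rw [memLp_two_iff_integrable_sq_norm hmeas]; exact h1
    rw [e, eLpNorm_congr_ae hww', eLpNorm_two_eq hM, eLpNorm_two_eq hw', ← ENNReal.ofReal_mul hl]
    refine ENNReal.ofReal_le_ofReal ((Real.sqrt_le_sqrt h2).trans ?_)
    rw [Real.sqrt_mul (by positivity), Real.sqrt_sq hl]
  -- the eigenfunction itself shows that the bound is attained
  · have hbm := hf.ofReal
    have hMf : MemLp (fun x => (f x : ℂ)) 2 π := by
      obtain ⟨D, hD⟩ := hbm.2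
      exact MemLp.of_bound hbm.1.aestronglyMeasurable D (.of_forall hD)
    have h1 := hd _ hMf
    have e : intOp π k (fun x => (f x : ℂ)) = (l : ℂ) • fun x => (f x : ℂ) := funext fun x => by
      rw [intOp_ofReal, hkf]; simp
    rw [e, eLpNorm_const_smul, eLpNorm_two_eq hMf, ← ofReal_norm, Complex.norm_real,
      Real.norm_of_nonneg hl, ← ENNReal.ofReal_mul hl, ← ENNReal.ofReal_mul hd0,
      ENNReal.ofReal_le_ofReal_iff (mul_nonneg hd0 (Real.sqrt_nonneg _))] at h1
    refine le_of_mul_le_mul_right h1 (Real.sqrt_pos.2 ?_)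
    refine (show 0 < c ^ 2 by positivity).trans_le (le_integral_of_const_le (by fun_prop) fun x => ?_)
    rw [Complex.norm_real]
    exact pow_le_pow_left₀ hc.le ((hcf x).trans (le_abs_self _)) 2

end OpNorm

/-! ### A priori bounds on solutions -/

section Pointwise

variable {X : Type*} [MeasurableSpace X] {π : Measure X} [IsProbabilityMeasure π]

/-- `w` solves the quadratic vector equation at the point `z` of the closed upper half plane. -/
structure SolvesAt (π : Measure X) (a : X → ℝ) (s : X → X → ℝ) (z : ℂ) (w : X → ℂ) : Prop where
  z_im_nonneg : 0 ≤ z.im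
  bddMeas : BddMeas w
  im_nonneg : ∀ x, 0 ≤ (w x).im
  ne_zero : ∀ x, w x ≠ 0
  eq : ∀ x, -1 / w x = z + a x + intOp π s w x

/-- The kernel of the operator `F`. -/
noncomputable def kerF (s : X → X → ℝ) (w : X → ℂ) (x y : X) : ℝ := ‖w x‖ * s x y * ‖w y‖

/-- The function `Im w / |w|`, that is the sine of the argument of `w`. -/
noncomputable def sinArg (w : X → ℂ) (x : X) : ℝ := (w x).im / ‖w x‖

variable {a : X → ℝ} {s : X → X → ℝ} {z : ℂ} {w : X → ℂ}

lemma isSymmKernel_kerF (hs : IsSymmKernel s) (hw : BddMeas w) : IsSymmKernel (kerF s w) := by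
  obtain ⟨M, hM0, hM⟩ := hs.exists_bound
  obtain ⟨C, hC0, hC⟩ := hw.norm_le_const
  refine ⟨((hw.1.norm.comp measurable_fst).mul hs.measurable).mul (hw.1.norm.comp measurable_snd),
    ⟨C * M * C, fun x y => ?_⟩, fun x y => ?_, fun x y => ?_⟩
  · exact mul_le_mul (mul_le_mul (hC x) (hM x y) (hs.nonneg x y) hC0.le) (hC y) (norm_nonneg _)
      (by positivity)
  · exact mul_nonneg (mul_nonneg (norm_nonneg _) (hs.nonneg x y)) (norm_nonneg _)
  · simp only [kerF, hs.symm x y]; ring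

omit [IsProbabilityMeasure π] in
lemma opF_eq (s : X → X → ℝ) (w : X → ℂ) : opF π s w = intOp π (kerF s w) := by
  funext u x
  simp only [opF, intOp, kerF, ← integral_const_mul]
  congr 1; ext y; push_cast; ring

omit [IsProbabilityMeasure π] in
lemma rOp_kerF (s : X → X → ℝ) (w : X → ℂ) (g : X → ℝ) (x : X) :
    rOp π (kerF s w) g x = ‖w x‖ * rOp π s (fun y => ‖w y‖ * g y) x := by
  simp only [rOp, kerF, ← integral_const_mul]
  congr 1; ext y; ring

lemma kerF_le {M Φ : ℝ} (hs : IsSymmKernel s) (hM : ∀ x y, s x y ≤ M) (hΦ : ∀ x, ‖w x‖ ≤ Φ)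
    (x y : X) : kerF s w x y ≤ Φ * M * Φ := by
  have hΦ0 : 0 ≤ Φ := (norm_nonneg _).trans (hΦ x)
  have hM0 : 0 ≤ M := (hs.nonneg x y).trans (hM x y)
  exact mul_le_mul (mul_le_mul (hΦ x) (hM x y) (hs.nonneg x y) hΦ0) (hΦ y) (norm_nonneg _)
    (by positivity)

/-- Uniform primitivity of `S` passes to `F` where `|w|` is bounded below. -/
lemma le_kernelPow_kerF (hs : IsSymmKernel s) (hw : BddMeas w) {c₀ c : ℝ} (hc₀ : 0 < c₀)
    (h : ∀ x, c₀ ≤ ‖w x‖) {n : ℕ} (hc : ∀ x y, c ≤ kernelPow π s n x y) (x y : X) :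
    (c₀ ^ 2) ^ (n + 1) * c ≤ kernelPow π (kerF s w) n x y := by
  refine (mul_le_mul_of_nonneg_left (hc x y) (by positivity)).trans ?_
  have hk := isSymmKernel_kerF hs hw
  have h2 : ∀ x y, c₀ ^ 2 * s x y ≤ kerF s w x y := fun x y => by
    have : c₀ * c₀ ≤ ‖w x‖ * ‖w y‖ := mul_le_mul (h x) (h y) hc₀.le (norm_nonneg _)
    have := mul_le_mul_of_nonneg_right this (hs.nonneg x y)
    simp only [kerF]; linarith
  clear hc
  induction n generalizing x with
  | zero => simpa [kernelPow] using h2 x y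
  | succ n ih =>
    have hb1 := hs.bddMeas x
    have hb2 := hk.bddMeas x
    have hb3 := bddMeas_kernelPow_right (π := π) hs n y
    have hb4 := bddMeas_kernelPow_right (π := π) hk n y
    simp only [kernelPow]
    rw [← integral_const_mul]
    refine integral_mono (BddMeas.integrable (by fun_prop)) (BddMeas.integrable (by fun_prop))
      fun u => ?_
    calc (c₀ ^ 2) ^ (n + 1 + 1) * (s x u * kernelPow π s n u y)
        = (c₀ ^ 2 * s x u) * ((c₀ ^ 2) ^ (n + 1) * kernelPow π s n u y) := by ring
      _ ≤ kerF s w x u * kernelPow π (kerF s w) n u y :=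
          mul_le_mul (h2 x u) (ih u) (mul_nonneg (by positivity) (kernelPow_nonneg hs n u y))
            (hk.nonneg x u)

omit [IsProbabilityMeasure π] in
lemma IsSolution.solvesAt {m : ℂ → X → ℂ} (h : IsSolution π a s m) (hz : 0 < z.im) :
    SolvesAt π a s z (m z) := by
  obtain ⟨h1, h2, h3⟩ := h z hz
  exact ⟨hz.le, h1, fun x => (h2 x).le, fun x hx => by have := h2 x; simp [hx] at this, h3⟩

omit [IsProbabilityMeasure π] in
lemma SolvesAt.norm_pos (h : SolvesAt π a s z w) (x : X) : 0 < ‖w x‖ := norm_pos_iff.2 (h.ne_zero x)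

lemma neg_one_div_im (ζ : ℂ) : (-1 / ζ).im = ζ.im / ‖ζ‖ ^ 2 := by
  rw [neg_div, one_div, Complex.neg_im, Complex.inv_im, Complex.normSq_eq_norm_sq]; ring

lemma SolvesAt.im_div_eq (h : SolvesAt π a s z w) (hs : IsSymmKernel s) (x : X) :
    (w x).im / ‖w x‖ ^ 2 = z.im + rOp π s (fun y => (w y).im) x := by
  rw [← neg_one_div_im, h.eq, Complex.add_im, Complex.add_im, intOp_im hs h.bddMeas]; simp

lemma SolvesAt.im_eq (h : SolvesAt π a s z w) (hs : IsSymmKernel s) (x : X) :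
    (w x).im = ‖w x‖ ^ 2 * (z.im + rOp π s (fun y => (w y).im) x) := by
  rw [← h.im_div_eq hs]; have := (h.norm_pos x).ne'; field_simp

lemma SolvesAt.im_pos (h : SolvesAt π a s z w) (hs : IsSymmKernel s) (hz : 0 < z.im) (x : X) :
    0 < (w x).im := by
  rw [h.im_eq hs]
  have := h.norm_pos x
  have := rOp_nonneg (π := π) hs h.im_nonneg x
  positivity

/-- The lower bound on a bounded solution: `|w|⁻¹ = |z + a + S w|` is bounded. -/
lemma SolvesAt.one_le (h : SolvesAt π a s z w) (hs : IsSymmKernel s) {A M Φ R : ℝ}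
    (hA : ∀ x, |a x| ≤ A) (hM : ∀ x y, s x y ≤ M) (hΦ : ∀ x, ‖w x‖ ≤ Φ) (hR : ‖z‖ ≤ R) (x : X) :
    1 ≤ ‖w x‖ * (R + A + M * Φ) := by
  have hM0 : 0 ≤ M := (hs.nonneg x x).trans (hM x x)
  have h1 : ‖intOp π s w x‖ ≤ M * Φ := (norm_intOp_le_n2 hs hM h.bddMeas x).trans
    (mul_le_mul_of_nonneg_left (n2_le_of_bound h.bddMeas hΦ) hM0)
  have h2 : ‖z + a x + intOp π s w x‖ ≤ R + A + M * Φ := by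
    refine (norm_add_le _ _).trans (add_le_add ((norm_add_le _ _).trans (add_le_add hR ?_)) h1)
    rw [Complex.norm_real]; exact hA x
  have h3 : (1 : ℝ) = ‖w x‖ * ‖z + a x + intOp π s w x‖ := by
    rw [← h.eq, norm_div, norm_neg, norm_one]; have := (h.norm_pos x).ne'; field_simp
  calc (1 : ℝ) = _ := h3
    _ ≤ _ := mul_le_mul_of_nonneg_left h2 (norm_nonneg _)

lemma SolvesAt.exists_le_norm (h : SolvesAt π a s z w) (ha : BddMeas a) (hs : IsSymmKernel s) :
    ∃ c, 0 < c ∧ ∀ x, c ≤ ‖w x‖ := by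
  obtain ⟨A, hA0, hA⟩ := ha.le_const
  obtain ⟨M, hM0, hM⟩ := hs.exists_bound
  obtain ⟨Φ, hΦ0, hΦ⟩ := h.bddMeas.norm_le_const
  have : 0 < ‖z‖ + A + M * Φ := by positivity
  refine ⟨1 / (‖z‖ + A + M * Φ), by positivity, fun x => ?_⟩
  rw [div_le_iff₀ this]
  exact h.one_le hs hA hM hΦ le_rfl x

lemma SolvesAt.bddMeas_inv_norm (h : SolvesAt π a s z w) (ha : BddMeas a) (hs : IsSymmKernel s) :
    BddMeas (fun x => ‖w x‖⁻¹) := by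
  obtain ⟨c, hc0, hc⟩ := h.exists_le_norm ha hs
  exact h.bddMeas.norm.inv_real hc0 hc

lemma SolvesAt.bddMeas_sinArg (h : SolvesAt π a s z w) (ha : BddMeas a) (hs : IsSymmKernel s) :
    BddMeas (sinArg w) := by
  have h1 := h.bddMeas_inv_norm ha hs
  have h2 := h.bddMeas
  unfold sinArg
  simp only [div_eq_mul_inv]
  fun_prop

omit [MeasurableSpace X] in
lemma sinArg_le_one (w : X → ℂ) (x : X) : sinArg w x ≤ 1 :=
  div_le_one_of_le₀ ((le_abs_self _).trans (Complex.abs_im_le_norm _)) (norm_nonneg _)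

omit [IsProbabilityMeasure π] in
lemma SolvesAt.sinArg_nonneg (h : SolvesAt π a s z w) (x : X) : 0 ≤ sinArg w x :=
  div_nonneg (h.im_nonneg x) (norm_nonneg _)

omit [IsProbabilityMeasure π] in
lemma SolvesAt.norm_mul_sinArg (h : SolvesAt π a s z w) (x : X) :
    ‖w x‖ * sinArg w x = (w x).im := mul_div_cancel₀ _ (h.norm_pos x).ne'

/-- The imaginary part of the equation: `sinArg w` is an approximate eigenfunction of `F`. -/
lemma SolvesAt.sinArg_eq (h : SolvesAt π a s z w) (hs : IsSymmKernel s) (x : X) :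
    sinArg w x = z.im * ‖w x‖ + rOp π (kerF s w) (sinArg w) x := by
  rw [rOp_kerF]
  simp only [h.norm_mul_sinArg]
  have h1 := h.im_eq hs x
  have := (h.norm_pos x).ne'
  rw [sinArg, h1]; field_simp

lemma SolvesAt.rOp_sinArg_le (h : SolvesAt π a s z w) (hs : IsSymmKernel s) (x : X) :
    rOp π (kerF s w) (sinArg w) x ≤ 1 * sinArg w x := by
  rw [one_mul, h.sinArg_eq hs x]
  have := mul_nonneg h.z_im_nonneg (norm_nonneg (w x))
  linarith

lemma SolvesAt.exists_le_sinArg (h : SolvesAt π a s z w) (ha : BddMeas a) (hs : IsSymmKernel s)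
    (hz : 0 < z.im) : ∃ c, 0 < c ∧ ∀ x, c ≤ sinArg w x := by
  obtain ⟨c, hc0, hc⟩ := h.exists_le_norm ha hs
  refine ⟨z.im * c, by positivity, fun x => ?_⟩
  rw [h.sinArg_eq hs x]
  have := rOp_nonneg (π := π) (isSymmKernel_kerF hs h.bddMeas) h.sinArg_nonneg x
  have := mul_le_mul_of_nonneg_left (hc x) hz.le
  linarith

/-- In the upper half plane `F` has norm at most one on `L²`: the Schur test applies with the
positive function `sinArg w`. -/
lemma SolvesAt.n2_intOp_kerF_le (h : SolvesAt π a s z w) (ha : BddMeas a) (hs : IsSymmKernel s)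
    (hz : 0 < z.im) {u : X → ℂ} (hu : BddMeas u) :
    n2 π (fun x => intOp π (kerF s w) u x) ≤ n2 π u := by
  obtain ⟨c, hc0, hc⟩ := h.exists_le_sinArg ha hs hz
  simpa using n2_intOp_le (π := π) (isSymmKernel_kerF hs h.bddMeas) (h.bddMeas_sinArg ha hs) hc0 hc
    zero_le_one (h.rOp_sinArg_le hs) hu

/-- The `L²` bound: the operator `|w| R R |w| ≤ F` has norm at most one, hence so has `|w| R`, which
is applied to the constant function. -/
lemma SolvesAt.n2_le (h : SolvesAt π a s z w) (ha : BddMeas a) (hs : IsSymmKernel s)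
    (hz : 0 < z.im) {r : X → X → ℝ} (hr : IsSymmKernel r)
    (hrs : ∀ x y, ∫ u, r x u * r u y ∂π ≤ s x y) {c : ℝ} (hc : 0 < c)
    (hcr : ∀ x, c ≤ ∫ y, r x y ∂π) : n2 π w ≤ 1 / c := by
  have hw := h.bddMeas
  have hk := isSymmKernel_kerF hs hw
  have hR1 : ∀ x, rOp π r (fun _ => 1) x = ∫ y, r x y ∂π := fun x => by simp [rOp]
  have hR1b : BddMeas (fun x => rOp π r (fun _ => 1) x) := (BddMeas.const (1 : ℝ)).rOp hr
  have hR0 : ∀ x, 0 ≤ rOp π r (fun _ => 1) x := rOp_nonneg hr fun _ => zero_le_one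
  -- `b = |w| R 1` satisfies `‖b‖ ≤ 1`, while `R 1 ≥ c`
  set b : X → ℝ := fun x => ‖w x‖ * rOp π r (fun _ => 1) x with hb
  have hbb : BddMeas b := by fun_prop
  have hb0 : ∀ x, 0 ≤ b x := fun x => mul_nonneg (norm_nonneg _) (hR0 x)
  set g : X → ℝ := fun x => ‖w x‖ * b x with hg
  have hgb : BddMeas g := by fun_prop
  have hg0 : ∀ x, 0 ≤ g x := fun x => mul_nonneg (norm_nonneg _) (hb0 x)
  have hRg := hgb.rOp (π := π) hr
  have hKb := hbb.rOp (π := π) hk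
  set N := n2 π (fun x => (b x : ℂ)) with hN
  have hN2 : N ^ 2 = ∫ x, b x ^ 2 ∂π := by rw [hN, n2_sq]; simp
  -- the pairing of `b` with itself is the mean of `R g`
  have h1 : N ^ 2 = ∫ x, rOp π r g x ∂π := by
    have := integral_mul_rOp (π := π) hr (u := fun _ => 1) (BddMeas.const (1 : ℝ)) hgb
    simp only [one_mul] at this
    rw [hN2, this]
    congr 1; ext x; simp only [hb, hg]; ring
  have h2 : (∫ x, rOp π r g x ∂π) ^ 2 ≤ ∫ x, rOp π r g x ^ 2 ∂π := by
    have := sq_integral_le_mul (π := π) (a := fun _ => 1) (b := fun x => rOp π r g x ^ 2)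
      (c := fun x => rOp π r g x) (integrable_const _) (hRg.pow 2).integrable hRg.integrable
      (fun _ => zero_le_one) (fun x => sq_nonneg _) (fun x => by simp)
    simpa using this
  -- `‖R g‖² = ⟨g, R R g⟩ ≤ ⟨g, S g⟩ = ⟨b, F b⟩` for `g = |w| b`
  have h3 : ∫ x, rOp π r g x ^ 2 ∂π ≤ ∫ x, b x * rOp π (kerF s w) b x ∂π := by
    have e1 : ∫ x, rOp π r g x ^ 2 ∂π = ∫ x, g x * rOp π (kernelPow π r 1) g x ∂π := by
      simp only [sq]
      rw [← integral_mul_rOp hr hgb hRg]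
      simp only [rOp_kernelPow hr hgb]
      rfl
    have hr1 := isSymmKernel_kernelPow (π := π) hr 1
    have hRRg := hgb.rOp (π := π) hr1
    rw [e1]
    refine integral_mono (hgb.mul hRRg).integrable (hbb.mul hKb).integrable fun x => ?_
    have e2 : b x * rOp π (kerF s w) b x = g x * rOp π s g x := by
      rw [rOp_kerF]; simp only [hg]; ring
    simp only [e2]
    refine mul_le_mul_of_nonneg_left ?_ (hg0 x)
    have hb1 := hr1.bddMeas x
    have hb2 := hs.bddMeas x
    exact integral_mono (BddMeas.integrable (by fun_prop)) (BddMeas.integrable (by fun_prop))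
      fun y => mul_le_mul_of_nonneg_right (hrs x y) (hg0 y)
  have h4 : ∫ x, b x * rOp π (kerF s w) b x ∂π ≤ N * N := by
    have h5 := (integral_norm_mul_le_n2 (π := π) hbb.ofReal hKb.ofReal)
    have h6 := h.n2_intOp_kerF_le ha hs hz hbb.ofReal
    simp only [intOp_ofReal] at h6
    refine le_trans (le_of_eq ?_) (h5.trans (mul_le_mul_of_nonneg_left h6 (n2_nonneg _)))
    congr 1; ext x
    rw [Complex.norm_real, Complex.norm_real, Real.norm_of_nonneg (hb0 x),
      Real.norm_of_nonneg (rOp_nonneg hk hb0 x)]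
  have hN0 : 0 ≤ N := n2_nonneg _
  have h5 : N ≤ 1 := by
    rw [← h1] at h2
    by_contra hcon
    push Not at hcon
    have h7 : N ^ 2 * N ^ 2 ≤ N ^ 2 * 1 := by linarith [h2, h3, h4]
    have h8 := le_of_mul_le_mul_left h7 (by positivity)
    nlinarith
  have h6 : c * n2 π w ≤ N := by
    have := n2_mono (π := π) (u := fun x => (c : ℂ) * w x) (w := fun x => (b x : ℂ)) (by fun_prop)
      (by fun_prop) fun x => by
        rw [norm_mul, Complex.norm_real, Complex.norm_real, Real.norm_of_nonneg hc.le,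
          Real.norm_of_nonneg (hb0 x), mul_comm]
        refine mul_le_mul_of_nonneg_left ?_ (norm_nonneg _)
        rw [hR1]; exact hcr x
    rwa [n2_const_mul, Complex.norm_real, Real.norm_of_nonneg hc.le] at this
  rw [le_div_iff₀ hc]; linarith

/-- The uniform bound: an `L²` bound and the regularity of the components exclude a large value at a
single point, because the values at many other points would then be large too. -/
lemma exists_sup_bound (ha : BddMeas a) (hs : IsSymmKernel s) (hA : DiagonalPositivity π s)
    (hC : ComponentRegularity π a s) :
    ∃ Φ, 0 < Φ ∧ ∀ (z : ℂ) (w : X → ℂ), 0 < z.im → SolvesAt π a s z w → ∀ x, ‖w x‖ ≤ Φ := by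
  obtain ⟨r, hr, hrs, c, hc, hcr⟩ := hA
  set B := max (1 / c) 1 with hB
  have hB1 : 1 ≤ B := le_max_right _ _
  -- for small `ε` the integral in the regularity assumption exceeds what the `L²` bound allows
  obtain ⟨ε₀, hε₀, hε⟩ : ∃ ε₀ > 0, ∀ ε, 0 < ε → ε < ε₀ → 3 * B ^ 2 * B ^ 2 + 1 ≤
      ⨅ x, ∫ y, 1 / (ε + (a x - a y) ^ 2 + ∫ u, (s x u - s y u) ^ 2 ∂π) ∂π := by
    have h1 := hC.eventually_ge_atTop (3 * B ^ 2 * B ^ 2 + 1)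
    rw [eventually_nhdsWithin_iff, Metric.eventually_nhds_iff] at h1
    obtain ⟨ε₀, h0, h1⟩ := h1
    refine ⟨ε₀, h0, fun ε h2 h3 => h1 ?_ h2⟩
    rwa [Real.dist_eq, sub_zero, abs_of_pos h2]
  refine ⟨√(1 / ε₀), by positivity, fun z w hz h x => ?_⟩
  have hwb := h.bddMeas
  have hwB : n2 π w ≤ B := (h.n2_le ha hs hz hr hrs hc hcr).trans (le_max_left _ _)
  refine Real.le_sqrt_of_sq_le (le_of_not_gt fun hlt => ?_)
  have hwx := h.norm_pos x
  -- a large value at `x` makes this `ε` small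
  set ε := 1 / ‖w x‖ ^ 2 with hεdef
  have hεpos : 0 < ε := by positivity
  have h1 := hε ε hεpos (by rw [hεdef, div_lt_iff₀ (by positivity)]
                            rwa [div_lt_iff₀ hε₀, mul_comm] at hlt)
  have hbdd : BddBelow (range fun x => ∫ y, 1 / (ε + (a x - a y) ^ 2
      + ∫ u, (s x u - s y u) ^ 2 ∂π) ∂π) :=
    ⟨0, by
      rintro _ ⟨x, rfl⟩
      refine integral_nonneg fun y => ?_
      have : 0 ≤ ∫ u, (s x u - s y u) ^ 2 ∂π := integral_nonneg fun u => sq_nonneg _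
      positivity⟩
  have h2 := h1.trans (ciInf_le hbdd x)
  -- subtract the equations at `x` and `y`: `1 / |w y| ≤ 1 / |w x| + |a x - a y| + ‖s x - s y‖ ‖w‖`
  have h3 : ∀ y, 1 / (ε + (a x - a y) ^ 2 + ∫ u, (s x u - s y u) ^ 2 ∂π)
      ≤ 3 * B ^ 2 * ‖w y‖ ^ 2 := by
    intro y
    have hD0 : 0 ≤ ∫ u, (s x u - s y u) ^ 2 ∂π := integral_nonneg fun u => sq_nonneg _
    set D := ∫ u, (s x u - s y u) ^ 2 ∂π with hD
    have hwy := h.norm_pos y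
    have hbx := hs.bddMeas x
    have hby := hs.bddMeas y
    have e1 : 1 / w y = 1 / w x + ((a x - a y : ℝ) : ℂ)
        + ∫ u, ((s x u - s y u : ℝ) : ℂ) * w u ∂π := by
      have e2 : ∫ u, ((s x u - s y u : ℝ) : ℂ) * w u ∂π = intOp π s w x - intOp π s w y := by
        unfold intOp
        rw [← integral_sub (BddMeas.integrable (by fun_prop)) (BddMeas.integrable (by fun_prop))]
        congr 1; ext u; push_cast; ring
      have e3 := h.eq x
      have e4 := h.eq y
      rw [neg_div] at e3 e4
      rw [e2]; push_cast
      linear_combination e3 - e4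
    have e5 : ‖∫ u, ((s x u - s y u : ℝ) : ℂ) * w u ∂π‖ ≤ √D * B := by
      refine (norm_integral_mul_le_n2 (BddMeas.ofReal (hbx.sub hby)) hwb).trans ?_
      have : n2 π (fun u => ((s x u - s y u : ℝ) : ℂ)) = √D := by
        simp only [n2, hD, Complex.norm_real, Real.norm_eq_abs, sq_abs]
      rw [this]
      exact mul_le_mul_of_nonneg_left hwB (Real.sqrt_nonneg _)
    have e6 : 1 / ‖w y‖ ≤ 1 / ‖w x‖ + |a x - a y| + √D * B := by
      have e7 : 1 / ‖w y‖ = ‖1 / w y‖ := by simp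
      rw [e7, e1]
      refine (norm_add_le _ _).trans (add_le_add ((norm_add_le _ _).trans ?_) e5)
      rw [Complex.norm_real]; simp
    have e8 : 1 / ‖w y‖ ^ 2 ≤ 3 * B ^ 2 * (ε + (a x - a y) ^ 2 + D) := by
      have p1 : (1 / ‖w y‖) ^ 2 ≤ (1 / ‖w x‖ + |a x - a y| + √D * B) ^ 2 :=
        pow_le_pow_left₀ (by positivity) e6 2
      have p2 : (1 / ‖w x‖ + |a x - a y| + √D * B) ^ 2
          ≤ 3 * ((1 / ‖w x‖) ^ 2 + |a x - a y| ^ 2 + (√D * B) ^ 2) := by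
        nlinarith [sq_nonneg (1 / ‖w x‖ - |a x - a y|), sq_nonneg (1 / ‖w x‖ - √D * B),
          sq_nonneg (|a x - a y| - √D * B)]
      have p3 : (1 / ‖w x‖) ^ 2 = ε := by rw [hεdef, div_pow, one_pow]
      rw [p3, sq_abs, mul_pow, Real.sq_sqrt hD0] at p2
      rw [div_pow, one_pow] at p1
      have p4 : 1 ≤ B ^ 2 := one_le_pow₀ hB1
      nlinarith [mul_nonneg (sub_nonneg.2 p4) hεpos.le,
        mul_nonneg (sub_nonneg.2 p4) (sq_nonneg (a x - a y))]
    rw [div_le_iff₀ (by positivity)]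
    rw [div_le_iff₀ (by positivity)] at e8
    nlinarith
  have h4 : ∫ y, 1 / (ε + (a x - a y) ^ 2 + ∫ u, (s x u - s y u) ^ 2 ∂π) ∂π
      ≤ ∫ y, 3 * B ^ 2 * ‖w y‖ ^ 2 ∂π := by
    refine integral_mono_of_nonneg (.of_forall fun y => ?_) (BddMeas.integrable (by fun_prop))
      (.of_forall h3)
    have : 0 ≤ ∫ u, (s x u - s y u) ^ 2 ∂π := integral_nonneg fun u => sq_nonneg _
    simp only [Pi.zero_apply]
    positivity
  rw [integral_const_mul, ← n2_sq] at h4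
  have h5 : n2 π w ^ 2 ≤ B ^ 2 := pow_le_pow_left₀ (n2_nonneg _) hwB 2
  nlinarith [mul_le_mul_of_nonneg_left h5 (show 0 ≤ 3 * B ^ 2 by positivity)]

end Pointwise

/-! ### Hyperbolic contraction and existence of the solution -/

section Hyperbolic

variable {X : Type*} [MeasurableSpace X] {π : Measure X} [IsProbabilityMeasure π]
  {a : X → ℝ} {s : X → X → ℝ} {z z' : ℂ}

/-- The right hand side of the quadratic vector equation solved for the left hand side. -/
noncomputable def qveMap (π : Measure X) (a : X → ℝ) (s : X → X → ℝ) (z : ℂ) (u : X → ℂ) (x : X) :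
    ℂ := -1 / (z + a x + intOp π s u x)

/-- Averaging with non-negative weights does not increase the hyperbolic distance. -/
lemma norm_intOp_le_sqrt (hs : IsSymmKernel s) {u : X → ℂ} {p p' : X → ℝ} (hu : BddMeas u)
    (hp : BddMeas p) (hp' : BddMeas p') (hp0 : ∀ x, 0 ≤ p x) (hp0' : ∀ x, 0 ≤ p' x) {d : ℝ}
    (hd : 0 ≤ d) (h : ∀ x, ‖u x‖ ≤ d * √(p x * p' x)) (x : X) :
    ‖intOp π s u x‖ ≤ d * √(rOp π s p x * rOp π s p' x) := by
  have hb := hs.bddMeas x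
  have h1 : rOp π s (fun y => ‖u y‖) x ^ 2
      ≤ (∫ y, s x y * p y ∂π) * ∫ y, d ^ 2 * (s x y * p' y) ∂π := by
    refine sq_integral_le_mul (BddMeas.integrable (by fun_prop)) (BddMeas.integrable (by fun_prop))
      (BddMeas.integrable (by fun_prop)) (fun y => mul_nonneg (hs.nonneg x y) (hp0 y))
      (fun y => mul_nonneg (by positivity) (mul_nonneg (hs.nonneg x y) (hp0' y))) fun y => ?_
    have h2 : ‖u y‖ ^ 2 ≤ (d * √(p y * p' y)) ^ 2 := pow_le_pow_left₀ (norm_nonneg _) (h y) 2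
    rw [mul_pow, Real.sq_sqrt (mul_nonneg (hp0 y) (hp0' y))] at h2
    calc (s x y * ‖u y‖) ^ 2 = s x y ^ 2 * ‖u y‖ ^ 2 := by ring
      _ ≤ s x y ^ 2 * (d ^ 2 * (p y * p' y)) := mul_le_mul_of_nonneg_left h2 (sq_nonneg _)
      _ = _ := by ring
  rw [integral_const_mul] at h1
  refine (norm_intOp_le hs u x).trans ((Real.le_sqrt_of_sq_le h1).trans_eq ?_)
  rw [show (∫ y, s x y * p y ∂π) * (d ^ 2 * ∫ y, s x y * p' y ∂π)
    = d ^ 2 * (rOp π s p x * rOp π s p' x) by simp only [rOp]; ring,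
    Real.sqrt_mul (by positivity), Real.sqrt_sq hd]

/-- Adding the same kind of quantity to both imaginary parts is compatible with hyperbolic distances
(Cauchy–Schwarz in `ℝ²`). -/
lemma sqrt_mul_add_sqrt_mul_le {p p' t t' : ℝ} (hp : 0 ≤ p) (hp' : 0 ≤ p') (ht : 0 ≤ t)
    (ht' : 0 ≤ t') : √(p * p') + √(t * t') ≤ √((p + t) * (p' + t')) := by
  refine Real.le_sqrt_of_sq_le ?_
  have h1 := Real.sq_sqrt (mul_nonneg hp hp')
  have h2 := Real.sq_sqrt (mul_nonneg ht ht')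
  have h3 : √(p * p') * √(t * t') = √(p * t') * √(t * p') := by
    rw [← Real.sqrt_mul (by positivity), ← Real.sqrt_mul (by positivity)]; ring_nf
  have h4 := Real.sq_sqrt (mul_nonneg hp ht')
  have h5 := Real.sq_sqrt (mul_nonneg ht hp')
  nlinarith [sq_nonneg (√(p * t') - √(t * p'))]

/-- The map `ζ ↦ -1/ζ` preserves the hyperbolic distance `|ζ - ζ'| / √(Im ζ Im ζ')`. -/
lemma norm_neg_one_div_sub_le {ζ ζ' : ℂ} (hζ : ζ ≠ 0) (hζ' : ζ' ≠ 0) (hi : 0 ≤ ζ.im)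
    (hi' : 0 ≤ ζ'.im) {d : ℝ} (h : ‖ζ - ζ'‖ ≤ d * √(ζ.im * ζ'.im)) :
    ‖-1 / ζ - -1 / ζ'‖ ≤ d * √((-1 / ζ).im * (-1 / ζ').im) := by
  have n1 := norm_pos_iff.2 hζ
  have n2 := norm_pos_iff.2 hζ'
  have e1 : -1 / ζ - -1 / ζ' = (ζ - ζ') / (ζ * ζ') := by field_simp; ring
  have e2 : √((-1 / ζ).im * (-1 / ζ').im) = √(ζ.im * ζ'.im) / (‖ζ‖ * ‖ζ'‖) := by
    rw [neg_one_div_im, neg_one_div_im, div_mul_div_comm, ← mul_pow, Real.sqrt_div (by positivity),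
      Real.sqrt_sq (by positivity)]
  rw [e1, e2, norm_div, norm_mul, ← mul_div_assoc]
  exact div_le_div_of_nonneg_right h (by positivity)

omit [IsProbabilityMeasure π] in
lemma rOp_im_nonneg (hs : IsSymmKernel s) {u : X → ℂ} (hu : ∀ x, 0 ≤ (u x).im) (x : X) :
    0 ≤ rOp π s (fun y => (u y).im) x := rOp_nonneg hs hu x

lemma qve_rhs_im (hs : IsSymmKernel s) {u : X → ℂ} (hu : BddMeas u) (x : X) :
    (z + a x + intOp π s u x).im = z.im + rOp π s (fun y => (u y).im) x := by
  rw [Complex.add_im, Complex.add_im, intOp_im hs hu]; simp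

/-- The map `u ↦ -1/(z + a + S u)` shrinks hyperbolic distances, down to the distance of the
spectral parameters. -/
lemma qveMap_contraction (hs : IsSymmKernel s) (hz : 0 < z.im) (hz' : 0 < z'.im) {u w : X → ℂ}
    (hu : BddMeas u) (hw : BddMeas w) (hu0 : ∀ x, 0 ≤ (u x).im) (hw0 : ∀ x, 0 ≤ (w x).im)
    {A d d₀ : ℝ} (huA : ∀ x, rOp π s (fun y => (u y).im) x ≤ A)
    (hwA : ∀ x, rOp π s (fun y => (w y).im) x ≤ A) (hd₀ : 0 ≤ d₀) (hd : d₀ ≤ d)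
    (hzz : ‖z - z'‖ ≤ d₀ * √(z.im * z'.im))
    (huw : ∀ x, ‖u x - w x‖ ≤ d * √((u x).im * (w x).im)) (x : X) :
    ‖qveMap π a s z u x - qveMap π a s z' w x‖
      ≤ (d₀ + (1 - √(z.im * z'.im) / √((z.im + A) * (z'.im + A))) * (d - d₀))
        * √((qveMap π a s z u x).im * (qveMap π a s z' w x).im) := by
  have i1 := qve_rhs_im (π := π) (a := a) (z := z) hs hu x
  have i2 := qve_rhs_im (π := π) (a := a) (z := z') hs hw x
  have t1 := rOp_im_nonneg (π := π) hs hu0 x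
  have t2 := rOp_im_nonneg (π := π) hs hw0 x
  set t := rOp π s (fun y => (u y).im) x with ht
  set t' := rOp π s (fun y => (w y).im) x with ht'
  have hA : 0 ≤ A := t1.trans (huA x)
  refine norm_neg_one_div_sub_le (fun h => ?_) (fun h => ?_) ?_ ?_ ?_
  · rw [h] at i1; simp at i1; linarith
  · rw [h] at i2; simp at i2; linarith
  · rw [i1]; positivity
  · rw [i2]; positivity
  rw [i1, i2]
  have e1 : ‖intOp π s (fun y => u y - w y) x‖ ≤ d * √(t * t') :=
    norm_intOp_le_sqrt hs (hu.sub hw) hu.im hw.im hu0 hw0 (hd₀.trans hd) huw x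
  have e2 : z + a x + intOp π s u x - (z' + a x + intOp π s w x)
      = (z - z') + intOp π s (fun y => u y - w y) x := by rw [intOp_sub hs hu hw]; ring
  rw [e2]
  have e3 := sqrt_mul_add_sqrt_mul_le hz.le hz'.le t1 t2
  set P := √(z.im * z'.im) with hP
  have hP0 : 0 < P := by positivity
  have e4 : √((z.im + t) * (z'.im + t')) ≤ √((z.im + A) * (z'.im + A)) :=
    Real.sqrt_le_sqrt (mul_le_mul (by linarith [huA x]) (by linarith [hwA x]) (by positivity)
      (by positivity))
  set R := √((z.im + t) * (z'.im + t'))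
  set RA := √((z.im + A) * (z'.im + A))
  have hRA : 0 < RA := by positivity
  -- the strictly positive share of `z` in the imaginary parts gives the contraction factor
  have e5 : P / RA * R ≤ P := by
    rw [div_mul_eq_mul_div, div_le_iff₀ hRA]
    exact mul_le_mul_of_nonneg_left e4 hP0.le
  have e6 : 0 ≤ d - d₀ := sub_nonneg.2 hd
  calc _ ≤ d₀ * P + d * √(t * t') := (norm_add_le _ _).trans (add_le_add hzz e1)
    _ = d * (P + √(t * t')) - (d - d₀) * P := by ring
    _ ≤ d * R - (d - d₀) * (P / RA * R) := by
        have := mul_le_mul_of_nonneg_left e3 (hd₀.trans hd)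
        have := mul_le_mul_of_nonneg_left e5 e6
        linarith
    _ = _ := by ring

omit [IsProbabilityMeasure π] in
lemma SolvesAt.qveMap_eq {w : X → ℂ} (h : SolvesAt π a s z w) (x : X) : qveMap π a s z w x = w x := by
  have := h.ne_zero x
  rw [qveMap, ← h.eq]; field_simp

/-- **Schwarz–Pick.** The solution does not increase hyperbolic distances. -/
lemma SolvesAt.schwarzPick {w w' : X → ℂ} (h : SolvesAt π a s z w) (h' : SolvesAt π a s z' w')
    (ha : BddMeas a) (hs : IsSymmKernel s) (hz : 0 < z.im) (hz' : 0 < z'.im) (x : X) :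
    ‖w x - w' x‖ ≤ ‖z - z'‖ / √(z.im * z'.im) * √((w x).im * (w' x).im) := by
  obtain ⟨M, hM0, hM⟩ := hs.exists_bound
  obtain ⟨B, hB0, hB⟩ := h.bddMeas.norm_le_const
  obtain ⟨B', hB0', hB'⟩ := h'.bddMeas.norm_le_const
  obtain ⟨c, hc0, hc⟩ := h.exists_le_norm ha hs
  obtain ⟨c', hc0', hc'⟩ := h'.exists_le_norm ha hs
  obtain ⟨e, he0, he⟩ := h.exists_le_sinArg ha hs hz
  obtain ⟨e', he0', he'⟩ := h'.exists_le_sinArg ha hs hz'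
  set P := √(z.im * z'.im) with hP
  have hP0 : 0 < P := by positivity
  set d₀ := ‖z - z'‖ / P
  have hd₀ : 0 ≤ d₀ := by positivity
  set A := M * (B + B') with hA
  have hA0 : 0 ≤ A := by positivity
  have hwA : ∀ x, rOp π s (fun y => (w y).im) x ≤ A := rOp_le_const hs hM hM0.le h.bddMeas.im
    h.im_nonneg fun x => ((le_abs_self _).trans (Complex.abs_im_le_norm _)).trans
      ((hB x).trans (by linarith))
  have hwA' : ∀ x, rOp π s (fun y => (w' y).im) x ≤ A := rOp_le_const hs hM hM0.le h'.bddMeas.im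
    h'.im_nonneg fun x => ((le_abs_self _).trans (Complex.abs_im_le_norm _)).trans
      ((hB' x).trans (by linarith))
  set θ := P / √((z.im + A) * (z'.im + A)) with hθ
  have hθ0 : 0 < θ := by positivity
  have hθ1 : θ ≤ 1 := by
    refine div_le_one_of_le₀ (Real.sqrt_le_sqrt ?_) (Real.sqrt_nonneg _)
    exact mul_le_mul (by linarith) (by linarith) hz'.le (by linarith)
  -- `D` bounds the initial distance; the excess over `d₀` is contracted by `1 - θ` in each step
  set D := (B + B') / √((c * e) * (c' * e')) with hD
  have hD0 : 0 ≤ D := by positivity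
  have key : ∀ n : ℕ, ∀ x, ‖w x - w' x‖ ≤ (d₀ + (1 - θ) ^ n * D) * √((w x).im * (w' x).im) := by
    intro n
    induction n with
    | zero =>
      intro x
      have i1 : c * e ≤ (w x).im := by
        rw [← h.norm_mul_sinArg]; exact mul_le_mul (hc x) (he x) he0.le (norm_nonneg _)
      have i2 : c' * e' ≤ (w' x).im := by
        rw [← h'.norm_mul_sinArg]; exact mul_le_mul (hc' x) (he' x) he0'.le (norm_nonneg _)
      have i3 : √((c * e) * (c' * e')) ≤ √((w x).im * (w' x).im) :=
        Real.sqrt_le_sqrt (mul_le_mul i1 i2 (by positivity) (h.im_nonneg x))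
      calc ‖w x - w' x‖ ≤ B + B' := (norm_sub_le _ _).trans (add_le_add (hB x) (hB' x))
        _ = D * √((c * e) * (c' * e')) := by rw [hD]; field_simp
        _ ≤ (d₀ + (1 - θ) ^ 0 * D) * √((w x).im * (w' x).im) := by
            rw [pow_zero, one_mul]
            exact mul_le_mul (by linarith) i3 (Real.sqrt_nonneg _) (by positivity)
    | succ n ih =>
      intro x
      have hd : d₀ ≤ d₀ + (1 - θ) ^ n * D := by
        have : 0 ≤ (1 - θ) ^ n * D := mul_nonneg (pow_nonneg (by linarith) _) hD0
        linarith
      have := qveMap_contraction (a := a) hs hz hz' h.bddMeas h'.bddMeas h.im_nonneg h'.im_nonneg hwA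
        hwA' hd₀ hd (by rw [div_mul_cancel₀ _ hP0.ne']) ih x
      rw [h.qveMap_eq, h'.qveMap_eq] at this
      refine this.trans_eq ?_
      rw [← hP, ← hθ]; ring
  have hlim : Tendsto (fun n : ℕ => (d₀ + (1 - θ) ^ n * D) * √((w x).im * (w' x).im)) atTop
      (𝓝 ((d₀ + 0 * D) * √((w x).im * (w' x).im))) :=
    (((tendsto_pow_atTop_nhds_zero_of_lt_one (by linarith) (by linarith)).mul_const D).const_add
      d₀).mul_const _
  rw [zero_mul, add_zero] at hlim
  exact ge_of_tendsto' hlim fun n => key n x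

/-- The solution in the upper half plane is the limit of the iterates of the contraction. -/
lemma exists_solvesAt (π : Measure X) [IsProbabilityMeasure π] (ha : BddMeas a)
    (hs : IsSymmKernel s) (hz : 0 < z.im) : ∃ w, SolvesAt π a s z w := by
  obtain ⟨M, hM0, hM⟩ := hs.exists_bound
  obtain ⟨A₀, hA₀, hA₀'⟩ := ha.le_const
  set B := 1 + 1 / z.im with hB
  have hB0 : 0 < B := by positivity
  set K := ‖z‖ + A₀ + M * B with hK
  have hK0 : 0 < K := by positivity
  -- one step of the iteration keeps the values in a bounded part of the upper half plane
  have hstep : ∀ u : X → ℂ, BddMeas u → (∀ x, 0 < (u x).im) → (∀ x, ‖u x‖ ≤ B) →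
      BddMeas (qveMap π a s z u) ∧ (∀ x, z.im / K ^ 2 ≤ (qveMap π a s z u x).im) ∧
      ∀ x, ‖qveMap π a s z u x‖ ≤ B := by
    intro u hu hu0 huB
    have him : ∀ x, z.im ≤ (z + a x + intOp π s u x).im := fun x => by
      rw [qve_rhs_im hs hu]
      have := rOp_im_nonneg (π := π) hs (fun x => (hu0 x).le) x
      linarith
    have hlow : ∀ x, z.im ≤ ‖z + a x + intOp π s u x‖ := fun x =>
      (him x).trans ((le_abs_self _).trans (Complex.abs_im_le_norm _))
    have hup : ∀ x, ‖z + a x + intOp π s u x‖ ≤ K := fun x => by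
      refine (norm_add_le _ _).trans (add_le_add ((norm_add_le _ _).trans
        (add_le_add le_rfl ?_)) ?_)
      · rw [Complex.norm_real]; exact hA₀' x
      · exact (norm_intOp_le_n2 hs hM hu x).trans
          (mul_le_mul_of_nonneg_left (n2_le_of_bound hu huB) hM0.le)
    refine ⟨?_, fun x => ?_, fun x => ?_⟩
    · have h1 := hu.intOp (π := π) hs
      have h2 : BddMeas fun x => (z + a x + intOp π s u x)⁻¹ := BddMeas.inv (by fun_prop) hz hlow
      unfold qveMap
      simp only [div_eq_mul_inv]
      fun_prop
    · rw [qveMap, neg_one_div_im]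
      have := hz.trans_le (hlow x)
      exact div_le_div₀ (hz.le.trans (him x)) (him x) (by positivity)
        (pow_le_pow_left₀ (norm_nonneg _) (hup x) 2)
    · rw [qveMap, norm_div, norm_neg, norm_one]
      exact (one_div_le_one_div_of_le hz (hlow x)).trans (by rw [hB]; linarith)
  set u : ℕ → X → ℂ := fun n => (qveMap π a s z)^[n] (fun _ => Complex.I) with hu
  have hsucc : ∀ n, u (n + 1) = qveMap π a s z (u n) := fun n => Function.iterate_succ_apply' _ _ _
  have hprop : ∀ n, BddMeas (u n) ∧ (∀ x, 0 < (u n x).im) ∧ ∀ x, ‖u n x‖ ≤ B := by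
    intro n
    induction n with
    | zero =>
      refine ⟨BddMeas.const _, fun x => by simp [hu], fun x => ?_⟩
      simp only [hu, Function.iterate_zero, id, Complex.norm_I, hB]
      have : 0 < 1 / z.im := by positivity
      linarith
    | succ n ih =>
      obtain ⟨h1, h2, h3⟩ := hstep (u n) ih.1 ih.2.1 ih.2.2
      rw [hsucc]
      exact ⟨h1, fun x => (show 0 < z.im / K ^ 2 by positivity).trans_le (h2 x), h3⟩
  set A := M * B with hA
  have hA0 : 0 < A := by positivity
  have himB : ∀ n x, (u n x).im ≤ B := fun n x =>
    ((le_abs_self _).trans (Complex.abs_im_le_norm _)).trans ((hprop n).2.2 x)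
  have hSA : ∀ n x, rOp π s (fun y => (u n y).im) x ≤ A := fun n =>
    rOp_le_const hs hM hM0.le (hprop n).1.im (fun x => ((hprop n).2.1 x).le) (himB n)
  -- at equal spectral parameters the contraction factor is `1 - θ`
  set θ := √(z.im * z.im) / √((z.im + A) * (z.im + A)) with hθ
  have hθ' : θ = z.im / (z.im + A) := by
    rw [hθ, Real.sqrt_mul_self hz.le, Real.sqrt_mul_self (by positivity)]
  have hθ0 : 0 < θ := by rw [hθ']; positivity
  have hθ1 : θ < 1 := by rw [hθ', div_lt_one (by positivity)]; linarith
  set D := (B + B) / √(z.im / K ^ 2) with hD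
  have hD0 : 0 ≤ D := by positivity
  have key : ∀ n x, ‖u (n + 1) x - u n x‖
      ≤ (1 - θ) ^ n * D * √((u (n + 1) x).im * (u n x).im) := by
    intro n
    induction n with
    | zero =>
      intro x
      have i1 : z.im / K ^ 2 ≤ (u 1 x).im * (u 0 x).im := by
        have := (hstep (u 0) (hprop 0).1 (hprop 0).2.1 (hprop 0).2.2).2.1 x
        rw [hsucc 0]
        simpa [hu] using this
      calc ‖u (0 + 1) x - u 0 x‖ ≤ B + B :=
            (norm_sub_le _ _).trans (add_le_add ((hprop 1).2.2 x) ((hprop 0).2.2 x))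
        _ = (1 - θ) ^ 0 * D * √(z.im / K ^ 2) := by rw [pow_zero, one_mul, hD]; field_simp
        _ ≤ _ := mul_le_mul_of_nonneg_left (Real.sqrt_le_sqrt i1) (by simpa using hD0)
    | succ n ih =>
      intro x
      have h1 := qveMap_contraction (a := a) hs hz hz (hprop (n + 1)).1 (hprop n).1
        (fun x => ((hprop (n + 1)).2.1 x).le) (fun x => ((hprop n).2.1 x).le) (hSA (n + 1)) (hSA n)
        (d₀ := 0) le_rfl (mul_nonneg (pow_nonneg (by linarith) n) hD0) (by simp) ih x
      rw [← hsucc, ← hsucc, ← hθ] at h1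
      refine h1.trans_eq ?_
      ring
  have hdist : ∀ x n, dist (u n x) (u (n + 1) x) ≤ D * B * (1 - θ) ^ n := by
    intro x n
    rw [dist_comm, dist_eq_norm]
    refine (key n x).trans ?_
    have h1 : √((u (n + 1) x).im * (u n x).im) ≤ B := by
      rw [← Real.sqrt_mul_self hB0.le]
      exact Real.sqrt_le_sqrt (mul_le_mul (himB _ x) (himB _ x) ((hprop n).2.1 x).le hB0.le)
    calc _ ≤ (1 - θ) ^ n * D * B := mul_le_mul_of_nonneg_left h1
          (mul_nonneg (pow_nonneg (by linarith) n) hD0)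
      _ = _ := by ring
  have hlim : ∀ x, ∃ y, Tendsto (fun j => u j x) atTop (𝓝 y) := fun x =>
    cauchySeq_tendsto_of_complete (cauchySeq_of_le_geometric (1 - θ) _ (by linarith) (hdist x))
  choose w hw using hlim
  have hwb : BddMeas w := BddMeas.of_tendsto (fun j => (hprop j).1) (fun j => (hprop j).2.2) hw
  -- the equation in product form passes to the limit
  have hprod : ∀ x, w x * (z + a x + intOp π s w x) = -1 := by
    intro x
    have h1 := ((tendsto_add_atTop_iff_nat 1).2 (hw x)).mul
      ((tendsto_intOp (π := π) hs (fun j => (hprop j).1) (fun j => (hprop j).2.2) hw x).const_add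
        (z + a x))
    have h2 : ∀ n, u (n + 1) x * (z + a x + intOp π s (u n) x) = -1 := fun n => by
      rw [hsucc, qveMap]
      refine div_mul_cancel₀ _ fun h0 => ?_
      have := qve_rhs_im (π := π) (a := a) (z := z) hs (hprop n).1 x
      rw [h0] at this
      have h4 := rOp_im_nonneg (π := π) hs (fun x => ((hprop n).2.1 x).le) x
      simp at this; linarith
    simp only [h2] at h1
    exact (tendsto_nhds_unique h1 tendsto_const_nhds)
  have hne : ∀ x, w x ≠ 0 := fun x h0 => by have := hprod x; simp [h0] at this
  refine ⟨w, hz.le, hwb, fun x => ?_, hne, fun x => ?_⟩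
  · exact ge_of_tendsto' ((Complex.continuous_im.tendsto _).comp (hw x)) fun n =>
      ((hprop n).2.1 x).le
  · rw [← hprod x]
    exact mul_div_cancel_left₀ _ (hne x)

end Hyperbolic

/-! ### Stability of the linearized equation -/

section Stability

variable {X : Type*} [MeasurableSpace X] {π : Measure X} [IsProbabilityMeasure π]

/-- A positive function `g` with `K g ≤ g` bounds the eigenvalue of a positive eigenfunction: pair
the two. -/
lemma eigenvalue_le_one {k : X → X → ℝ} (hk : IsSymmKernel k) {f g : X → ℝ} {l : ℝ}
    (hf : BddMeas f) (hf0 : ∀ x, 0 ≤ f x) (hl : ∀ x, rOp π k f x = l * f x) (hg : BddMeas g)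
    (hkg : ∀ x, rOp π k g x ≤ 1 * g x) (hfg : 0 < ∫ x, f x * g x ∂π) : l ≤ 1 := by
  have h1 := integral_mul_rOp (π := π) hk hf hg
  have h2 : ∫ x, f x * rOp π k g x ∂π ≤ ∫ x, f x * g x ∂π :=
    integral_mono (hf.mul (hg.rOp hk)).integrable (hf.mul hg).integrable fun x =>
      mul_le_mul_of_nonneg_left (by simpa using hkg x) (hf0 x)
  simp only [hl, mul_assoc] at h1
  rw [h1, integral_const_mul] at h2
  exact le_of_mul_le_mul_right (by linarith) hfg

/-- The components of the imaginary part are comparable with each other. -/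
lemma SolvesAt.sinArg_bounds {a : X → ℝ} {s : X → X → ℝ} {z : ℂ} {w : X → ℂ}
    (h : SolvesAt π a s z w) (ha : BddMeas a) (hs : IsSymmKernel s) {c₀ Φ M c : ℝ} {n : ℕ}
    (hc₀ : 0 < c₀) (hlow : ∀ x, c₀ ≤ ‖w x‖) (hΦ : ∀ x, ‖w x‖ ≤ Φ) (hM : ∀ x y, s x y ≤ M)
    (hc : ∀ x y, c ≤ kernelPow π s n x y) (x : X) :
    (c₀ ^ 2) ^ (n + 1) * c * ∫ y, sinArg w y ∂π ≤ sinArg w x ∧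
      sinArg w x ≤ (Φ / c₀ + Φ * M * Φ) * ∫ y, sinArg w y ∂π := by
  have hk := isSymmKernel_kerF hs h.bddMeas
  have hsb := h.bddMeas_sinArg ha hs
  constructor
  -- `F v ≤ v` iterates to `F ^ (n + 1) v ≤ v`, and the kernel of the power is bounded below
  · refine (mul_integral_le_rOp (isSymmKernel_kernelPow hk n)
      (le_kernelPow_kerF hs h.bddMeas hc₀ hlow hc) hsb h.sinArg_nonneg x).trans ?_
    rw [rOp_kernelPow hk hsb]
    have := (iterate_bounds_of_quotient_bounds (π := π) hk hsb (α := 0) (β := 1) le_rfl zero_le_one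
      (fun x => by rw [zero_mul]; exact rOp_nonneg hk h.sinArg_nonneg x) (h.rOp_sinArg_le hs)
      (n + 1) x).2
    simpa using this
  -- `v = Im z |w| + F v`, where `Im z` is at most a multiple of the mean of `v`
  · have h1 : z.im * c₀ ≤ ∫ y, sinArg w y ∂π := le_integral_of_const_le hsb fun y => by
      rw [h.sinArg_eq hs y]
      have h2 := rOp_nonneg (π := π) hk h.sinArg_nonneg y
      have h3 := mul_le_mul_of_nonneg_left (hlow y) h.z_im_nonneg
      linarith
    have h2 := rOp_le (π := π) hk (kerF_le hs hM hΦ) hsb h.sinArg_nonneg x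
    have h3 : z.im * ‖w x‖ ≤ Φ / c₀ * ∫ y, sinArg w y ∂π := by
      have hΦ0 : 0 ≤ Φ := (norm_nonneg _).trans (hΦ x)
      calc z.im * ‖w x‖ ≤ z.im * Φ := mul_le_mul_of_nonneg_left (hΦ x) h.z_im_nonneg
        _ = Φ / c₀ * (z.im * c₀) := by field_simp
        _ ≤ _ := mul_le_mul_of_nonneg_left h1 (by positivity)
    have h4 := h.sinArg_eq hs x
    linarith

/-- The spectral gap of `F`, with constants that depend only on the bounds on `|w|`. The second part
adds that at solutions in the upper half plane the eigenfunction exists and the eigenvalue is at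
most one. -/
lemma exists_gapped (s : X → X → ℝ) (a : X → ℝ) (ha : BddMeas a) (hs : IsSymmKernel s) {c₀ Φ c : ℝ}
    {n : ℕ} (hc₀ : 0 < c₀) (hΦ0 : 0 < Φ) (hc0 : 0 < c) (hc : ∀ x y, c ≤ kernelPow π s n x y) :
    ∃ q M δ : ℝ, 0 ≤ q ∧ q < 1 ∧ 0 < M ∧ 0 < δ ∧
      (∀ w : X → ℂ, BddMeas w → (∀ x, c₀ ≤ ‖w x‖) → (∀ x, ‖w x‖ ≤ Φ) →
        ∀ (f : X → ℝ) (l : ℝ), BddMeas f → (∀ x, 0 ≤ f x) → ∫ x, f x ^ 2 ∂π = 1 →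
        (∀ x, rOp π (kerF s w) f x = l * f x) → 0 ≤ l → l ≤ 1 →
        IsGapped π (kerF s w) f l q M δ) ∧
      ∀ (z : ℂ) (w : X → ℂ), SolvesAt π a s z w → 0 < z.im → (∀ x, c₀ ≤ ‖w x‖) →
        (∀ x, ‖w x‖ ≤ Φ) → ∃ f l, IsGapped π (kerF s w) f l q M δ := by
  obtain ⟨M, hM0, hM⟩ := hs.exists_bound
  have hcc : 0 < (c₀ ^ 2) ^ (n + 1) * c := by positivity
  have hMM : 0 < Φ * M * Φ := by positivity
  obtain ⟨q, hq0, hq1, hq⟩ := exists_gap (π := π) n hcc hMM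
  have hfirst : ∀ w : X → ℂ, BddMeas w → (∀ x, c₀ ≤ ‖w x‖) → (∀ x, ‖w x‖ ≤ Φ) →
        ∀ (f : X → ℝ) (l : ℝ), BddMeas f → (∀ x, 0 ≤ f x) → ∫ x, f x ^ 2 ∂π = 1 →
        (∀ x, rOp π (kerF s w) f x = l * f x) → 0 ≤ l → l ≤ 1 →
        IsGapped π (kerF s w) f l q (Φ * M * Φ) (((c₀ ^ 2) ^ (n + 1) * c) ^ 2 / (Φ * M * Φ)) :=
    fun w hw hlow hΦ f l => hq _ (isSymmKernel_kerF hs hw) (le_kernelPow_kerF hs hw hc₀ hlow hc)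
      (kerF_le hs hM hΦ) f l
  refine ⟨q, _, _, hq0, hq1, hMM, by positivity, hfirst, fun z w h hz hlow hΦ => ?_⟩
  have hk := isSymmKernel_kerF hs h.bddMeas
  obtain ⟨f, l, δ, hf, hδ, hfδ, hl, hf1, hfl⟩ := exists_perron (π := π) hk hcc
    (le_kernelPow_kerF hs h.bddMeas hc₀ hlow hc)
  have hf0 : ∀ x, 0 ≤ f x := fun x => hδ.le.trans (hfδ x)
  obtain ⟨e, he0, he⟩ := h.exists_le_sinArg ha hs hz
  have hsb := h.bddMeas_sinArg ha hs
  have hl1 : l ≤ 1 := eigenvalue_le_one hk hf hf0 hfl hsb (h.rOp_sinArg_le hs)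
    ((show 0 < δ * e by positivity).trans_le (le_integral_of_const_le (by fun_prop) fun x =>
      mul_le_mul (hfδ x) (he x) he0.le (hf0 x)))
  exact ⟨f, l, hfirst w h.bddMeas hlow hΦ f l hf hf0 hf1 hfl hl.le hl1⟩

omit [IsProbabilityMeasure π] in
lemma integral_mul_self_ofReal {f : X → ℝ} (hf : ∫ x, f x ^ 2 ∂π = 1) :
    ∫ x, (f x : ℂ) * f x ∂π = 1 := by
  have : ∫ x, (f x : ℂ) * f x ∂π = ∫ x, ((f x ^ 2 : ℝ) : ℂ) ∂π := by
    congr 1; ext x; push_cast; ring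
  rw [this, integral_complex_ofReal, hf, Complex.ofReal_one]

/-- The component of `w` orthogonal to a normalized `f`. -/
lemma integral_mul_sub_proj {f : X → ℝ} (hf : BddMeas f) (hf1 : ∫ x, f x ^ 2 ∂π = 1) {w : X → ℂ}
    (hw : BddMeas w) :
    ∫ x, (f x : ℂ) * (w x - (∫ y, (f y : ℂ) * w y ∂π) * f x) ∂π = 0 := by
  set θ := ∫ x, (f x : ℂ) * w x ∂π with hθ
  have e : ∀ x, (f x : ℂ) * (w x - θ * f x) = f x * w x - θ * (f x * f x) := fun x => by ring
  simp only [e]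
  rw [integral_sub (BddMeas.integrable (by fun_prop)) (BddMeas.integrable (by fun_prop)),
    integral_const_mul, integral_mul_self_ofReal hf1, ← hθ]; ring

lemma re_integral_sq_mul_le {f : X → ℝ} (hf : BddMeas f) (hf1 : ∫ x, f x ^ 2 ∂π = 1) {U : X → ℂ}
    (hU : BddMeas U) {t : ℝ} (h : ∀ x, (U x).re ≤ t) : (∫ x, (f x : ℂ) ^ 2 * U x ∂π).re ≤ t := by
  have h1 := integral_re (𝕜 := ℂ) (μ := π) (f := fun x => (f x : ℂ) ^ 2 * U x)
    (BddMeas.integrable (by fun_prop))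
  have h2 : ∀ x, RCLike.re ((f x : ℂ) ^ 2 * U x) = f x ^ 2 * (U x).re := fun x => by
    rw [← Complex.ofReal_pow]; exact Complex.re_ofReal_mul _ _
  simp only [h2] at h1
  have h3 : ∫ x, f x ^ 2 * (U x).re ∂π ≤ ∫ x, t * f x ^ 2 ∂π :=
    integral_mono (BddMeas.integrable (by fun_prop)) (BddMeas.integrable (by fun_prop)) fun x => by
      nlinarith [mul_le_mul_of_nonneg_left (h x) (sq_nonneg (f x))]
  rw [integral_const_mul, hf1, mul_one] at h3
  exact h1.symm.trans_le h3

/-- The two estimates on the components of the solution are combined by completing the square. -/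
lemma stability_arith {α c C D W T ρ H : ℝ} (hα : 0 < α) (hα1 : α ≤ 1) (hc : 0 < c) (hC : 0 ≤ C)
    (hD : 0 ≤ D) (hW : 0 ≤ W) (hρ : 0 ≤ ρ) (hH : 0 ≤ H) (hWT : W ≤ T + ρ)
    (hρ2 : ρ ^ 2 ≤ D * (H * W)) (hT : (c * α) ^ 2 * T ≤ 2 * (C * α) * ρ + H) :
    α ^ 2 * W ≤ ((2 * C / c ^ 2 + 1) ^ 2 * D + 2 / c ^ 2) * H := by
  set B := 2 * C / c ^ 2 + 1 with hB
  have hB0 : 0 < B := by positivity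
  have h1 : α ^ 2 * W ≤ B * (α * ρ) + H / c ^ 2 := by
    have h2 : α ^ 2 * T ≤ (2 * (C * α) * ρ + H) / c ^ 2 := by
      rw [le_div_iff₀ (by positivity)]; linarith
    have h3 : α ^ 2 * ρ ≤ α * ρ := by
      have := mul_le_mul_of_nonneg_right hα1 (mul_nonneg hα.le hρ)
      linarith
    have h4 := mul_le_mul_of_nonneg_left hWT (sq_nonneg α)
    calc α ^ 2 * W ≤ α ^ 2 * T + α ^ 2 * ρ := by linarith
      _ ≤ (2 * (C * α) * ρ + H) / c ^ 2 + α * ρ := add_le_add h2 h3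
      _ = _ := by rw [hB]; field_simp; ring
  have h4 : (B * (α * ρ)) ^ 2 ≤ (B ^ 2 * D * H) * (α ^ 2 * W) := by
    calc (B * (α * ρ)) ^ 2 = B ^ 2 * α ^ 2 * ρ ^ 2 := by ring
      _ ≤ B ^ 2 * α ^ 2 * (D * (H * W)) := mul_le_mul_of_nonneg_left hρ2 (by positivity)
      _ = _ := by ring
  have h5 : B * (α * ρ) ≤ (B ^ 2 * D * H + α ^ 2 * W) / 2 := by
    refine le_of_sq_le_sq ?_ (by positivity)
    nlinarith [sq_nonneg (B ^ 2 * D * H - α ^ 2 * W)]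
  have h6 : H / c ^ 2 * 2 = 2 / c ^ 2 * H := by ring
  linarith

/-- The bound `ζ.re ≤ 1 - 2 ε` also covers negative real parts, where `1 - l ζ` is far from zero. -/
lemma norm_one_sub_mul_ge {l ε : ℝ} {ζ : ℂ} (hl0 : 0 ≤ l) (hl1 : l ≤ 1) (hε0 : 0 ≤ ε) (hε : ε ≤ 1)
    (h : ζ.re ≤ 1 - 2 * ε) : ε ≤ ‖1 - l * ζ‖ := by
  refine le_trans ?_ ((le_abs_self _).trans (Complex.abs_re_le_norm _))
  rw [Complex.sub_re, Complex.re_ofReal_mul, Complex.one_re]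
  rcases le_total ζ.re 0 with ht | ht
  · nlinarith
  · nlinarith

/-- **Stability.** The operator `1 - U K`, with a unimodular multiplication operator `U`, is bounded
below by the square of the distance `α` of `U` from `1`. A solution of `w = U K w + h` is decomposed
into `θ f + r`: the spectral gap of `K` controls `r`, and the projection of the equation to `f`
controls `θ`. -/
lemma IsGapped.n2_stability {k : X → X → ℝ} {f : X → ℝ} {l q M δ : ℝ}
    (h : IsGapped π k f l q M δ) (hq0 : 0 ≤ q) (hq : q < 1) {U : X → ℂ} (hU : BddMeas U)
    (hU1 : ∀ x, ‖U x‖ = 1) {α c C : ℝ} (hα : 0 < α) (hα1 : α ≤ 1) (hc : 0 < c) (hC : 0 ≤ C)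
    (hcα : c * α ≤ 1) (hUC : ∀ x, ‖U x - 1‖ ≤ 2 * (C * α))
    (hUc : ∀ x, (U x).re ≤ 1 - 2 * (c * α) ^ 2) {w p : X → ℂ} (hw : BddMeas w) (hp : BddMeas p)
    (hwp : ∀ x, w x = U x * intOp π k w x + p x) :
    α ^ 2 * n2 π w ≤ ((2 * C / c ^ 2 + 1) ^ 2 * (2 / (1 - q ^ 2)) + 2 / c ^ 2) * n2 π p := by
  have hf := h.bddMeas
  have hk := h.symmKernel
  have hfn : n2 π (fun x => (f x : ℂ)) = 1 := n2_ofReal_eq_one h.normalized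
  set θ := ∫ x, (f x : ℂ) * w x ∂π with hθ
  set r : X → ℂ := fun x => w x - θ * f x with hr
  have hrb : BddMeas r := by fun_prop
  have hfr : ∫ x, (f x : ℂ) * r x ∂π = 0 := integral_mul_sub_proj hf h.normalized hw
  have hKw := hw.intOp (π := π) hk
  have hKr := hrb.intOp (π := π) hk
  have ewr : ∀ x, w x = θ * f x + r x := fun x => by simp only [hr]; ring
  have eKw : ∀ x, intOp π k w x = θ * l * f x + intOp π k r x := fun x => by
    rw [funext ewr, intOp_add hk (by fun_prop) hrb, intOp_const_mul, intOp_ofReal, h.eigen]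
    push_cast; ring
  have hfKr : ∫ x, (f x : ℂ) * intOp π k r x ∂π = 0 := by
    rw [h.integral_mul_intOp_eigen hrb, hfr, mul_zero]
  set W := n2 π w with hW
  set H := n2 π p with hH
  set ρ := n2 π r with hρ
  set T := ‖θ‖ with hT
  have hW0 : 0 ≤ W := n2_nonneg _
  have hH0 : 0 ≤ H := n2_nonneg _
  have hρ0 : 0 ≤ ρ := n2_nonneg _
  have hT0 : 0 ≤ T := norm_nonneg _
  have pyth1 : W ^ 2 = T ^ 2 + ρ ^ 2 := by
    rw [← h.n2_sq_eq hrb hfr θ, hW, funext ewr]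
  have hWT : W ≤ T + ρ := by nlinarith
  have hrgap : n2 π (fun x => intOp π k r x) ≤ q * ρ := h.gap r hrb hfr
  have hKr0 : 0 ≤ n2 π (fun x => intOp π k r x) := n2_nonneg _
  have hrgap1 : n2 π (fun x => intOp π k r x) ≤ ρ := hrgap.trans (by nlinarith)
  have pyth2 : n2 π (fun x => intOp π k w x) ^ 2 ≤ T ^ 2 + q ^ 2 * ρ ^ 2 := by
    rw [funext eKw, h.n2_sq_eq hKr hfKr (θ * l), norm_mul, Complex.norm_real,
      Real.norm_of_nonneg h.eigenvalue_nonneg, mul_pow]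
    have h1 : l ^ 2 ≤ 1 := pow_le_one₀ h.eigenvalue_nonneg h.eigenvalue_le_one
    have h2 := pow_le_pow_left₀ hKr0 hrgap 2
    rw [mul_pow] at h2
    nlinarith [mul_le_mul_of_nonneg_left h1 (sq_nonneg T)]
  -- multiplication by the unimodular `U` preserves the norm, so the gap enters through `‖K w‖`
  have hWK : W ≤ n2 π (fun x => intOp π k w x) + H := by
    have h1 : W = n2 π (fun x => U x * intOp π k w x + p x) := by rw [hW]; congr 1; ext x; exact hwp x
    have h2 : n2 π (fun x => U x * intOp π k w x) = n2 π (fun x => intOp π k w x) :=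
      n2_congr fun x => by rw [norm_mul, hU1, one_mul]
    rw [h1, ← h2]
    exact n2_add_le (by fun_prop) hp
  set Y := n2 π (fun x => intOp π k w x) with hY
  have hY0 : 0 ≤ Y := n2_nonneg _
  have hq2 : 0 < 1 - q ^ 2 := by nlinarith
  have hYW : Y ≤ W := by
    refine le_of_sq_le_sq ?_ hW0
    nlinarith [mul_nonneg hq2.le (sq_nonneg ρ)]
  have hρ2 : ρ ^ 2 ≤ 2 / (1 - q ^ 2) * (H * W) := by
    rw [div_mul_eq_mul_div, le_div_iff₀ hq2]
    nlinarith
  -- the component along `f`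
  have hθeq : θ * (1 - l * ∫ x, (f x : ℂ) ^ 2 * U x ∂π)
      = ∫ x, (f x : ℂ) * ((U x - 1) * intOp π k r x) ∂π + ∫ x, (f x : ℂ) * p x ∂π := by
    have e1 : ∀ x, (f x : ℂ) * w x = θ * l * ((f x : ℂ) ^ 2 * U x)
        + ((f x : ℂ) * ((U x - 1) * intOp π k r x) + (f x : ℂ) * intOp π k r x)
        + (f x : ℂ) * p x := fun x => by rw [hwp x, eKw]; ring
    have e2 : θ = θ * l * ∫ x, (f x : ℂ) ^ 2 * U x ∂π
        + (∫ x, (f x : ℂ) * ((U x - 1) * intOp π k r x) ∂π + 0) + ∫ x, (f x : ℂ) * p x ∂π := by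
      conv_lhs => rw [hθ]
      simp only [e1]
      rw [integral_add (BddMeas.integrable (by fun_prop)) (BddMeas.integrable (by fun_prop)),
        integral_add (BddMeas.integrable (by fun_prop)) (BddMeas.integrable (by fun_prop)),
        integral_add (BddMeas.integrable (by fun_prop)) (BddMeas.integrable (by fun_prop)),
        integral_const_mul, hfKr]
    linear_combination e2
  have hlow : (c * α) ^ 2 ≤ ‖1 - l * ∫ x, (f x : ℂ) ^ 2 * U x ∂π‖ :=
    norm_one_sub_mul_ge h.eigenvalue_nonneg h.eigenvalue_le_one (sq_nonneg _)
      (pow_le_one₀ (by positivity) hcα) (re_integral_sq_mul_le hf h.normalized hU hUc)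
  have hTest : (c * α) ^ 2 * T ≤ 2 * (C * α) * ρ + H := by
    calc (c * α) ^ 2 * T ≤ ‖θ * (1 - l * ∫ x, (f x : ℂ) ^ 2 * U x ∂π)‖ := by
          rw [norm_mul, mul_comm]; exact mul_le_mul_of_nonneg_left hlow hT0
      _ ≤ _ := by
          rw [hθeq]
          refine (norm_add_le _ _).trans (add_le_add ?_ ?_)
          · refine (norm_integral_mul_le_n2 hf.ofReal (by fun_prop)).trans ?_
            rw [hfn, one_mul]
            have h1 : n2 π (fun x => (U x - 1) * intOp π k r x)
                ≤ n2 π (fun x => ((2 * (C * α) : ℝ) : ℂ) * intOp π k r x) :=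
              n2_mono (by fun_prop) (by fun_prop) fun x => by
                rw [norm_mul, norm_mul, Complex.norm_real, Real.norm_of_nonneg (by positivity)]
                exact mul_le_mul_of_nonneg_right (hUC x) (norm_nonneg _)
            rw [n2_const_mul, Complex.norm_real, Real.norm_of_nonneg (by positivity)] at h1
            exact h1.trans (mul_le_mul_of_nonneg_left hrgap1 (by positivity))
          · refine (norm_integral_mul_le_n2 hf.ofReal hp).trans ?_
            rw [hfn, one_mul]
  exact stability_arith hα hα1 hc hC (by positivity) hW0 hρ0 hH0 hWT hρ2 hTest

/-- Stability in the supremum norm, which follows from stability in `L²` since the kernel is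
bounded. -/
lemma IsGapped.sup_stability {k : X → X → ℝ} {f : X → ℝ} {l q M δ : ℝ}
    (h : IsGapped π k f l q M δ) (hq0 : 0 ≤ q) (hq : q < 1) {U : X → ℂ} (hU : BddMeas U)
    (hU1 : ∀ x, ‖U x‖ = 1) {α c C : ℝ} (hα : 0 < α) (hα1 : α ≤ 1) (hc : 0 < c) (hC : 0 ≤ C)
    (hcα : c * α ≤ 1) (hUC : ∀ x, ‖U x - 1‖ ≤ 2 * (C * α))
    (hUc : ∀ x, (U x).re ≤ 1 - 2 * (c * α) ^ 2) {w p : X → ℂ} (hw : BddMeas w) (hp : BddMeas p)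
    (hwp : ∀ x, w x = U x * intOp π k w x + p x) {H : ℝ} (hH : ∀ x, ‖p x‖ ≤ H) (x : X) :
    α ^ 2 * ‖w x‖
      ≤ (1 + M * ((2 * C / c ^ 2 + 1) ^ 2 * (2 / (1 - q ^ 2)) + 2 / c ^ 2)) * H := by
  have h1 := h.n2_stability hq0 hq hU hU1 hα hα1 hc hC hcα hUC hUc hw hp hwp
  set E := (2 * C / c ^ 2 + 1) ^ 2 * (2 / (1 - q ^ 2)) + 2 / c ^ 2 with hE
  have hq2 : 0 < 1 - q ^ 2 := by nlinarith
  have hE0 : 0 ≤ E := by positivity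
  have hM0 : 0 ≤ M := (h.symmKernel.nonneg x x).trans (h.kernel_le x x)
  have hH0 : 0 ≤ H := (norm_nonneg _).trans (hH x)
  have h2 : ‖w x‖ ≤ M * n2 π w + H := by
    rw [hwp x]
    refine (norm_add_le _ _).trans (add_le_add ?_ (hH x))
    rw [norm_mul, hU1, one_mul]
    exact norm_intOp_le_n2 h.symmKernel h.kernel_le hw x
  have h3 : n2 π p ≤ H := n2_le_of_bound hp hH
  have h4 : α ^ 2 * H ≤ H := mul_le_of_le_one_left hH0 (pow_le_one₀ hα.le hα1)
  have h5 : M * (α ^ 2 * n2 π w) ≤ M * (E * H) :=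
    mul_le_mul_of_nonneg_left (h1.trans (mul_le_mul_of_nonneg_left h3 hE0)) hM0
  nlinarith [mul_le_mul_of_nonneg_left h2 (sq_nonneg α)]

end Stability

/-! ### The equation for the difference of two solutions -/

section Phase

variable {X : Type*} [MeasurableSpace X] {π : Measure X} [IsProbabilityMeasure π]
  {a : X → ℝ} {s : X → X → ℝ} {z z' : ℂ} {w w' : X → ℂ}

/-- The square of the sign of `w`. -/
noncomputable def phase (w : X → ℂ) (x : X) : ℂ := w x ^ 2 / (‖w x‖ : ℂ) ^ 2

lemma SolvesAt.bddMeas_phase (h : SolvesAt π a s z w) (ha : BddMeas a) (hs : IsSymmKernel s) :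
    BddMeas (phase w) := by
  have h1 := (h.bddMeas_inv_norm ha hs).ofReal
  have h2 := h.bddMeas
  have e : phase w = fun x => w x ^ 2 * ((‖w x‖⁻¹ : ℝ) : ℂ) ^ 2 := funext fun x => by
    rw [phase, div_eq_mul_inv]; push_cast; ring
  rw [e]; fun_prop

omit [IsProbabilityMeasure π] in
lemma SolvesAt.norm_phase (h : SolvesAt π a s z w) (x : X) : ‖phase w x‖ = 1 := by
  have := (h.norm_pos x).ne'
  rw [phase, norm_div, norm_pow, norm_pow, Complex.norm_real, norm_norm]
  field_simp

omit [IsProbabilityMeasure π] in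
lemma SolvesAt.norm_phase_sub_one (h : SolvesAt π a s z w) (x : X) :
    ‖phase w x - 1‖ = 2 * sinArg w x := by
  have h0 := (h.norm_pos x).ne'
  have h1 : (‖w x‖ : ℂ) ≠ 0 := by exact_mod_cast h0
  have h2 : (‖w x‖ : ℂ) ^ 2 = w x * (starRingEnd ℂ) (w x) := by
    rw [Complex.mul_conj, Complex.normSq_eq_norm_sq]; push_cast; ring
  have h3 : w x - (starRingEnd ℂ) (w x) = ((2 * (w x).im : ℝ) : ℂ) * Complex.I := by
    rw [Complex.sub_conj]
  have e : phase w x - 1 = w x * (((2 * (w x).im : ℝ) : ℂ) * Complex.I) / (‖w x‖ : ℂ) ^ 2 := by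
    rw [phase, ← h3, eq_div_iff (pow_ne_zero 2 h1), sub_mul, div_mul_cancel₀ _ (pow_ne_zero 2 h1),
      one_mul]
    rw [h2]; ring
  rw [e, norm_div, norm_mul, norm_mul, Complex.norm_I, Complex.norm_real, norm_pow,
    Complex.norm_real, norm_norm, Real.norm_of_nonneg (by have := h.im_nonneg x; positivity), sinArg]
  field_simp

omit [IsProbabilityMeasure π] in
lemma SolvesAt.phase_re (h : SolvesAt π a s z w) (x : X) :
    (phase w x).re = 1 - 2 * sinArg w x ^ 2 := by
  have h0 := (h.norm_pos x).ne'
  have e : phase w x = (((‖w x‖ ^ 2)⁻¹ : ℝ) : ℂ) * w x ^ 2 := by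
    rw [phase, div_eq_mul_inv]; push_cast; ring
  have e2 : ‖w x‖ ^ 2 = (w x).re ^ 2 + (w x).im ^ 2 := by
    rw [← Complex.normSq_eq_norm_sq, Complex.normSq_apply]; ring
  rw [e, Complex.re_ofReal_mul, sinArg, div_pow, sq (w x), Complex.mul_re]
  field_simp
  rw [e2]; ring

/-- The equation for the difference of two solutions, relative to `|w|`. -/
lemma SolvesAt.difference_eq (h : SolvesAt π a s z w) (h' : SolvesAt π a s z' w')
    (hs : IsSymmKernel s) {t : ℂ} (ht : t = z' - z) (ht0 : t ≠ 0) (x : X) :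
    (w' x - w x) / ‖w x‖ / t
      = phase w x * intOp π (kerF s w) (fun y => (w' y - w y) / ‖w y‖ / t) x
        + (phase w x * ‖w x‖ + w x * ((w' x - w x) / ‖w x‖ / t)
          * (t + intOp π s (fun y => w' y - w y) x)) := by
  have n0 : ∀ y, (‖w y‖ : ℂ) ≠ 0 := fun y => by exact_mod_cast (h.norm_pos y).ne'
  have e1 : intOp π (kerF s w) (fun y => (w' y - w y) / ‖w y‖ / t) x
      = ‖w x‖ * (intOp π s (fun y => w' y - w y) x / t) := by
    rw [← opF_eq]
    unfold opF
    have : (fun y => (‖w y‖ : ℂ) * ((w' y - w y) / ‖w y‖ / t)) = fun y => t⁻¹ * (w' y - w y) := by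
      funext y; have := n0 y; field_simp
    rw [this, intOp_const_mul]; ring
  -- the difference of the two equations, multiplied by `w w'`
  have e2 : w' x - w x = w x * w' x * (t + intOp π s (fun y => w' y - w y) x) := by
    rw [intOp_sub hs h'.bddMeas h.bddMeas, ht]
    have h1 := h.eq x
    have h2 := h'.eq x
    have h3 := h.ne_zero x
    have h4 := h'.ne_zero x
    field_simp at h1 h2
    linear_combination (-w' x) * h1 + (w x) * h2
  rw [e1, phase]
  set N := (‖w x‖ : ℂ) with hN
  set J := intOp π s (fun y => w' y - w y) x
  have hN0 : N ≠ 0 := n0 x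
  have e3 : w' x = w x + (w' x - w x) := by ring
  set d := w' x - w x with hd
  rw [e3] at e2
  field_simp
  linear_combination e2

end Phase

/-! ### The derivative of the solution -/

section Derivative

variable {X : Type*} [MeasurableSpace X] {π : Measure X} [IsProbabilityMeasure π]
  {a : X → ℝ} {s : X → X → ℝ}

lemma integral_sinArg_pos {z : ℂ} {w : X → ℂ} (h : SolvesAt π a s z w) (ha : BddMeas a)
    (hs : IsSymmKernel s) (hz : 0 < z.im) :
    0 < ∫ x, sinArg w x ∂π ∧ ∫ x, sinArg w x ∂π ≤ 1 := by
  obtain ⟨e, he0, he⟩ := h.exists_le_sinArg ha hs hz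
  exact ⟨he0.trans_le (le_integral_of_const_le (h.bddMeas_sinArg ha hs) he),
    integral_le_of_le_const (h.bddMeas_sinArg ha hs) (sinArg_le_one w)⟩

/-- The arithmetic of interpolating `t α² ≲ 1` and `t η ≲ α` to `t ≲ η^(-2/3)`. -/
lemma le_rpow_of_cube_mul_sq_le {t η K : ℝ} (ht : 0 ≤ t) (hη : 0 < η) (h : t ^ 3 * η ^ 2 ≤ K) :
    t ≤ K ^ (1 / 3 : ℝ) * η ^ (-(2 / 3) : ℝ) := by
  have hK : 0 ≤ K := le_trans (by positivity) h
  have h1 : t ^ 3 ≤ K * η ^ (-2 : ℝ) := by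
    rw [Real.rpow_neg hη.le, ← div_eq_mul_inv, le_div_iff₀ (by positivity)]
    exact_mod_cast h
  calc t = (t ^ 3) ^ (1 / 3 : ℝ) := by
        rw [← Real.rpow_natCast, ← Real.rpow_mul ht]; norm_num
    _ ≤ (K * η ^ (-2 : ℝ)) ^ (1 / 3 : ℝ) := Real.rpow_le_rpow (by positivity) h1 (by norm_num)
    _ = _ := by
        rw [Real.mul_rpow hK (by positivity), ← Real.rpow_mul hη.le]; norm_num

/-- The stability estimate, with constants that depend only on the bounds of `w`: a bounded solution
of the linearized equation is at most `C α⁻²` times the right hand side, where `α` is the mean of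
`sinArg w`. -/
lemma exists_stability_const (ha : BddMeas a) (hs : IsSymmKernel s) {c₀ Φ c : ℝ} {n : ℕ}
    (hc₀ : 0 < c₀) (hΦ0 : 0 < Φ) (hc0 : 0 < c) (hc : ∀ x y, c ≤ kernelPow π s n x y) :
    ∃ C E, 0 < C ∧ 0 < E ∧ ∀ (z : ℂ) (w : X → ℂ), SolvesAt π a s z w → 0 < z.im →
      (∀ x, c₀ ≤ ‖w x‖) → (∀ x, ‖w x‖ ≤ Φ) →
      (∀ x, sinArg w x ≤ E * ∫ y, sinArg w y ∂π) ∧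
      ∀ (u p : X → ℂ) (H : ℝ), BddMeas u → BddMeas p → (∀ x, ‖p x‖ ≤ H) →
        (∀ x, u x = phase w x * intOp π (kerF s w) u x + p x) →
        ∀ x, (∫ y, sinArg w y ∂π) ^ 2 * ‖u x‖ ≤ C * H := by
  obtain ⟨S, hS0, hS⟩ := hs.exists_bound
  obtain ⟨q, M, δ, hq0, hq1, hM0, hδ, -, hgap⟩ := exists_gapped (π := π) s a ha hs hc₀ hΦ0 hc0 hc
  set e := (c₀ ^ 2) ^ (n + 1) * c with he
  set E := Φ / c₀ + Φ * S * Φ with hE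
  have he0 : 0 < e := by positivity
  have hE0 : 0 < E := by positivity
  have hq2 : 0 < 1 - q ^ 2 := by nlinarith
  refine ⟨1 + M * ((2 * E / e ^ 2 + 1) ^ 2 * (2 / (1 - q ^ 2)) + 2 / e ^ 2), E, by positivity, hE0,
    fun z w h hz hlow hΦ => ?_⟩
  have hbd := h.sinArg_bounds ha hs hc₀ hlow hΦ hS hc
  refine ⟨fun x => (hbd x).2, fun u p H hu hp hH hup x => ?_⟩
  obtain ⟨hα, hα1⟩ := integral_sinArg_pos h ha hs hz
  obtain ⟨f, l, hf⟩ := hgap z w h hz hlow hΦ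
  -- the bounds on `sinArg w` are the bounds on the distance of the phase from one
  refine hf.sup_stability hq0 hq1 (h.bddMeas_phase ha hs) h.norm_phase hα hα1 he0 hE0.le ?_
    (fun x => ?_) (fun x => ?_) hu hp hup hH x
  · exact (hbd x).1.trans (sinArg_le_one w x)
  · rw [h.norm_phase_sub_one]; linarith [(hbd x).2]
  · rw [h.phase_re]
    have := pow_le_pow_left₀ (by positivity) (hbd x).1 2
    linarith

/-- The solution is differentiable in the upper half plane, because its difference quotients solve
the linearized equation up to a small error. The derivative is bounded both by stability and by
Schwarz–Pick; the two bounds together give the exponent `-2/3`. -/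
lemma exists_hasDerivAt (ha : BddMeas a) (hs : IsSymmKernel s) {c₀ Φ c R : ℝ} {n : ℕ}
    (hc₀ : 0 < c₀) (hΦ0 : 0 < Φ) (hc0 : 0 < c) (hc : ∀ x y, c ≤ kernelPow π s n x y) :
    ∃ C, 0 < C ∧ ∀ m : ℂ → X → ℂ, IsSolution π a s m →
      (∀ z, 0 < z.im → ‖z‖ ≤ R → ∀ x, c₀ ≤ ‖m z x‖) → (∀ z, 0 < z.im → ∀ x, ‖m z x‖ ≤ Φ) →
      ∀ z, 0 < z.im → ‖z‖ ≤ R → ∀ x, ∃ D, HasDerivAt (fun z => m z x) D z ∧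
        ‖D‖ ≤ C * z.im ^ (-(2 / 3) : ℝ) := by
  obtain ⟨C, E, hC0, hE0, hst⟩ := exists_stability_const (π := π) (a := a) ha hs hc₀ hΦ0 hc0 hc
  obtain ⟨S, hS0, hS⟩ := hs.exists_bound
  refine ⟨Φ * (C * Φ * E ^ 2) ^ (1 / 3 : ℝ), by positivity, fun m hm hlow hΦ z hz hzR x => ?_⟩
  have h := hm.solvesAt hz
  obtain ⟨hE, hsta⟩ := hst z (m z) h hz (hlow z hz hzR) (hΦ z hz)
  obtain ⟨hα, hα1⟩ := integral_sinArg_pos h ha hs hz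
  set α := ∫ y, sinArg (m z) y ∂π with hαdef
  have hw := h.bddMeas
  have hwi := (h.bddMeas_inv_norm ha hs).ofReal
  have hUb := h.bddMeas_phase ha hs
  -- near `z` the difference is at most `V |z' - z|`
  set V := Φ / (z.im / 2) with hV
  have hV0 : 0 < V := by positivity
  have hnear : ∀ z' : ℂ, ‖z' - z‖ ≤ z.im / 2 → z.im / 2 ≤ z'.im := fun z' h1 => by
    have h2 := (Complex.abs_im_le_norm (z' - z)).trans h1
    rw [Complex.sub_im] at h2
    linarith [(abs_le.1 h2).1]
  have hdiff : ∀ z' : ℂ, ‖z' - z‖ ≤ z.im / 2 → ∀ y, ‖m z' y - m z y‖ ≤ V * ‖z' - z‖ := by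
    intro z' h1 y
    have hz'' := hnear z' h1
    have hz' : 0 < z'.im := by linarith
    refine ((hm.solvesAt hz').schwarzPick h ha hs hz' hz y).trans ?_
    have e1 : z.im / 2 ≤ √(z'.im * z.im) := by
      refine Real.le_sqrt_of_sq_le ?_
      nlinarith
    have him : ∀ ζ : ℂ, 0 < ζ.im → (m ζ y).im ≤ Φ := fun ζ hζ =>
      (le_abs_self _).trans ((Complex.abs_im_le_norm _).trans (hΦ ζ hζ y))
    have e2 : √((m z' y).im * (m z y).im) ≤ Φ := by
      rw [← Real.sqrt_mul_self hΦ0.le]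
      exact Real.sqrt_le_sqrt (mul_le_mul (him z' hz') (him z hz) (h.im_nonneg y) hΦ0.le)
    calc _ ≤ ‖z' - z‖ / (z.im / 2) * Φ := mul_le_mul
          (div_le_div_of_nonneg_left (norm_nonneg _) (by positivity) e1) e2 (Real.sqrt_nonneg _)
          (by positivity)
      _ = _ := by rw [hV]; ring
  -- the relative difference quotient and its equation
  set v : ℂ → X → ℂ := fun z' y => (m z' y - m z y) / ‖m z y‖ / (z' - z) with hv
  set g : ℂ → X → ℂ := fun z' y => m z y * v z' y
    * ((z' - z) + intOp π s (fun y => m z' y - m z y) y) with hg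
  have hvb : ∀ z', ‖z' - z‖ ≤ z.im / 2 → BddMeas (v z') := fun z' h1 => by
    have hw' := (hm.solvesAt (z := z') (by linarith [hnear z' h1])).bddMeas
    have e : v z' = fun y => (m z' y - m z y) * ((‖m z y‖⁻¹ : ℝ) : ℂ) / (z' - z) := funext fun y => by
      simp only [hv]; push_cast; ring
    rw [e]; fun_prop
  have hgb : ∀ z', ‖z' - z‖ ≤ z.im / 2 → BddMeas (g z') := fun z' h1 => by
    have hw' := (hm.solvesAt (z := z') (by linarith [hnear z' h1])).bddMeas
    have h2 := hvb z' h1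
    have h3 : BddMeas fun x => intOp π s (fun y => m z' y - m z y) x := (hw'.sub hw).intOp hs
    simp only [hg]
    fun_prop
  have hveq : ∀ z', ‖z' - z‖ ≤ z.im / 2 → z' ≠ z → ∀ y,
      v z' y = phase (m z) y * intOp π (kerF s (m z)) (v z') y
        + (phase (m z) y * ‖m z y‖ + g z' y) := fun z' h1 h2 y =>
    h.difference_eq (hm.solvesAt (by linarith [hnear z' h1])) hs rfl (sub_ne_zero.2 h2) y
  set G := Φ * (V / c₀) * (1 + S * V) with hG
  have hG0 : 0 < G := by positivity
  have hgle : ∀ z', ‖z' - z‖ ≤ z.im / 2 → z' ≠ z → ∀ y, ‖g z' y‖ ≤ G * ‖z' - z‖ := by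
    intro z' h1 h2 y
    have hw' := (hm.solvesAt (z := z') (by linarith [hnear z' h1])).bddMeas
    have hpos : 0 < ‖z' - z‖ := norm_pos_iff.2 (sub_ne_zero.2 h2)
    have e1 : ‖v z' y‖ ≤ V / c₀ := by
      simp only [hv]
      rw [norm_div, norm_div, Complex.norm_real, norm_norm, div_div, div_le_div_iff₀
        (mul_pos (h.norm_pos y) hpos) hc₀]
      calc ‖m z' y - m z y‖ * c₀ ≤ (V * ‖z' - z‖) * ‖m z y‖ :=
            mul_le_mul (hdiff z' h1 y) (hlow z hz hzR y) hc₀.le (by positivity)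
        _ = _ := by ring
    have e2 : ‖intOp π s (fun y => m z' y - m z y) y‖ ≤ S * (V * ‖z' - z‖) :=
      (norm_intOp_le_n2 hs hS (hw'.sub hw) y).trans
        (mul_le_mul_of_nonneg_left (n2_le_of_bound (hw'.sub hw) (hdiff z' h1)) hS0.le)
    calc ‖g z' y‖ ≤ Φ * (V / c₀) * (‖z' - z‖ + S * (V * ‖z' - z‖)) := by
          simp only [hg]
          rw [norm_mul, norm_mul]
          exact mul_le_mul (mul_le_mul (hΦ z hz y) e1 (norm_nonneg _) hΦ0.le)
            ((norm_add_le _ _).trans (add_le_add le_rfl e2)) (norm_nonneg _) (by positivity)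
      _ = _ := by rw [hG]; ring
  -- the quotients form a Cauchy family
  have hcau : ∀ z₁ z₂, ‖z₁ - z‖ ≤ z.im / 2 → z₁ ≠ z → ‖z₂ - z‖ ≤ z.im / 2 → z₂ ≠ z →
      α ^ 2 * ‖v z₁ x - v z₂ x‖ ≤ C * (G * ‖z₁ - z‖ + G * ‖z₂ - z‖) := by
    intro z₁ z₂ h1 h1' h2 h2'
    have hk := isSymmKernel_kerF hs hw
    refine hsta (fun y => v z₁ y - v z₂ y) (fun y => g z₁ y - g z₂ y) _
      ((hvb z₁ h1).sub (hvb z₂ h2)) ((hgb z₁ h1).sub (hgb z₂ h2))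
      (fun y => (norm_sub_le _ _).trans (add_le_add (hgle z₁ h1 h1' y) (hgle z₂ h2 h2' y)))
      (fun y => ?_) x
    rw [intOp_sub hk (hvb z₁ h1) (hvb z₂ h2), hveq z₁ h1 h1' y, hveq z₂ h2 h2' y]; ring
  have hnhds : ∀ ε > 0, ∀ᶠ z' in 𝓝[≠] z, ‖z' - z‖ < ε ∧ z' ≠ z := fun ε hε => by
    rw [eventually_nhdsWithin_iff, Metric.eventually_nhds_iff]
    exact ⟨ε, hε, fun y hy hy' => ⟨by rwa [← dist_eq_norm], hy'⟩⟩
  obtain ⟨D', hD'⟩ : ∃ D', Tendsto (fun z' => v z' x) (𝓝[≠] z) (𝓝 D') := by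
    refine cauchy_map_iff_exists_tendsto.1 (Metric.cauchy_iff.2 ⟨inferInstance, fun ε hε => ?_⟩)
    set ρ := min (z.im / 2) (α ^ 2 * ε / (4 * C * G)) with hρ
    have hρ0 : 0 < ρ := by positivity
    refine ⟨_, image_mem_map (hnhds ρ hρ0), ?_⟩
    rintro _ ⟨z₁, ⟨h1, h1'⟩, rfl⟩ _ ⟨z₂, ⟨h2, h2'⟩, rfl⟩
    rw [dist_eq_norm]
    have h3 := hcau z₁ z₂ (h1.le.trans (min_le_left _ _)) h1' (h2.le.trans (min_le_left _ _)) h2'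
    have h4 : ρ ≤ α ^ 2 * ε / (4 * C * G) := min_le_right _ _
    rw [le_div_iff₀ (by positivity)] at h4
    have h5 : α ^ 2 * ‖v z₁ x - v z₂ x‖ < α ^ 2 * ε := by
      have h6 : C * (G * ‖z₁ - z‖ + G * ‖z₂ - z‖) ≤ C * (G * ρ + G * ρ) := by gcongr
      have h7 : 0 < α ^ 2 * ε := by positivity
      linarith
    exact lt_of_mul_lt_mul_left h5 (by positivity)
  have hslope : Tendsto (slope (fun z => m z x) z) (𝓝[≠] z) (𝓝 (‖m z x‖ * D')) := by
    refine (hD'.const_mul (‖m z x‖ : ℂ)).congr fun z' => ?_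
    have : (‖m z x‖ : ℂ) ≠ 0 := by exact_mod_cast (h.norm_pos x).ne'
    rw [slope_def_field]
    simp only [hv]
    field_simp
  refine ⟨_, hasDerivAt_iff_tendsto_slope.2 hslope, ?_⟩
  -- first bound: stability
  have hb1 : α ^ 2 * ‖D'‖ ≤ C * Φ := by
    have hid : Tendsto (fun z' : ℂ => ‖z' - z‖) (𝓝[≠] z) (𝓝 0) := by
      have : Tendsto (fun z' : ℂ => ‖z' - z‖) (𝓝 z) (𝓝 ‖z - z‖) :=
        Continuous.tendsto (by fun_prop) z
      rw [sub_self, norm_zero] at this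
      exact this.mono_left nhdsWithin_le_nhds
    have hr : Tendsto (fun z' : ℂ => C * (Φ + G * ‖z' - z‖)) (𝓝[≠] z) (𝓝 (C * (Φ + G * 0))) :=
      ((hid.const_mul G).const_add Φ).const_mul C
    rw [mul_zero, add_zero] at hr
    refine le_of_tendsto_of_tendsto (hD'.norm.const_mul (α ^ 2)) hr ?_
    filter_upwards [hnhds (z.im / 2) (by positivity)] with z' hz'
    refine hsta (v z') (fun y => phase (m z) y * ‖m z y‖ + g z' y) _ (hvb z' hz'.1.le) ?_
      (fun y => (norm_add_le _ _).trans (add_le_add ?_ (hgle z' hz'.1.le hz'.2 y)))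
      (hveq z' hz'.1.le hz'.2) x
    · have := hgb z' hz'.1.le
      fun_prop
    · rw [norm_mul, h.norm_phase, one_mul, Complex.norm_real, norm_norm]; exact hΦ z hz y
  -- second bound: Schwarz–Pick
  have hb2 : ‖D'‖ * z.im ≤ sinArg (m z) x := by
    have hcont : Tendsto (fun z' => m z' x) (𝓝[≠] z) (𝓝 (m z x)) := by
      have h1 : Tendsto (fun z' => v z' x * (‖m z x‖ * (z' - z)) + m z x) (𝓝[≠] z)
          (𝓝 (D' * (‖m z x‖ * (z - z)) + m z x)) :=
        (hD'.mul ((((continuous_id.tendsto z).mono_left nhdsWithin_le_nhds).sub_const z).const_mul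
          _)).add_const _
      rw [sub_self, mul_zero, mul_zero, zero_add] at h1
      refine h1.congr' ?_
      filter_upwards [self_mem_nhdsWithin] with z' hz'
      have h2 : (‖m z x‖ : ℂ) ≠ 0 := by exact_mod_cast (h.norm_pos x).ne'
      have h3 : z' - z ≠ 0 := sub_ne_zero.2 hz'
      simp only [hv]
      field_simp
      ring
    have hr : Tendsto (fun z' => √((m z' x).im * (m z x).im)) (𝓝[≠] z)
        (𝓝 √((m z x).im * (m z x).im)) :=
      (Real.continuous_sqrt.tendsto _).comp
        (((Complex.continuous_im.tendsto _).comp hcont).mul_const _)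
    have hl : Tendsto (fun z' => ‖v z' x‖ * ‖m z x‖ * √(z'.im * z.im)) (𝓝[≠] z)
        (𝓝 (‖D'‖ * ‖m z x‖ * √(z.im * z.im))) := by
      refine (hD'.norm.mul_const _).mul ((Real.continuous_sqrt.tendsto _).comp
        (((Complex.continuous_im.tendsto z).mono_left nhdsWithin_le_nhds).mul_const _))
    have hle := le_of_tendsto_of_tendsto hl hr (by
      filter_upwards [hnhds (z.im / 2) (by positivity)] with z' hz'
      have hz'' : 0 < z'.im := by linarith [hnear z' hz'.1.le]
      have h1 := (hm.solvesAt hz'').schwarzPick h ha hs hz'' hz x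
      have hpos : 0 < ‖z' - z‖ := norm_pos_iff.2 (sub_ne_zero.2 hz'.2)
      have hsq : 0 < √(z'.im * z.im) := by positivity
      have hn := h.norm_pos x
      simp only [hv]
      rw [norm_div, norm_div, Complex.norm_real, norm_norm]
      rw [div_mul_eq_mul_div, le_div_iff₀ hsq] at h1
      calc _ = ‖m z' x - m z x‖ * √(z'.im * z.im) / ‖z' - z‖ := by field_simp
        _ ≤ _ := by rw [div_le_iff₀ hpos]; linarith)
    rw [Real.sqrt_mul_self hz.le, Real.sqrt_mul_self (h.im_nonneg x), ← h.norm_mul_sinArg x] at hle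
    refine le_of_mul_le_mul_left ?_ (h.norm_pos x)
    linarith
  -- interpolation between the two bounds
  have hcube : ‖D'‖ ^ 3 * z.im ^ 2 ≤ C * Φ * E ^ 2 := by
    have h1 : (‖D'‖ * z.im) ^ 2 ≤ (E * α) ^ 2 :=
      pow_le_pow_left₀ (by positivity) (hb2.trans (hE x)) 2
    calc ‖D'‖ ^ 3 * z.im ^ 2 = ‖D'‖ * (‖D'‖ * z.im) ^ 2 := by ring
      _ ≤ ‖D'‖ * (E * α) ^ 2 := mul_le_mul_of_nonneg_left h1 (norm_nonneg _)
      _ = (α ^ 2 * ‖D'‖) * E ^ 2 := by ring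
      _ ≤ _ := mul_le_mul_of_nonneg_right hb1 (by positivity)
  rw [norm_mul, Complex.norm_real, norm_norm, mul_assoc]
  exact mul_le_mul (hΦ z hz x) (le_rpow_of_cube_mul_sq_le (norm_nonneg _) hz hcube)
    (norm_nonneg _) hΦ0.le

end Derivative

/-! ### Hölder continuity up to the boundary -/

section Holder

lemma rpow_third_mul {h : ℝ} (hh : 0 < h) : h ^ (-(2 / 3) : ℝ) * h = h ^ (1 / 3 : ℝ) := by
  conv_lhs => rw [← Real.rpow_one h, ← Real.rpow_mul hh.le, ← Real.rpow_add hh]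
  norm_num

/-- A function whose derivative is at most `C (Im z)^(-2/3)` changes by at most `3 C h^(1/3)` on a
vertical segment of length `h`. -/
lemma norm_sub_le_vertical {g : ℂ → ℂ} {z : ℂ} {h C : ℝ} (hz : 0 < z.im) (hh : 0 ≤ h) (hC : 0 ≤ C)
    (hg : ∀ t ∈ Icc 0 h, ∃ D, HasDerivAt g D (z + t * Complex.I) ∧
      ‖D‖ ≤ C * (z.im + t) ^ (-(2 / 3) : ℝ)) :
    ‖g (z + h * Complex.I) - g z‖ ≤ 3 * C * h ^ (1 / 3 : ℝ) := by
  choose! D hD hDle using hg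
  set F : ℝ → ℂ := fun t => g (z + t * Complex.I) - g z with hF
  have hFd : ∀ t ∈ Icc 0 h, HasDerivAt F (D t * Complex.I) t := fun t ht => by
    have h1 : HasDerivAt (fun t : ℝ => z + t * Complex.I) (1 * Complex.I) t :=
      ((Complex.ofRealCLM.hasDerivAt (x := t)).mul_const Complex.I).const_add z
    rw [one_mul] at h1
    exact ((hD t ht).comp t h1).sub_const _
  -- the primitive of the bound on the derivative
  set B : ℝ → ℝ := fun t => 3 * C * ((z.im + t) ^ (1 / 3 : ℝ) - z.im ^ (1 / 3 : ℝ)) with hB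
  have hBd : ∀ t ∈ Icc 0 h, HasDerivAt B (C * (z.im + t) ^ (-(2 / 3) : ℝ)) t := fun t ht => by
    have hpos : 0 < z.im + t := by linarith [ht.1]
    have h1 : HasDerivAt (fun t => z.im + t) 1 t := (hasDerivAt_id t).const_add _
    have h2 := ((h1.rpow_const (p := 1 / 3) (Or.inl hpos.ne')).sub_const
      (z.im ^ (1 / 3 : ℝ))).const_mul (3 * C)
    refine h2.congr_deriv ?_
    norm_num; ring
  have key := image_norm_le_of_norm_deriv_right_le_deriv_boundary' (f := F) (B := B) (a := 0)
    (b := h) (fun t ht => (hFd t ht).continuousAt.continuousWithinAt)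
    (fun t ht => (hFd t ⟨ht.1, ht.2.le⟩).hasDerivWithinAt) (by simp [hF, hB])
    (fun t ht => (hBd t ht).continuousAt.continuousWithinAt)
    (fun t ht => (hBd t ⟨ht.1, ht.2.le⟩).hasDerivWithinAt)
    (fun t ht => by
      rw [norm_mul, Complex.norm_I, mul_one]; exact hDle t ⟨ht.1, ht.2.le⟩)
    (right_mem_Icc.2 hh)
  refine key.trans ?_
  have h3 := Real.rpow_add_le_add_rpow hz.le hh (p := 1 / 3) (by norm_num) (by norm_num)
  simp only [hB]
  exact mul_le_mul_of_nonneg_left (by linarith) (by positivity)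

/-- Hölder continuity from the growth of the derivative at the boundary: two points are joined
through the points above them whose height is their distance. -/
lemma norm_sub_le_of_deriv_le {g : ℂ → ℂ} {R C : ℝ} (hC : 0 ≤ C)
    (hg : ∀ z, 0 < z.im → ‖z‖ ≤ 3 * R → ∃ D, HasDerivAt g D z ∧
      ‖D‖ ≤ C * z.im ^ (-(2 / 3) : ℝ)) {z z' : ℂ} (hz : 0 < z.im) (hz' : 0 < z'.im) (hzR : ‖z‖ ≤ R)
    (hzR' : ‖z'‖ ≤ R) : ‖g z - g z'‖ ≤ 7 * C * ‖z - z'‖ ^ (1 / 3 : ℝ) := by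
  rcases (norm_nonneg (z - z')).eq_or_lt with h0 | h0
  · have : z = z' := sub_eq_zero.1 (norm_eq_zero.1 h0.symm)
    simp [this]
  set h := ‖z - z'‖ with hh
  have hhR : h ≤ 2 * R := (norm_sub_le _ _).trans (by linarith)
  have hup : ∀ ζ : ℂ, ‖ζ‖ ≤ R → ∀ t ∈ Icc 0 h, ‖ζ + t * Complex.I‖ ≤ 3 * R := fun ζ hζ t ht => by
    refine (norm_add_le _ _).trans ?_
    rw [norm_mul, Complex.norm_I, mul_one, Complex.norm_real, Real.norm_of_nonneg ht.1]
    linarith [ht.2]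
  have him : ∀ (ζ : ℂ) (t : ℝ), (ζ + t * Complex.I).im = ζ.im + t := fun ζ t => by simp
  have hv : ∀ ζ : ℂ, 0 < ζ.im → ‖ζ‖ ≤ R → ‖g (ζ + h * Complex.I) - g ζ‖ ≤ 3 * C * h ^ (1 / 3 : ℝ) :=
    fun ζ hζ hζR => norm_sub_le_vertical hζ h0.le hC fun t ht => by
      obtain ⟨D, h1, h2⟩ := hg (ζ + t * Complex.I) (by rw [him]; linarith [ht.1]) (hup ζ hζR t ht)
      exact ⟨D, h1, by rwa [him] at h2⟩
  -- at height at least `h` the derivative is bounded by `C h ^ (-2/3)` on a convex set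
  have hhor : ‖g (z + h * Complex.I) - g (z' + h * Complex.I)‖ ≤ C * h ^ (1 / 3 : ℝ) := by
    set s : Set ℂ := {ζ | h ≤ ζ.im} ∩ Metric.closedBall 0 (3 * R)
    have hs : Convex ℝ s := (convex_halfSpace_im_ge h).inter (convex_closedBall _ _)
    have hder : ∀ ζ ∈ s, ∃ D, HasDerivAt g D ζ ∧ ‖D‖ ≤ C * h ^ (-(2 / 3) : ℝ) := fun ζ hζ => by
      have h1 : h ≤ ζ.im := hζ.1
      obtain ⟨D, h2, h3⟩ := hg ζ (h0.trans_le h1) (by simpa using hζ.2)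
      exact ⟨D, h2, h3.trans (mul_le_mul_of_nonneg_left
        (Real.rpow_le_rpow_of_nonpos h0 h1 (by norm_num)) hC)⟩
    choose! D hD hDle using hder
    have hmem : ∀ ζ : ℂ, 0 < ζ.im → ‖ζ‖ ≤ R → ζ + h * Complex.I ∈ s := fun ζ hζ hζR =>
      ⟨by show h ≤ _; rw [him]; linarith, by
        simpa using hup ζ hζR h (right_mem_Icc.2 h0.le)⟩
    have := hs.norm_image_sub_le_of_norm_hasDerivWithin_le
      (fun ζ hζ => (hD ζ hζ).hasDerivWithinAt) hDle (hmem z' hz' hzR') (hmem z hz hzR)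
    rw [show z + h * Complex.I - (z' + h * Complex.I) = z - z' by ring, ← hh, mul_assoc,
      rpow_third_mul h0] at this
    exact this
  calc ‖g z - g z'‖ = ‖(g (z + h * Complex.I) - g (z' + h * Complex.I))
        - (g (z + h * Complex.I) - g z) + (g (z' + h * Complex.I) - g z')‖ := by ring_nf
    _ ≤ C * h ^ (1 / 3 : ℝ) + 3 * C * h ^ (1 / 3 : ℝ) + 3 * C * h ^ (1 / 3 : ℝ) :=
        (norm_add_le _ _).trans (add_le_add ((norm_sub_le _ _).trans
          (add_le_add hhor (hv z hz hzR))) (hv z' hz' hzR'))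
    _ = _ := by ring

end Holder

section Constants

variable {X : Type*} [MeasurableSpace X] {π : Measure X} [IsProbabilityMeasure π]
  {a : X → ℝ} {s : X → X → ℝ}

/-- The lower bound on solutions at bounded spectral parameters. -/
lemma exists_lower_bound (π : Measure X) [IsProbabilityMeasure π] (ha : BddMeas a)
    (hs : IsSymmKernel s) {Φ R : ℝ} (hΦ : 0 < Φ) (hR : 0 < R) :
    ∃ c₀, 0 < c₀ ∧ ∀ z w, SolvesAt π a s z w → (∀ x, ‖w x‖ ≤ Φ) → ‖z‖ ≤ R → ∀ x, c₀ ≤ ‖w x‖ := by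
  obtain ⟨A, hA0, hA⟩ := ha.le_const
  obtain ⟨M, hM0, hM⟩ := hs.exists_bound
  refine ⟨1 / (R + A + M * Φ), by positivity, fun z w h hw hz x => ?_⟩
  rw [div_le_iff₀ (by positivity)]
  exact h.one_le hs hA hM hw hz x

/-- The solution is Hölder continuous with exponent `1/3`, uniformly in bounded parts of the upper
half plane. -/
lemma exists_holder (π : Measure X) [IsProbabilityMeasure π] (ha : BddMeas a) (hs : IsSymmKernel s)
    (hA : DiagonalPositivity π s) (hB : UniformPrimitivity π s)
    (hC : ComponentRegularity π a s) {R : ℝ} (hR : 0 < R) :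
    ∃ C, 0 < C ∧ ∀ m, IsSolution π a s m → ∀ x,
      (∀ z, 0 < z.im → ‖z‖ ≤ R → DifferentiableAt ℂ (fun z => m z x) z) ∧
      ∀ z z', 0 < z.im → 0 < z'.im → ‖z‖ ≤ R → ‖z'‖ ≤ R →
        ‖m z x - m z' x‖ ≤ C * ‖z - z'‖ ^ (1 / 3 : ℝ) := by
  obtain ⟨Φ, hΦ0, hΦ⟩ := exists_sup_bound ha hs hA hC
  obtain ⟨n, c, hc0, hc⟩ := hB
  obtain ⟨c₀, hc₀, hlow⟩ := exists_lower_bound π ha hs hΦ0 (show 0 < 3 * R by positivity)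
  obtain ⟨C, hC0, hCd⟩ := exists_hasDerivAt (π := π) ha hs (R := 3 * R) hc₀ hΦ0 hc0 hc
  refine ⟨7 * C, by positivity, fun m hm x => ?_⟩
  have hd : ∀ z, 0 < z.im → ‖z‖ ≤ 3 * R → ∃ D, HasDerivAt (fun z => m z x) D z ∧
      ‖D‖ ≤ C * z.im ^ (-(2 / 3) : ℝ) := fun z hz hzR =>
    hCd m hm (fun z hz hzR => hlow z _ (hm.solvesAt hz) (hΦ z _ hz (hm.solvesAt hz)) hzR)
      (fun z hz => hΦ z _ hz (hm.solvesAt hz)) z hz hzR x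
  refine ⟨fun z hz hzR => ?_, fun z z' hz hz' hzR hzR' =>
    norm_sub_le_of_deriv_le hC0.le hd hz hz' hzR hzR'⟩
  obtain ⟨D, hD, -⟩ := hd z hz (by linarith)
  exact hD.differentiableAt

end Constants

/-! ### The extension to the real axis -/

section Extension

variable {X : Type*} [MeasurableSpace X] {π : Measure X} [IsProbabilityMeasure π]
  {a : X → ℝ} {s : X → X → ℝ} {m : ℂ → X → ℂ}

/-- Points of the upper half plane converging to a given point of its closure. -/
lemma tendsto_add_I_div (z : ℂ) :
    Tendsto (fun n : ℕ => z + ((1 / ((n : ℝ) + 1) : ℝ) : ℂ) * Complex.I) atTop (𝓝 z) := by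
  have h1 : Tendsto (fun n : ℕ => ((1 / ((n : ℝ) + 1) : ℝ) : ℂ)) atTop (𝓝 ((0 : ℝ) : ℂ)) :=
    (Complex.continuous_ofReal.tendsto 0).comp tendsto_one_div_add_atTop_nhds_zero_nat
  simpa using (h1.mul_const Complex.I).const_add z

lemma im_add_I_div (z : ℂ) (n : ℕ) :
    (z + ((1 / ((n : ℝ) + 1) : ℝ) : ℂ) * Complex.I).im = z.im + 1 / ((n : ℝ) + 1) := by
  rw [Complex.add_im, Complex.mul_I_im, Complex.ofReal_re]

lemma im_add_I_div_pos {z : ℂ} (hz : 0 ≤ z.im) (n : ℕ) :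
    0 < (z + ((1 / ((n : ℝ) + 1) : ℝ) : ℂ) * Complex.I).im := by
  rw [im_add_I_div]; have := Nat.one_div_pos_of_nat (α := ℝ) (n := n); linarith

omit [IsProbabilityMeasure π] in
lemma IsExtendedSolution.tendsto_add_I_div (h : IsExtendedSolution π a s m) {z : ℂ}
    (hz : 0 ≤ z.im) (x : X) :
    Tendsto (fun n : ℕ => m (z + ((1 / ((n : ℝ) + 1) : ℝ) : ℂ) * Complex.I) x) atTop
      (𝓝 (m z x)) :=
  ((h.2 x z hz).tendsto).comp (tendsto_nhdsWithin_iff.2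
    ⟨QVE.tendsto_add_I_div z, Eventually.of_forall fun n => (im_add_I_div_pos hz n).le⟩)

/-- The equation and the bound persist on the real axis. -/
lemma IsExtendedSolution.solvesAt (h : IsExtendedSolution π a s m) (hs : IsSymmKernel s) {Φ : ℝ}
    (hΦ : ∀ (z : ℂ) (w : X → ℂ), 0 < z.im → SolvesAt π a s z w → ∀ x, ‖w x‖ ≤ Φ) {z : ℂ}
    (hz : 0 ≤ z.im) : SolvesAt π a s z (m z) ∧ ∀ x, ‖m z x‖ ≤ Φ := by
  set ζ : ℕ → ℂ := fun n => z + ((1 / ((n : ℝ) + 1) : ℝ) : ℂ) * Complex.I with hζ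
  have hpos : ∀ n, 0 < (ζ n).im := im_add_I_div_pos hz
  have hsol : ∀ n, SolvesAt π a s (ζ n) (m (ζ n)) := fun n => h.1.solvesAt (hpos n)
  have hB : ∀ n x, ‖m (ζ n) x‖ ≤ Φ := fun n => hΦ _ _ (hpos n) (hsol n)
  have ht : ∀ x, Tendsto (fun n => m (ζ n) x) atTop (𝓝 (m z x)) := fun x => h.tendsto_add_I_div hz x
  have hb : BddMeas (m z) := BddMeas.of_tendsto (fun n => (hsol n).bddMeas) hB ht
  have hprod : ∀ x, m z x * (z + a x + intOp π s (m z) x) = -1 := fun x => by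
    have h1 : Tendsto (fun n => m (ζ n) x * (ζ n + a x + intOp π s (m (ζ n)) x)) atTop
        (𝓝 (m z x * (z + a x + intOp π s (m z) x))) :=
      (ht x).mul (((QVE.tendsto_add_I_div z).add_const _).add
        (tendsto_intOp hs (fun n => (hsol n).bddMeas) hB ht x))
    refine tendsto_nhds_unique h1 (tendsto_const_nhds.congr fun n => ?_)
    rw [← (hsol n).eq x, mul_div_cancel₀ _ ((hsol n).ne_zero x)]
  have hne : ∀ x, m z x ≠ 0 := fun x hx => by
    have := hprod x
    rw [hx, zero_mul] at this
    exact absurd this (by norm_num)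
  refine ⟨⟨hz, hb, fun x => ?_, hne, fun x => ?_⟩, fun x => ?_⟩
  · exact ge_of_tendsto' ((Complex.continuous_im.tendsto _).comp (ht x))
      fun n => (hsol n).im_nonneg x
  · rw [div_eq_iff (hne x), mul_comm, hprod x]
  · exact le_of_tendsto' (ht x).norm fun n => hB n x

omit [IsProbabilityMeasure π] in
/-- The Hölder estimate passes to the closed half plane by approximation from above, which needs a
slightly larger radius in the open half plane. -/
lemma IsExtendedSolution.holder (h : IsExtendedSolution π a s m) {R C : ℝ} {x : X}
    (hC : ∀ z z' : ℂ, 0 < z.im → 0 < z'.im → ‖z‖ ≤ R + 1 → ‖z'‖ ≤ R + 1 →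
      ‖m z x - m z' x‖ ≤ C * ‖z - z'‖ ^ (1 / 3 : ℝ)) {z z' : ℂ} (hz : 0 ≤ z.im) (hz' : 0 ≤ z'.im)
    (hzR : ‖z‖ ≤ R) (hzR' : ‖z'‖ ≤ R) : ‖m z x - m z' x‖ ≤ C * ‖z - z'‖ ^ (1 / 3 : ℝ) := by
  refine le_of_tendsto' ((h.tendsto_add_I_div hz x).sub (h.tendsto_add_I_div hz' x)).norm
    fun n => ?_
  have hn : ∀ ζ : ℂ, ‖ζ‖ ≤ R → ‖ζ + ((1 / ((n : ℝ) + 1) : ℝ) : ℂ) * Complex.I‖ ≤ R + 1 :=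
    fun ζ hζ => by
      refine (norm_add_le _ _).trans (add_le_add hζ ?_)
      rw [norm_mul, Complex.norm_I, mul_one, Complex.norm_real,
        Real.norm_of_nonneg Nat.one_div_pos_of_nat.le, div_le_one (by positivity)]
      linarith [Nat.cast_nonneg (α := ℝ) n]
  refine (hC _ _ (im_add_I_div_pos hz n) (im_add_I_div_pos hz' n) (hn z hzR) (hn z' hzR')).trans ?_
  rw [add_sub_add_right_eq_sub]

/-- Existence of the solution of the quadratic vector equation with its continuous extension. -/
lemma exists_isExtendedSolution (π : Measure X) [IsProbabilityMeasure π] (ha : BddMeas a)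
    (hs : IsSymmKernel s) (hA : DiagonalPositivity π s) (hB : UniformPrimitivity π s)
    (hC : ComponentRegularity π a s) : ∃ m, IsExtendedSolution π a s m := by
  choose! w hw using fun (z : ℂ) (hz : 0 < z.im) => exists_solvesAt (z := z) π ha hs hz
  have hsol : IsSolution π a s w := fun z hz =>
    ⟨(hw z hz).bddMeas, (hw z hz).im_pos hs hz, (hw z hz).eq⟩
  set A : Set ℂ := {z : ℂ | 0 < z.im} with hAdef
  have hcl : {z : ℂ | 0 ≤ z.im} ⊆ closure A := (Complex.closure_setOfPred_lt_im 0).ge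
  -- the Hölder estimate makes the values near a boundary point a Cauchy filter
  have hlim : ∀ x, ∀ z ∈ {z : ℂ | 0 ≤ z.im}, ∃ y, Tendsto (fun z => w z x) (𝓝[A] z) (𝓝 y) := by
    intro x z hz
    have hne : (𝓝[A] z).NeBot := mem_closure_iff_nhdsWithin_neBot.1 (hcl hz)
    obtain ⟨K, hK0, hK⟩ := exists_holder π ha hs hA hB hC (R := ‖z‖ + 1) (by positivity)
    obtain ⟨-, hK⟩ := hK w hsol x
    refine cauchy_map_iff_exists_tendsto.1 (Metric.cauchy_iff.2 ⟨inferInstance, fun ε hε => ?_⟩)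
    have hcont : Tendsto (fun t : ℝ => K * t ^ (1 / 3 : ℝ)) (𝓝 0) (𝓝 0) := by
      have : Tendsto (fun t : ℝ => K * t ^ (1 / 3 : ℝ)) (𝓝 0) (𝓝 (K * (0 : ℝ) ^ (1 / 3 : ℝ))) :=
        ((Real.continuousAt_rpow_const 0 (1 / 3) (Or.inr (by norm_num))).tendsto).const_mul K
      simpa using this
    obtain ⟨δ, hδ, hδε⟩ := Metric.eventually_nhds_iff.1 (hcont.eventually (gt_mem_nhds hε))
    refine ⟨(fun z => w z x) '' (A ∩ Metric.ball z (min 1 (δ / 2))), image_mem_map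
      (inter_mem self_mem_nhdsWithin (mem_nhdsWithin_of_mem_nhds
        (Metric.ball_mem_nhds z (by positivity)))), ?_⟩
    rintro _ ⟨ζ, ⟨hζ, hζb⟩, rfl⟩ _ ⟨ζ', ⟨hζ', hζb'⟩, rfl⟩
    rw [Metric.mem_ball, lt_min_iff] at hζb hζb'
    have hR : ∀ ζ : ℂ, dist ζ z < 1 → ‖ζ‖ ≤ ‖z‖ + 1 := fun ζ h => by
      have h1 : ‖ζ - z‖ < 1 := by rwa [← dist_eq_norm]
      have := norm_add_le z (ζ - z)
      rw [add_sub_cancel] at this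
      linarith
    rw [dist_eq_norm]
    refine (hK ζ ζ' hζ hζ' (hR ζ hζb.1) (hR ζ' hζb'.1)).trans_lt (hδε ?_)
    rw [Real.dist_0_eq_abs, abs_of_nonneg (norm_nonneg _), ← dist_eq_norm]
    linarith [dist_triangle_right ζ ζ' z]
  have hcont : ∀ x, ContinuousOn (fun z => w z x) A := fun x z hz => by
    obtain ⟨K, hK0, hK⟩ := exists_holder π ha hs hA hB hC (R := ‖z‖ + 1) (by positivity)
    exact ((hK w hsol x).1 z hz (by linarith)).continuousAt.continuousWithinAt
  have hopen : IsOpen A := isOpen_lt continuous_const Complex.continuous_im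
  have hext : ∀ z ∈ A, (fun x => extendFrom A (fun z => w z x) z) = w z := fun z hz => by
    funext x
    exact extendFrom_extends (hcont x) z hz
  refine ⟨fun z x => extendFrom A (fun z => w z x) z, fun z hz => ?_, fun x =>
    continuousOn_extendFrom hcl (hlim x)⟩
  have h1 := hsol z hz
  rw [← hext z hz] at h1
  exact h1

end Extension

/-! ### The top eigenvalue of `F` -/

section TopEigenvalue

variable {X : Type*} [MeasurableSpace X] {π : Measure X} [IsProbabilityMeasure π]
  {a : X → ℝ} {s : X → X → ℝ} {z : ℂ} {w w₀ : X → ℂ} {f : X → ℝ}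

omit [IsProbabilityMeasure π] in
lemma l2OpNorm_nonneg (T : (X → ℂ) → X → ℂ) : 0 ≤ l2OpNorm π T :=
  Real.sInf_nonneg fun _ hc => hc.1

omit [IsProbabilityMeasure π] in
lemma IsTopEigenfunction.rOp_eq (h : IsTopEigenfunction π s w f) (x : X) :
    rOp π (kerF s w) f x = l2OpNorm π (opF π s w) * f x := by
  have := h.eigen x
  rw [opF_eq, intOp_ofReal, ← opF_eq] at this
  exact_mod_cast this

/-- The Perron–Frobenius eigenfunction is a top eigenfunction. -/
lemma exists_isTopEigenfunction (hs : IsSymmKernel s) (hw : BddMeas w) {c₀ c : ℝ} {n : ℕ}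
    (hc₀ : 0 < c₀) (hlow : ∀ x, c₀ ≤ ‖w x‖) (hc0 : 0 < c)
    (hc : ∀ x y, c ≤ kernelPow π s n x y) : ∃ f, IsTopEigenfunction π s w f := by
  have hk := isSymmKernel_kerF hs hw
  obtain ⟨f, l, δ, hf, hδ, hδf, hl, hf1, hfl⟩ := exists_perron hk
    (c := (c₀ ^ 2) ^ (n + 1) * c) (by positivity) (le_kernelPow_kerF hs hw hc₀ hlow hc)
  refine ⟨f, hf, fun x => hδ.le.trans (hδf x), hf1, fun x => ?_⟩
  rw [opF_eq, l2OpNorm_intOp hk hf hδ hδf hl.le hfl, intOp_ofReal, hfl x]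
  push_cast; rfl

/-- If `w` solves the equation at `z` and is close to `w₀`, then `sinArg w` is an approximate
eigenfunction of the operator `F` built from `w₀`, which locates the top eigenvalue of that
operator. -/
lemma SolvesAt.eigenvalue_near (h : SolvesAt π a s z w) (ha : BddMeas a) (hs : IsSymmKernel s)
    {Φ M c ε l : ℝ} (hΦ : ∀ x, ‖w x‖ ≤ Φ) (hΦ₀ : ∀ x, ‖w₀ x‖ ≤ Φ) (hw₀ : BddMeas w₀)
    (hM : ∀ x y, s x y ≤ M) (hc : 0 < c) (hε : ∀ x, ‖w x - w₀ x‖ ≤ ε)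
    (hA : 0 < ∫ x, sinArg w x ∂π) (hlow : ∀ x, c * ∫ y, sinArg w y ∂π ≤ sinArg w x)
    (hf : BddMeas f) (hf0 : ∀ x, 0 ≤ f x) (hf1 : ∫ x, f x ^ 2 ∂π = 1)
    (hfl : ∀ x, rOp π (kerF s w₀) f x = l * f x) :
    l ≤ 1 + 2 * Φ * M / c * ε ∧ (z.im = 0 → 1 - 2 * Φ * M / c * ε ≤ l) := by
  have hg := h.bddMeas_sinArg ha hs
  have hk := isSymmKernel_kerF hs h.bddMeas
  have hk₀ := isSymmKernel_kerF hs hw₀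
  set A := ∫ x, sinArg w x ∂π
  obtain ⟨x₀⟩ : Nonempty X := nonempty_of_isProbabilityMeasure π
  have hΦ0 : 0 ≤ Φ := (norm_nonneg _).trans (hΦ x₀)
  have hM0 : 0 ≤ M := (hs.nonneg x₀ x₀).trans (hM x₀ x₀)
  have hε0 : 0 ≤ ε := (norm_nonneg _).trans (hε x₀)
  -- the kernels are close to each other because `|w|` and `|w₀|` are
  have hker : ∀ x y, |kerF s w₀ x y - kerF s w x y| ≤ 2 * Φ * M * ε := fun x y => by
    have h1 : ∀ x, |‖w₀ x‖ - ‖w x‖| ≤ ε := fun x =>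
      (abs_norm_sub_norm_le _ _).trans (by rw [norm_sub_rev]; exact hε x)
    have h2 : kerF s w₀ x y - kerF s w x y
        = s x y * ((‖w₀ x‖ - ‖w x‖) * ‖w₀ y‖ + ‖w x‖ * (‖w₀ y‖ - ‖w y‖)) := by
      simp only [kerF]; ring
    rw [h2, abs_mul, abs_of_nonneg (hs.nonneg x y)]
    have h3 : |(‖w₀ x‖ - ‖w x‖) * ‖w₀ y‖ + ‖w x‖ * (‖w₀ y‖ - ‖w y‖)| ≤ ε * Φ + Φ * ε := by
      refine (abs_add_le _ _).trans (add_le_add ?_ ?_)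
      · rw [abs_mul, abs_norm]
        exact mul_le_mul (h1 x) (hΦ₀ y) (norm_nonneg _) hε0
      · rw [abs_mul, abs_norm]
        exact mul_le_mul (hΦ x) (h1 y) (abs_nonneg _) hΦ0
    calc _ ≤ M * (ε * Φ + Φ * ε) := mul_le_mul (hM x y) h3 (abs_nonneg _) hM0
      _ = _ := by ring
  have hdiff : ∀ x, |rOp π (kerF s w₀) (sinArg w) x - rOp π (kerF s w) (sinArg w) x|
      ≤ 2 * Φ * M * ε * A := fun x => by
    have hb := hk.bddMeas x
    have hb₀ := hk₀.bddMeas x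
    simp only [rOp]
    rw [← integral_sub (BddMeas.integrable (by fun_prop)) (BddMeas.integrable (by fun_prop)),
      ← integral_const_mul]
    refine abs_integral_le_integral_abs.trans
      (integral_mono ?_ ?_ fun y => ?_)
    · exact (BddMeas.integrable (by fun_prop)).abs
    · exact BddMeas.integrable (by fun_prop)
    simp only [← sub_mul, abs_mul, abs_of_nonneg (h.sinArg_nonneg y)]
    exact mul_le_mul_of_nonneg_right (hker x y) (h.sinArg_nonneg y)
  have hr := hg.rOp (π := π) hk
  have hr₀ := hg.rOp (π := π) hk₀
  have hnw := h.bddMeas.norm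
  -- the eigenvalue equation tested against `sinArg w`
  have key : (l - 1) * ∫ x, f x * sinArg w x ∂π
      = ∫ x, f x * (rOp π (kerF s w₀) (sinArg w) x - rOp π (kerF s w) (sinArg w) x) ∂π
        - z.im * ∫ x, f x * ‖w x‖ ∂π := by
    have h1 : ∫ x, f x * rOp π (kerF s w₀) (sinArg w) x ∂π = l * ∫ x, f x * sinArg w x ∂π := by
      rw [integral_mul_rOp hk₀ hf hg, ← integral_const_mul]
      congr 1; ext x; rw [hfl x]; ring
    have h2 : ∫ x, f x * rOp π (kerF s w) (sinArg w) x ∂π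
        = ∫ x, f x * sinArg w x ∂π - z.im * ∫ x, f x * ‖w x‖ ∂π := by
      rw [← integral_const_mul, ← integral_sub (BddMeas.integrable (by fun_prop))
        (BddMeas.integrable (by fun_prop))]
      congr 1; ext x
      have := h.sinArg_eq hs x
      rw [show rOp π (kerF s w) (sinArg w) x = sinArg w x - z.im * ‖w x‖ by linarith]; ring
    simp only [mul_sub]
    rw [integral_sub (BddMeas.integrable (by fun_prop)) (BddMeas.integrable (by fun_prop)), h1, h2]
    ring
  -- the lower bound on `sinArg w` makes the pairing with `f` positive, so it can be divided out
  have hf_int : 0 < ∫ x, f x ∂π := by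
    rcases (integral_nonneg hf0 : 0 ≤ ∫ x, f x ∂π).eq_or_lt with h0 | h0
    · have h1 := (integral_eq_zero_iff_of_nonneg hf0 hf.integrable).1 h0.symm
      have : ∫ x, f x ^ 2 ∂π = 0 := integral_eq_zero_of_ae (h1.mono fun x hx => by simp [hx])
      rw [this] at hf1; norm_num at hf1
    · exact h0
  set J := ∫ x, f x * sinArg w x ∂π
  have hJ : c * A * ∫ x, f x ∂π ≤ J := by
    rw [← integral_const_mul]
    exact integral_mono (BddMeas.integrable (by fun_prop)) (BddMeas.integrable (by fun_prop))
      fun x => by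
        show c * A * f x ≤ f x * sinArg w x
        rw [mul_comm]; exact mul_le_mul_of_nonneg_left (hlow x) (hf0 x)
  have hJ0 : 0 < J := lt_of_lt_of_le (by positivity) hJ
  have herr : |∫ x, f x * (rOp π (kerF s w₀) (sinArg w) x - rOp π (kerF s w) (sinArg w) x) ∂π|
      ≤ 2 * Φ * M / c * ε * J := by
    have h1 : |∫ x, f x * (rOp π (kerF s w₀) (sinArg w) x - rOp π (kerF s w) (sinArg w) x) ∂π|
        ≤ ∫ x, (2 * Φ * M * ε * A) * f x ∂π := by
      refine abs_integral_le_integral_abs.trans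
        (integral_mono ?_ ?_ fun x => ?_)
      · exact (BddMeas.integrable (by fun_prop)).abs
      · exact BddMeas.integrable (by fun_prop)
      simp only [abs_mul, abs_of_nonneg (hf0 x)]
      rw [mul_comm]
      exact mul_le_mul_of_nonneg_right (hdiff x) (hf0 x)
    rw [integral_const_mul] at h1
    refine h1.trans ?_
    calc 2 * Φ * M * ε * A * ∫ x, f x ∂π = 2 * Φ * M / c * ε * (c * A * ∫ x, f x ∂π) := by
          field_simp
      _ ≤ _ := mul_le_mul_of_nonneg_left hJ (by positivity)
  have hfw : 0 ≤ ∫ x, f x * ‖w x‖ ∂π :=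
    integral_nonneg fun x => mul_nonneg (hf0 x) (norm_nonneg _)
  have h5 := abs_le.1 herr
  have hη := mul_nonneg h.z_im_nonneg hfw
  refine ⟨?_, fun hz => ?_⟩
  · have : (l - 1) * J ≤ 2 * Φ * M / c * ε * J := by linarith [h5.2]
    linarith [le_of_mul_le_mul_right this hJ0]
  · rw [hz, zero_mul, sub_zero] at key
    have : (-(2 * Φ * M / c * ε)) * J ≤ (l - 1) * J := by linarith [h5.1]
    linarith [le_of_mul_le_mul_right this hJ0]

end TopEigenvalue

/-! ### Uniform constants on bounded sets -/

section Regular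

variable {X : Type*} [MeasurableSpace X] {π : Measure X} [IsProbabilityMeasure π]
  {a : X → ℝ} {s : X → X → ℝ} {m : ℂ → X → ℂ} {R K q : ℝ}

/-- The quantitative properties of the extended solution `m` at points `z` of the closed upper half
plane with `‖z‖ ≤ R`, with a single constant `K` for all bounds and a spectral gap `1 - q` of the
operator `F` on the real axis. -/
structure IsRegular (π : Measure X) (a : X → ℝ) (s : X → X → ℝ) (m : ℂ → X → ℂ) (R K q : ℝ) :
    Prop where
  one_le : 1 ≤ K
  q_nonneg : 0 ≤ q
  q_lt_one : q < 1
  kernel_le : ∀ x y, s x y ≤ K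
  solvesAt : ∀ z : ℂ, 0 ≤ z.im → SolvesAt π a s z (m z)
  norm_le : ∀ z : ℂ, 0 ≤ z.im → ∀ x, ‖m z x‖ ≤ K
  one_le_norm : ∀ z : ℂ, 0 ≤ z.im → ‖z‖ ≤ R → ∀ x, 1 ≤ K * ‖m z x‖
  holder : ∀ z z' : ℂ, 0 ≤ z.im → 0 ≤ z'.im → ‖z‖ ≤ R → ‖z'‖ ≤ R → ∀ x,
    ‖m z x - m z' x‖ ≤ K * ‖z - z'‖ ^ (1 / 3 : ℝ)
  sinArg_le : ∀ z : ℂ, 0 ≤ z.im → ‖z‖ ≤ R → ∀ x, sinArg (m z) x ≤ K * ∫ y, sinArg (m z) y ∂π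
  le_sinArg : ∀ z : ℂ, 0 ≤ z.im → ‖z‖ ≤ R → ∀ x, ∫ y, sinArg (m z) y ∂π ≤ K * sinArg (m z) x
  gapped : ∀ τ : ℝ, |τ| ≤ R → ∀ f, IsTopEigenfunction π s (m τ) f →
    IsGapped π (kerF s (m τ)) f (l2OpNorm π (opF π s (m τ))) q K K⁻¹
  eigenfunction_le : ∀ τ : ℝ, |τ| ≤ R → ∀ f, IsTopEigenfunction π s (m τ) f → ∀ x, f x ≤ K

omit [IsProbabilityMeasure π] in
lemma IsGapped.mono {k : X → X → ℝ} {f : X → ℝ} {l q M M' δ δ' : ℝ}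
    (h : IsGapped π k f l q M δ) (hM : M ≤ M') (hδ : δ' ≤ δ) : IsGapped π k f l q M' δ' :=
  { h with
    kernel_le := fun x y => (h.kernel_le x y).trans hM
    le_eigenfunction := fun x => hδ.trans (h.le_eigenfunction x) }

/-- The number `C t^(1/3)` tends to zero along `t = 1 / (n + 1)`. -/
lemma tendsto_mul_rpow_third (C : ℝ) :
    Tendsto (fun n : ℕ => C * (1 / ((n : ℝ) + 1)) ^ (1 / 3 : ℝ)) atTop (𝓝 0) := by
  have h1 := (Real.continuousAt_rpow_const 0 (1 / 3) (Or.inr (by norm_num))).tendsto.comp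
    tendsto_one_div_add_atTop_nhds_zero_nat
  simpa using h1.const_mul C

/-- On the real axis the top eigenvalue of `F` is at most one: `F` is a limit of the operators at
points of the upper half plane, which satisfy `F v ≤ v` for the positive function `v = sinArg m`. -/
lemma IsExtendedSolution.l2OpNorm_le_one (h : IsExtendedSolution π a s m) (ha : BddMeas a)
    (hs : IsSymmKernel s) (hA : DiagonalPositivity π s) (hB : UniformPrimitivity π s)
    (hC : ComponentRegularity π a s) {τ : ℝ} {f : X → ℝ} (hf : IsTopEigenfunction π s (m τ) f) :
    l2OpNorm π (opF π s (m τ)) ≤ 1 := by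
  obtain ⟨Φ, hΦ0, hΦ⟩ := exists_sup_bound ha hs hA hC
  obtain ⟨M, hM0, hM⟩ := hs.exists_bound
  obtain ⟨H, hH0, hH⟩ := exists_holder π ha hs hA hB hC (R := |τ| + 1 + 1) (by positivity)
  obtain ⟨n, c, hc0, hc⟩ := hB
  obtain ⟨c₀, hc₀, hlow⟩ := exists_lower_bound π ha hs hΦ0 (show 0 < |τ| + 1 by positivity)
  set c₁ := (c₀ ^ 2) ^ (n + 1) * c with hc₁
  have hc₁0 : 0 < c₁ := by positivity
  have hτ0 : (0 : ℝ) ≤ (τ : ℂ).im := by simp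
  have hsol := h.solvesAt hs hΦ hτ0
  have hlim : Tendsto (fun n : ℕ => 1 + 2 * Φ * M / c₁ * (H * (1 / ((n : ℝ) + 1)) ^ (1 / 3 : ℝ)))
      atTop (𝓝 (1 + 2 * Φ * M / c₁ * 0)) :=
    ((tendsto_mul_rpow_third H).const_mul _).const_add _
  rw [mul_zero, add_zero] at hlim
  refine ge_of_tendsto' hlim fun j => ?_
  -- the operator at `τ` is compared with the one at a point `ζ` above `τ`
  set ζ : ℂ := τ + ((1 / ((j : ℝ) + 1) : ℝ) : ℂ) * Complex.I with hζ
  have hζ0 : 0 < ζ.im := im_add_I_div_pos hτ0 j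
  have hdist : ‖ζ - τ‖ = 1 / ((j : ℝ) + 1) := by
    rw [hζ, add_sub_cancel_left, norm_mul, Complex.norm_I, mul_one, Complex.norm_real,
      Real.norm_of_nonneg Nat.one_div_pos_of_nat.le]
  have hj1 : 1 / ((j : ℝ) + 1) ≤ 1 := by
    rw [div_le_one (by positivity)]; linarith [Nat.cast_nonneg (α := ℝ) j]
  have hτR : ‖(τ : ℂ)‖ ≤ |τ| + 1 := by rw [Complex.norm_real, Real.norm_eq_abs]; linarith
  have hζR : ‖ζ‖ ≤ |τ| + 1 := by
    have h1 := norm_add_le (τ : ℂ) (ζ - τ)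
    rw [add_sub_cancel, hdist, Complex.norm_real, Real.norm_eq_abs] at h1
    linarith
  have hζsol := h.1.solvesAt hζ0
  have hpos := integral_sinArg_pos hζsol ha hs hζ0
  refine (hζsol.eigenvalue_near ha hs (hΦ _ _ hζ0 hζsol) hsol.2 hsol.1.bddMeas hM hc₁0
    (fun x => ?_) hpos.1 (fun x => ?_) hf.bddMeas hf.nonneg hf.normalized hf.rOp_eq).1
  · rw [← hdist]
    exact h.holder (hH m h.1 x).2 hζ0.le hτ0 hζR hτR
  · exact (hζsol.sinArg_bounds ha hs hc₀ (hlow _ _ hζsol (hΦ _ _ hζ0 hζsol) hζR)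
      (hΦ _ _ hζ0 hζsol) hM hc x).1

/-- The bounds on the solution hold with a common constant on every bounded part of the closed half
plane. -/
lemma IsExtendedSolution.exists_isRegular (h : IsExtendedSolution π a s m) (ha : BddMeas a)
    (hs : IsSymmKernel s) (hA : DiagonalPositivity π s) (hB : UniformPrimitivity π s)
    (hC : ComponentRegularity π a s) (hR : 0 < R) : ∃ K q, IsRegular π a s m R K q := by
  obtain ⟨Φ, hΦ0, hΦ⟩ := exists_sup_bound ha hs hA hC
  obtain ⟨M, hM0, hM⟩ := hs.exists_bound
  obtain ⟨H, hH0, hH⟩ := exists_holder π ha hs hA hB hC (R := R + 1) (by positivity)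
  have hle1 : ∀ {τ : ℝ} {f : X → ℝ}, IsTopEigenfunction π s (m τ) f →
    l2OpNorm π (opF π s (m τ)) ≤ 1 := fun hf => h.l2OpNorm_le_one ha hs hA hB hC hf
  obtain ⟨n, c, hc0, hc⟩ := hB
  obtain ⟨c₀, hc₀, hlow⟩ := exists_lower_bound π ha hs hΦ0 hR
  obtain ⟨q, M', δ, hq0, hq, hM'0, hδ, hgap, -⟩ := exists_gapped s a ha hs hc₀ hΦ0 hc0 hc
  have hsol : ∀ z : ℂ, 0 ≤ z.im → SolvesAt π a s z (m z) ∧ ∀ x, ‖m z x‖ ≤ Φ :=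
    fun z hz => h.solvesAt hs hΦ hz
  set c₁ := (c₀ ^ 2) ^ (n + 1) * c with hc₁
  have hc₁0 : 0 < c₁ := by positivity
  -- the sum of all the constants that occur
  set K := 1 + M + Φ + 1 / c₀ + H + (Φ / c₀ + Φ * M * Φ) + 1 / c₁ + M' + 1 / δ
    + Φ * M * Φ / c₁ with hK
  have p1 : 0 < 1 / c₀ := by positivity
  have p2 : 0 < Φ / c₀ + Φ * M * Φ := by positivity
  have p3 : 0 < 1 / c₁ := by positivity
  have p4 : 0 < 1 / δ := by positivity
  have p5 : 0 < Φ * M * Φ / c₁ := by positivity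
  have hlowz : ∀ z : ℂ, 0 ≤ z.im → ‖z‖ ≤ R → ∀ x, c₀ ≤ ‖m z x‖ := fun z hz hzR =>
    hlow z _ (hsol z hz).1 (hsol z hz).2 hzR
  have hbounds : ∀ z : ℂ, 0 ≤ z.im → ‖z‖ ≤ R → ∀ x, c₁ * ∫ y, sinArg (m z) y ∂π ≤ sinArg (m z) x ∧
      sinArg (m z) x ≤ (Φ / c₀ + Φ * M * Φ) * ∫ y, sinArg (m z) y ∂π := fun z hz hzR =>
    (hsol z hz).1.sinArg_bounds ha hs hc₀ (hlowz z hz hzR) (hsol z hz).2 hM hc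
  have hint : ∀ z : ℂ, 0 ≤ z.im → 0 ≤ ∫ y, sinArg (m z) y ∂π := fun z hz =>
    integral_nonneg fun y => (hsol z hz).1.sinArg_nonneg y
  refine ⟨K, q, by linarith, hq0, hq, fun x y => (hM x y).trans (by linarith),
    fun z hz => (hsol z hz).1, fun z hz x => ((hsol z hz).2 x).trans (by linarith),
    fun z hz hzR x => ?_, fun z z' hz hz' hzR hzR' x => ?_, fun z hz hzR x => ?_,
    fun z hz hzR x => ?_, fun τ hτ f hf => ?_, fun τ hτ f hf x => ?_⟩
  · calc (1 : ℝ) = 1 / c₀ * c₀ := by field_simp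
      _ ≤ K * ‖m z x‖ := mul_le_mul (by linarith) (hlowz z hz hzR x) hc₀.le (by linarith)
  · exact (h.holder (hH m h.1 x).2 hz hz' hzR hzR').trans
      (mul_le_mul_of_nonneg_right (by linarith) (by positivity))
  · exact (hbounds z hz hzR x).2.trans (mul_le_mul_of_nonneg_right (by linarith) (hint z hz))
  · calc ∫ y, sinArg (m z) y ∂π = 1 / c₁ * (c₁ * ∫ y, sinArg (m z) y ∂π) := by field_simp
      _ ≤ K * sinArg (m z) x := mul_le_mul (by linarith) (hbounds z hz hzR x).1
          (mul_nonneg hc₁0.le (hint z hz)) (by linarith)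
  · have hτ0 : (0 : ℝ) ≤ (τ : ℂ).im := by simp
    have hτR : ‖(τ : ℂ)‖ ≤ R := by rwa [Complex.norm_real, Real.norm_eq_abs]
    refine (hgap (m τ) (hsol τ hτ0).1.bddMeas (hlowz τ hτ0 hτR) (hsol τ hτ0).2 f _ hf.bddMeas
      hf.nonneg hf.normalized hf.rOp_eq (l2OpNorm_nonneg _) (hle1 hf)).mono (by linarith) ?_
    rw [inv_le_comm₀ (by linarith) hδ]
    rw [one_div] at p4
    rw [hK, one_div δ]
    linarith
  · have hτ0 : (0 : ℝ) ≤ (τ : ℂ).im := by simp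
    have hτR : ‖(τ : ℂ)‖ ≤ R := by rwa [Complex.norm_real, Real.norm_eq_abs]
    have hb := (hsol τ hτ0).1.bddMeas
    refine ((eigenfunction_bounds (isSymmKernel_kerF hs hb) hc₁0 (by positivity)
      (le_kernelPow_kerF hs hb hc₀ (hlowz τ hτ0 hτR) hc) (kerF_le hs hM (hsol τ hτ0).2) hf.bddMeas
      hf.nonneg hf.normalized hf.rOp_eq (l2OpNorm_nonneg _) (hle1 hf)).1 x).trans (by linarith)

/-- Where the real axis carries points of positive imaginary part arbitrarily close to `τ`, the top
eigenvalue of `F` is one: at such points `sinArg m` is an eigenfunction for the eigenvalue one. -/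
lemma IsRegular.l2OpNorm_eq_one (h : IsRegular π a s m R K q) (ha : BddMeas a)
    (hs : IsSymmKernel s) {τ : ℝ} (hτ : |τ| ≤ R) {f : X → ℝ} (hf : IsTopEigenfunction π s (m τ) f)
    (hτR : ∀ ε > 0, ∃ τ' : ℝ, |τ'| ≤ R ∧ |τ' - τ| ≤ ε ∧ 0 < ∫ x, sinArg (m τ') x ∂π) :
    l2OpNorm π (opF π s (m τ)) = 1 := by
  have hK0 : 0 < K := lt_of_lt_of_le one_pos h.one_le
  have hreal : ∀ t : ℝ, (0 : ℝ) ≤ (t : ℂ).im := fun t => by simp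
  have hnorm : ∀ t : ℝ, |t| ≤ R → ‖(t : ℂ)‖ ≤ R := fun t ht => by
    rwa [Complex.norm_real, Real.norm_eq_abs]
  refine le_antisymm (h.gapped τ hτ f hf).eigenvalue_le_one ?_
  have hlim := (((tendsto_mul_rpow_third K).const_mul (2 * K * K / K⁻¹)).const_sub 1)
  rw [mul_zero, sub_zero] at hlim
  -- compare with points of positive imaginary part at distance at most `1 / (j + 1)`
  refine le_of_tendsto' hlim fun j => ?_
  obtain ⟨τ', hτ'R, hd, hpos⟩ := hτR (1 / ((j : ℝ) + 1)) Nat.one_div_pos_of_nat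
  refine ((h.solvesAt τ' (hreal τ')).eigenvalue_near ha hs (h.norm_le _ (hreal τ'))
    (h.norm_le _ (hreal τ)) (h.solvesAt _ (hreal τ)).bddMeas h.kernel_le (inv_pos.2 hK0)
    (fun x => ?_) hpos (fun x => ?_) hf.bddMeas hf.nonneg hf.normalized hf.rOp_eq).2 (by simp)
  · refine (h.holder _ _ (hreal τ') (hreal τ) (hnorm _ hτ'R) (hnorm _ hτ) x).trans ?_
    rw [← Complex.ofReal_sub, Complex.norm_real, Real.norm_eq_abs]
    gcongr
  · rw [inv_mul_le_iff₀ hK0]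
    exact h.le_sinArg _ (hreal τ') (hnorm _ hτ'R) x

end Regular

/-! ### Cauchy and Poisson integrals on the half plane -/

section HalfPlane

/-- A continuous function with quadratic decay is integrable. -/
lemma integrable_of_norm_le_div_sq {E : Type*} [NormedAddCommGroup E] {f : ℝ → E}
    (hf : Continuous f) {ρ C : ℝ} (hρ : 1 ≤ ρ) (h : ∀ t, ρ ≤ |t| → ‖f t‖ ≤ C / t ^ 2) :
    Integrable f := by
  obtain ⟨B, hB⟩ := isCompact_Icc.exists_bound_of_continuousOn (s := Icc (-ρ) ρ) hf.continuousOn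
  have hB0 : 0 ≤ B := (norm_nonneg _).trans (hB 0 ⟨by linarith, by linarith⟩)
  refine (integrable_inv_one_add_sq.const_mul (B * (1 + ρ ^ 2) + 2 * |C|)).mono'
    hf.aestronglyMeasurable (ae_of_all _ fun t => ?_)
  have h1 : 0 < 1 + t ^ 2 := by positivity
  rw [← div_eq_mul_inv, le_div_iff₀ h1]
  rcases le_total ρ |t| with ht | ht
  · have ht2 : 1 ≤ t ^ 2 := by rw [← sq_abs]; nlinarith
    have h2 := h t ht
    rw [le_div_iff₀ (by linarith)] at h2
    have h3 : 0 ≤ ‖f t‖ * (t ^ 2 - 1) := mul_nonneg (norm_nonneg _) (by linarith)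
    have h4 : 0 ≤ B * (1 + ρ ^ 2) := by positivity
    linarith [le_abs_self C]
  · have h2 := hB t (abs_le.1 ht)
    have h3 : t ^ 2 ≤ ρ ^ 2 := by rw [← sq_abs]; exact pow_le_pow_left₀ (abs_nonneg _) ht 2
    have h4 : ‖f t‖ * (1 + t ^ 2) ≤ B * (1 + ρ ^ 2) :=
      mul_le_mul h2 (by linarith) h1.le hB0
    linarith [abs_nonneg C]

lemma continuous_comp_ofReal {F : ℂ → ℂ} (hF : ContinuousOn F {z | 0 ≤ z.im}) :
    Continuous fun t : ℝ => F t :=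
  hF.comp_continuous Complex.continuous_ofReal fun t => by simp

/-- The integral over the real line of a function that is holomorphic in the upper half plane,
continuous up to the boundary, and decays quadratically vanishes. -/
lemma integral_eq_zero_of_decay {F : ℂ → ℂ} {p : ℂ} (hF : ContinuousOn F {z | 0 ≤ z.im})
    (hd : ∀ z : ℂ, 0 < z.im → z ≠ p → DifferentiableAt ℂ F z) {ρ C : ℝ} (hρ : 1 ≤ ρ)
    (hC : ∀ z : ℂ, 0 ≤ z.im → ρ ≤ ‖z‖ → ‖F z‖ ≤ C / ‖z‖ ^ 2) :
    (Integrable fun t : ℝ => F t) ∧ ∫ t : ℝ, F t = 0 := by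
  have hcont := continuous_comp_ofReal hF
  have hint : Integrable fun t : ℝ => F t := integrable_of_norm_le_div_sq (C := C) hcont hρ
    fun t ht => by
      have := hC t (by simp) (by rwa [Complex.norm_real])
      rwa [Complex.norm_real, Real.norm_eq_abs, sq_abs] at this
  have hC0 : 0 ≤ C := by
    have h1 := (norm_nonneg _).trans (hC (ρ : ℂ) (by simp) (by
      rw [Complex.norm_real]; exact Real.le_norm_self ρ))
    rw [Complex.norm_real, Real.norm_eq_abs, sq_abs] at h1
    have h2 : 0 < ρ ^ 2 := by positivity
    by_contra hneg
    exact absurd (div_neg_of_neg_of_pos (not_le.1 hneg) h2) (not_lt.2 h1)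
  refine ⟨hint, ?_⟩
  have hlim := intervalIntegral_tendsto_integral hint tendsto_neg_atTop_atBot tendsto_id
  have hzero : Tendsto (fun T : ℝ => 4 * C / T) atTop (𝓝 0) :=
    tendsto_const_nhds.div_atTop tendsto_id
  refine tendsto_nhds_unique hlim (squeeze_zero_norm' ?_ hzero)
  -- Cauchy theorem on the rectangle with vertices `±T` and `±T + i T`; the three sides off the real
  -- axis contribute `O(1 / T)`
  filter_upwards [eventually_ge_atTop ρ] with T hT
  have hT0 : 0 < T := by linarith
  have hrect := Complex.integral_boundary_rect_eq_zero_of_differentiable_on_off_countable F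
    (-T : ℂ) (T + T * Complex.I) {p} (countable_singleton p) ?_ ?_
  · have e1 : (-T : ℂ).re = -T := by simp
    have e2 : (-T : ℂ).im = 0 := by simp
    have e3 : (T + T * Complex.I : ℂ).re = T := by simp
    have e4 : (T + T * Complex.I : ℂ).im = T := by simp
    rw [e1, e2, e3, e4] at hrect
    have hbd : ∀ z : ℂ, 0 ≤ z.im → T ≤ ‖z‖ → ‖F z‖ ≤ C / T ^ 2 := fun z hz hzT =>
      (hC z hz (hT.trans hzT)).trans (div_le_div_of_nonneg_left hC0 (by positivity)
        (pow_le_pow_left₀ hT0.le hzT 2))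
    have htop : ‖∫ x : ℝ in (-T)..T, F (x + T * Complex.I)‖ ≤ C / T ^ 2 * |T - -T| :=
      intervalIntegral.norm_integral_le_of_norm_le_const fun x _ => hbd _ (by simp [hT0.le]) (by
        have := Complex.abs_im_le_norm (x + T * Complex.I)
        simpa [abs_of_pos hT0] using this)
    have hside : ∀ r : ℝ, |r| = T → ‖∫ y : ℝ in (0 : ℝ)..T, F (r + y * Complex.I)‖
        ≤ C / T ^ 2 * |T - 0| := fun r hr =>
      intervalIntegral.norm_integral_le_of_norm_le_const fun y hy => by
        rw [uIoc_of_le hT0.le] at hy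
        refine hbd _ (by simp [hy.1.le]) ?_
        have := Complex.abs_re_le_norm (r + y * Complex.I)
        simpa [hr] using this
    have hr := hside T (abs_of_pos hT0)
    have hl := hside (-T) (by rw [abs_neg, abs_of_pos hT0])
    simp only [Complex.ofReal_neg, Complex.ofReal_zero, zero_mul, add_zero, smul_eq_mul]
      at hrect hl ⊢
    have heq : ∫ x : ℝ in (-T)..T, F x = (∫ x : ℝ in (-T)..T, F (x + T * Complex.I))
        - Complex.I * (∫ y : ℝ in (0 : ℝ)..T, F (T + y * Complex.I))
        + Complex.I * ∫ y : ℝ in (0 : ℝ)..T, F (-T + y * Complex.I) := by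
      linear_combination hrect
    simp only [id]
    rw [heq]
    refine (norm_add_le _ _).trans ((add_le_add (norm_sub_le _ _) le_rfl).trans ?_)
    rw [norm_mul, norm_mul, Complex.norm_I, one_mul, one_mul]
    rw [abs_of_pos (by linarith)] at htop hr hl
    have e5 : C / T ^ 2 * (T - -T) + C / T ^ 2 * (T - 0) + C / T ^ 2 * (T - 0) = 4 * C / T := by
      field_simp; ring
    linarith
  · refine hF.mono fun z hz => ?_
    have h2 := hz.2
    simp only [mem_preimage, Complex.neg_im, Complex.ofReal_im, Complex.add_im, Complex.mul_im,
      Complex.I_im, Complex.I_re, Complex.ofReal_re] at h2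
    rw [uIcc_of_le (by linarith)] at h2
    have := h2.1
    simpa using this
  · rintro z ⟨hz, hzp⟩
    refine hd z ?_ hzp
    have h2 := hz.2
    simp only [mem_preimage, Complex.neg_im, Complex.ofReal_im, Complex.add_im, Complex.mul_im,
      Complex.I_im, Complex.I_re, Complex.ofReal_re] at h2
    have := h2.1
    rw [min_eq_left (by linarith)] at this
    simpa using this

/-- The total mass of the Poisson kernel. -/
lemma integral_one_div_sub_mul {z : ℂ} (hz : 0 < z.im) :
    ∫ t : ℝ, 1 / (((t : ℂ) - z) * (t - (starRingEnd ℂ) z)) = (Real.pi / z.im : ℝ) := by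
  have h1 := ProbabilityTheory.integral_cauchyPDFReal_eq_one z.re
    (γ := z.im.toNNReal) (Real.toNNReal_pos.2 hz).ne'
  have h2 : ∀ t : ℝ, 1 / (((t : ℂ) - z) * (t - (starRingEnd ℂ) z))
      = ((Real.pi / z.im * ProbabilityTheory.cauchyPDFReal z.re z.im.toNNReal t : ℝ) : ℂ) :=
    fun t => by
      have e1 : ((t : ℂ) - z) * (t - (starRingEnd ℂ) z) = (((t - z.re) ^ 2 + z.im ^ 2 : ℝ) : ℂ) := by
        apply Complex.ext <;> simp only [Complex.ofReal_re, Complex.ofReal_im, Complex.mul_re,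
          Complex.mul_im, Complex.sub_re, Complex.sub_im, Complex.conj_re, Complex.conj_im] <;> ring
      rw [e1, ProbabilityTheory.cauchyPDFReal_def, ← Complex.ofReal_one, ← Complex.ofReal_div]
      congr 1
      have := Real.pi_pos
      have e2 : (z.im.toNNReal : ℝ) = z.im := Real.coe_toNNReal _ hz.le
      rw [e2]
      field_simp
  simp only [h2]
  rw [integral_complex_ofReal, integral_const_mul, h1, mul_one]

lemma half_norm_le_norm_sub {z p : ℂ} (h : 2 * ‖p‖ ≤ ‖z‖) : ‖z‖ / 2 ≤ ‖z - p‖ := by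
  have := norm_sub_norm_le z p
  linarith

/-- A function that is holomorphic in the upper half plane, continuous up to the boundary, and
decays at infinity is the Stieltjes transform of the boundary values of its imaginary part. -/
lemma integral_im_div_sub {g : ℂ → ℂ} (hg : ContinuousOn g {z | 0 ≤ z.im})
    (hd : ∀ z : ℂ, 0 < z.im → DifferentiableAt ℂ g z) {ρ C : ℝ} (hρ : 1 ≤ ρ)
    (hC : ∀ z : ℂ, 0 ≤ z.im → ρ ≤ ‖z‖ → ‖g z‖ ≤ C / ‖z‖) {z : ℂ} (hz : 0 < z.im) :
    ∫ t : ℝ, ((g t).im : ℂ) / (t - z) = Real.pi * g z := by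
  set zb := (starRingEnd ℂ) z with hzb
  have hnzb : ‖zb‖ = ‖z‖ := Complex.norm_conj z
  have hne : ∀ ζ : ℂ, 0 ≤ ζ.im → ζ - zb ≠ 0 := fun ζ hζ h => by
    have := congrArg Complex.im h
    simp [hzb] at this
    linarith
  have hneR : ∀ t : ℝ, (t : ℂ) - z ≠ 0 := fun t h => by
    have := congrArg Complex.im h
    simp at this
    exact hz.ne' this
  have hneR' : ∀ t : ℝ, (t : ℂ) - zb ≠ 0 := fun t => hne t (by simp)
  have hcont1 : ContinuousOn (fun ζ => ζ - zb) {ζ : ℂ | 0 ≤ ζ.im} := by fun_prop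
  set ρ' := max ρ (2 * ‖z‖) with hρ'
  have hρ'1 : 1 ≤ ρ' := hρ.trans (le_max_left _ _)
  -- the integral of `g / (t - zb)` vanishes
  obtain ⟨hi2, h2⟩ := integral_eq_zero_of_decay (F := fun ζ => g ζ / (ζ - zb)) (p := 0)
    (hg.div hcont1 fun ζ hζ => hne ζ hζ)
    (fun ζ hζ _ => (hd ζ hζ).div (by fun_prop) (hne ζ hζ.le)) (C := 2 * C) hρ'1
    (fun ζ hζ hζρ => by
      have h1 := hC ζ hζ ((le_max_left _ _).trans hζρ)
      have h2 := half_norm_le_norm_sub (z := ζ) (p := zb) (by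
        rw [hnzb]; exact (le_max_right _ _).trans hζρ)
      have h0 : 0 < ‖ζ‖ := by linarith
      rw [norm_div, show 2 * C / ‖ζ‖ ^ 2 = (C / ‖ζ‖) / (‖ζ‖ / 2) by field_simp]
      exact div_le_div₀ ((norm_nonneg _).trans h1) h1 (by positivity) h2)
  -- the Cauchy integral of `g`, regularized at `z` and at infinity
  set D := g z * (z - zb) with hD
  set G : ℂ → ℂ := fun ζ => g ζ - D / (ζ - zb) with hG
  have hGz : G z = 0 := by
    simp only [hG, hD]
    rw [mul_div_cancel_right₀ _ (hne z hz.le), sub_self]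
  have hGd : ∀ ζ : ℂ, 0 < ζ.im → DifferentiableAt ℂ G ζ := fun ζ hζ =>
    (hd ζ hζ).sub ((differentiableAt_const _).div (by fun_prop) (hne ζ hζ.le))
  have hnhds : {ζ : ℂ | 0 ≤ ζ.im} ∈ 𝓝 z :=
    mem_of_superset ((isOpen_lt continuous_const Complex.continuous_im).mem_nhds hz)
      fun ζ (hζ : 0 < ζ.im) => hζ.le
  obtain ⟨hi1, h1⟩ := integral_eq_zero_of_decay (F := dslope G z) (p := z)
    ((continuousOn_dslope hnhds).2 ⟨hg.sub (continuousOn_const.div hcont1 fun ζ hζ => hne ζ hζ),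
      hGd z hz⟩)
    (fun ζ hζ hζz => (differentiableAt_dslope_of_ne hζz).2 (hGd ζ hζ))
    (C := 2 * (C + 2 * ‖D‖)) hρ'1
    (fun ζ hζ hζρ => by
      have h1 := hC ζ hζ ((le_max_left _ _).trans hζρ)
      have h2 := half_norm_le_norm_sub (z := ζ) (p := zb) (by
        rw [hnzb]; exact (le_max_right _ _).trans hζρ)
      have h3 := half_norm_le_norm_sub (z := ζ) (p := z) ((le_max_right _ _).trans hζρ)
      have h0 : 0 < ‖ζ‖ := by linarith
      have hζz : ζ ≠ z := fun h => by rw [h, sub_self, norm_zero] at h3; rw [h] at h0; linarith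
      have h4 : ‖D / (ζ - zb)‖ ≤ 2 * ‖D‖ / ‖ζ‖ := by
        rw [norm_div, show 2 * ‖D‖ / ‖ζ‖ = ‖D‖ / (‖ζ‖ / 2) by field_simp]
        exact div_le_div_of_nonneg_left (norm_nonneg _) (by positivity) h2
      have h5 : ‖G ζ‖ ≤ (C + 2 * ‖D‖) / ‖ζ‖ := by
        rw [add_div]
        exact (norm_sub_le _ _).trans (add_le_add h1 h4)
      rw [dslope_of_ne _ hζz, slope_def_field, hGz, sub_zero, norm_div,
        show 2 * (C + 2 * ‖D‖) / ‖ζ‖ ^ 2 = ((C + 2 * ‖D‖) / ‖ζ‖) / (‖ζ‖ / 2) by field_simp]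
      exact div_le_div₀ ((norm_nonneg _).trans h5) h5 (by positivity) h3)
  have hcontR := continuous_comp_ofReal hg
  -- `g / (t - z)` is the sum of the regularized integrand and a multiple of the Poisson kernel
  have hdec : ∀ t : ℝ, g t / (t - z) = dslope G z t + D * (1 / (((t : ℂ) - z) * (t - zb))) :=
    fun t => by
      have htz : (t : ℂ) ≠ z := fun h => hneR t (by rw [h, sub_self])
      rw [dslope_of_ne _ htz, slope_def_field, hGz, sub_zero]
      have e1 := hneR t
      have e2 := hneR' t
      simp only [hG]
      field_simp
      ring
  have hPint : Integrable fun t : ℝ => 1 / (((t : ℂ) - z) * (t - zb)) := by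
    by_contra hcon
    have := integral_one_div_sub_mul hz
    rw [integral_undef hcon] at this
    exact (div_pos Real.pi_pos hz).ne (by exact_mod_cast this)
  have hzz : z - zb = 2 * z.im * Complex.I := by
    apply Complex.ext <;> simp [hzb]; ring
  have hCauchy : ∫ t : ℝ, g t / (t - z) = 2 * Real.pi * Complex.I * g z := by
    simp only [hdec]
    rw [integral_add hi1 (hPint.const_mul D), h1, integral_const_mul, integral_one_div_sub_mul hz,
      hD, hzz]
    have : (z.im : ℂ) ≠ 0 := by exact_mod_cast hz.ne'
    push_cast
    field_simp
    ring
  have hCint : Integrable fun t : ℝ => g t / (t - z) := by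
    simp only [hdec]
    exact hi1.add (hPint.const_mul D)
  have hconj : ∀ t : ℝ, (starRingEnd ℂ) (g t / (t - zb)) = (starRingEnd ℂ) (g t) / (t - z) :=
    fun t => by simp [hzb]
  have h3 : ∫ t : ℝ, (starRingEnd ℂ) (g t) / (t - z) = 0 := by
    simp only [← hconj]
    rw [integral_conj, h2, map_zero]
  have hi3 : Integrable fun t : ℝ => (starRingEnd ℂ) (g t) / (t - z) := by
    simp only [← hconj]
    exact (Complex.conjCLE.toContinuousLinearMap.integrable_comp hi2)
  have him : ∀ t : ℝ, ((g t).im : ℂ) / (t - z)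
      = 1 / (2 * Complex.I) * (g t / (t - z) - (starRingEnd ℂ) (g t) / (t - z)) := fun t => by
    have h5 : (2 * Complex.I : ℂ) ≠ 0 := by simp
    rw [← sub_div, Complex.sub_conj]
    push_cast
    field_simp
  simp only [him]
  rw [integral_const_mul, integral_sub hCint hi3, hCauchy, h3, sub_zero]
  field_simp

end HalfPlane

/-! ### The generating density -/

section Density

/-- The boundary values of `Im g / π` form a probability density with Stieltjes transform `g`; the
normalization is read off from `z g(z) → -1` along the imaginary axis. -/
lemma isProbabilityMeasure_of_tendsto {g : ℂ → ℂ} (hg : ContinuousOn g {z | 0 ≤ z.im})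
    (hd : ∀ z : ℂ, 0 < z.im → DifferentiableAt ℂ g z) {ρ C C' : ℝ} (hρ : 1 ≤ ρ)
    (hC : ∀ z : ℂ, 0 ≤ z.im → ρ ≤ ‖z‖ → ‖g z‖ ≤ C / ‖z‖) (him : ∀ t : ℝ, 0 ≤ (g t).im)
    (hC' : ∀ t : ℝ, ρ ≤ |t| → (g t).im ≤ C' / t ^ 2)
    (hlim : Tendsto (fun n : ℕ => ((n : ℂ) + 1) * Complex.I * g (((n : ℂ) + 1) * Complex.I)) atTop
      (𝓝 (-1))) :
    IsProbabilityMeasure (volume.withDensity fun t : ℝ => ENNReal.ofReal ((g t).im / Real.pi)) ∧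
      ∀ z : ℂ, 0 < z.im → g z = ∫ t : ℝ, 1 / ((t : ℂ) - z)
        ∂(volume.withDensity fun t : ℝ => ENNReal.ofReal ((g t).im / Real.pi)) := by
  have hpi := Real.pi_pos
  have hcont : Continuous fun t : ℝ => (g t).im :=
    Complex.continuous_im.comp (continuous_comp_ofReal hg)
  have hint : Integrable fun t : ℝ => (g t).im :=
    integrable_of_norm_le_div_sq (C := C') hcont hρ fun t ht => by
      rw [Real.norm_of_nonneg (him t)]; exact hC' t ht
  have hpoisson := fun {z : ℂ} (hz : 0 < z.im) => integral_im_div_sub hg hd hρ hC hz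
  -- `z ∫ Im g / (t - z) = π z g(z)` for `z = i (n + 1)`, with limits `-∫ Im g` and `-π`
  have htot : ∫ t : ℝ, (g t).im = Real.pi := by
    have h1 : ∀ n : ℕ, ∫ t : ℝ, ((g t).im : ℂ)
        * (((n : ℂ) + 1) * Complex.I / (t - ((n : ℂ) + 1) * Complex.I))
        = Real.pi * (((n : ℂ) + 1) * Complex.I * g (((n : ℂ) + 1) * Complex.I)) := fun n => by
      have h2 := hpoisson (z := ((n : ℂ) + 1) * Complex.I) (by simp; positivity)
      rw [mul_left_comm, ← h2, ← integral_const_mul]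
      congr 1; ext t; ring
    have h3 : Tendsto (fun n : ℕ => ∫ t : ℝ, ((g t).im : ℂ)
        * (((n : ℂ) + 1) * Complex.I / (t - ((n : ℂ) + 1) * Complex.I))) atTop
        (𝓝 (∫ t : ℝ, ((g t).im : ℂ) * (-1))) := by
      refine tendsto_integral_of_dominated_convergence (fun t => (g t).im) (fun n => ?_) hint
        (fun n => ae_of_all _ fun t => ?_) (ae_of_all _ fun t => ?_)
      · refine ((Complex.continuous_ofReal.comp hcont).mul (continuous_const.div₀ (by fun_prop)
          fun t h => ?_)).aestronglyMeasurable
        have := congrArg Complex.im h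
        simp at this
        have h0 : (0 : ℝ) < (n : ℝ) + 1 := by positivity
        linarith
      · rw [norm_mul, Complex.norm_real, Real.norm_of_nonneg (him t)]
        refine mul_le_of_le_one_right (him t) ?_
        rw [norm_div]
        refine div_le_one_of_le₀ ?_ (norm_nonneg _)
        have h4 := Complex.abs_im_le_norm (t - ((n : ℂ) + 1) * Complex.I)
        rw [norm_mul, Complex.norm_I, mul_one, ← Nat.cast_succ, Complex.norm_natCast]
        rw [← Nat.cast_succ] at h4
        simp only [Complex.sub_im, Complex.ofReal_im, Complex.mul_im, Complex.natCast_re,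
          Complex.I_im, mul_one, Complex.natCast_im, Complex.I_re, mul_zero, add_zero, zero_sub,
          abs_neg, Nat.abs_cast] at h4
        exact h4
      · refine tendsto_const_nhds.mul ?_
        have h5 : Tendsto (fun n : ℕ => (t : ℂ) * ((1 / ((n : ℝ) + 1) : ℝ) : ℂ) / Complex.I - 1)
            atTop (𝓝 ((t : ℂ) * ((0 : ℝ) : ℂ) / Complex.I - 1)) :=
          (((((Complex.continuous_ofReal.tendsto 0).comp
            tendsto_one_div_add_atTop_nhds_zero_nat).const_mul _).div_const _).sub_const _)
        have h6 := h5.inv₀ (by simp)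
        simp only [Complex.ofReal_zero, mul_zero, zero_div, zero_sub, inv_neg, inv_one] at h6
        refine h6.congr fun n => ?_
        have h7 : ((n : ℂ) + 1) ≠ 0 := by exact_mod_cast Nat.succ_ne_zero n
        have h8 := Complex.I_ne_zero
        rw [← inv_inv (((n : ℂ) + 1) * Complex.I / (t - ((n : ℂ) + 1) * Complex.I)), inv_div,
          sub_div, div_self (mul_ne_zero h7 h8)]
        push_cast
        field_simp
    simp only [h1] at h3
    have h9 := tendsto_nhds_unique h3 (hlim.const_mul (Real.pi : ℂ))
    rw [integral_mul_const, integral_complex_ofReal] at h9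
    have h10 : ((∫ t : ℝ, (g t).im : ℝ) : ℂ) = Real.pi := by linear_combination -h9
    exact_mod_cast h10
  refine ⟨⟨?_⟩, fun z hz => ?_⟩
  · rw [withDensity_apply _ MeasurableSet.univ, Measure.restrict_univ,
      ← ofReal_integral_eq_lintegral_ofReal (hint.div_const _)
        (ae_of_all _ fun t => div_nonneg (him t) hpi.le), integral_div, htot, div_self hpi.ne',
      ENNReal.ofReal_one]
  · rw [integral_withDensity_eq_integral_toReal_smul (hcont.div_const _).measurable.ennreal_ofReal
      (ae_of_all _ fun t => ENNReal.ofReal_lt_top)]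
    have h1 : ∀ t : ℝ, (ENNReal.ofReal ((g t).im / Real.pi)).toReal • (1 / ((t : ℂ) - z))
        = 1 / Real.pi * (((g t).im : ℂ) / (t - z)) := fun t => by
      rw [ENNReal.toReal_ofReal (div_nonneg (him t) hpi.le), Complex.real_smul]
      push_cast
      ring
    simp only [h1]
    rw [integral_const_mul, hpoisson hz]
    have : (Real.pi : ℂ) ≠ 0 := by exact_mod_cast hpi.ne'
    field_simp

/-- Stieltjes inversion for a continuous density whose Stieltjes transform extends continuously to
the real line. -/
lemma im_eq_pi_mul_density {g : ℂ → ℂ} (hg : ContinuousOn g {z | 0 ≤ z.im}) {v : ℝ → ℝ}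
    (hv : Continuous v) (hv0 : ∀ t, 0 ≤ v t)
    (hprob : IsProbabilityMeasure (volume.withDensity fun t => ENNReal.ofReal (v t)))
    (h : ∀ z : ℂ, 0 < z.im → g z = ∫ t : ℝ, 1 / ((t : ℂ) - z)
      ∂(volume.withDensity fun t => ENNReal.ofReal (v t))) (τ : ℝ) :
    (g τ).im = Real.pi * v τ := by
  have hpi := Real.pi_pos
  have hvint : Integrable v := by
    refine ⟨hv.aestronglyMeasurable, ?_⟩
    rw [hasFiniteIntegral_iff_ofReal (ae_of_all _ hv0)]
    have := hprob.measure_univ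
    rw [withDensity_apply _ MeasurableSet.univ, Measure.restrict_univ] at this
    rw [this]; exact ENNReal.one_lt_top
  -- the imaginary part is the Poisson integral of the density
  have h1 : ∀ z : ℂ, 0 < z.im → (g z).im = ∫ t : ℝ, z.im / ((t - z.re) ^ 2 + z.im ^ 2) * v t := by
    intro z hz
    have hint : Integrable fun t : ℝ => (v t : ℂ) * (1 / ((t : ℂ) - z)) := by
      refine (hvint.ofReal (𝕜 := ℂ)).mul_bdd (c := 1 / z.im) (by
        refine (continuous_const.div₀ (by fun_prop) fun t h => ?_).aestronglyMeasurable
        have := congrArg Complex.im h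
        simp at this
        exact hz.ne' this) (ae_of_all _ fun t => ?_)
      rw [norm_div, norm_one]
      refine one_div_le_one_div_of_le hz ?_
      have := Complex.abs_im_le_norm (t - z)
      simpa [abs_of_pos hz] using this
    have h2 : g z = ∫ t : ℝ, (v t : ℂ) * (1 / ((t : ℂ) - z)) := by
      rw [h z hz, integral_withDensity_eq_integral_toReal_smul (by fun_prop)
        (ae_of_all _ fun t => ENNReal.ofReal_lt_top)]
      congr 1; ext t
      rw [ENNReal.toReal_ofReal (hv0 t), Complex.real_smul]
    rw [h2, ← RCLike.im_to_complex, ← integral_im hint]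
    congr 1; ext t
    rw [RCLike.im_to_complex, Complex.im_ofReal_mul, one_div, Complex.inv_im, Complex.normSq_apply]
    simp only [Complex.sub_im, Complex.ofReal_im, Complex.sub_re, Complex.ofReal_re]
    ring
  -- the Poisson kernel is an approximate identity
  have hpeak := tendsto_integral_comp_smul_smul_of_integrable' (μ := (volume : Measure ℝ))
    (φ := fun x : ℝ => (1 + x ^ 2)⁻¹ / Real.pi) (fun x => by positivity)
    (by rw [integral_div, integral_univ_inv_one_add_sq, div_self hpi.ne'])
    (by
      simp only [Module.finrank_self, pow_one]
      have hinv : Tendsto (fun x : ℝ => ‖x‖⁻¹) (Bornology.cobounded ℝ) (𝓝 0) :=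
        tendsto_norm_cobounded_atTop.inv_tendsto_atTop
      refine squeeze_zero' (Eventually.of_forall fun x => by positivity) ?_ hinv
      filter_upwards [(tendsto_norm_cobounded_atTop (E := ℝ)).eventually_gt_atTop 0] with x hx
      have h2 : ‖x‖ * ‖x‖ = x ^ 2 := by rw [← sq, Real.norm_eq_abs, sq_abs]
      rw [inv_eq_one_div ‖x‖, le_div_iff₀ hx, show ‖x‖ * ((1 + x ^ 2)⁻¹ / Real.pi) * ‖x‖
        = (‖x‖ * ‖x‖) / ((1 + x ^ 2) * Real.pi) by field_simp, h2, div_le_one (by positivity)]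
      nlinarith [Real.pi_gt_three, sq_nonneg x]) hvint hv.continuousAt (x₀ := τ)
  have hseq := hpeak.comp (tendsto_natCast_atTop_atTop.comp (tendsto_add_atTop_nat 1))
  have hleft : Tendsto (fun n : ℕ => (g (τ + ((1 / ((n : ℝ) + 1) : ℝ) : ℂ) * Complex.I)).im) atTop
      (𝓝 (g τ).im) := (Complex.continuous_im.tendsto _).comp (((hg τ (by simp)).tendsto).comp
        (tendsto_nhdsWithin_iff.2 ⟨tendsto_add_I_div τ, Eventually.of_forall fun n =>
          (im_add_I_div_pos (by simp) n).le⟩))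
  refine tendsto_nhds_unique hleft ((hseq.const_mul Real.pi).congr fun n => ?_)
  rw [h1 _ (im_add_I_div_pos (by simp) n), im_add_I_div]
  simp only [Function.comp, ← integral_const_mul]
  congr 1; ext t
  have hn : (0 : ℝ) < (n : ℝ) + 1 := by positivity
  have e1 : (τ + ((1 / ((n : ℝ) + 1) : ℝ) : ℂ) * Complex.I : ℂ).re = τ := by
    rw [Complex.add_re, Complex.mul_I_re, Complex.ofReal_re, Complex.ofReal_im, neg_zero, add_zero]
  rw [e1]
  simp only [Module.finrank_self, pow_one, smul_eq_mul, Complex.ofReal_im, zero_add, Nat.cast_add,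
    Nat.cast_one]
  field_simp
  ring

variable {X : Type*} [MeasurableSpace X] {π : Measure X} [IsProbabilityMeasure π]
  {a : X → ℝ} {s : X → X → ℝ} {m : ℂ → X → ℂ} {z : ℂ} {w : X → ℂ}

omit [IsProbabilityMeasure π] in
lemma SolvesAt.mul_eq (h : SolvesAt π a s z w) (x : X) :
    w x * (z + a x + intOp π s w x) = -1 := by
  rw [← h.eq x, mul_div_cancel₀ _ (h.ne_zero x)]

/-- The equation as an expansion at infinity: `z m(z) → -1`. -/
lemma SolvesAt.norm_mul_add_one_le (h : SolvesAt π a s z w) (hs : IsSymmKernel s) {A M Φ : ℝ}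
    (hA : ∀ x, |a x| ≤ A) (hM : ∀ x y, s x y ≤ M) (hΦ : ∀ x, ‖w x‖ ≤ Φ) (x : X) :
    ‖z * w x + 1‖ ≤ ‖w x‖ * (A + M * Φ) := by
  have hM0 : 0 ≤ M := (hs.nonneg x x).trans (hM x x)
  have h1 : z * w x + 1 = -(w x * (a x + intOp π s w x)) := by linear_combination h.mul_eq x
  rw [h1, norm_neg, norm_mul]
  refine mul_le_mul_of_nonneg_left ((norm_add_le _ _).trans (add_le_add ?_ ?_)) (norm_nonneg _)
  · rw [Complex.norm_real]; exact hA x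
  · exact (norm_intOp_le_n2 hs hM h.bddMeas x).trans
      (mul_le_mul_of_nonneg_left (n2_le_of_bound h.bddMeas hΦ) hM0)

lemma SolvesAt.norm_le_div (h : SolvesAt π a s z w) (hs : IsSymmKernel s) {A M Φ : ℝ}
    (hA : ∀ x, |a x| ≤ A) (hM : ∀ x y, s x y ≤ M) (hΦ : ∀ x, ‖w x‖ ≤ Φ)
    (hz : 2 * (A + M * Φ) + 1 ≤ ‖z‖) (x : X) : ‖w x‖ ≤ 2 / ‖z‖ := by
  have h1 := h.norm_mul_add_one_le hs hA hM hΦ x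
  have h2 := norm_sub_le (z * w x + 1) 1
  rw [add_sub_cancel_right, norm_mul, norm_one] at h2
  have hA0 : 0 ≤ A := (abs_nonneg _).trans (hA x)
  have hMΦ : 0 ≤ M * Φ := mul_nonneg ((hs.nonneg x x).trans (hM x x))
    ((norm_nonneg _).trans (hΦ x))
  have hz0 : 0 < ‖z‖ := by linarith
  rw [le_div_iff₀ hz0]
  nlinarith [norm_nonneg (w x)]

/-- Existence of the generating density `Im m / π`. -/
lemma IsExtendedSolution.isGeneratingDensity (h : IsExtendedSolution π a s m) (ha : BddMeas a)
    (hs : IsSymmKernel s) (hA : DiagonalPositivity π s) (hB : UniformPrimitivity π s)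
    (hC : ComponentRegularity π a s) :
    IsGeneratingDensity m fun t x => (m t x).im / Real.pi := by
  obtain ⟨Φ, hΦ0, hΦ⟩ := exists_sup_bound ha hs hA hC
  obtain ⟨M, hM0, hM⟩ := hs.exists_bound
  obtain ⟨A, hA0, hAa⟩ := ha.le_const
  have hsol : ∀ z : ℂ, 0 ≤ z.im → SolvesAt π a s z (m z) ∧ ∀ x, ‖m z x‖ ≤ Φ :=
    fun z hz => h.solvesAt hs hΦ hz
  have hreal : ∀ t : ℝ, (0 : ℝ) ≤ (t : ℂ).im := fun t => by simp
  intro x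
  have him : ∀ t : ℝ, 0 ≤ (m t x).im := fun t => (hsol t (hreal t)).1.im_nonneg x
  have hdec : ∀ z : ℂ, 0 ≤ z.im → 2 * (A + M * Φ) + 1 ≤ ‖z‖ → ‖m z x‖ ≤ 2 / ‖z‖ :=
    fun z hz hzρ => (hsol z hz).1.norm_le_div hs hAa hM (hsol z hz).2 hzρ x
  have hρ : 1 ≤ 2 * (A + M * Φ) + 1 := by
    have : 0 < M * Φ := by positivity
    linarith
  have hcont : Continuous fun t : ℝ => (m t x).im :=
    Complex.continuous_im.comp (continuous_comp_ofReal (h.2 x))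
  refine ⟨hcont.div_const _, fun t => div_nonneg (him t) Real.pi_pos.le, ?_⟩
  refine isProbabilityMeasure_of_tendsto (g := fun z => m z x) (h.2 x) (fun z hz => ?_) hρ hdec him
    (C' := 4 * (M * Φ)) (fun t ht => ?_) ?_
  · obtain ⟨K, -, hK⟩ := exists_holder π ha hs hA hB hC (R := ‖z‖ + 1) (by positivity)
    exact (hK m h.1 x).1 z hz (by linarith)
  -- on the real line `Im m = |m|² S Im m` decays quadratically
  · have h1 := (hsol t (hreal t)).1.im_eq hs x
    have h2 := hdec t (hreal t) (by rwa [Complex.norm_real])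
    have hb := (hsol t (hreal t)).1.bddMeas
    rw [Complex.ofReal_im, zero_add] at h1
    have h3 : rOp π s (fun y => (m t y).im) x ≤ M * Φ :=
      rOp_le_const hs hM hM0.le (by fun_prop) (hsol t (hreal t)).1.im_nonneg
        (fun y => (Complex.im_le_norm _).trans ((hsol t (hreal t)).2 y)) x
    have h4 : 0 ≤ rOp π s (fun y => (m t y).im) x :=
      rOp_nonneg hs (hsol t (hreal t)).1.im_nonneg x
    rw [h1]
    calc ‖m t x‖ ^ 2 * rOp π s (fun y => (m t y).im) x ≤ (2 / ‖(t : ℂ)‖) ^ 2 * (M * Φ) :=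
          mul_le_mul (pow_le_pow_left₀ (norm_nonneg _) h2 2) h3 h4 (by positivity)
      _ = 4 * (M * Φ) / t ^ 2 := by
          rw [Complex.norm_real, Real.norm_eq_abs, div_pow, sq_abs]; ring
  · have hz0 : ∀ n : ℕ, 0 ≤ (((n : ℂ) + 1) * Complex.I).im := fun n => by
      simp; positivity
    have hzn : ∀ n : ℕ, ‖((n : ℂ) + 1) * Complex.I‖ = (n : ℝ) + 1 := fun n => by
      rw [norm_mul, Complex.norm_I, mul_one, ← Nat.cast_succ, Complex.norm_natCast, Nat.cast_succ]
    have hto : Tendsto (fun n : ℕ => (n : ℝ) + 1) atTop atTop :=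
      tendsto_atTop_add_const_right _ _ tendsto_natCast_atTop_atTop
    rw [tendsto_iff_norm_sub_tendsto_zero]
    have hlim : Tendsto (fun n : ℕ => 2 * (A + M * Φ) / ((n : ℝ) + 1)) atTop (𝓝 0) :=
      tendsto_const_nhds.div_atTop hto
    refine squeeze_zero' (Eventually.of_forall fun n => norm_nonneg _) ?_ hlim
    filter_upwards [hto.eventually_ge_atTop (2 * (A + M * Φ) + 1)] with n hn
    rw [sub_neg_eq_add]
    refine ((hsol _ (hz0 n)).1.norm_mul_add_one_le hs hAa hM (hsol _ (hz0 n)).2 x).trans ?_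
    have h2 := hdec _ (hz0 n) (by rw [hzn]; exact hn)
    rw [hzn] at h2
    calc _ ≤ 2 / ((n : ℝ) + 1) * (A + M * Φ) := mul_le_mul_of_nonneg_right h2 (by positivity)
      _ = _ := by ring

omit [IsProbabilityMeasure π] in
/-- Any generating density is given by the boundary values of `Im m`. -/
lemma IsGeneratingDensity.im_eq {v : ℝ → X → ℝ} (h : IsExtendedSolution π a s m)
    (hv : IsGeneratingDensity m v) (τ : ℝ) (x : X) : (m τ x).im = Real.pi * v τ x :=
  im_eq_pi_mul_density (h.2 x) (hv x).1 (hv x).2.1 (hv x).2.2.1 (hv x).2.2.2 τ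

end Density

/-! ### The positivity set and its boundary -/

section Support

variable {X : Type*} [MeasurableSpace X] {π : Measure X} [IsProbabilityMeasure π]
  {a : X → ℝ} {s : X → X → ℝ} {m : ℂ → X → ℂ} {z : ℂ} {w : X → ℂ} {R K q : ℝ}

lemma abs_le_supNorm (ha : BddMeas a) (x : X) : |a x| ≤ supNorm a := by
  obtain ⟨C, hC⟩ := ha.2
  exact le_ciSup (f := fun x => ‖a x‖) ⟨C, by rintro _ ⟨x, rfl⟩; exact hC x⟩ x

omit [MeasurableSpace X] in
lemma supNorm_nonneg {E : Type*} [NormedAddCommGroup E] (w : X → E) : 0 ≤ supNorm w :=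
  Real.iSup_nonneg fun _ => norm_nonneg _

lemma supOpNorm_nonneg (T : (X → ℂ) → X → ℂ) : 0 ≤ supOpNorm T :=
  Real.sInf_nonneg fun _ hc => hc.1

lemma kappa_nonneg (π : Measure X) (a : X → ℝ) (s : X → X → ℝ) : 0 ≤ kappa π a s :=
  add_nonneg (supNorm_nonneg _) (mul_nonneg zero_le_two (Real.sqrt_nonneg _))

/-- The row sums of a non-negative kernel are bounded by the operator norm. -/
lemma rOp_one_le_supOpNorm (hs : IsSymmKernel s) (x : X) :
    rOp π s (fun _ => 1) x ≤ supOpNorm (intOp π s) := by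
  obtain ⟨M, hM0, hM⟩ := hs.exists_bound
  have hX : Nonempty X := ⟨x⟩
  have hbd : ∀ w : X → ℂ, BddMeas w → BddAbove (range fun x => ‖intOp π s w x‖) := fun w hw => by
    obtain ⟨C, hC⟩ := (hw.intOp (π := π) hs).2
    exact ⟨C, by rintro _ ⟨x, rfl⟩; exact hC x⟩
  refine le_csInf ⟨M, hM0.le, fun w hw => ciSup_le fun y => ?_⟩ fun c hc => ?_
  · obtain ⟨C, hC⟩ := hw.2
    have h1 : ∀ x, ‖w x‖ ≤ supNorm w := fun x =>
      le_ciSup (f := fun x => ‖w x‖) ⟨C, by rintro _ ⟨x, rfl⟩; exact hC x⟩ x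
    exact (norm_intOp_le_n2 hs hM hw y).trans
      (mul_le_mul_of_nonneg_left (n2_le_of_bound hw h1) hM0.le)
  · have h1 := hc.2 (fun _ => ((1 : ℝ) : ℂ)) (BddMeas.const _)
    have h2 : ‖intOp π s (fun _ => ((1 : ℝ) : ℂ)) x‖ ≤ supNorm (intOp π s fun _ => ((1 : ℝ) : ℂ)) :=
      le_ciSup (hbd _ (BddMeas.const _)) x
    rw [intOp_ofReal, Complex.norm_real, Real.norm_eq_abs] at h2
    have h3 : supNorm (fun _ : X => ((1 : ℝ) : ℂ)) = 1 := by simp [supNorm]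
    rw [h3, mul_one] at h1
    exact (le_abs_self _).trans (h2.trans h1)

/-- A real point at which the solution has positive imaginary part lies in `[-κ, κ]`. With
`v = sinArg w` and `b = |w|`, the equation gives `(|t| - ‖a‖) ⟨v b⟩ ≤ 2 ⟨v⟩` and
`⟨v / b⟩ ≤ ‖S‖ ⟨v b⟩`, and `⟨v⟩² ≤ ⟨v / b⟩ ⟨v b⟩`. -/
lemma SolvesAt.abs_le_kappa {t : ℝ} (h : SolvesAt π a s t w) (ha : BddMeas a)
    (hs : IsSymmKernel s) (hpos : 0 < ∫ x, sinArg w x ∂π) : |t| ≤ kappa π a s := by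
  have hv := h.bddMeas_sinArg ha hs
  have hb := h.bddMeas.norm
  have hib := h.bddMeas_inv_norm ha hs
  have hbw := h.bddMeas
  obtain ⟨c, hc0, hc⟩ := h.exists_le_norm ha hs
  have hv0 := h.sinArg_nonneg
  set σ := supOpNorm (intOp π s)
  set P := ∫ x, sinArg w x * ‖w x‖ ∂π with hP
  set J := ∫ x, sinArg w x ∂π with hJ
  have hP0 : 0 < P := by
    refine (mul_pos hc0 hpos).trans_le ?_
    rw [hP, ← integral_const_mul]
    refine integral_mono (BddMeas.integrable (by fun_prop)) (BddMeas.integrable (by fun_prop))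
      fun x => ?_
    show c * sinArg w x ≤ sinArg w x * ‖w x‖
    rw [mul_comm]
    exact mul_le_mul_of_nonneg_left (hc x) (hv0 x)
  have him : (fun x => (w x).im) = fun x => sinArg w x * ‖w x‖ := by
    ext x; rw [mul_comm, h.norm_mul_sinArg]
  have hdiv : ∀ x, sinArg w x * ‖w x‖⁻¹ = rOp π s (fun x => sinArg w x * ‖w x‖) x := fun x => by
    have h1 := h.im_div_eq hs x
    rw [Complex.ofReal_im, zero_add, him] at h1
    rw [← h1, ← h.norm_mul_sinArg x]
    have := h.norm_pos x
    field_simp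
  have hrb : BddMeas fun x => rOp π s (fun x => sinArg w x * ‖w x‖) x :=
    BddMeas.rOp hs (by fun_prop)
  have hrn := hb.rOp (π := π) hs
  -- `v / b = S (v b)` by the imaginary part of the equation; integrate it against the row sums of
  -- `S`
  have hQ : ∫ x, sinArg w x * ‖w x‖⁻¹ ∂π ≤ σ * P := by
    simp only [hdiv]
    have h1 := integral_mul_rOp (π := π) hs (u := fun _ => 1) (w := fun x => sinArg w x * ‖w x‖)
      (BddMeas.const _) (by fun_prop)
    simp only [one_mul] at h1
    have hr1 : BddMeas fun x => rOp π s (fun _ => 1) x := BddMeas.rOp hs (BddMeas.const _)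
    rw [h1, hP, ← integral_const_mul]
    refine integral_mono (BddMeas.integrable (by fun_prop)) (BddMeas.integrable (by fun_prop))
      fun x => ?_
    exact mul_le_mul_of_nonneg_right (rOp_one_le_supOpNorm hs x)
      (mul_nonneg (hv0 x) (norm_nonneg _))
  -- Cauchy–Schwarz for `v = √(v / b) √(v b)`
  have hcs : J ^ 2 ≤ (∫ x, sinArg w x * ‖w x‖⁻¹ ∂π) * P := by
    refine sq_integral_le_mul (BddMeas.integrable (by fun_prop)) (BddMeas.integrable (by fun_prop))
      (BddMeas.integrable (by fun_prop)) (fun x => mul_nonneg (hv0 x) (by positivity))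
      (fun x => mul_nonneg (hv0 x) (norm_nonneg _)) fun x => ?_
    have := (h.norm_pos x).ne'
    exact le_of_eq (by field_simp)
  -- multiply `|t| ≤ 1 / b + |a| + S b` by `v b`, where `⟨v b S b⟩ = ⟨b S (v b)⟩ = ⟨v⟩`
  have hreal : (|t| - supNorm a) * P ≤ 2 * J := by
    have hpt : ∀ x, (|t| - supNorm a) * (sinArg w x * ‖w x‖)
        ≤ sinArg w x + (sinArg w x * ‖w x‖) * rOp π s (fun y => ‖w y‖) x := fun x => by
      have h1 : ‖(t : ℂ)‖ ≤ ‖w x‖⁻¹ + |a x| + rOp π s (fun y => ‖w y‖) x := by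
        have h2 : (t : ℂ) = -1 / w x - a x - intOp π s w x := by rw [h.eq x]; ring
        rw [h2]
        refine (norm_sub_le _ _).trans (add_le_add ((norm_sub_le _ _).trans (add_le_add ?_ ?_))
          (norm_intOp_le hs _ _))
        · rw [norm_div, norm_neg, norm_one, one_div]
        · rw [Complex.norm_real, Real.norm_eq_abs]
      rw [Complex.norm_real, Real.norm_eq_abs] at h1
      have h3 := abs_le_supNorm ha x
      have h4 : |t| - supNorm a ≤ ‖w x‖⁻¹ + rOp π s (fun y => ‖w y‖) x := by linarith
      have h5 := mul_le_mul_of_nonneg_right h4 (mul_nonneg (hv0 x) (norm_nonneg (w x)))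
      refine h5.trans (le_of_eq ?_)
      have := (h.norm_pos x).ne'
      field_simp
    have h6 : ∫ x, (sinArg w x * ‖w x‖) * rOp π s (fun y => ‖w y‖) x ∂π = J := by
      rw [integral_mul_rOp hs (by fun_prop) hb]
      congr 1; ext x
      rw [← hdiv x, inv_mul_cancel_right₀ (h.norm_pos x).ne']
    rw [hP, ← integral_const_mul, two_mul]
    nth_rw 2 [← h6]
    rw [hJ, ← integral_add (BddMeas.integrable (by fun_prop)) (BddMeas.integrable (by fun_prop))]
    exact integral_mono (BddMeas.integrable (by fun_prop)) (BddMeas.integrable (by fun_prop)) hpt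
  have hσ0 : 0 ≤ σ := supOpNorm_nonneg _
  have hJ' : J ≤ √σ * P := by
    refine abs_le_of_sq_le_sq' ?_ (by positivity) |>.2
    rw [mul_pow, Real.sq_sqrt hσ0, sq P, ← mul_assoc]
    exact hcs.trans (mul_le_mul_of_nonneg_right hQ hP0.le)
  have : (|t| - supNorm a) * P ≤ (2 * √σ) * P := by linarith
  have := le_of_mul_le_mul_right this hP0
  simp only [kappa]
  linarith

omit [IsProbabilityMeasure π] in
/-- The components of `Im m` are comparable, so that they are positive simultaneously. -/
lemma IsRegular.im_pos_iff (h : IsRegular π a s m R K q) {τ : ℝ} (hτ : |τ| ≤ R) (x : X) :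
    0 < (m τ x).im ↔ 0 < ∫ y, sinArg (m τ) y ∂π := by
  have hK0 : 0 < K := lt_of_lt_of_le one_pos h.one_le
  have hτ0 : (0 : ℝ) ≤ (τ : ℂ).im := by simp
  have hτR : ‖(τ : ℂ)‖ ≤ R := by rwa [Complex.norm_real, Real.norm_eq_abs]
  have hw := (h.solvesAt τ hτ0).norm_pos x
  constructor
  · intro hp
    have h1 := h.sinArg_le τ hτ0 hτR x
    have h2 : 0 < sinArg (m τ) x := div_pos hp hw
    exact pos_of_mul_pos_right (h2.trans_le h1) hK0.le
  · intro hp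
    have h1 := h.le_sinArg τ hτ0 hτR x
    have h2 := pos_of_mul_pos_right (hp.trans_le h1) hK0.le
    rw [← (h.solvesAt τ hτ0).norm_mul_sinArg x]
    exact mul_pos hw h2

variable {v : ℝ → X → ℝ}

/-- The set on which the generating density is positive, in terms of any component of `m`. -/
lemma setOf_density_pos_eq (h : IsExtendedSolution π a s m) (ha : BddMeas a)
    (hs : IsSymmKernel s) (hA : DiagonalPositivity π s) (hB : UniformPrimitivity π s)
    (hC : ComponentRegularity π a s) (hv : IsGeneratingDensity m v) (x : X) :
    {t : ℝ | 0 < v t x} = posSet v := by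
  ext t
  obtain ⟨K, q, hreg⟩ := h.exists_isRegular ha hs hA hB hC (R := |t| + 1) (by positivity)
  have key : ∀ y, 0 < v t y ↔ 0 < ∫ y, sinArg (m t) y ∂π := fun y => by
    rw [← hreg.im_pos_iff (by linarith) y, hv.im_eq h, mul_pos_iff_of_pos_left Real.pi_pos]
  exact ⟨fun hx y => (key y).2 ((key x).1 hx), fun hx => hx x⟩

lemma posSet_subset (h : IsExtendedSolution π a s m) (ha : BddMeas a)
    (hs : IsSymmKernel s) (hA : DiagonalPositivity π s) (hB : UniformPrimitivity π s)
    (hC : ComponentRegularity π a s) (hv : IsGeneratingDensity m v) :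
    posSet v ⊆ Icc (-kappa π a s) (kappa π a s) := fun t ht => by
  obtain ⟨K, q, hreg⟩ := h.exists_isRegular ha hs hA hB hC (R := |t| + 1) (by positivity)
  obtain ⟨x⟩ : Nonempty X := nonempty_of_isProbabilityMeasure π
  refine abs_le.1 ((hreg.solvesAt t (by simp)).abs_le_kappa ha hs ?_)
  rw [← hreg.im_pos_iff (by linarith) x, hv.im_eq h]
  exact mul_pos Real.pi_pos (ht x)

lemma closure_posSet_subset (h : IsExtendedSolution π a s m) (ha : BddMeas a)
    (hs : IsSymmKernel s) (hA : DiagonalPositivity π s) (hB : UniformPrimitivity π s)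
    (hC : ComponentRegularity π a s) (hv : IsGeneratingDensity m v) :
    closure (posSet v) ⊆ Icc (-kappa π a s) (kappa π a s) :=
  closure_minimal (posSet_subset h ha hs hA hB hC hv) isClosed_Icc

/-- At the boundary of the positivity set the solution is real and the top eigenvalue of `F` is
one. -/
lemma frontier_posSet (h : IsExtendedSolution π a s m) (ha : BddMeas a)
    (hs : IsSymmKernel s) (hA : DiagonalPositivity π s) (hB : UniformPrimitivity π s)
    (hC : ComponentRegularity π a s) (hv : IsGeneratingDensity m v)
    (hreg : IsRegular π a s m R K q) (hR : kappa π a s ≤ R) {τ : ℝ}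
    (hτ : τ ∈ frontier (posSet v)) :
    |τ| ≤ kappa π a s ∧ (∀ x, (m τ x).im = 0) ∧ ∀ f, IsTopEigenfunction π s (m τ) f →
      l2OpNorm π (opF π s (m τ)) = 1 := by
  have hτκ : |τ| ≤ kappa π a s := abs_le.2 (closure_posSet_subset h ha hs hA hB hC hv hτ.1)
  have hset := setOf_density_pos_eq h ha hs hA hB hC hv
  refine ⟨hτκ, fun x => ?_, fun f hf => ?_⟩
  · have hopen : IsOpen (posSet v) := by
      rw [← hset x]
      exact isOpen_lt continuous_const (hv x).1
    have hnot : τ ∉ posSet v := by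
      have := hτ.2
      rwa [hopen.interior_eq] at this
    rw [← hset x] at hnot
    have h0 : v τ x = 0 := le_antisymm (not_lt.1 hnot) ((hv x).2.1 τ)
    rw [hv.im_eq h, h0, mul_zero]
  · refine hreg.l2OpNorm_eq_one ha hs (hτκ.trans hR) hf fun ε hε => ?_
    obtain ⟨τ', hτ', hd⟩ := Metric.mem_closure_iff.1 hτ.1 ε hε
    have hτ'R : |τ'| ≤ R := (abs_le.2 (posSet_subset h ha hs hA hB hC hv hτ')).trans hR
    obtain ⟨x⟩ : Nonempty X := nonempty_of_isProbabilityMeasure π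
    refine ⟨τ', hτ'R, ?_, ?_⟩
    · rw [Real.dist_eq, abs_sub_comm] at hd; exact hd.le
    · rw [← hreg.im_pos_iff hτ'R x, hv.im_eq h]
      exact mul_pos Real.pi_pos (hτ' x)

end Support

/-! ### The quadratic form `𝓓` and the coefficients `σ` and `ψ` -/

section QuadraticForm

variable {X : Type*} [MeasurableSpace X] {π : Measure X} [IsProbabilityMeasure π]
  {a : X → ℝ} {s : X → X → ℝ} {m : ℂ → X → ℂ} {μ : X → ℂ} {f : X → ℝ} {l q M δ R K : ℝ}

lemma norm_csign {ζ : ℂ} (h : ζ ≠ 0) : ‖csign ζ‖ = 1 := by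
  rw [csign, norm_div, Complex.norm_real, norm_norm, div_self (norm_ne_zero_iff.2 h)]

lemma csign_eq_ofReal {ζ : ℂ} (h : ζ.im = 0) : csign ζ = ((ζ.re / ‖ζ‖ : ℝ) : ℂ) := by
  rw [csign, Complex.ofReal_div]
  congr 1
  exact Complex.ext rfl (by simp [h])

lemma SolvesAt.bddMeas_csign {z : ℂ} {w : X → ℂ} (h : SolvesAt π a s z w) (ha : BddMeas a)
    (hs : IsSymmKernel s) : BddMeas fun x => csign (w x) := by
  have h1 := h.bddMeas_inv_norm ha hs
  have h2 := h.bddMeas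
  have h3 : (fun x => csign (w x)) = fun x => w x * ((‖w x‖⁻¹ : ℝ) : ℂ) := by
    funext x; rw [csign, Complex.ofReal_inv, div_eq_mul_inv]
  rw [h3]
  fun_prop

/-- The operator `1 - F` is invertible on the orthogonal complement of the top eigenfunction. -/
lemma IsGapped.existsUnique_isReducedInverse (h : IsGapped π (kerF s μ) f l q M δ) (hq0 : 0 ≤ q)
    (hq : q < 1) {w : X → ℂ} (hw : BddMeas w) (hfw : avg π (fun x => (f x : ℂ) * w x) = 0) :
    ∃! g, IsReducedInverse π s μ f w g := by
  obtain ⟨g, hg, hfg, hgw⟩ := h.exists_sub_eq hq0 hq hw hfw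
  refine ⟨g, ⟨hg, hfg, fun x => by rw [opF_eq]; exact hgw x⟩, ?_⟩
  rintro g' ⟨hg', hfg', hgw'⟩
  have hf := h.bddMeas
  have hd : ∫ x, (f x : ℂ) * (g' x - g x) ∂π = 0 := by
    simp only [mul_sub]
    rw [integral_sub (BddMeas.integrable (by fun_prop)) (BddMeas.integrable (by fun_prop)), hfg]
    rw [show ∫ x, (f x : ℂ) * g' x ∂π = 0 from hfg', sub_zero]
  funext x
  have h0 := (h.norm_le_of_sub_eq hq (g := fun x => g' x - g x) (w := fun _ => 0) (by fun_prop)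
    (BddMeas.const _) hd (fun x => by
      have h1 := hgw' x
      rw [opF_eq] at h1
      rw [intOp_sub h.symmKernel hg' hg]
      linear_combination h1 - hgw x) (B := 0) (fun x => by simp)).2 x
  rw [mul_zero] at h0
  exact sub_eq_zero.1 (norm_le_zero_iff.1 h0)

/-- The form `𝓓` in terms of `g = (1 - F)⁻¹ Q w`: it equals `‖g‖² - ‖F g‖²`. -/
lemma IsGapped.formD_eq (h : IsGapped π (kerF s μ) f l q M δ) (hq0 : 0 ≤ q) (hq : q < 1)
    {w : X → ℂ} (hw : BddMeas w) :
    ∃ g : X → ℂ, BddMeas g ∧ ∫ x, (f x : ℂ) * g x ∂π = 0 ∧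
      (∀ x, g x - intOp π (kerF s μ) g x = w x - (∫ y, (f y : ℂ) * w y ∂π) * f x) ∧
      formD π s μ f w = ∫ x, (starRingEnd ℂ) (w x) * (g x + intOp π (kerF s μ) g x) ∂π ∧
      formD π s μ f w
        = ((n2 π g ^ 2 - n2 π (fun x => intOp π (kerF s μ) g x) ^ 2 : ℝ) : ℂ) := by
  have hf := h.bddMeas
  have hk := h.symmKernel
  set θ := ∫ y, (f y : ℂ) * w y ∂π with hθ
  have hQ : projQ π f w = fun x => w x - θ * f x := rfl
  have hQb : BddMeas (projQ π f w) := by rw [hQ]; fun_prop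
  have hfQ : avg π (fun x => (f x : ℂ) * projQ π f w x) = 0 :=
    integral_mul_sub_proj hf h.normalized hw
  have hspec : IsReducedInverse π s μ f (projQ π f w) (reducedInverse π s μ f (projQ π f w)) :=
    Classical.epsilon_spec (h.existsUnique_isReducedInverse hq0 hq hQb hfQ).exists
  set g := reducedInverse π s μ f (projQ π f w) with hg
  obtain ⟨hgb, hfg, hgw⟩ := hspec
  rw [opF_eq] at hgw
  replace hfg : ∫ x, (f x : ℂ) * g x ∂π = 0 := hfg
  have hKg := hgb.intOp (π := π) hk
  have hfK : ∫ x, (f x : ℂ) * intOp π (kerF s μ) g x ∂π = 0 := by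
    rw [h.integral_mul_intOp_eigen hgb, hfg, mul_zero]
  have hfs : ∫ x, (f x : ℂ) * (g x + intOp π (kerF s μ) g x) ∂π = 0 := by
    simp only [mul_add]
    rw [integral_add (BddMeas.integrable (by fun_prop)) (BddMeas.integrable (by fun_prop)), hfg,
      hfK, add_zero]
  have h1 : formD π s μ f w
      = ∫ x, (starRingEnd ℂ) (w x) * (g x + intOp π (kerF s μ) g x) ∂π := by
    simp only [formD, ← hg, opF_eq, projQ, avg]
    simp only [hfs, zero_mul, sub_zero]
  refine ⟨g, hgb, hfg, hgw, h1, ?_⟩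
  have h2 : ∫ x, (starRingEnd ℂ) (g x) * intOp π (kerF s μ) g x ∂π
      = ∫ x, (starRingEnd ℂ) (intOp π (kerF s μ) g x) * g x ∂π := by
    rw [integral_mul_intOp hk hgb.conj hgb]
    simp only [intOp_conj]
  -- insert `w = g - F g + θ f`: the mixed terms cancel after integration since `F` is symmetric,
  -- and the last one is orthogonal to `f`
  have hpt : ∀ x, (starRingEnd ℂ) (w x) * (g x + intOp π (kerF s μ) g x)
      = ((‖g x‖ ^ 2 - ‖intOp π (kerF s μ) g x‖ ^ 2 : ℝ) : ℂ)
        + ((starRingEnd ℂ) (g x) * intOp π (kerF s μ) g x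
          - (starRingEnd ℂ) (intOp π (kerF s μ) g x) * g x)
        + (starRingEnd ℂ) θ * ((f x : ℂ) * (g x + intOp π (kerF s μ) g x)) := fun x => by
    have h3 : w x = g x - intOp π (kerF s μ) g x + θ * f x := by
      have := hgw x
      rw [hQ] at this
      linear_combination -this
    rw [h3]
    simp only [map_add, map_sub, map_mul, Complex.conj_ofReal]
    push_cast
    rw [← Complex.conj_mul', ← Complex.conj_mul']
    ring
  rw [h1]
  simp only [hpt]
  have hcg := hgb.conj
  have hcK := hKg.conj
  have hreal : BddMeas fun x => ‖g x‖ ^ 2 - ‖intOp π (kerF s μ) g x‖ ^ 2 := by fun_prop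
  rw [integral_add (BddMeas.integrable (by fun_prop)) (BddMeas.integrable (by fun_prop)),
    integral_add (BddMeas.integrable (by fun_prop)) (BddMeas.integrable (by fun_prop)),
    integral_const_mul, hfs, mul_zero, add_zero,
    integral_sub (BddMeas.integrable (by fun_prop)) (BddMeas.integrable (by fun_prop)), h2,
    sub_self, add_zero, integral_complex_ofReal,
    integral_sub (BddMeas.integrable (by fun_prop)) (BddMeas.integrable (by fun_prop)), n2_sq, n2_sq]

/-- Non-negativity of the form, since `‖F g‖ ≤ q ‖g‖` on the complement of `f`. -/
lemma IsGapped.formD_nonneg (h : IsGapped π (kerF s μ) f l q M δ) (hq0 : 0 ≤ q) (hq : q < 1)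
    {w : X → ℂ} (hw : BddMeas w) : 0 ≤ (formD π s μ f w).re ∧ (formD π s μ f w).im = 0 := by
  obtain ⟨g, hg, hfg, -, -, hD⟩ := h.formD_eq hq0 hq hw
  rw [hD, Complex.ofReal_re, Complex.ofReal_im]
  refine ⟨sub_nonneg.2 (pow_le_pow_left₀ (n2_nonneg _) ((h.gap g hg hfg).trans ?_) 2), rfl⟩
  exact mul_le_of_le_one_left (n2_nonneg _) hq.le

/-- The two coefficients of the cubic equation cannot be small simultaneously: with
`w = f² sign μ` the form `𝓓(w)` controls the norm of `Q w`, and `‖Q w‖² = ‖w‖² - |σ|²`, where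
`‖w‖² = ⟨f⁴⟩ ≥ ⟨f²⟩² = 1`. -/
lemma IsGapped.psi_add_sigma_bounds (h : IsGapped π (kerF s μ) f l q M δ) (hq0 : 0 ≤ q)
    (hq : q < 1) (hμ : BddMeas fun x => csign (μ x)) (hμ0 : ∀ x, μ x ≠ 0) {D : ℝ}
    (hf0 : ∀ x, 0 ≤ f x) (hD : ∀ x, f x ≤ D) :
    (1 - q ^ 2) / 4 ≤ (psi π s μ f).re + ‖sigma π μ f‖ ^ 2 ∧
      (psi π s μ f).re + ‖sigma π μ f‖ ^ 2 ≤ D ^ 4 / (1 - q) ^ 2 + D ^ 4 := by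
  have hf := h.bddMeas
  have hq2 : 0 < 1 - q := by linarith
  have hw : BddMeas fun x => (f x : ℂ) ^ 2 * csign (μ x) := by fun_prop
  obtain ⟨g, hg, hfg, hgw, -, hpsi⟩ := h.formD_eq hq0 hq hw
  have hKg := hg.intOp (π := π) h.symmKernel
  have hσ : ∫ y, (f y : ℂ) * ((f y : ℂ) ^ 2 * csign (μ y)) ∂π = sigma π μ f := by
    simp only [sigma, avg]
    congr 1; ext y; ring
  rw [hσ] at hgw
  set σ := sigma π μ f
  set r : X → ℂ := fun x => (f x : ℂ) ^ 2 * csign (μ x) - σ * f x with hr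
  have hrb : BddMeas r := by fun_prop
  have hfr : ∫ x, (f x : ℂ) * r x ∂π = 0 := by
    rw [hr, ← hσ]; exact integral_mul_sub_proj hf h.normalized hw
  -- Pythagoras: `⟨f⁴⟩ = |σ|² + ‖Q w‖²`
  have hpyth := h.n2_sq_eq hrb hfr σ
  have hnw : n2 π (fun x => σ * f x + r x) ^ 2 = ∫ x, f x ^ 4 ∂π := by
    rw [n2_sq]
    congr 1; ext x
    rw [hr, show σ * f x + ((f x : ℂ) ^ 2 * csign (μ x) - σ * f x) = (f x : ℂ) ^ 2 * csign (μ x) by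
      ring, norm_mul, norm_csign (hμ0 x), mul_one, norm_pow, Complex.norm_real, Real.norm_eq_abs,
      sq_abs, ← pow_mul]
  rw [hnw] at hpyth
  have hf4 : 1 ≤ ∫ x, f x ^ 4 ∂π := by
    have := sq_integral_le_mul (π := π) (a := fun _ => 1) (b := fun x => f x ^ 4)
      (c := fun x => f x ^ 2) (BddMeas.const _).integrable (BddMeas.integrable (by fun_prop))
      (BddMeas.integrable (by fun_prop)) (fun _ => zero_le_one) (fun x => by positivity)
      (fun x => le_of_eq (by ring))
    rw [h.normalized] at this
    simpa using this
  have hf4' : ∫ x, f x ^ 4 ∂π ≤ D ^ 4 := integral_le_of_le_const (by fun_prop) fun x =>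
    pow_le_pow_left₀ (hf0 x) (hD x) 4
  have hgap := h.gap g hg hfg
  have hrg : r = fun x => g x - intOp π (kerF s μ) g x := by funext x; exact (hgw x).symm
  have h1 : n2 π r ≤ 2 * n2 π g := by
    rw [hrg]
    have := n2_sub_le (π := π) hg hKg
    nlinarith [n2_nonneg (π := π) g]
  -- any bound on `r` may be used here, as only the estimate in `L²` is needed
  have hinv := (h.norm_le_of_sub_eq hq hg hrb hfg hgw (B := hrb.2.choose) hrb.2.choose_spec).1
  rw [le_div_iff₀ hq2] at hinv
  have hpsi' : (psi π s μ f).re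
      = n2 π g ^ 2 - n2 π (fun x => intOp π (kerF s μ) g x) ^ 2 := by
    rw [psi, hpsi, Complex.ofReal_re]
  rw [hpsi']
  have hg0 := n2_nonneg (π := π) g
  have hr0 := n2_nonneg (π := π) r
  have hK0 := n2_nonneg (π := π) fun x => intOp π (kerF s μ) g x
  have hσ0 : 0 ≤ ‖σ‖ ^ 2 := by positivity
  have hK2 := pow_le_pow_left₀ hK0 hgap 2
  have hr2 := pow_le_pow_left₀ hr0 h1 2
  have hi2 := pow_le_pow_left₀ (mul_nonneg hg0 hq2.le) hinv 2
  rw [mul_pow] at hK2 hr2 hi2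
  have hq3 : 0 < 1 - q ^ 2 := by nlinarith
  constructor
  · have h5 : (1 - q ^ 2) * n2 π r ^ 2 ≤ (1 - q ^ 2) * (2 ^ 2 * n2 π g ^ 2) :=
      mul_le_mul_of_nonneg_left hr2 hq3.le
    have h6 : 0 ≤ (1 - q ^ 2) * (∫ x, f x ^ 4 ∂π - 1) := mul_nonneg hq3.le (by linarith)
    have h7 : 0 ≤ (3 + q ^ 2) * ‖σ‖ ^ 2 := by positivity
    nlinarith
  · have h5 : n2 π g ^ 2 ≤ D ^ 4 / (1 - q) ^ 2 := by
      rw [le_div_iff₀ (by positivity)]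
      linarith
    have h6 : 0 ≤ n2 π (fun x => intOp π (kerF s μ) g x) ^ 2 := by positivity
    have h7 : 0 ≤ n2 π r ^ 2 := by positivity
    linarith

omit [IsProbabilityMeasure π] in
lemma sigma_im_eq_zero (hμ : ∀ x, (μ x).im = 0) : (sigma π μ f).im = 0 := by
  have h1 : ∀ x, (f x : ℂ) ^ 3 * csign (μ x) = ((f x ^ 3 * ((μ x).re / ‖μ x‖) : ℝ) : ℂ) := fun x => by
    rw [csign_eq_ofReal (hμ x)]; push_cast; rfl
  simp only [sigma, avg, h1]
  rw [integral_complex_ofReal, Complex.ofReal_im]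

end QuadraticForm

/-! ### First order perturbation theory at the edge -/

section Perturbation

variable {X : Type*} [MeasurableSpace X] {π : Measure X} [IsProbabilityMeasure π]
  {k : X → X → ℝ} {f B p : X → ℝ} {u : X → ℂ} {l q M δ D K ω t : ℝ}

lemma im_integral_mul {w : X → ℂ} (hf : BddMeas f) (hw : BddMeas w) :
    (∫ x, (f x : ℂ) * w x ∂π).im = ∫ x, f x * (w x).im ∂π := by
  have h : Integrable (fun x => (f x : ℂ) * w x) π := BddMeas.integrable (by fun_prop)
  rw [← RCLike.im_to_complex, ← integral_im h]
  congr 1; ext x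
  rw [RCLike.im_to_complex, Complex.im_ofReal_mul]

lemma abs_im_mul_le (z w : ℂ) : |(z * w).im| ≤ ‖z‖ * |w.im| + |z.im| * ‖w‖ := by
  rw [Complex.mul_im]
  refine (abs_add_le _ _).trans (add_le_add ?_ ?_)
  · rw [abs_mul]; exact mul_le_mul_of_nonneg_right (Complex.abs_re_le_norm z) (abs_nonneg _)
  · rw [abs_mul]; exact mul_le_mul_of_nonneg_left (Complex.abs_re_le_norm w) (abs_nonneg _)

lemma norm_intOp_le_const (hk : IsSymmKernel k) (hM : ∀ x y, k x y ≤ M) (hM0 : 0 ≤ M) {w : X → ℂ}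
    (hw : BddMeas w) {U : ℝ} (hU : ∀ x, ‖w x‖ ≤ U) (x : X) : ‖intOp π k w x‖ ≤ M * U :=
  (norm_intOp_le_n2 hk hM hw x).trans (mul_le_mul_of_nonneg_left (n2_le_of_bound hw hU) hM0)

lemma abs_im_intOp_le_const (hk : IsSymmKernel k) (hM : ∀ x y, k x y ≤ M) (hM0 : 0 ≤ M)
    {w : X → ℂ} (hw : BddMeas w) {U : ℝ} (hU : ∀ x, |(w x).im| ≤ U) (x : X) :
    |(intOp π k w x).im| ≤ M * U := by
  have h := norm_intOp_le_const (π := π) hk hM hM0 (w := fun x => ((w x).im : ℂ)) hw.im.ofReal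
    (fun x => by rw [Complex.norm_real]; exact hU x) x
  rwa [intOp_ofReal, Complex.norm_real, ← intOp_im hk hw] at h

lemma norm_integral_le_of_bound {w : X → ℂ} {U : ℝ} (hU : ∀ x, ‖w x‖ ≤ U) :
    ‖∫ x, w x ∂π‖ ≤ U := by
  simpa using norm_integral_le_of_norm_le_const (μ := π) (ae_of_all _ hU)

lemma abs_im_integral_le_of_bound {w : X → ℂ} (hw : BddMeas w) {U : ℝ}
    (hU : ∀ x, |(w x).im| ≤ U) : |(∫ x, w x ∂π).im| ≤ U := by
  rw [← RCLike.im_to_complex, ← integral_im hw.integrable, ← Real.norm_eq_abs]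
  simpa using norm_integral_le_of_norm_le_const (μ := π) (f := fun x => RCLike.im (w x))
    (ae_of_all _ hU)

lemma norm_integral_mul_le_of_bound (hf : BddMeas f) (hf1 : ∫ x, f x ^ 2 ∂π = 1) {w : X → ℂ}
    (hw : BddMeas w) {U : ℝ} (hU : ∀ x, ‖w x‖ ≤ U) : ‖∫ x, (f x : ℂ) * w x ∂π‖ ≤ U := by
  refine (norm_integral_mul_le_n2 (by fun_prop) hw).trans ?_
  rw [n2_ofReal_eq_one hf1, one_mul]
  exact n2_le_of_bound hw hU

/-- The inverse of `1 - F` composed with the projection orthogonal to the eigenfunction is bounded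
in the supremum norm. -/
lemma IsGapped.norm_le_of_sub_eq_proj (h : IsGapped π k f l q M δ) (hq : q < 1)
    (hf0 : ∀ x, 0 ≤ f x) (hD : ∀ x, f x ≤ D) {d η : X → ℂ} (hd : BddMeas d) (hη : BddMeas η)
    (hfd : ∫ x, (f x : ℂ) * d x ∂π = 0)
    (heq : ∀ x, d x - intOp π k d x = η x - (∫ y, (f y : ℂ) * η y ∂π) * f x) {H : ℝ}
    (hH : ∀ x, ‖η x‖ ≤ H) (x : X) : ‖d x‖ ≤ (1 + M / (1 - q)) * (1 + D) * H := by
  have hf := h.bddMeas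
  have hH0 : 0 ≤ H := (norm_nonneg _).trans (hH x)
  rw [mul_assoc]
  refine (h.norm_le_of_sub_eq hq hd (w := fun x => η x - (∫ y, (f y : ℂ) * η y ∂π) * f x)
    (by fun_prop) hfd heq fun y => ?_).2 x
  refine (norm_sub_le _ _).trans ?_
  rw [norm_mul, Complex.norm_real, Real.norm_of_nonneg (hf0 y), add_mul, one_mul, mul_comm D]
  exact add_le_add (hH y) (mul_le_mul (norm_integral_mul_le_of_bound hf h.normalized hη hH) (hD y)
    (hf0 y) hH0)

/-- The imaginary part of a solution is controlled by the imaginary part of the right hand side,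
because the operator is real. -/
lemma IsGapped.abs_im_le_of_sub_eq_proj (h : IsGapped π k f l q M δ) (hq : q < 1)
    (hf0 : ∀ x, 0 ≤ f x) (hD : ∀ x, f x ≤ D) {d η : X → ℂ} (hd : BddMeas d) (hη : BddMeas η)
    (hfd : ∫ x, (f x : ℂ) * d x ∂π = 0)
    (heq : ∀ x, d x - intOp π k d x = η x - (∫ y, (f y : ℂ) * η y ∂π) * f x) {H : ℝ}
    (hH : ∀ x, |(η x).im| ≤ H) (x : X) : |(d x).im| ≤ (1 + M / (1 - q)) * (1 + D) * H := by
  have hf := h.bddMeas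
  have hfim : ∀ w : X → ℂ, BddMeas w →
      ∫ x, (f x : ℂ) * ((w x).im : ℂ) ∂π = ((∫ x, (f x : ℂ) * w x ∂π).im : ℂ) := fun w hw => by
    rw [im_integral_mul hf hw, ← integral_complex_ofReal]
    congr 1; ext x; push_cast; rfl
  have key := h.norm_le_of_sub_eq_proj hq hf0 hD (d := fun x => ((d x).im : ℂ))
    (η := fun x => ((η x).im : ℂ)) hd.im.ofReal hη.im.ofReal
    (by rw [hfim d hd, hfd]; simp) (fun x => by
      rw [hfim η hη, intOp_ofReal, ← intOp_im h.symmKernel hd]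
      have := congrArg Complex.im (heq x)
      rw [Complex.sub_im, Complex.sub_im, Complex.im_mul_ofReal] at this
      exact_mod_cast this) (fun x => by rw [Complex.norm_real]; exact hH x) x
  rwa [Complex.norm_real] at key

/-- The relative change `u = (m(τ + ω) - m(τ)) / |m(τ)|` at a point `τ` where `m` is real and the
top eigenvalue of `F` is one; here `B = |m(τ)|` and `p = sign m(τ)`. The bound `t` on `u` encodes
the `1/3`-Hölder continuity of `m`, and the last field says that all components of `Im m` are
comparable. -/
structure IsPerturbation (π : Measure X) (k : X → X → ℝ) (f B p : X → ℝ) (u : X → ℂ)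
    (ω t q K : ℝ) : Prop where
  gapped : IsGapped π k f 1 q K K⁻¹
  nonneg : ∀ x, 0 ≤ f x
  le_const : ∀ x, f x ≤ K
  bddMeas_norm : BddMeas B
  norm_nonneg : ∀ x, 0 ≤ B x
  norm_le : ∀ x, B x ≤ K
  bddMeas_sign : BddMeas p
  abs_sign_le : ∀ x, |p x| ≤ 1
  bddMeas : BddMeas u
  eq : ∀ x, u x - intOp π k u x
    = B x * ω + p x * (u x * intOp π k u x) + ω * p x * B x * u x
  le_bound : ∀ x, ‖u x‖ ≤ t
  cube_le : t ^ 3 ≤ K * |ω|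
  abs_le : |ω| ≤ K
  im_nonneg : ∀ x, 0 ≤ (u x).im
  im_le : ∀ x, (u x).im ≤ K * (∫ y, (f y : ℂ) * u y ∂π).im

/-- A quadratic term `(K T + ρ)²` is absorbed in `ρ` without a smallness assumption: if the a priori
bound `t` on `ρ` is small, directly, and otherwise because `W ≳ t³` is then bounded below. -/
lemma absorb_quadratic {c c' T W ρ t₀ : ℝ} (hc : 0 ≤ c) (hc' : 0 ≤ c') (hK : 0 ≤ K)
    (hW : 0 ≤ W) (hρ0 : 0 ≤ ρ) (ht : 0 ≤ t) (hρ : ρ ≤ c * W + c' * (K * T + ρ) ^ 2)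
    (hρt : ρ ≤ (1 + K) * t) (htt : t ≤ t₀) (hcube : t ^ 3 ≤ K * W) :
    ρ ≤ (2 * c + 4 * c' * K ^ 2 + (1 + K) * t₀ * ((4 * c' * (1 + K)) ^ 3 * K)) * (W + T ^ 2) := by
  have ht₀ : 0 ≤ t₀ := ht.trans htt
  have h1 : 0 ≤ (1 + K) * t₀ * ((4 * c' * (1 + K)) ^ 3 * K) := by positivity
  have hT2 : 0 ≤ T ^ 2 := by positivity
  rcases le_total (4 * c' * (1 + K) * t) 1 with h | h
  · have h2 : (K * T + ρ) ^ 2 ≤ 2 * (K ^ 2 * T ^ 2) + 2 * ρ ^ 2 := by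
      nlinarith [sq_nonneg (K * T - ρ)]
    have h3 : c' * ρ ^ 2 * 4 ≤ ρ := by
      calc c' * ρ ^ 2 * 4 = 4 * c' * ρ * ρ := by ring
        _ ≤ 4 * c' * ((1 + K) * t) * ρ := by gcongr
        _ = (4 * c' * (1 + K) * t) * ρ := by ring
        _ ≤ 1 * ρ := by gcongr
        _ = ρ := one_mul ρ
    have h4 := mul_le_mul_of_nonneg_left h2 hc'
    have h5 : ρ ≤ 2 * c * W + 4 * c' * K ^ 2 * T ^ 2 := by linarith
    have h6 : 0 ≤ 4 * c' * K ^ 2 * W := by positivity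
    have h7 : 0 ≤ 2 * c * T ^ 2 := by positivity
    have h8 := mul_nonneg h1 (add_nonneg hW hT2)
    linarith
  · have h2 : 1 ≤ (4 * c' * (1 + K)) ^ 3 * K * W := by
      calc (1 : ℝ) ≤ (4 * c' * (1 + K) * t) ^ 3 := one_le_pow₀ h
        _ = (4 * c' * (1 + K)) ^ 3 * t ^ 3 := by ring
        _ ≤ (4 * c' * (1 + K)) ^ 3 * (K * W) := by gcongr
        _ = _ := by ring
    have h3 : ρ ≤ (1 + K) * t₀ * ((4 * c' * (1 + K)) ^ 3 * K * W) := by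
      calc ρ ≤ (1 + K) * t₀ * 1 := by rw [mul_one]; exact hρt.trans (by gcongr)
        _ ≤ _ := by gcongr
    have h4 : 0 ≤ (2 * c + 4 * c' * K ^ 2) * (W + T ^ 2) := by positivity
    have h5 := mul_nonneg h1 hT2
    linarith

/-- The a priori bound `t` may be taken bounded. -/
lemma IsPerturbation.bound_le (h : IsPerturbation π k f B p u ω t q K) (hK : 1 ≤ K) :
    0 ≤ t ∧ t ≤ 1 + K ^ 2 := by
  obtain ⟨x⟩ : Nonempty X := nonempty_of_isProbabilityMeasure π
  have ht : 0 ≤ t := (_root_.norm_nonneg _).trans (h.le_bound x)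
  refine ⟨ht, ?_⟩
  have h1 : t ^ 3 ≤ K ^ 2 := by
    rw [sq]; exact h.cube_le.trans (mul_le_mul_of_nonneg_left h.abs_le (by linarith))
  rcases le_total t 1 with h2 | h2
  · nlinarith
  · have : t ≤ t ^ 3 := le_self_pow₀ h2 (by norm_num)
    linarith

/-- The change `u` is, to leading order, a multiple of the eigenfunction `f`. -/
lemma exists_first_order (π : Measure X) [IsProbabilityMeasure π] (hK : 1 ≤ K) (hq : q < 1) :
    ∃ C, 0 < C ∧ ∀ (k : X → X → ℝ) (f B p : X → ℝ) (u : X → ℂ) (ω t : ℝ),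
      IsPerturbation π k f B p u ω t q K → ∀ Θ, Θ = ∫ y, (f y : ℂ) * u y ∂π → ∀ x,
        ‖u x - Θ * f x‖ ≤ C * (|ω| + ‖Θ‖ ^ 2) ∧ ‖u x‖ ≤ C * (‖Θ‖ + |ω|) ∧
        |(u x - Θ * f x).im| ≤ C * ((‖Θ‖ + |ω|) * Θ.im) := by
  have hK0 : 0 < K := by linarith
  have hq1 : 0 < 1 - q := by linarith
  -- `N` bounds `(1 - F)⁻¹ Q`; the other constants collect the factors of the estimates below
  set N := (1 + K / (1 - q)) * (1 + K) with hN
  have hN0 : 0 < N := by positivity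
  set t₀ := 1 + K ^ 2 with ht₀
  have ht₀0 : 0 < t₀ := by positivity
  set c := N * (K + K * t₀) with hc
  set c' := N * K with hc'
  have hc0 : 0 < c := by positivity
  have hc'0 : 0 < c' := by positivity
  set c₁ := 2 * c + 4 * c' * K ^ 2 + (1 + K) * t₀ * ((4 * c' * (1 + K)) ^ 3 * K) with hc₁
  have hc₁0 : 0 < c₁ := by positivity
  set c₂ := K + c₁ * t₀ + c₁ with hc₂
  have hc₂0 : 0 < c₂ := by positivity
  set c₃ := N * (2 * K * K * c₂ + K * K) with hc₃
  have hc₃0 : 0 < c₃ := by positivity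
  refine ⟨c₁ + c₂ + c₃, by positivity, fun k f B p u ω t h Θ hΘ => ?_⟩
  have hf := h.gapped.bddMeas
  have hk := h.gapped.symmKernel
  have hu := h.bddMeas
  have hB := h.bddMeas_norm
  have hp := h.bddMeas_sign
  have hKu := hu.intOp (π := π) hk
  obtain ⟨ht, htt⟩ := h.bound_le hK
  have hW : 0 ≤ |ω| := abs_nonneg ω
  have hT : 0 ≤ ‖Θ‖ := norm_nonneg Θ
  have hTt : ‖Θ‖ ≤ t := by
    rw [hΘ]; exact norm_integral_mul_le_of_bound hf h.gapped.normalized hu h.le_bound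
  set r : X → ℂ := fun x => u x - Θ * f x with hr
  have hrb : BddMeas r := by fun_prop
  have hfr : ∫ x, (f x : ℂ) * r x ∂π = 0 := by
    rw [hr, hΘ]; exact integral_mul_sub_proj hf h.gapped.normalized hu
  have hKf : ∀ x, intOp π k (fun y => (f y : ℂ)) x = f x := fun x => by
    rw [intOp_ofReal, h.gapped.eigen x, one_mul]
  have hKr : ∀ x, intOp π k r x = intOp π k u x - Θ * f x := fun x => by
    rw [hr, intOp_sub hk hu (by fun_prop), intOp_const_mul, hKf]
  set η : X → ℂ := fun x => B x * ω + p x * (u x * intOp π k u x) + ω * p x * B x * u x with hη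
  have hηb : BddMeas η := by fun_prop
  -- since `F f = f`, the remainder satisfies the equation for `u` with the same right hand side
  -- `η`, which is therefore orthogonal to `f`
  have hrη : ∀ x, r x - intOp π k r x = η x := fun x => by
    rw [hKr x]
    simp only [hη, hr]
    rw [← h.eq x]; ring
  have hfη : ∫ x, (f x : ℂ) * η x ∂π = 0 := by
    simp only [← hrη, mul_sub]
    have := hrb.intOp (π := π) hk
    rw [integral_sub (BddMeas.integrable (by fun_prop)) (BddMeas.integrable (by fun_prop)),
      h.gapped.integral_mul_intOp_eigen hrb, hfr, mul_zero, sub_zero]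
  have hproj : ∀ x, r x - intOp π k r x = η x - (∫ y, (f y : ℂ) * η y ∂π) * f x := fun x => by
    rw [hrη, hfη, zero_mul, sub_zero]
  have hBp : ∀ x, ‖(ω : ℂ) * p x * B x‖ ≤ K * |ω| := fun x => by
    rw [norm_mul, norm_mul, Complex.norm_real, Complex.norm_real, Complex.norm_real,
      Real.norm_of_nonneg (h.norm_nonneg x), Real.norm_eq_abs, Real.norm_eq_abs, mul_comm K]
    exact mul_le_mul (mul_le_of_le_one_right hW (h.abs_sign_le x)) (h.norm_le x) (h.norm_nonneg x)
      hW
  have hpn : ∀ (x : X) (z : ℂ), ‖(p x : ℂ) * z‖ ≤ ‖z‖ := fun x z => by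
    rw [norm_mul, Complex.norm_real]
    exact mul_le_of_le_one_left (norm_nonneg _) (h.abs_sign_le x)
  have hηle : ∀ U, (∀ x, ‖u x‖ ≤ U) → ∀ x, ‖η x‖ ≤ (K + K * t₀) * |ω| + K * U ^ 2 := by
    intro U hU x
    have hU0 : 0 ≤ U := (norm_nonneg _).trans (hU x)
    have h1 : ‖(B x : ℂ) * ω‖ ≤ K * |ω| := by
      rw [norm_mul, Complex.norm_real, Complex.norm_real, Real.norm_of_nonneg (h.norm_nonneg x)]
      exact mul_le_mul_of_nonneg_right (h.norm_le x) hW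
    have h2 : ‖(p x : ℂ) * (u x * intOp π k u x)‖ ≤ U * (K * U) := by
      refine (hpn x _).trans ?_
      rw [norm_mul]
      exact mul_le_mul (hU x) (norm_intOp_le_const hk h.gapped.kernel_le hK0.le hu hU x)
        (norm_nonneg _) hU0
    have h3 : ‖(ω : ℂ) * p x * B x * u x‖ ≤ K * |ω| * t₀ := by
      rw [norm_mul]
      exact mul_le_mul (hBp x) ((h.le_bound x).trans htt) (norm_nonneg _) (by positivity)
    calc ‖η x‖ ≤ K * |ω| + U * (K * U) + K * |ω| * t₀ :=
          (norm_add_le _ _).trans (add_le_add ((norm_add_le _ _).trans (add_le_add h1 h2)) h3)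
      _ = _ := by ring
  have hrρ : ∀ x, ‖r x‖ ≤ supNorm r := fun x => by
    obtain ⟨C, hC⟩ := hrb.2
    exact le_ciSup (f := fun x => ‖r x‖) ⟨C, by rintro _ ⟨x, rfl⟩; exact hC x⟩ x
  have hfΘ : ∀ x, ‖Θ * f x‖ ≤ K * ‖Θ‖ := fun x => by
    rw [norm_mul, Complex.norm_real, Real.norm_of_nonneg (h.nonneg x), mul_comm]
    exact mul_le_mul_of_nonneg_right (h.le_const x) hT
  have huρ : ∀ x, ‖u x‖ ≤ K * ‖Θ‖ + supNorm r := fun x => by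
    rw [show u x = Θ * f x + r x by rw [hr]; ring]
    exact (norm_add_le _ _).trans (add_le_add (hfΘ x) (hrρ x))
  have hX : Nonempty X := nonempty_of_isProbabilityMeasure π
  -- `η` is quadratic in `u = Θ f + r` up to terms of order `ω`, and the square of `r` is absorbed
  have hρ : supNorm r ≤ c₁ * (|ω| + ‖Θ‖ ^ 2) := by
    refine absorb_quadratic hc0.le hc'0.le hK0.le hW (supNorm_nonneg r) ht
      (ciSup_le fun x => ?_) (ciSup_le fun x => ?_) htt h.cube_le
    · refine (h.gapped.norm_le_of_sub_eq_proj hq h.nonneg h.le_const hrb hηb hfr hproj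
        (hηle _ huρ) x).trans (le_of_eq ?_)
      rw [← hN, hc, hc']; ring
    · refine (norm_sub_le _ _).trans ?_
      rw [add_mul, one_mul]
      exact add_le_add (h.le_bound x) ((hfΘ x).trans (by gcongr))
  have hu₂ : ∀ x, ‖u x‖ ≤ c₂ * (‖Θ‖ + |ω|) := fun x => by
    refine (huρ x).trans ((add_le_add_right hρ _).trans ?_)
    have h1 : ‖Θ‖ ^ 2 ≤ t₀ * ‖Θ‖ := by
      rw [sq]; exact mul_le_mul_of_nonneg_right (hTt.trans htt) hT
    have h2 := mul_le_mul_of_nonneg_left h1 hc₁0.le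
    have h3 : 0 ≤ (K + c₁ * t₀) * |ω| := by positivity
    have h4 : 0 ≤ c₁ * ‖Θ‖ := by positivity
    rw [hc₂]
    linarith
  have hI : ∀ x, |(u x).im| ≤ K * Θ.im := fun x => by
    rw [abs_of_nonneg (h.im_nonneg x), hΘ]; exact h.im_le x
  have hI0 : 0 ≤ Θ.im := by
    obtain ⟨x⟩ := hX
    exact nonneg_of_mul_nonneg_right ((abs_nonneg _).trans (hI x)) hK0
  -- the leading term of `η` is real, so that each term of `Im η` has a factor `Im u ≲ Im Θ`
  have hηim : ∀ x, |(η x).im| ≤ (2 * K * K * c₂ + K * K) * ((‖Θ‖ + |ω|) * Θ.im) := fun x => by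
    have e1 : (η x).im = p x * (u x * intOp π k u x).im + ω * p x * B x * (u x).im := by
      have e2 : (ω : ℂ) * p x * B x * u x = ((ω * p x * B x : ℝ) : ℂ) * u x := by push_cast; ring
      have e3 : ((B x : ℂ) * ω) = ((B x * ω : ℝ) : ℂ) := by push_cast; ring
      simp only [hη]
      rw [e2, e3, Complex.add_im, Complex.add_im, Complex.ofReal_im, Complex.im_ofReal_mul,
        Complex.im_ofReal_mul, zero_add]
    have h1 : |(u x * intOp π k u x).im|
        ≤ c₂ * (‖Θ‖ + |ω|) * (K * (K * Θ.im)) + K * Θ.im * (K * (c₂ * (‖Θ‖ + |ω|))) := by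
      refine (abs_im_mul_le _ _).trans (add_le_add ?_ ?_)
      · exact mul_le_mul (hu₂ x) (abs_im_intOp_le_const hk h.gapped.kernel_le hK0.le hu hI x)
          (abs_nonneg _) (by positivity)
      · exact mul_le_mul (hI x) (norm_intOp_le_const hk h.gapped.kernel_le hK0.le hu hu₂ x)
          (norm_nonneg _) (by positivity)
    have h2 : |p x * (u x * intOp π k u x).im| ≤ |(u x * intOp π k u x).im| := by
      rw [abs_mul]; exact mul_le_of_le_one_left (abs_nonneg _) (h.abs_sign_le x)
    have h3 : |ω * p x * B x * (u x).im| ≤ K * |ω| * (K * Θ.im) := by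
      rw [abs_mul]
      refine mul_le_mul ?_ (hI x) (abs_nonneg _) (by positivity)
      have := hBp x
      rwa [← Complex.ofReal_mul, ← Complex.ofReal_mul, Complex.norm_real] at this
    rw [e1]
    have h4 : 0 ≤ K * K * (‖Θ‖ * Θ.im) := by positivity
    calc _ ≤ (c₂ * (‖Θ‖ + |ω|) * (K * (K * Θ.im)) + K * Θ.im * (K * (c₂ * (‖Θ‖ + |ω|))))
          + K * |ω| * (K * Θ.im) := (abs_add_le _ _).trans (add_le_add (h2.trans h1) h3)
      _ ≤ _ := by linarith
  intro x
  refine ⟨(hrρ x).trans (hρ.trans ?_), (hu₂ x).trans ?_, ?_⟩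
  · exact mul_le_mul_of_nonneg_right (by linarith) (by positivity)
  · exact mul_le_mul_of_nonneg_right (by linarith) (by positivity)
  · refine (h.gapped.abs_im_le_of_sub_eq_proj hq h.nonneg h.le_const hrb hηb hfr hproj
      hηim x).trans ?_
    rw [← mul_assoc, ← hN, ← hc₃]
    exact mul_le_mul_of_nonneg_right (by linarith) (by positivity)

end Perturbation

/-! ### The cubic equation -/

section Cubic

variable {X : Type*} [MeasurableSpace X] {π : Measure X} [IsProbabilityMeasure π]
  {k : X → X → ℝ} {f B p : X → ℝ} {u : X → ℂ} {q K ω t : ℝ}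

lemma norm_ofReal_mul_le {c C Z : ℝ} {z : ℂ} (hc : |c| ≤ C) (hz : ‖z‖ ≤ Z) :
    ‖(c : ℂ) * z‖ ≤ C * Z := by
  rw [norm_mul, Complex.norm_real]
  exact mul_le_mul hc hz (norm_nonneg _) ((abs_nonneg _).trans hc)

lemma abs_im_ofReal_mul_le {c C Z : ℝ} {z : ℂ} (hc : |c| ≤ C) (hz : |z.im| ≤ Z) :
    |((c : ℂ) * z).im| ≤ C * Z := by
  rw [Complex.im_ofReal_mul, abs_mul]
  exact mul_le_mul hc hz (abs_nonneg _) ((abs_nonneg _).trans hc)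

lemma norm_mul_le_mul {z w : ℂ} {Z W : ℝ} (hz : ‖z‖ ≤ Z) (hw : ‖w‖ ≤ W) : ‖z * w‖ ≤ Z * W := by
  rw [norm_mul]; exact mul_le_mul hz hw (norm_nonneg _) ((norm_nonneg _).trans hz)

lemma abs_im_mul_le_mul {z w : ℂ} {Z W Zi Wi : ℝ} (hz : ‖z‖ ≤ Z) (hw : ‖w‖ ≤ W)
    (hzi : |z.im| ≤ Zi) (hwi : |w.im| ≤ Wi) : |(z * w).im| ≤ Z * Wi + Zi * W :=
  (abs_im_mul_le z w).trans (add_le_add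
    (mul_le_mul hz hwi (abs_nonneg _) ((norm_nonneg _).trans hz))
    (mul_le_mul hzi hw (norm_nonneg _) ((abs_nonneg _).trans hzi)))

/-- The cubic equation for the component `Θ` of the change `u` along the eigenfunction. It is the
projection of the equation for `u` onto `f`, with `u = Θ f + Θ² g + r̃`, where
`g = (1 - F)⁻¹ Q (p f²)` and `r̃` is of the order `ω`. The error is estimated by `|Θ|³ ≲ |ω|`. -/
lemma exists_cubic_bounds (π : Measure X) [IsProbabilityMeasure π] (hK : 1 ≤ K) (hq : q < 1) :
    ∃ C, 0 < C ∧ ∀ (k : X → X → ℝ) (f B p : X → ℝ) (u g : X → ℂ) (ω t : ℝ),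
      IsPerturbation π k f B p u ω t q K → ∀ Θ, Θ = ∫ y, (f y : ℂ) * u y ∂π → BddMeas g →
      ∫ x, (f x : ℂ) * g x ∂π = 0 → ∀ σ, σ = ∫ y, (f y : ℂ) * ((f y : ℂ) ^ 2 * p y) ∂π →
      (∀ x, g x - intOp π k g x = (f x : ℂ) ^ 2 * p x - σ * f x) → ∀ e : ℂ,
      e = (∫ x, ((f x : ℂ) ^ 2 * p x) * (g x + intOp π k g x) ∂π) * Θ ^ 3 + σ * Θ ^ 2
        + (∫ x, (B x : ℂ) * f x ∂π) * ω →
      ‖e‖ ≤ C * (|ω| * ‖Θ‖ + |ω| ^ 2) ∧ |e.im| ≤ C * (|ω| * Θ.im) := by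
  obtain ⟨c, hc0, hfirst⟩ := exists_first_order π hK hq
  have hK0 : 0 < K := by linarith
  have hq1 : 0 < 1 - q := by linarith
  -- `N` bounds `(1 - F)⁻¹ Q`, and `t₀` the change `u`; each `dᵢ` is the constant of one estimate
  -- below
  set N := (1 + K / (1 - q)) * (1 + K) with hN
  have hN0 : 0 < N := by positivity
  set t₀ := 1 + K ^ 2 with ht₀
  have ht₀0 : 0 < t₀ := by positivity
  set d₁ := K + K * t₀ + (K * (1 + K) * (c * (t₀ + K)) + K * (c ^ 2 * (1 + 2 * t₀ + K) * (t₀ + K)))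
    with hd₁
  have hd₁0 : 0 < d₁ := by positivity
  set d₂ := N * d₁ with hd₂
  have hd₂0 : 0 < d₂ := by positivity
  set d₃ := K * K + (K * (1 + K) * (c * (1 + t₀)) + K * (1 + K) * c) + 2 * K * (c ^ 2 * (t₀ + K))
    with hd₃
  have hd₃0 : 0 < d₃ := by positivity
  set d₄ := N * d₃ with hd₄
  have hd₄0 : 0 < d₄ := by positivity
  set d₅ := K ^ 2 * (1 + K) * d₂ + K * K * (c ^ 2 * (1 + 2 * t₀ + K)) + K ^ 2 * c with hd₅
  have hd₅0 : 0 < d₅ := by positivity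
  set d₆ := K ^ 2 * ((1 + K) * d₄ * (t₀ + K) + (1 + K) * d₂)
    + 2 * K * K * (c ^ 2 * (t₀ + K + K + t₀ ^ 2)) + K ^ 2 * K with hd₆
  have hd₆0 : 0 < d₆ := by positivity
  refine ⟨d₅ + d₆, by positivity, fun k f B p u g ω t h Θ hΘ hg hfg σ hσ hgσ e he => ?_⟩
  have hf := h.gapped.bddMeas
  have hk := h.gapped.symmKernel
  have hM := h.gapped.kernel_le
  have hu := h.bddMeas
  have hB := h.bddMeas_norm
  have hp := h.bddMeas_sign
  have hKu := hu.intOp (π := π) hk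
  have hKg := hg.intOp (π := π) hk
  obtain ⟨ht, htt⟩ := h.bound_le hK
  have hX : Nonempty X := nonempty_of_isProbabilityMeasure π
  have hW : 0 ≤ |ω| := abs_nonneg ω
  have hT : 0 ≤ ‖Θ‖ := norm_nonneg Θ
  have hTt : ‖Θ‖ ≤ t := by
    rw [hΘ]; exact norm_integral_mul_le_of_bound hf h.gapped.normalized hu h.le_bound
  have hT₀ : ‖Θ‖ ≤ t₀ := hTt.trans htt
  have hT3 : ‖Θ‖ ^ 3 ≤ K * |ω| := (pow_le_pow_left₀ hT hTt 3).trans h.cube_le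
  have hWK := h.abs_le
  have hI : ∀ x, |(u x).im| ≤ K * Θ.im := fun x => by
    rw [abs_of_nonneg (h.im_nonneg x), hΘ]; exact h.im_le x
  have hI0 : 0 ≤ Θ.im := by
    obtain ⟨x⟩ := hX
    exact nonneg_of_mul_nonneg_right ((abs_nonneg _).trans (hI x)) hK0
  -- the decomposition of `u`
  set r : X → ℂ := fun x => u x - Θ * f x with hr
  have hrb : BddMeas r := by fun_prop
  have hfr : ∫ x, (f x : ℂ) * r x ∂π = 0 := by
    rw [hr, hΘ]; exact integral_mul_sub_proj hf h.gapped.normalized hu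
  have hKf : ∀ x, intOp π k (fun y => (f y : ℂ)) x = f x := fun x => by
    rw [intOp_ofReal, h.gapped.eigen x, one_mul]
  have hKr : ∀ x, intOp π k r x = intOp π k u x - Θ * f x := fun x => by
    rw [hr, intOp_sub hk hu (by fun_prop), intOp_const_mul, hKf]
  have hKrb := hrb.intOp (π := π) hk
  set w : X → ℂ := fun x => r x - Θ ^ 2 * g x with hw
  have hwb : BddMeas w := by fun_prop
  have hfw : ∫ x, (f x : ℂ) * w x ∂π = 0 := by
    have e1 : ∀ x, (f x : ℂ) * w x = (f x : ℂ) * r x - Θ ^ 2 * ((f x : ℂ) * g x) := fun x => by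
      rw [hw]; ring
    simp only [e1]
    rw [integral_sub (BddMeas.integrable (by fun_prop)) (BddMeas.integrable (by fun_prop)),
      integral_const_mul, hfr, hfg, mul_zero, sub_zero]
  have hKw : ∀ x, intOp π k w x = intOp π k r x - Θ ^ 2 * intOp π k g x := fun x => by
    rw [hw, intOp_sub hk hrb (by fun_prop), intOp_const_mul]
  have hKwb := hwb.intOp (π := π) hk
  -- the bounds on `r` and its imaginary part
  set W := |ω| with hWdef
  set T := ‖Θ‖ with hTdef
  set I := Θ.im with hIdef
  set ρ := c * (W + T ^ 2) with hρ
  set ι := c * ((T + W) * I) with hι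
  have hρ0 : 0 ≤ ρ := by positivity
  have hι0 : 0 ≤ ι := by positivity
  have hrρ : ∀ x, ‖r x‖ ≤ ρ := fun x => (hfirst k f B p u ω t h Θ hΘ x).1
  have hu₂ : ∀ x, ‖u x‖ ≤ c * (T + W) := fun x => (hfirst k f B p u ω t h Θ hΘ x).2.1
  have hrι : ∀ x, |(r x).im| ≤ ι := fun x => (hfirst k f B p u ω t h Θ hΘ x).2.2
  have hKrρ := norm_intOp_le_const (π := π) hk hM hK0.le hrb hrρ
  have hKrι := abs_im_intOp_le_const (π := π) hk hM hK0.le hrb hrι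
  -- all of these use `T ≤ t₀`, `W ≤ K` and `T³ ≤ K W`
  have hTρ : T * ρ ≤ c * (t₀ + K) * W := by
    have h1 := mul_le_mul_of_nonneg_right hT₀ hW
    have h2 : T * W + T ^ 3 ≤ (t₀ + K) * W := by linarith
    have h3 := mul_le_mul_of_nonneg_left h2 hc0.le
    rw [hρ]; linarith
  have hρρ : ρ * ρ ≤ c ^ 2 * (1 + 2 * t₀ + K) * (W * T + W ^ 2) := by
    have h1 := mul_le_mul_of_nonneg_right hT₀ (mul_nonneg hW hT)
    have h2 := mul_le_mul_of_nonneg_left hT3 hT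
    have h3 : 0 ≤ (2 * t₀ + K) * W ^ 2 := by positivity
    have h3' : 0 ≤ W * T := mul_nonneg hW hT
    have h4 : (W + T ^ 2) * (W + T ^ 2) ≤ (1 + 2 * t₀ + K) * (W * T + W ^ 2) := by linarith
    have h5 := mul_le_mul_of_nonneg_left h4 (sq_nonneg c)
    rw [hρ]; linarith
  have hWTW : W * T + W ^ 2 ≤ (t₀ + K) * W := by
    have h1 := mul_le_mul_of_nonneg_left hT₀ hW
    have h2 := mul_le_mul_of_nonneg_left hWK hW
    linarith
  have hρρ' : ρ * ρ ≤ c ^ 2 * (1 + 2 * t₀ + K) * (t₀ + K) * W := by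
    have := mul_le_mul_of_nonneg_left hWTW (show 0 ≤ c ^ 2 * (1 + 2 * t₀ + K) by positivity)
    linarith
  have hTι : T * ι ≤ c * (1 + t₀) * ((W + T ^ 2) * I) := by
    have h1 := mul_le_mul_of_nonneg_right hT₀ hW
    have h2 : 0 ≤ t₀ * T ^ 2 := by positivity
    have h3 : T * (T + W) ≤ (1 + t₀) * (W + T ^ 2) := by linarith
    have h4 := mul_le_mul_of_nonneg_left h3 (mul_nonneg hc0.le hI0)
    rw [hι]; linarith
  have hρι : ρ * ι ≤ c ^ 2 * (t₀ + K) * ((W + T ^ 2) * I) := by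
    have h1 : T + W ≤ t₀ + K := add_le_add hT₀ hWK
    have h2 := mul_le_mul_of_nonneg_left h1
      (show 0 ≤ c ^ 2 * ((W + T ^ 2) * I) by positivity)
    rw [hρ, hι]; linarith
  have hρι' : ρ * ι ≤ c ^ 2 * (t₀ + K + K + t₀ ^ 2) * (W * I) := by
    have h1 := mul_le_mul_of_nonneg_right hT₀ hW
    have h2 := mul_le_mul_of_nonneg_left hWK hW
    have h3 := mul_le_mul_of_nonneg_right (pow_le_pow_left₀ hT hT₀ 2) hW
    have h4 : (W + T ^ 2) * (T + W) ≤ (t₀ + K + K + t₀ ^ 2) * W := by linarith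
    have h5 := mul_le_mul_of_nonneg_left h4 (show 0 ≤ c ^ 2 * I by positivity)
    rw [hρ, hι]; linarith
  have hTWT : T * (W + T ^ 2) ≤ (t₀ + K) * W := by
    have h1 := mul_le_mul_of_nonneg_right hT₀ hW
    linarith
  -- bounds on the real coefficients
  have hfa : ∀ x, |f x| ≤ K := fun x => by rw [abs_of_nonneg (h.nonneg x)]; exact h.le_const x
  have hBa : ∀ x, |B x| ≤ K := fun x => by
    rw [abs_of_nonneg (h.norm_nonneg x)]; exact h.norm_le x
  have hfp : ∀ x, |f x * p x| ≤ K := fun x => by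
    rw [abs_mul]
    exact (mul_le_of_le_one_right (abs_nonneg _) (h.abs_sign_le x)).trans (hfa x)
  have hffp : ∀ x, |f x ^ 2 * p x| ≤ K ^ 2 := fun x => by
    rw [sq, mul_assoc, abs_mul, sq]
    exact mul_le_mul (hfa x) (hfp x) (abs_nonneg _) hK0.le
  have hpB : ∀ x, |ω * p x * B x| ≤ K * W := fun x => by
    rw [abs_mul, abs_mul, mul_comm K]
    exact mul_le_mul (mul_le_of_le_one_right hW (h.abs_sign_le x)) (hBa x) (abs_nonneg _) hW
  have hfpB : ∀ x, |f x * (ω * p x * B x)| ≤ K ^ 2 * W := fun x => by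
    rw [abs_mul, show K ^ 2 * W = K * (K * W) by ring]
    exact mul_le_mul (hfa x) (hpB x) (abs_nonneg _) hK0.le
  have hrs : ∀ x, ‖r x + intOp π k r x‖ ≤ (1 + K) * ρ := fun x => by
    rw [add_mul, one_mul]
    exact (norm_add_le _ _).trans (add_le_add (hrρ x) (hKrρ x))
  have hrsi : ∀ x, |(r x + intOp π k r x).im| ≤ (1 + K) * ι := fun x => by
    rw [add_mul, one_mul, Complex.add_im]
    exact (abs_add_le _ _).trans (add_le_add (hrι x) (hKrι x))
  -- the equation for the second order remainder `w`
  set η : X → ℂ := fun x => ((B x * ω : ℝ) : ℂ) + ((ω * p x * B x : ℝ) : ℂ) * u x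
    + (((f x * p x : ℝ) : ℂ) * (Θ * (r x + intOp π k r x)) + (p x : ℂ) * (r x * intOp π k r x))
    with hη
  have hηb : BddMeas η := by
    have h1 : BddMeas fun x => ((B x * ω : ℝ) : ℂ) := BddMeas.ofReal (by fun_prop)
    have h2 : BddMeas fun x => ((ω * p x * B x : ℝ) : ℂ) := BddMeas.ofReal (by fun_prop)
    have h3 : BddMeas fun x => ((f x * p x : ℝ) : ℂ) := BddMeas.ofReal (by fun_prop)
    fun_prop
  have hweq : ∀ x, w x - intOp π k w x = η x + Θ ^ 2 * σ * f x := fun x => by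
    have h1 := h.eq x
    have h2 := hgσ x
    have h3 := hKr x
    rw [hKw x]
    simp only [hη, hw]
    push_cast
    have h4 : intOp π k u x = intOp π k r x + Θ * f x := by rw [h3]; ring
    have h5 : u x = r x + Θ * f x := by rw [hr]; ring
    rw [h4] at h1
    have h6 : u x * (intOp π k r x + Θ * f x) = r x * intOp π k r x
        + Θ * f x * (r x + intOp π k r x) + Θ ^ 2 * f x ^ 2 := by rw [h5]; ring
    rw [h6] at h1
    linear_combination h1 - Θ ^ 2 * h2 - h5
  have hfη : ∫ x, (f x : ℂ) * η x ∂π = -(Θ ^ 2 * σ) := by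
    have e1 : ∀ x, (f x : ℂ) * η x = (f x : ℂ) * w x - (f x : ℂ) * intOp π k w x
        - Θ ^ 2 * σ * ((f x : ℂ) * f x) := fun x => by
      rw [show η x = w x - intOp π k w x - Θ ^ 2 * σ * f x by rw [hweq x]; ring]; ring
    simp only [e1]
    rw [integral_sub (BddMeas.integrable (by fun_prop)) (BddMeas.integrable (by fun_prop)),
      integral_sub (BddMeas.integrable (by fun_prop)) (BddMeas.integrable (by fun_prop)),
      h.gapped.integral_mul_intOp_eigen hwb, integral_const_mul, hfw,
      integral_mul_self_ofReal h.gapped.normalized]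
    simp
  have hwproj : ∀ x, w x - intOp π k w x = η x - (∫ y, (f y : ℂ) * η y ∂π) * f x := fun x => by
    rw [hweq x, hfη]; ring
  have hηle : ∀ x, ‖η x‖ ≤ d₁ * W := fun x => by
    have h1 : ‖((B x * ω : ℝ) : ℂ)‖ ≤ K * W := by
      rw [Complex.norm_real, Real.norm_eq_abs, abs_mul]
      exact mul_le_mul_of_nonneg_right (hBa x) hW
    have h2 := norm_ofReal_mul_le (hpB x) ((h.le_bound x).trans htt)
    have h3 := norm_ofReal_mul_le (hfp x) (norm_mul_le_mul (le_refl ‖Θ‖) (hrs x))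
    have h4 := norm_ofReal_mul_le (h.abs_sign_le x) (norm_mul_le_mul (hrρ x) (hKrρ x))
    have h5 := mul_le_mul_of_nonneg_left hTρ (show 0 ≤ K * (1 + K) by positivity)
    have h6 := mul_le_mul_of_nonneg_left hρρ' hK0.le
    calc ‖η x‖ ≤ K * W + K * W * t₀ + (K * (T * ((1 + K) * ρ)) + 1 * (ρ * (K * ρ))) :=
          (norm_add_le _ _).trans (add_le_add ((norm_add_le _ _).trans (add_le_add h1 h2))
            ((norm_add_le _ _).trans (add_le_add h3 h4)))
      _ ≤ d₁ * W := by rw [hd₁]; linarith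
  have hηim : ∀ x, |(η x).im| ≤ d₃ * ((W + T ^ 2) * I) := fun x => by
    have h2 := abs_im_ofReal_mul_le (hpB x) (hI x)
    have h3 := abs_im_ofReal_mul_le (hfp x)
      (abs_im_mul_le_mul (le_refl ‖Θ‖) (hrs x) (abs_of_nonneg hI0).le (hrsi x))
    have h4 := abs_im_ofReal_mul_le (h.abs_sign_le x)
      (abs_im_mul_le_mul (hrρ x) (hKrρ x) (hrι x) (hKrι x))
    have h5 := mul_le_mul_of_nonneg_left hTι (show 0 ≤ K * (1 + K) by positivity)
    have h6 := mul_le_mul_of_nonneg_left hρι (show 0 ≤ 2 * K by positivity)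
    have h7 : 0 ≤ K * K * (T ^ 2 * I) := by positivity
    have e1 : (η x).im = (((ω * p x * B x : ℝ) : ℂ) * u x).im
        + ((((f x * p x : ℝ) : ℂ) * (Θ * (r x + intOp π k r x))).im
          + ((p x : ℂ) * (r x * intOp π k r x)).im) := by
      simp only [hη, Complex.add_im, Complex.ofReal_im, zero_add]
    rw [e1]
    calc _ ≤ K * W * (K * I) + (K * (T * ((1 + K) * ι) + I * ((1 + K) * ρ))
          + 1 * (ρ * (K * ι) + ι * (K * ρ))) :=
          (abs_add_le _ _).trans (add_le_add h2 ((abs_add_le _ _).trans (add_le_add h3 h4)))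
      _ ≤ d₃ * ((W + T ^ 2) * I) := by
          have e2 : I * ((1 + K) * ρ) = (1 + K) * c * ((W + T ^ 2) * I) := by rw [hρ]; ring
          rw [hd₃, e2]; linarith
  have hwle : ∀ x, ‖w x‖ ≤ d₂ * W := fun x => by
    rw [hd₂, mul_assoc]
    exact h.gapped.norm_le_of_sub_eq_proj hq h.nonneg h.le_const hwb hηb hfw hwproj hηle x
  have hwim : ∀ x, |(w x).im| ≤ d₄ * ((W + T ^ 2) * I) := fun x => by
    rw [hd₄, mul_assoc]
    exact h.gapped.abs_im_le_of_sub_eq_proj hq h.nonneg h.le_const hwb hηb hfw hwproj hηim x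
  have hKwle := norm_intOp_le_const (π := π) hk hM hK0.le hwb hwle
  have hKwim := abs_im_intOp_le_const (π := π) hk hM hK0.le hwb hwim
  have hws : ∀ x, ‖w x + intOp π k w x‖ ≤ (1 + K) * (d₂ * W) := fun x => by
    rw [add_mul, one_mul]
    exact (norm_add_le _ _).trans (add_le_add (hwle x) (hKwle x))
  have hwsi : ∀ x, |(w x + intOp π k w x).im| ≤ (1 + K) * (d₄ * ((W + T ^ 2) * I)) := fun x => by
    rw [add_mul, one_mul, Complex.add_im]
    exact (abs_add_le _ _).trans (add_le_add (hwim x) (hKwim x))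
  -- the error term as an integral
  set ξ : X → ℂ := fun x => ((f x ^ 2 * p x : ℝ) : ℂ) * (Θ * (w x + intOp π k w x))
    + ((f x * p x : ℝ) : ℂ) * (r x * intOp π k r x) + ((f x * (ω * p x * B x) : ℝ) : ℂ) * u x
    with hξ
  have hξb : BddMeas ξ := by
    have h1 : BddMeas fun x => ((f x ^ 2 * p x : ℝ) : ℂ) := BddMeas.ofReal (by fun_prop)
    have h2 : BddMeas fun x => ((f x * (ω * p x * B x) : ℝ) : ℂ) := BddMeas.ofReal (by fun_prop)
    have h3 : BddMeas fun x => ((f x * p x : ℝ) : ℂ) := BddMeas.ofReal (by fun_prop)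
    fun_prop
  have heξ : e = -∫ x, ξ x ∂π := by
    have e1 : ∀ x, ξ x = (f x : ℂ) * η x - (ω : ℂ) * ((B x : ℂ) * f x)
        - Θ ^ 3 * (((f x : ℂ) ^ 2 * p x) * (g x + intOp π k g x)) := fun x => by
      simp only [hξ, hη]
      rw [hKw x, show w x = r x - Θ ^ 2 * g x from rfl]
      push_cast
      ring
    have hgs : BddMeas fun x => ((f x : ℂ) ^ 2 * p x) * (g x + intOp π k g x) := by fun_prop
    simp only [e1]
    rw [integral_sub (BddMeas.integrable (by fun_prop)) (BddMeas.integrable (by fun_prop)),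
      integral_sub (BddMeas.integrable (by fun_prop)) (BddMeas.integrable (by fun_prop)),
      integral_const_mul, integral_const_mul, hfη, he]
    ring
  have hξle : ∀ x, ‖ξ x‖ ≤ d₅ * (W * T + W ^ 2) := fun x => by
    have h1 := norm_ofReal_mul_le (hffp x) (norm_mul_le_mul (le_refl ‖Θ‖) (hws x))
    have h2 := norm_ofReal_mul_le (hfp x) (norm_mul_le_mul (hrρ x) (hKrρ x))
    have h3 := norm_ofReal_mul_le (hfpB x) (hu₂ x)
    have h4 := mul_le_mul_of_nonneg_left hρρ (show 0 ≤ K * K by positivity)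
    have h5 : 0 ≤ K ^ 2 * (1 + K) * d₂ * W ^ 2 := by positivity
    calc ‖ξ x‖ ≤ K ^ 2 * (T * ((1 + K) * (d₂ * W))) + K * (ρ * (K * ρ))
          + K ^ 2 * W * (c * (T + W)) :=
          (norm_add_le _ _).trans (add_le_add ((norm_add_le _ _).trans (add_le_add h1 h2)) h3)
      _ ≤ d₅ * (W * T + W ^ 2) := by rw [hd₅]; linarith
  have hξim : ∀ x, |(ξ x).im| ≤ d₆ * (W * I) := fun x => by
    have h1 := abs_im_ofReal_mul_le (hffp x)
      (abs_im_mul_le_mul (le_refl ‖Θ‖) (hws x) (abs_of_nonneg hI0).le (hwsi x))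
    have h2 := abs_im_ofReal_mul_le (hfp x)
      (abs_im_mul_le_mul (hrρ x) (hKrρ x) (hrι x) (hKrι x))
    have h3 := abs_im_ofReal_mul_le (hfpB x) (hI x)
    have h4 := mul_le_mul_of_nonneg_left hρι' (show 0 ≤ 2 * K * K by positivity)
    have h5 := mul_le_mul_of_nonneg_left hTWT (show 0 ≤ K ^ 2 * ((1 + K) * d₄ * I) by positivity)
    calc |(ξ x).im| ≤ K ^ 2 * (T * ((1 + K) * (d₄ * ((W + T ^ 2) * I))) + I * ((1 + K) * (d₂ * W)))
          + K * (ρ * (K * ι) + ι * (K * ρ)) + K ^ 2 * W * (K * I) := by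
          simp only [hξ, Complex.add_im]
          exact (abs_add_le _ _).trans (add_le_add ((abs_add_le _ _).trans (add_le_add h1 h2)) h3)
      _ ≤ d₆ * (W * I) := by rw [hd₆]; linarith
  rw [heξ, norm_neg, Complex.neg_im, abs_neg]
  refine ⟨(norm_integral_le_of_bound hξle).trans ?_,
    (abs_im_integral_le_of_bound hξb hξim).trans ?_⟩
  · exact mul_le_mul_of_nonneg_right (by linarith) (by positivity)
  · exact mul_le_mul_of_nonneg_right (by linarith) (by positivity)

end Cubic

/-! ### Perturbation theory for the solution -/

section Application

/-- The difference of the equations at two points in terms of the relative change `U`; here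
`n = |b|` and `P = sign b`. -/
lemma change_eq {n P U b b' ω S : ℂ} (hn : n ≠ 0) (h1 : b' - b = n * U) (h2 : P * n = b)
    (h3 : P * P = 1) (h4 : b' - b = b * b' * (ω + S)) :
    U - n * S = n * ω + P * (U * (n * S)) + ω * P * n * U := by
  subst h2
  have h5 : n * U = n * (n * (1 + P * U) * (ω + S)) := by
    rw [← h1, h4, show b' = P * n + n * U by linear_combination h1]
    linear_combination (n * n * (ω + S)) * h3
  linear_combination mul_left_cancel₀ hn h5

variable {X : Type*} [MeasurableSpace X] {π : Measure X} [IsProbabilityMeasure π]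
  {a : X → ℝ} {s : X → X → ℝ} {m : ℂ → X → ℂ} {f : X → ℝ} {κ R K q τ ω : ℝ}

/-- At a point `τ` where `m` is real and the top eigenvalue is one, the relative change of `m`
satisfies the assumptions of the perturbation analysis. -/
lemma IsRegular.isPerturbation (h : IsRegular π a s m R K q) (ha : BddMeas a)
    (hs : IsSymmKernel s) (hκ : 0 ≤ κ) (hR : 2 * κ ≤ R) (hτ : |τ| ≤ κ) (hω : |ω| ≤ κ)
    (him : ∀ x, (m τ x).im = 0) (hf : IsTopEigenfunction π s (m τ) f)
    (hl : l2OpNorm π (opF π s (m τ)) = 1) :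
    IsPerturbation π (kerF s (m τ)) f (fun x => ‖m τ x‖) (fun x => (m τ x).re / ‖m τ x‖)
      (fun x => (m ((τ + ω : ℝ) : ℂ) x - m (τ : ℂ) x) / (‖m (τ : ℂ) x‖ : ℂ)) ω
      (K ^ 2 * |ω| ^ (1 / 3 : ℝ)) q (K ^ 7 + κ) := by
  have hK := h.one_le
  have hK0 : 0 < K := by linarith
  have hK7 : K ≤ K ^ 7 + κ := by
    have : K ≤ K ^ 7 := le_self_pow₀ hK (by norm_num)
    linarith
  have hreal : ∀ t : ℝ, (0 : ℝ) ≤ (t : ℂ).im := fun t => by simp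
  have hτR : |τ| ≤ R := by linarith
  have hτR' : ‖(τ : ℂ)‖ ≤ R := by rwa [Complex.norm_real, Real.norm_eq_abs]
  have hζR' : ‖((τ + ω : ℝ) : ℂ)‖ ≤ R := by
    rw [Complex.norm_real, Real.norm_eq_abs]
    exact (abs_add_le _ _).trans (by linarith)
  have hm := h.solvesAt τ (hreal τ)
  have hm' := h.solvesAt (τ + ω : ℝ) (hreal _)
  have hgap := h.gapped τ hτR f hf
  rw [hl] at hgap
  set b := m (τ : ℂ) with hb
  set b' := m ((τ + ω : ℝ) : ℂ) with hb'
  have hb0 := hm.norm_pos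
  have hbinv : ∀ x, ‖b x‖⁻¹ ≤ K := fun x => by
    rw [inv_le_iff_one_le_mul₀ (hb0 x)]
    exact h.one_le_norm τ (hreal τ) hτR' x
  have hib := hm.bddMeas_inv_norm ha hs
  have hbb := hm.bddMeas
  have hbb' := hm'.bddMeas
  have hu : BddMeas fun x => (b' x - b x) / (‖b x‖ : ℂ) := by
    have : (fun x => (b' x - b x) / (‖b x‖ : ℂ)) = fun x => (b' x - b x) * ((‖b x‖⁻¹ : ℝ) : ℂ) := by
      funext x; rw [Complex.ofReal_inv, div_eq_mul_inv]
    rw [this]; fun_prop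
  have hp : BddMeas fun x => (b x).re / ‖b x‖ := by
    simp only [div_eq_mul_inv]
    have := hbb.re
    fun_prop
  have hpb : ∀ x, (((b x).re / ‖b x‖ : ℝ) : ℂ) * ‖b x‖ = b x := fun x => by
    rw [← Complex.ofReal_mul, div_mul_cancel₀ _ (hb0 x).ne']
    exact Complex.ext rfl (him x).symm
  have hpp : ∀ x, (((b x).re / ‖b x‖ : ℝ) : ℂ) * (((b x).re / ‖b x‖ : ℝ) : ℂ) = 1 := fun x => by
    rw [← Complex.ofReal_mul, ← Complex.ofReal_one]
    congr 1
    have h1 : ‖b x‖ ^ 2 = (b x).re ^ 2 := by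
      rw [← Complex.normSq_eq_norm_sq, Complex.normSq_apply, him x]; ring
    have := (hb0 x).ne'
    field_simp
    exact h1.symm
  -- the imaginary part of the change is that of the solution at `τ + ω`
  have huim : ∀ x, ((b' x - b x) / (‖b x‖ : ℂ)).im = ‖b' x‖ * sinArg b' x * ‖b x‖⁻¹ := fun x => by
    rw [Complex.div_ofReal_im, Complex.sub_im, him x, sub_zero, hm'.norm_mul_sinArg, div_eq_mul_inv]
  have hsin0 := hm'.sinArg_nonneg
  set A := ∫ y, sinArg b' y ∂π with hA
  have hA0 : 0 ≤ A := integral_nonneg hsin0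
  have hImu : ∀ x, ((b' x - b x) / (‖b x‖ : ℂ)).im ≤ K ^ 3 * A := fun x => by
    rw [huim]
    calc ‖b' x‖ * sinArg b' x * ‖b x‖⁻¹ ≤ K * (K * A) * K :=
          mul_le_mul (mul_le_mul (h.norm_le _ (hreal _) x) (h.sinArg_le _ (hreal _) hζR' x)
            (hsin0 x) hK0.le) (hbinv x) (by positivity) (by positivity)
      _ = _ := by ring
  have hImu' : ∀ x, A ≤ K ^ 3 * ((b' x - b x) / (‖b x‖ : ℂ)).im := fun x => by
    rw [huim]
    have h1 : 1 ≤ K * ‖b' x‖ := h.one_le_norm _ (hreal _) hζR' x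
    have h2 : 1 ≤ K * ‖b x‖⁻¹ := by
      have := h.norm_le τ (hreal τ) x
      rw [← div_eq_mul_inv, le_div_iff₀ (hb0 x), one_mul]; exact this
    have h3 := h.le_sinArg _ (hreal _) hζR' x
    calc A ≤ K * sinArg b' x := h3
      _ ≤ (K * sinArg b' x) * ((K * ‖b' x‖) * (K * ‖b x‖⁻¹)) :=
          le_mul_of_one_le_right (mul_nonneg hK0.le (hsin0 x)) (one_le_mul_of_one_le_of_one_le h1 h2)
      _ = _ := by ring
  -- the imaginary part of the projection to `f ≥ 1 / K` is at least a multiple of the mean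
  have hΘ : A ≤ K ^ 4 * (∫ y, (f y : ℂ) * ((b' y - b y) / (‖b y‖ : ℂ)) ∂π).im := by
    rw [im_integral_mul hf.bddMeas hu, ← integral_const_mul]
    have hfb := hf.bddMeas
    have hui := hu.im
    refine le_integral_of_const_le (by fun_prop) fun x => ?_
    have h1 : 1 ≤ K * f x := by
      have := hgap.le_eigenfunction x
      rwa [inv_le_iff_one_le_mul₀' hK0] at this
    have h2 : 0 ≤ ((b' x - b x) / (‖b x‖ : ℂ)).im := by
      rw [huim]
      exact mul_nonneg (mul_nonneg (norm_nonneg _) (hsin0 x)) (by positivity)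
    calc A ≤ K ^ 3 * ((b' x - b x) / (‖b x‖ : ℂ)).im := hImu' x
      _ ≤ (K ^ 3 * ((b' x - b x) / (‖b x‖ : ℂ)).im) * (K * f x) :=
          le_mul_of_one_le_right (by positivity) h1
      _ = _ := by ring
  have hΘ0 : 0 ≤ (∫ y, (f y : ℂ) * ((b' y - b y) / (‖b y‖ : ℂ)) ∂π).im :=
    nonneg_of_mul_nonneg_right (hA0.trans hΘ) (by positivity)
  refine ⟨hgap.mono hK7 (inv_anti₀ hK0 hK7), hf.nonneg,
    fun x => (h.eigenfunction_le τ hτR f hf x).trans hK7, hbb.norm, fun x => norm_nonneg _,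
    fun x => (h.norm_le τ (hreal τ) x).trans hK7, hp, fun x => ?_, hu, fun x => ?_, fun x => ?_, ?_,
    ?_, fun x => ?_, fun x => ?_⟩
  · rw [abs_div, abs_norm]
    exact div_le_one_of_le₀ (Complex.abs_re_le_norm _) (norm_nonneg _)
  · -- the difference of the equations at `τ + ω` and at `τ`
    set S := intOp π s (fun y => b' y - b y) x with hS
    have hF : intOp π (kerF s b) (fun y => (b' y - b y) / (‖b y‖ : ℂ)) x = ‖b x‖ * S := by
      rw [← opF_eq]
      simp only [opF, hS]
      congr 2
      funext y
      rw [mul_div_cancel₀]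
      exact_mod_cast (hb0 y).ne'
    have hdiff : b' x - b x = b x * b' x * (ω + S) := by
      have h1 := hm.mul_eq x
      have h2 := hm'.mul_eq x
      rw [hS, intOp_sub hs hbb' hbb]
      push_cast at h2
      linear_combination b' x * h1 - b x * h2
    have hne : (‖b x‖ : ℂ) ≠ 0 := by exact_mod_cast (hb0 x).ne'
    rw [hF]
    exact change_eq hne (mul_div_cancel₀ _ hne).symm (hpb x) (hpp x) hdiff
  · rw [norm_div, Complex.norm_real, norm_norm, div_eq_mul_inv]
    have h1 := h.holder _ _ (hreal (τ + ω)) (hreal τ) hζR' hτR' x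
    rw [← Complex.ofReal_sub, add_sub_cancel_left, Complex.norm_real, Real.norm_eq_abs] at h1
    calc ‖b' x - b x‖ * ‖b x‖⁻¹ ≤ (K * |ω| ^ (1 / 3 : ℝ)) * K :=
          mul_le_mul h1 (hbinv x) (by positivity) (by positivity)
      _ = _ := by ring
  -- the cube of the Hölder bound
  · have h1 : (|ω| ^ (1 / 3 : ℝ)) ^ 3 = |ω| := by
      rw [← Real.rpow_natCast, ← Real.rpow_mul (abs_nonneg ω)]; norm_num
    rw [mul_pow, h1, ← pow_mul]
    refine mul_le_mul_of_nonneg_right ?_ (abs_nonneg ω)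
    have : K ^ (2 * 3) ≤ K ^ 7 := pow_le_pow_right₀ hK (by norm_num)
    linarith
  · have : 0 < K ^ 7 := by positivity
    linarith
  · rw [huim]
    exact mul_nonneg (mul_nonneg (norm_nonneg _) (hsin0 x)) (by positivity)
  · calc _ ≤ K ^ 3 * A := hImu x
      _ ≤ K ^ 3 * (K ^ 4 * (∫ y, (f y : ℂ) * ((b' y - b y) / (‖b y‖ : ℂ)) ∂π).im) := by gcongr
      _ = K ^ 7 * (∫ y, (f y : ℂ) * ((b' y - b y) / (‖b y‖ : ℂ)) ∂π).im := by ring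
      _ ≤ _ := mul_le_mul_of_nonneg_right (by linarith) hΘ0

/-- The expansion of `m` and the cubic equation at points where `m` is real and the top eigenvalue
is one. -/
lemma IsRegular.exists_cubic (h : IsRegular π a s m R K q) (ha : BddMeas a)
    (hs : IsSymmKernel s) (hκ : 0 ≤ κ) (hR : 2 * κ ≤ R) :
    ∃ C, 0 < C ∧ ∀ (τ ω : ℝ) (f : ℝ → X → ℝ), |τ| ≤ κ → |ω| ≤ κ → (∀ x, (m τ x).im = 0) →
      IsTopEigenfunction π s (m τ) (f τ) → l2OpNorm π (opF π s (m τ)) = 1 →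
      (∀ x, ‖m ((τ + ω : ℝ) : ℂ) x - m τ x - Theta π m f ω τ * (‖m τ x‖ : ℂ) * (f τ x : ℂ)‖
        ≤ C * (‖Theta π m f ω τ‖ ^ 2 + |ω|)) ∧
      ∀ e : ℂ, e = psi π s (m τ) (f τ) * Theta π m f ω τ ^ 3
          + sigma π (m τ) (f τ) * Theta π m f ω τ ^ 2
          + avg π (fun x => (‖m τ x‖ : ℂ) * (f τ x : ℂ)) * (ω : ℂ) →
        ‖e‖ ≤ C * (|ω| * ‖Theta π m f ω τ‖ + |ω| ^ 2) ∧
        |e.im| ≤ C * (|ω| * (Theta π m f ω τ).im) := by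
  have hK7 : 1 ≤ K ^ 7 + κ := by
    have : 1 ≤ K ^ 7 := one_le_pow₀ h.one_le
    linarith
  obtain ⟨C₁, hC₁, hfirst⟩ := exists_first_order π hK7 h.q_lt_one
  obtain ⟨C₂, hC₂, hcubic⟩ := exists_cubic_bounds π hK7 h.q_lt_one
  have hK0 : 0 < K := lt_of_lt_of_le one_pos h.one_le
  refine ⟨K * C₁ + C₂, by positivity, fun τ ω f hτ hω him hf hl => ?_⟩
  have hreal : (0 : ℝ) ≤ (τ : ℂ).im := by simp
  have hpert := h.isPerturbation ha hs hκ hR hτ hω him hf hl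
  have hm := h.solvesAt τ hreal
  set Θ := Theta π m f ω τ with hΘ
  have hgap := h.gapped τ (hτ.trans (by linarith)) (f τ) hf
  have hfb := hf.bddMeas
  constructor
  · intro x
    have h1 := (hfirst _ _ _ _ _ _ _ hpert Θ rfl x).1
    have hne : (‖m τ x‖ : ℂ) ≠ 0 := by exact_mod_cast (hm.norm_pos x).ne'
    have e1 : m ((τ + ω : ℝ) : ℂ) x - m τ x - Θ * (‖m τ x‖ : ℂ) * (f τ x : ℂ)
        = ‖m τ x‖ * ((m ((τ + ω : ℝ) : ℂ) x - m τ x) / (‖m τ x‖ : ℂ) - Θ * f τ x) := by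
      rw [mul_sub, mul_div_cancel₀ _ hne]; ring
    rw [e1, norm_mul, Complex.norm_real, norm_norm]
    calc _ ≤ K * (C₁ * (|ω| + ‖Θ‖ ^ 2)) :=
          mul_le_mul (h.norm_le τ hreal x) h1 (norm_nonneg _) hK0.le
      _ = K * C₁ * (‖Θ‖ ^ 2 + |ω|) := by ring
      _ ≤ _ := mul_le_mul_of_nonneg_right (by linarith) (by positivity)
  · intro e he
    -- the coefficients `ψ` and `σ` are those of the perturbation analysis, as `sign m` is real
    have hcs := hm.bddMeas_csign ha hs
    obtain ⟨g, hg, hfg, hgw, hpsi, -⟩ := hgap.formD_eq h.q_nonneg h.q_lt_one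
      (w := fun x => (f τ x : ℂ) ^ 2 * csign (m τ x)) (by fun_prop)
    have hp : ∀ x, csign (m τ x) = (((m τ x).re / ‖m τ x‖ : ℝ) : ℂ) := fun x =>
      csign_eq_ofReal (him x)
    simp only [hp] at hgw hpsi
    have hσ : sigma π (m τ) (f τ)
        = ∫ y, (f τ y : ℂ) * ((f τ y : ℂ) ^ 2 * (((m τ y).re / ‖m τ y‖ : ℝ) : ℂ)) ∂π := by
      simp only [sigma, avg, hp]
      congr 1; ext y; ring
    rw [← hσ] at hgw
    have hψ : psi π s (m τ) (f τ) = ∫ x, ((f τ x : ℂ) ^ 2 * (((m τ x).re / ‖m τ x‖ : ℝ) : ℂ))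
        * (g x + intOp π (kerF s (m τ)) g x) ∂π := by
      simp only [psi, hp]
      rw [hpsi]
      congr 1; ext x
      rw [map_mul, map_pow, Complex.conj_ofReal, Complex.conj_ofReal]
    obtain ⟨h1, h2⟩ := hcubic _ _ _ _ _ g _ _ hpert Θ rfl hg hfg _ hσ hgw e (by
      rw [he, hψ]; rfl)
    have hI0 : 0 ≤ |ω| * Θ.im := nonneg_of_mul_nonneg_right ((abs_nonneg _).trans h2) hC₂
    refine ⟨h1.trans (mul_le_mul_of_nonneg_right ?_ (by positivity)),
      h2.trans (mul_le_mul_of_nonneg_right ?_ hI0)⟩ <;>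
    linarith [mul_pos hK0 hC₁]

end Application
end QVE

theorem mainTheorem4 {X : Type*} [MeasurableSpace X] (π : Measure X) [IsProbabilityMeasure π]
    (a : X → ℝ) (s : X → X → ℝ) (ha : QVE.BddMeas a) (hs : QVE.IsSymmKernel s)
    (hA : QVE.DiagonalPositivity π s) (hB : QVE.UniformPrimitivity π s)
    (hC : QVE.ComponentRegularity π a s) :
    -- the extended solution, the generating density and the eigenfunctions exist
    (∃ (m : ℂ → X → ℂ) (v : ℝ → X → ℝ) (f : ℝ → X → ℝ),
      QVE.IsExtendedSolution π a s m ∧ QVE.IsGeneratingDensity m v ∧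
      ∀ τ : ℝ, QVE.IsTopEigenfunction π s (m τ) (f τ)) ∧
    ∀ (m : ℂ → X → ℂ) (v : ℝ → X → ℝ) (f : ℝ → X → ℝ),
      QVE.IsExtendedSolution π a s m → QVE.IsGeneratingDensity m v →
      (∀ τ : ℝ, QVE.IsTopEigenfunction π s (m τ) (f τ)) →
      -- the positivity set does not depend on the component
      (∀ x, {t : ℝ | 0 < v t x} = QVE.posSet v) ∧
      frontier (QVE.posSet v) ⊆ Icc (-QVE.kappa π a s) (QVE.kappa π a s) ∧
      -- the quadratic form is well defined and non-negative
      (∀ τ ∈ Icc (-QVE.kappa π a s) (QVE.kappa π a s),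
        (∀ h : X → ℂ, QVE.BddMeas h → QVE.avg π (fun x => (f τ x : ℂ) * h x) = 0 →
          ∃! g : X → ℂ, QVE.IsReducedInverse π s (m τ) (f τ) h g) ∧
        ∀ w : X → ℂ, QVE.BddMeas w →
          0 ≤ (QVE.formD π s (m τ) (f τ) w).re ∧ (QVE.formD π s (m τ) (f τ) w).im = 0) ∧
      -- the coefficients are real at the boundary of the positivity set
      (∀ τ ∈ frontier (QVE.posSet v),
        (QVE.sigma π (m τ) (f τ)).im = 0 ∧ (QVE.psi π s (m τ) (f τ)).im = 0) ∧
      ∃ (c C : ℝ) (e : ℝ → ℝ → ℂ), 0 < c ∧ 0 < C ∧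
        (∀ τ ∈ frontier (QVE.posSet v),
          ∀ ω ∈ Icc (-QVE.kappa π a s) (QVE.kappa π a s),
            -- leading order of the change of the solution
            (∀ x, ‖m ((τ + ω : ℝ) : ℂ) x - m τ x
                - QVE.Theta π m f ω τ * (‖m τ x‖ : ℂ) * (f τ x : ℂ)‖
              ≤ C * (‖QVE.Theta π m f ω τ‖ ^ 2 + |ω|)) ∧
            -- approximate cubic equation with its error bounds
            QVE.psi π s (m τ) (f τ) * QVE.Theta π m f ω τ ^ 3
                + QVE.sigma π (m τ) (f τ) * QVE.Theta π m f ω τ ^ 2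
                + QVE.avg π (fun x => (‖m τ x‖ : ℂ) * (f τ x : ℂ)) * (ω : ℂ) = e ω τ ∧
            ‖e ω τ‖ ≤ C * (|ω| * ‖QVE.Theta π m f ω τ‖ + |ω| ^ 2) ∧
            |(e ω τ).im| ≤ C * (|ω| * (QVE.Theta π m f ω τ).im)) ∧
        -- stability
        (∀ τ ∈ frontier (QVE.posSet v),
          c ≤ (QVE.psi π s (m τ) (f τ)).re + (QVE.sigma π (m τ) (f τ)).re ^ 2 ∧
          (QVE.psi π s (m τ) (f τ)).re + (QVE.sigma π (m τ) (f τ)).re ^ 2 ≤ C) ∧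
        (∀ τ ∈ Icc (-QVE.kappa π a s) (QVE.kappa π a s),
          c ≤ (QVE.psi π s (m τ) (f τ)).re + ‖QVE.sigma π (m τ) (f τ)‖ ^ 2 ∧
          (QVE.psi π s (m τ) (f τ)).re + ‖QVE.sigma π (m τ) (f τ)‖ ^ 2 ≤ C) := by
  have hκ := QVE.kappa_nonneg π a s
  refine ⟨?_, fun m v f hm hv hf => ?_⟩
  · obtain ⟨m, hm⟩ := QVE.exists_isExtendedSolution π ha hs hA hB hC
    have hfex : ∀ τ : ℝ, ∃ f, QVE.IsTopEigenfunction π s (m τ) f := fun τ => by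
      obtain ⟨K, q, hreg⟩ := hm.exists_isRegular ha hs hA hB hC (R := |τ| + 1) (by positivity)
      have hsol := hreg.solvesAt τ (by simp)
      obtain ⟨c₀, hc₀, hlow⟩ := hsol.exists_le_norm ha hs
      obtain ⟨n, c, hc0, hc⟩ := hB
      exact QVE.exists_isTopEigenfunction hs hsol.bddMeas hc₀ hlow hc0 hc
    choose f hf using hfex
    exact ⟨m, _, f, hm, hm.isGeneratingDensity ha hs hA hB hC, hf⟩
  -- all points that occur lie in the interval `[-2κ, 2κ]`
  obtain ⟨K, q, hreg⟩ := hm.exists_isRegular ha hs hA hB hC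
    (R := 2 * QVE.kappa π a s + 1) (by linarith)
  have habs : ∀ τ ∈ Icc (-QVE.kappa π a s) (QVE.kappa π a s),
      |τ| ≤ 2 * QVE.kappa π a s + 1 := fun τ hτ => (abs_le.2 hτ).trans (by linarith)
  have hfront : frontier (QVE.posSet v) ⊆ Icc (-QVE.kappa π a s) (QVE.kappa π a s) :=
    frontier_subset_closure.trans (QVE.closure_posSet_subset hm ha hs hA hB hC hv)
  have hedge := fun τ (hτ : τ ∈ frontier (QVE.posSet v)) =>
    QVE.frontier_posSet hm ha hs hA hB hC hv hreg (by linarith) hτ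
  have hsol := fun τ : ℝ => hreg.solvesAt τ (by simp)
  have hσ : ∀ τ ∈ frontier (QVE.posSet v), (QVE.sigma π (m τ) (f τ)).im = 0 := fun τ hτ =>
    QVE.sigma_im_eq_zero (hedge τ hτ).2.1
  have hstab := fun τ (hτ : τ ∈ Icc (-QVE.kappa π a s) (QVE.kappa π a s)) =>
    (hreg.gapped τ (habs τ hτ) (f τ) (hf τ)).psi_add_sigma_bounds hreg.q_nonneg hreg.q_lt_one
      ((hsol τ).bddMeas_csign ha hs) (hsol τ).ne_zero (hf τ).nonneg
      (hreg.eigenfunction_le τ (habs τ hτ) (f τ) (hf τ))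
  obtain ⟨C, hC0, hcubic⟩ := hreg.exists_cubic ha hs hκ (by linarith)
  have hq2 : 0 < 1 - q ^ 2 := by nlinarith [hreg.q_nonneg, hreg.q_lt_one]
  have hq1 : 0 < 1 - q := sub_pos.2 hreg.q_lt_one
  have hK0 : 0 < K := lt_of_lt_of_le one_pos hreg.one_le
  set D := K ^ 4 / (1 - q) ^ 2 + K ^ 4 with hD
  have hD0 : 0 < D := by positivity
  have hstab' : ∀ τ ∈ Icc (-QVE.kappa π a s) (QVE.kappa π a s),
      (1 - q ^ 2) / 4 ≤ (QVE.psi π s (m τ) (f τ)).re + ‖QVE.sigma π (m τ) (f τ)‖ ^ 2 ∧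
      (QVE.psi π s (m τ) (f τ)).re + ‖QVE.sigma π (m τ) (f τ)‖ ^ 2 ≤ C + D := fun τ hτ =>
    ⟨(hstab τ hτ).1, (hstab τ hτ).2.trans (by linarith)⟩
  have hψ : ∀ τ ∈ frontier (QVE.posSet v), (QVE.psi π s (m τ) (f τ)).im = 0 := fun τ hτ => by
    have hfb := (hf τ).bddMeas
    have hcs := (hsol τ).bddMeas_csign ha hs
    exact ((hreg.gapped τ (habs τ (hfront hτ)) (f τ) (hf τ)).formD_nonneg hreg.q_nonneg
      hreg.q_lt_one (by fun_prop)).2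
  refine ⟨QVE.setOf_density_pos_eq hm ha hs hA hB hC hv, hfront, fun τ hτ => ?_,
    fun τ hτ => ⟨hσ τ hτ, hψ τ hτ⟩, (1 - q ^ 2) / 4, C + D,
    fun ω τ => QVE.psi π s (m τ) (f τ) * QVE.Theta π m f ω τ ^ 3
      + QVE.sigma π (m τ) (f τ) * QVE.Theta π m f ω τ ^ 2
      + QVE.avg π (fun x => (‖m τ x‖ : ℂ) * (f τ x : ℂ)) * (ω : ℂ), by positivity, by positivity,
    fun τ hτ ω hω => ?_, fun τ hτ => ?_, hstab'⟩
  · have hgap := hreg.gapped τ (habs τ hτ) (f τ) (hf τ)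
    exact ⟨fun h hh hfh => hgap.existsUnique_isReducedInverse hreg.q_nonneg hreg.q_lt_one hh hfh,
      fun w hw => hgap.formD_nonneg hreg.q_nonneg hreg.q_lt_one hw⟩
  · obtain ⟨hτκ, him, hl⟩ := hedge τ hτ
    obtain ⟨h1, h2⟩ := hcubic τ ω f hτκ (abs_le.2 hω) him (hf τ) (hl _ (hf τ))
    obtain ⟨h3, h4⟩ := h2 _ rfl
    have hI0 : 0 ≤ |ω| * (QVE.Theta π m f ω τ).im :=
      nonneg_of_mul_nonneg_right ((abs_nonneg _).trans h4) hC0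
    exact ⟨fun x => (h1 x).trans (mul_le_mul_of_nonneg_right (by linarith) (by positivity)), rfl,
      h3.trans (mul_le_mul_of_nonneg_right (by linarith) (by positivity)),
      h4.trans (mul_le_mul_of_nonneg_right (by linarith) hI0)⟩
  · have h1 := hstab' τ (hfront hτ)
    -- the coefficient `σ` is real here
    have h2 : ‖QVE.sigma π (m τ) (f τ)‖ ^ 2 = (QVE.sigma π (m τ) (f τ)).re ^ 2 := by
      rw [← Complex.normSq_eq_norm_sq, Complex.normSq_apply, hσ τ hτ]; ring
    rwa [h2] at h1
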